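/- Let $(M,J_M,\omega_M)$ be a compact Kähler manifold, $H\subset M$ a smooth reduced complex hypersurface with $[\omega_M]=\mathrm{PD}[H]$, $\mathcal O(H)\to M$ the holomorphic line bundle corresponding to $H$ (local frames $e_i$ with $f_ie_i=f_je_j$ for local equations $f_i$ of $H$), $p:\mathcal O(-H)\to M$ its dual, with complex structure $J$ on the total space, and $s$ a holomorphic section of $\mathcal O(H)$ with $s^{-1}(0)=H$. Let $\|\cdot\|$ be a hermitian metric on $\mathcal O(-H)$ and $\nabla$ a hermitian connection on $\mathcal O(-H)$ with curvature $2\pi i\,\omega_M$ which is compatible with the holomorphic structure ($\nabla^{0,1}=\bar\partial$). (The existence of such a $\nabla$ already forces $[\omega_M]=c_1(\mathcal O(H))=\mathrm{PD}[H]$ in real cohomology.) Let $\alpha^\nabla$ be the 1-form on the complement of the zero section that vanishes on the horizontal distribution of $\nabla$ and satisfies $\alpha^\nabla_u(u)=0$, $\alpha^\nabla_u(iu)=\frac1{2\pi}$, let $r=\|\cdot\|$, and put $$\Omega=p^*\omega_M+d(r^2\alpha^\nabla),\qquad \pi:\mathcal O(-H)\to\mathbb C,\quad \pi(x)=\langle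 s(p(x)),x\rangle .$$ Then $\Omega$ (extended smoothly over the zero section) is a symplectic form on $\mathcal O(-H)$, the critical set $\mathrm{Crit}(\pi)$ is the image of $H$ under the zero section, and $\pi:(\mathcal O(-H),\Omega)\to\mathbb C$ is a Lefschetz–Bott fibration. Here a smooth map $\pi:E\to\mathbb C$ on an even-dimensional open manifold $E$ with a closed 2-form $\Omega$ is a Lefschetz–Bott fibration if $\mathrm{Crit}(\pi)$ is a submanifold with finitely many connected components, $\Omega$ is nondegenerate on $\ker D_x\pi$ for every $x\in E$, and there are an $\Omega$-compatible almost complex structure $J$ on a tubular neighborhood $\mathcal U$ of $\mathrm{Crit}(\pi)$ and a positively oriented complex structure $j$ on a tubular neighborhood $\mathcal V$ of the set of critical values such that: $\pi(\mathcal U)\subset\mathcal V$ and $\pi|_{\mathcal U}$ is $(J,j)$-holomorphic; $\Omega$ is normally Kähler along $\mathrm{Crit}(\pi)$, i.e. $\mathrm{Crit}(\pi)$ is an almost complex submanifold which has a tubular neighborhood in $\mathcal U$ foliated by $J$-holomorphic normal discs $N_x$, $x\in\mathrm{Crit}(\pi)$, on which $J$ is integrable and $\Omega$ is Kähler; and for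 every $x\in\mathrm{Crit}(\pi)$ the normal complex Hessian $D_x^2\pi|_{T_xN_x\otimes T_xN_x}$ is nondegenerate. -/

import Mathlib

open Set
open scoped Manifold ContDiff Topology ComplexConjugate

/-! ## Complex manifolds as real manifolds -/

/-- A complex manifold is a smooth real manifold, with the same charts. -/
theorem realIsManifold_of_complex {V Y : Type*} [NormedAddCommGroup V] [NormedSpace ℂ V]
    [TopologicalSpace Y] [ChartedSpace V Y] [IsManifold 𝓘(ℂ, V) ω Y] :
    IsManifold 𝓘(ℝ, V) ∞ Y := by
  apply isManifold_of_contDiffOn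
  intro e e' he he'
  have h1 := (contDiffGroupoid ω 𝓘(ℂ, V)).compatible he he'
  have h2 := (contDiffGroupoid_le (m := ∞) (n := ω) le_top) h1
  have h3 := ((mem_groupoid_of_pregroupoid).1 h2).1
  simp only [contDiffPregroupoid, modelWithCornersSelf_coe, modelWithCornersSelf_coe_symm,
    Function.id_comp, Function.comp_id, range_id, inter_univ, preimage_id] at h3 ⊢
  exact h3.restrict_scalars ℝ

instance instRealIsManifold {E M : Type*} [NormedAddCommGroup E] [NormedSpace ℂ E]
    [TopologicalSpace M] [ChartedSpace E M] [IsManifold 𝓘(ℂ, E) ω M] :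
    IsManifold 𝓘(ℝ, E) ∞ M :=
  realIsManifold_of_complex

/-- The total space of a holomorphic vector bundle is a smooth real manifold. -/
instance instRealIsManifoldTotalSpace {E M F : Type*} [NormedAddCommGroup E] [NormedSpace ℂ E]
    [NormedAddCommGroup F] [NormedSpace ℂ F]
    [TopologicalSpace M] [ChartedSpace E M] [IsManifold 𝓘(ℂ, E) ω M]
    {N : M → Type*} [∀ x, AddCommGroup (N x)] [∀ x, Module ℂ (N x)]
    [∀ x, TopologicalSpace (N x)] [TopologicalSpace (Bundle.TotalSpace F N)]
    [FiberBundle F N] [VectorBundle ℂ F N] [ContMDiffVectorBundle ω F N 𝓘(ℂ, E)] :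
    IsManifold (𝓘(ℝ, E).prod 𝓘(ℝ, F)) ∞ (Bundle.TotalSpace F N) := by
  apply isManifold_of_contDiffOn
  intro e e' he he'
  have h1 := (contDiffGroupoid ω (𝓘(ℂ, E).prod 𝓘(ℂ, F))).compatible he he'
  have h2 := (contDiffGroupoid_le (m := ∞) (n := ω) le_top) h1
  have h3 := ((mem_groupoid_of_pregroupoid).1 h2).1
  exact h3.restrict_scalars ℝ

/-- Complex topological vector spaces are real topological vector spaces. -/
instance instContinuousSMulReal {X : Type*} [AddCommGroup X] [Module ℂ X] [TopologicalSpace X]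
    [ContinuousSMul ℂ X] : ContinuousSMul ℝ X :=
  IsScalarTower.continuousSMul ℂ

noncomputable section

/-! ## Differential forms on smooth manifolds -/

section Forms

variable {V : Type*} [NormedAddCommGroup V] [NormedSpace ℝ V] {B : Type*} [TopologicalSpace B]
  (I : ModelWithCorners ℝ V B) (X : Type*) [TopologicalSpace X] [ChartedSpace B X]

/-- Real differential `k`-forms on `X` (with no regularity required). -/
abbrev DiffForm (k : ℕ) := (x : X) → TangentSpace I x [⋀^Fin k]→L[ℝ] ℝ

variable {I X} {k : ℕ}

/-- The form `η` read in the preferred chart at `x₀`, i.e. its pullback under the inverse chart. -/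
def DiffForm.inChart (η : DiffForm I X k) (x₀ : X) : V → V [⋀^Fin k]→L[ℝ] ℝ := fun y =>
  (η ((extChartAt I x₀).symm y)).compContinuousLinearMap
    (mfderiv 𝓘(ℝ, V) I (extChartAt I x₀).symm y)

def DiffForm.IsSmooth (η : DiffForm I X k) : Prop :=
  ∀ x₀ : X, ContDiffOn ℝ ∞ (η.inChart x₀) (extChartAt I x₀).target

/-- The exterior derivative, computed at `x` in the preferred chart at `x`
(in which `TangentSpace I x` is the model space `V`). -/
def DiffForm.extD (η : DiffForm I X k) : DiffForm I X (k + 1) := fun x =>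
  let dη : V [⋀^Fin (k + 1)]→L[ℝ] ℝ := extDeriv (η.inChart x) (extChartAt I x x)
  dη

def DiffForm.IsClosed (η : DiffForm I X k) : Prop := ∀ x, η.extD x = 0

/-- The pullback of a form by a map. -/
def DiffForm.pullback {V' : Type*} [NormedAddCommGroup V'] [NormedSpace ℝ V'] {B' : Type*}
    [TopologicalSpace B'] {I' : ModelWithCorners ℝ V' B'} {Y : Type*} [TopologicalSpace Y]
    [ChartedSpace B' Y] (f : Y → X) (η : DiffForm I X k) : DiffForm I' Y k := fun y =>
  (η (f y)).compContinuousLinearMap (mfderiv I' I f y)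

/-- Nondegeneracy of a `2`-form on a set (in practice a subspace) of tangent vectors at `x`. -/
def DiffForm.NondegenerateOn (Ω : DiffForm I X 2) (x : X) (K : Set (TangentSpace I x)) : Prop :=
  ∀ v ∈ K, (∀ w ∈ K, Ω x ![v, w] = 0) → v = 0

end Forms

/-! ## Submanifolds, tubular neighborhoods, Lefschetz–Bott fibrations -/

section LefschetzBott

variable {V : Type*} [NormedAddCommGroup V] [NormedSpace ℝ V] {B : Type*} [TopologicalSpace B]
  (I : ModelWithCorners ℝ V B) {X : Type*} [TopologicalSpace X] [ChartedSpace B X]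

/-- `N` is an embedded smooth submanifold without boundary: near each of its points there is a
smooth chart `φ` of `X` in which `N` is a coordinate plane. The dimension may depend on the
component. -/
def IsSubmanifold (N : Set X) : Prop :=
  ∀ x ∈ N, ∃ (m k : ℕ)
    (φ : OpenPartialHomeomorph X (EuclideanSpace ℝ (Fin m) × EuclideanSpace ℝ (Fin k))),
    x ∈ φ.source ∧
    ContMDiffOn I 𝓘(ℝ, EuclideanSpace ℝ (Fin m) × EuclideanSpace ℝ (Fin k)) ∞ φ φ.source ∧
    ContMDiffOn 𝓘(ℝ, EuclideanSpace ℝ (Fin m) × EuclideanSpace ℝ (Fin k)) I ∞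
      φ.symm φ.target ∧
    ∀ y ∈ φ.source, y ∈ N ↔ (φ y).2 = 0

/-- The vectors at `x` tangent to the subset `S`: velocities of smooth curves lying in `S`.
For a submanifold `S` this is the tangent space `T_x S`. -/
def tangentVectors (S : Set X) (x : X) : Set (TangentSpace I x) :=
  {v | ∃ γ : ℝ → X, γ 0 = x ∧ ContMDiffAt 𝓘(ℝ, ℝ) I ∞ γ 0 ∧ (∀ᶠ t in 𝓝 (0 : ℝ), γ t ∈ S) ∧
    (mfderiv 𝓘(ℝ, ℝ) I γ 0 (1 : ℝ) : V) = (v : V)}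

/-- `Φ` is a local trivialization of the family of discs `D x` (`x ∈ N`): it is a diffeomorphism
from `A × (open unit ball)` onto an open set, its zero section parametrizes a piece of `N`, and the
whole disc through `Φ (a, 0)` is the image of `{a} × (open unit ball)`. -/
structure IsDiscChart (N : Set X) (D : X → Set X) {m k : ℕ}
    (Φ : OpenPartialHomeomorph (EuclideanSpace ℝ (Fin m) × EuclideanSpace ℝ (Fin k)) X) :
    Prop where
  source_eq : ∃ A : Set (EuclideanSpace ℝ (Fin m)), Φ.source = A ×ˢ Metric.ball 0 1
  smooth : ContMDiffOn 𝓘(ℝ, EuclideanSpace ℝ (Fin m) × EuclideanSpace ℝ (Fin k)) I ∞ Φ Φ.source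
  smooth_symm :
    ContMDiffOn I 𝓘(ℝ, EuclideanSpace ℝ (Fin m) × EuclideanSpace ℝ (Fin k)) ∞ Φ.symm Φ.target
  mem_iff : ∀ p ∈ Φ.source, Φ p ∈ N ↔ p.2 = 0
  disc_eq : ∀ p ∈ Φ.source, p.2 = 0 → D (Φ p) = Φ '' ({p.1} ×ˢ Metric.ball 0 1)

/-- `U` is a tubular neighborhood of `N` whose fiber (normal slice) through `x ∈ N` is the disc
`D x`: the slices are disjoint, fill `U`, and form a smooth, locally trivial bundle of
discs over `N` with zero section `N`. -/
structure IsTubularFoliation (N U : Set X) (D : X → Set X) : Prop where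
  isOpen : IsOpen U
  eq_iUnion : U = ⋃ x ∈ N, D x
  disjoint : N.PairwiseDisjoint D
  locally_trivial : ∀ x ∈ N, ∃ (m k : ℕ)
    (Φ : OpenPartialHomeomorph (EuclideanSpace ℝ (Fin m) × EuclideanSpace ℝ (Fin k)) X),
    IsDiscChart I N D Φ ∧ x ∈ Φ.target

def IsTubularNeighborhood (N U : Set X) : Prop := ∃ D, IsTubularFoliation I N U D

variable (X) in
/-- Fields of endomorphisms of the tangent spaces (with no regularity required). -/
abbrev EndField := (x : X) → TangentSpace I x →L[ℝ] TangentSpace I x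

/-- `J` is a smooth almost complex structure on the open set `U`. Smoothness: `J` sends smooth
vector fields to smooth vector fields. -/
structure IsAlmostComplexOn [IsManifold I ∞ X] (J : EndField I X) (U : Set X) : Prop where
  sq : ∀ x ∈ U, ∀ v, J x (J x v) = -v
  smooth : ∀ x ∈ U, ∀ Y : (y : X) → TangentSpace I y,
    ContMDiffAt I I.tangent ∞ (fun y => (⟨y, Y y⟩ : TangentBundle I X)) x →
    ContMDiffAt I I.tangent ∞ (fun y => (⟨y, J y (Y y)⟩ : TangentBundle I X)) x

variable {I}

/-- `J` is compatible with `Ω` at `x`: `Ω(·, J ·)` is a positive definite symmetric form. -/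
def IsCompatibleAt (Ω : DiffForm I X 2) (J : EndField I X) (x : X) : Prop :=
  (∀ v w, Ω x ![J x v, J x w] = Ω x ![v, w]) ∧ ∀ v, v ≠ 0 → 0 < Ω x ![v, J x v]

/-- `J` restricts to an integrable complex structure on the submanifold `S`: every point
of `S` has a neighborhood in `S` parametrized by an open set `O` of some `ℂ^d` via a smooth embedding
`c` with `dc ∘ i = J ∘ dc`. -/
def IsIntegrableAlong (J : EndField I X) (S : Set X) : Prop :=
  ∀ y ∈ S, ∃ (d : ℕ) (O : Set (EuclideanSpace ℂ (Fin d))) (c : EuclideanSpace ℂ (Fin d) → X),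
    IsOpen O ∧ ContMDiffOn 𝓘(ℝ, EuclideanSpace ℂ (Fin d)) I ∞ c O ∧ InjOn c O ∧
    c '' O ⊆ S ∧ y ∈ c '' O ∧ c '' O ∈ 𝓝[S] y ∧
    ∀ z ∈ O, Function.Injective (mfderiv 𝓘(ℝ, EuclideanSpace ℂ (Fin d)) I c z) ∧
      ∀ v : EuclideanSpace ℂ (Fin d),
        mfderiv 𝓘(ℝ, EuclideanSpace ℂ (Fin d)) I c z (Complex.I • v) =
          J (c z) (mfderiv 𝓘(ℝ, EuclideanSpace ℂ (Fin d)) I c z v)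

/-- The closed form `Ω` on the almost complex manifold `(W, J)` (`W` open in `X`) is normally
Kähler near the almost complex submanifold `N`, as exhibited by the tubular neighborhood `U`
foliated by the `J`-holomorphic normal discs `D x`, `x ∈ N`.

On each disc the restriction of `Ω` is Kähler for `J`: it is closed because `Ω` is, compatible with
`J` by `compatible`, and `J` is integrable there by `disc_integrable`. -/
structure IsNormallyKahler (Ω : DiffForm I X 2) (J : EndField I X) (W N U : Set X)
    (D : X → Set X) : Prop where
  subset : U ⊆ W
  foliation : IsTubularFoliation I N U D
  closed : ∀ x ∈ U, Ω.extD x = 0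
  almostComplex : ∀ x ∈ N, ∀ v ∈ tangentVectors I N x, J x v ∈ tangentVectors I N x
  compatible : ∀ x ∈ U, IsCompatibleAt Ω J x
  disc_holomorphic : ∀ x ∈ N, ∀ y ∈ D x, ∀ v ∈ tangentVectors I (D x) y,
    J y v ∈ tangentVectors I (D x) y
  disc_integrable : ∀ x ∈ N, IsIntegrableAlong J (D x)

variable (I)

/-- The critical points of `f : X → ℂ`: the points where `Df` is not surjective. -/
def critSet (f : X → ℂ) : Set X :=
  {x | ¬ Function.Surjective (mfderiv I 𝓘(ℝ, ℂ) f x)}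

/-- The `ℂ`-valued Hessian `D²f(v, w)` of `f`, computed in the preferred chart at `x`.
At points where `Df = 0` it does not depend on the chart; this is the case at the critical points of
a map that is holomorphic near them. -/
def hessianAt (f : X → ℂ) (x : X) (v w : TangentSpace I x) : ℂ :=
  fderiv ℝ (fderiv ℝ (f ∘ (extChartAt I x).symm)) (extChartAt I x x) v w

/-- `j` is a smooth, positively oriented (almost) complex structure on the open set `W ⊆ ℂ`.
In real dimension two it is automatically integrable. -/
structure IsPositiveComplexStructureOn (j : ℂ → ℂ →L[ℝ] ℂ) (W : Set ℂ) : Prop where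
  smooth : ContDiffOn ℝ ∞ j W
  sq : ∀ z ∈ W, ∀ v, j z (j z v) = -v
  positive : ∀ z ∈ W, 0 < (j z 1).im

/-- `f : (X, Ω) → ℂ` is a Lefschetz–Bott fibration. -/
structure IsLefschetzBottFibration [I.Boundaryless] [IsManifold I ∞ X]
    (Ω : DiffForm I X 2) (f : X → ℂ) : Prop where
  /-- `X` is an open manifold: no component is compact (and there is no boundary). -/
  open_manifold : ∀ x : X, ¬ IsCompact (connectedComponent x)
  even_dim : Even (Module.finrank ℝ V)
  form_smooth : Ω.IsSmooth
  form_closed : Ω.IsClosed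
  smooth : ContMDiff I 𝓘(ℝ, ℂ) ∞ f
  crit_submanifold : IsSubmanifold I (critSet I f)
  crit_components : Finite (ConnectedComponents (critSet I f))
  /-- `Ω` is nondegenerate on `ker Df` at every point of `X`. -/
  nondegenerate : ∀ x : X, Ω.NondegenerateOn x {v | mfderiv I 𝓘(ℝ, ℂ) f x v = 0}
  /-- There are a compatible almost complex structure `J` on a tubular neighborhood `U` of the
  critical set and a positive complex structure `j` on a tubular neighborhood `W` of the set of
  critical values such that `f` is `(J, j)`-holomorphic, `Ω` is normally Kähler along the critical
  set, and the Hessian is nondegenerate on the tangent space of the normal slice at each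
  critical point. -/
  local_model : ∃ (U : Set X) (W : Set ℂ) (J : EndField I X) (j : ℂ → ℂ →L[ℝ] ℂ),
    IsTubularNeighborhood I (critSet I f) U ∧
    IsTubularNeighborhood 𝓘(ℝ, ℂ) (f '' critSet I f) W ∧
    IsAlmostComplexOn I J U ∧
    (∀ x ∈ U, IsCompatibleAt Ω J x) ∧
    IsPositiveComplexStructureOn j W ∧
    MapsTo f U W ∧
    (∀ x ∈ U, ∀ v, mfderiv I 𝓘(ℝ, ℂ) f x (J x v) = j (f x) (mfderiv I 𝓘(ℝ, ℂ) f x v)) ∧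
    ∃ (U' : Set X) (D : X → Set X),
      IsNormallyKahler Ω J U (critSet I f) U' D ∧
      ∀ x ∈ critSet I f, ∀ v ∈ tangentVectors I (D x) x,
        (∀ w ∈ tangentVectors I (D x) x, hessianAt I f x v w = 0) → v = 0

end LefschetzBott

/-! ## Kähler forms, hypersurfaces and their line bundles -/

section Complex

variable {E : Type*} [NormedAddCommGroup E] [NormedSpace ℂ E]
  {M : Type*} [TopologicalSpace M] [ChartedSpace E M]

/-- Kähler forms on a complex manifold: smooth, closed, and compatible with the complex structure,
which is multiplication by `i` on `TangentSpace 𝓘(ℝ, E) x = E`. -/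
structure IsKahlerForm (κ : DiffForm 𝓘(ℝ, E) M 2) : Prop where
  smooth : κ.IsSmooth
  closed : κ.IsClosed
  invariant : ∀ (x : M) (v w : E), κ x ![Complex.I • v, Complex.I • w] = κ x ![v, w]
  positive : ∀ (x : M) (v : E), v ≠ 0 → 0 < κ x ![v, Complex.I • v]

/-- `f` is a (reduced) holomorphic local equation of `H` on the open set `U`. -/
structure IsLocalEquation (H U : Set M) (f : M → ℂ) : Prop where
  isOpen : IsOpen U
  holomorphic : MDifferentiableOn 𝓘(ℂ, E) 𝓘(ℂ, ℂ) f U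
  zero_iff : ∀ y ∈ U, y ∈ H ↔ f y = 0
  regular : ∀ y ∈ U, y ∈ H → mfderiv 𝓘(ℂ, E) 𝓘(ℂ, ℂ) f y ≠ 0

/-- `H` is a smooth (closed, reduced) complex hypersurface. -/
def IsSmoothHypersurface (E : Type*) [NormedAddCommGroup E] [NormedSpace ℂ E]
    {M : Type*} [TopologicalSpace M] [ChartedSpace E M] (H : Set M) : Prop :=
  ∀ x : M, ∃ (U : Set M) (f : M → ℂ), x ∈ U ∧ IsLocalEquation (E := E) H U f

/-- `s` is holomorphic on `U` as a section of `N`. -/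
def IsHolomorphicSectionOn (E : Type*) [NormedAddCommGroup E] [NormedSpace ℂ E]
    {M : Type*} [TopologicalSpace M] [ChartedSpace E M]
    (F : Type*) [NormedAddCommGroup F] [NormedSpace ℂ F]
    {N : M → Type*} [∀ x, TopologicalSpace (N x)] [TopologicalSpace (Bundle.TotalSpace F N)]
    [FiberBundle F N] (s : (x : M) → N x) (U : Set M) : Prop :=
  MDifferentiableOn 𝓘(ℂ, E) (𝓘(ℂ, E).prod 𝓘(ℂ, F)) (fun x => Bundle.TotalSpace.mk' F x (s x)) U

/-- The holomorphic line bundle `L` is (a representative of) `𝒪(H)`: there are an open cover by sets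
`U x ∋ x`, local equations `f x` of `H` and holomorphic frames `e x` of `L` on `U x` whose
transition functions are the quotients of the local equations, `e x' = (f x / f x') • e x`. -/
def IsLineBundleOfHypersurface (E : Type*) [NormedAddCommGroup E] [NormedSpace ℂ E]
    {M : Type*} [TopologicalSpace M] [ChartedSpace E M] (H : Set M)
    (L : M → Type*) [∀ x, AddCommGroup (L x)] [∀ x, Module ℂ (L x)] [∀ x, TopologicalSpace (L x)]
    [TopologicalSpace (Bundle.TotalSpace ℂ L)] [FiberBundle ℂ L] : Prop :=
  ∃ (U : M → Set M) (f : M → M → ℂ) (e : M → (y : M) → L y),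
    (∀ x, x ∈ U x ∧ IsLocalEquation (E := E) H (U x) (f x) ∧
      IsHolomorphicSectionOn E ℂ (e x) (U x) ∧ ∀ y ∈ U x, e x y ≠ 0) ∧
    ∀ x x', ∀ y ∈ U x ∩ U x', f x y • e x y = f x' y • e x' y

/-- The fibers of the dual `L*` of a line bundle `L`. Mathlib equips the family `DualFiber L`
with its structure of holomorphic line bundle, with model fiber `ℂ →L[ℂ] ℂ`. -/
abbrev DualFiber {M : Type*} (L : M → Type*) [∀ x, AddCommGroup (L x)] [∀ x, Module ℂ (L x)]
    [∀ x, TopologicalSpace (L x)] (x : M) : Type _ :=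
  L x →L[ℂ] Bundle.Trivial M ℂ x

/-- The total space of the dual line bundle `L*`. -/
abbrev DualTotal {M : Type*} (L : M → Type*) [∀ x, AddCommGroup (L x)] [∀ x, Module ℂ (L x)]
    [∀ x, TopologicalSpace (L x)] : Type _ :=
  Bundle.TotalSpace (ℂ →L[ℂ] ℂ) (DualFiber L)

/-- The map `x ↦ ⟨s (p x), x⟩` on the total space of `p : L* → M` given by a section `s` of `L`. -/
def pairingMap {M : Type*} {L : M → Type*} [∀ x, AddCommGroup (L x)] [∀ x, Module ℂ (L x)]
    [∀ x, TopologicalSpace (L x)] (s : (x : M) → L x) : DualTotal L → ℂ :=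
  fun x => x.2 (s x.1)

end Complex

/-! ## Hermitian connections on line bundles and the associated symplectic form -/

section Connection

variable (E : Type*) [NormedAddCommGroup E] [NormedSpace ℂ E]
  {M : Type*} [TopologicalSpace M] [ChartedSpace E M]
  (F : Type*) [NormedAddCommGroup F] [NormedSpace ℂ F]
  (N : M → Type*) [∀ x, AddCommGroup (N x)] [∀ x, Module ℂ (N x)] [∀ x, TopologicalSpace (N x)]
  [TopologicalSpace (Bundle.TotalSpace F N)] [FiberBundle F N]

/-- The real model of the total space of a complex vector bundle. -/
abbrev realTotalModel : ModelWithCorners ℝ (E × F) (ModelProd E F) := 𝓘(ℝ, E).prod 𝓘(ℝ, F)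

/-- Smooth hermitian metrics on `N`, conjugate-linear in the first argument. -/
structure HermitianMetric where
  inner : (x : M) → N x →ₗ⋆[ℂ] N x →ₗ[ℂ] ℂ
  conj_symm : ∀ x u v, conj (inner x v u) = inner x u v
  pos : ∀ x u, u ≠ 0 → 0 < (inner x u u).re
  smooth : ContMDiff (realTotalModel E F) 𝓘(ℝ, ℝ) ∞
    (fun u : Bundle.TotalSpace F N => (inner u.1 u.2 u.2).re)

variable [∀ x, IsTopologicalAddGroup (N x)] [∀ x, ContinuousSMul ℂ (N x)]

/-- Connections on `N` regarded as a real vector bundle. `nabla σ x v` is `∇_v σ` at `x`. -/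
abbrev RealConnection := CovariantDerivative 𝓘(ℝ, E) F N

variable {E F N}

/-- `σ` is a section of `N` that is smooth (in the real sense) at `x`. -/
def SmoothSectionAt (E F : Type*) [NormedAddCommGroup E] [NormedSpace ℂ E]
    [NormedAddCommGroup F] [NormedSpace ℂ F]
    {M : Type*} [TopologicalSpace M] [ChartedSpace E M]
    {N : M → Type*} [∀ x, TopologicalSpace (N x)] [TopologicalSpace (Bundle.TotalSpace F N)]
    [FiberBundle F N] (σ : (x : M) → N x) (x : M) : Prop :=
  ContMDiffAt 𝓘(ℝ, E) (realTotalModel E F) ∞ (fun y => Bundle.TotalSpace.mk' F y (σ y)) x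

/-- `Y` is a vector field that is smooth at `x`. -/
def SmoothFieldAt [IsManifold 𝓘(ℝ, E) ∞ M] (Y : (y : M) → TangentSpace 𝓘(ℝ, E) y) (x : M) : Prop :=
  ContMDiffAt 𝓘(ℝ, E) 𝓘(ℝ, E).tangent ∞ (fun y => (⟨y, Y y⟩ : TangentBundle 𝓘(ℝ, E) M)) x

/-- `nabla` is a smooth complex-linear connection that is hermitian for `h` and compatible with the
holomorphic structure of `N` (its `(0,1)`-part is `∂bar`), i.e. it is the Chern connection of `h`. -/
structure IsHermitianHolomorphic [IsManifold 𝓘(ℝ, E) ∞ M] (h : HermitianMetric E F N)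
    (nabla : RealConnection E F N) : Prop where
  smooth : ∀ (x : M) (σ : (y : M) → N y) (Y : (y : M) → TangentSpace 𝓘(ℝ, E) y),
    SmoothSectionAt E F σ x → SmoothFieldAt Y x →
      SmoothSectionAt E F (fun y => nabla σ y (Y y)) x
  complex_linear : ∀ (x : M) (σ : (y : M) → N y), SmoothSectionAt E F σ x →
    ∀ v : TangentSpace 𝓘(ℝ, E) x,
      nabla (fun y => Complex.I • σ y) x v = Complex.I • nabla σ x v
  hermitian : ∀ (x : M) (σ τ : (y : M) → N y), SmoothSectionAt E F σ x → SmoothSectionAt E F τ x →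
    ∀ v : TangentSpace 𝓘(ℝ, E) x,
      mfderiv 𝓘(ℝ, E) 𝓘(ℝ, ℂ) (fun y => h.inner y (σ y) (τ y)) x v =
        h.inner x (nabla σ x v) (τ x) + h.inner x (σ x) (nabla τ x v)
  holomorphic : ∀ (U : Set M) (σ : (y : M) → N y), IsOpen U → IsHolomorphicSectionOn E F σ U →
    ∀ x ∈ U, ∀ v : E, nabla σ x (Complex.I • v : E) = Complex.I • nabla σ x (v : E)

/-- The curvature of `nabla` is `2πi κ`:
`∇_Y ∇_Z σ - ∇_Z ∇_Y σ - ∇_[Y,Z] σ = 2πi κ(Y, Z) σ`. -/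
def HasCurvatureTwoPiI [IsManifold 𝓘(ℝ, E) ∞ M] (nabla : RealConnection E F N)
    (κ : DiffForm 𝓘(ℝ, E) M 2) : Prop :=
  ∀ (x : M) (σ : (y : M) → N y) (Y Z : (y : M) → TangentSpace 𝓘(ℝ, E) y),
    SmoothSectionAt E F σ x → SmoothFieldAt Y x → SmoothFieldAt Z x →
    nabla (fun y => nabla σ y (Z y)) x (Y x) - nabla (fun y => nabla σ y (Y y)) x (Z x)
      - nabla σ x (VectorField.mlieBracket 𝓘(ℝ, E) Y Z x)
      = (2 * Real.pi * Complex.I * (κ x ![Y x, Z x] : ℝ)) • σ x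

variable [VectorBundle ℂ F N]

/-- The vertical projection `K : T_u N → N_{p(u)}` along the horizontal distribution of `nabla`.
In the preferred chart at `u`, a tangent vector is a pair `v = (v.1, v.2) : E × F` with
`dp(v) = v.1`. Let `σ` be the local section through `u` with constant coordinate in the
preferred trivialization `e` at `p(u)`. Then `v` is the sum of `dσ(v.1) = (v.1, 0)`, whose vertical
projection is `∇_{v.1} σ`, and of the vertical vector `(0, v.2)`. -/
def verticalProj (nabla : RealConnection E F N) (u : Bundle.TotalSpace F N) :
    E × F →ₗ[ℝ] N u.1 :=
  let e := trivializationAt F N u.1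
  let dσ : E →L[ℝ] N u.1 := nabla (fun y => e.symmₗ ℂ y (e u).2) u.1
  dσ.toLinearMap ∘ₗ LinearMap.fst ℝ E F +
    (e.symmₗ ℂ u.1).restrictScalars ℝ ∘ₗ LinearMap.snd ℝ E F

/-- The transgression `1`-form `α` of `nabla` on the complement of the zero section of the line
bundle `N`: the form with `α(u) = 0` and `α(iu) = 1 / 2π` on the vertical vectors `u`, `iu` at `u`,
vanishing on the horizontal distribution. Explicitly, `α_u(v) = Im ⟨u, K v⟩ / (2π ‖u‖²)` where `K`
is the vertical projection. On the zero section it is given the value `0`. -/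
def transgressionForm [FiniteDimensional ℂ E] [FiniteDimensional ℂ F] (h : HermitianMetric E F N)
    (nabla : RealConnection E F N) :
    DiffForm (realTotalModel E F) (Bundle.TotalSpace F N) 1 := fun u =>
  let α : E × F →ₗ[ℝ] ℝ := (2 * Real.pi * (h.inner u.1 u.2 u.2).re)⁻¹ •
    (Complex.imLm ∘ₗ (h.inner u.1 u.2).restrictScalars ℝ ∘ₗ verticalProj nabla u)
  let α' : (E × F) [⋀^Fin 1]→L[ℝ] ℝ :=
    ContinuousAlternatingMap.ofSubsingleton ℝ (E × F) ℝ 0 (LinearMap.toContinuousLinearMap α)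
  α'

/-- The canonical form `Ω = p^* κ + d(r² α)` on the total space of the line bundle
`p : N → M`, where `r = ‖·‖` and `α` is the transgression form of `nabla`
(the form `r² α` extends smoothly by `0` over the zero section). -/
def canonicalForm [FiniteDimensional ℂ E] [FiniteDimensional ℂ F] (h : HermitianMetric E F N)
    (nabla : RealConnection E F N) (κ : DiffForm 𝓘(ℝ, E) M 2) :
    DiffForm (realTotalModel E F) (Bundle.TotalSpace F N) 2 :=
  DiffForm.pullback (Bundle.TotalSpace.proj : Bundle.TotalSpace F N → M) κ +
    DiffForm.extD (fun u => (h.inner u.1 u.2 u.2).re • transgressionForm h nabla u)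

end Connection

end

/-!
All assertions are statements about the holomorphic function `π` and the form
`Ω = p^* κ + d(r² α)` on the total space of the line bundle `N = L*`, with complex structure `i`.
Apart from the last step, `π` may be any holomorphic family `ℓ` of linear functionals on the fibers
of `N` that vanishes transversely (`IsTransverseFunctional`).

**The form.** In a holomorphic frame `e` the connection form `A` has type `(1, 0)`, satisfies
`d‖e‖² = 2 ‖e‖² Re A`, and has exterior derivative `2πi κ`. If `ζ` is the fiber coordinate and
`K = ζ A + dζ` the vertical projection, then `r² α = (‖e‖² / 2π) Im (conj ζ · K)`; this is smooth
across the zero section, and differentiating it gives (`canonicalForm_apply`)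
`Ω = (1 + r²) p^* κ + (‖e‖² / π) Im (conj K · K)`.
As `K` is complex linear and `κ` is Kähler, `Ω` is compatible with `i` (`isCompatibleAt_mulI`), and
is therefore nondegenerate on every complex subspace of a tangent space, in particular on the kernel
of `dπ`.

**The critical set.** Locally `π = ζ g` with `g = ℓ e`, and `dg ≠ 0` wherever `g = 0`. Hence `dπ = 0`
exactly where `ζ = 0` and `g = 0`, that is, on the zero section over the zero locus `H` of `ℓ`
(`critSet_functionalMap`). If `dπ` is not zero it is surjective, being complex linear.

**The normal discs.** The point is to foliate a neighborhood of the critical set by complex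
surfaces. This is done by a smooth retraction `ρ` of a neighborhood of `H` in `M` onto `H` whose
fibers are holomorphic curves. In a chart of `M` adapted to `H` the displacement from `x ∈ H` to `y`
is a vector tangent to `H` at `x` that depends holomorphically on `y`. Averaging these vectors with a
partition of unity in the variable `x` preserves this (`hypDisplacement`), and the vanishing of the
average is an equation for `x = ρ y` which can be solved by the implicit function theorem
(`exists_retraction`). The tube `‖ℓ‖² + r² < ε²` in the total space is then fibered into the surfaces
`p⁻¹ (ρ⁻¹ x)`. A real chart built from `ρ`, the rescaled coefficient `g` and a unitary frame turns
them into round balls (`exists_isTubeChart`), so that this is a bundle of discs once `ε` is small;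
a uniform `ε` exists by compactness (`exists_isTubeBox`, `isTubularFoliation_tube`). On each surface
`(g, ζ)` are holomorphic coordinates in which `π` is the product of the coordinates
(`exists_isHolomorphicParam`). So the surfaces are complex submanifolds, `i` is integrable on them,
and the Hessian of `π` at the critical point is the nondegenerate form of `z₀ z₁`. The result is
`IsTransverseFunctional.isLefschetzBottFibration`.

**Transversality of the section.** The section `s` and the canonical section `f e` of `𝒪(H)` have
the same zero locus. Since the equations `f` are reduced, the quotient `s / (f e)` extends
holomorphically over `H`; as `M` is compact it is locally constant (`exists_const_mul`). So `s`
vanishes transversely, like `f` (`isTransverseFunctional`).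
-/

set_option linter.unusedSectionVars false

/-! ### Holomorphic functions of several variables -/

/-- Cauchy's estimate for the derivative of a holomorphic function of several variables. -/
theorem norm_fderiv_le_of_forall_closedBall {E G : Type*} [NormedAddCommGroup E] [NormedSpace ℂ E]
    [NormedAddCommGroup G] [NormedSpace ℂ G] {f : E → G} {x : E} {r C : ℝ}
    (hr : 0 < r) (hf : ∀ y ∈ Metric.closedBall x r, DifferentiableAt ℂ f y)
    (hC : ∀ y ∈ Metric.closedBall x r, ‖f y‖ ≤ C) : ‖fderiv ℂ f x‖ ≤ C / r := by
  have hC0 : 0 ≤ C := (norm_nonneg _).trans (hC x (by simp [hr.le]))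
  refine ContinuousLinearMap.opNorm_le_bound _ (by positivity) fun w => ?_
  rcases eq_or_ne w 0 with rfl | hw
  · simp
  have hw' : 0 < ‖w‖ := norm_pos_iff.2 hw
  have hmem : ∀ t ∈ Metric.closedBall (0 : ℂ) (r / ‖w‖), x + t • w ∈ Metric.closedBall x r := by
    intro t ht
    simp only [Metric.mem_closedBall, dist_zero_right] at ht
    simpa [norm_smul, ← le_div_iff₀ hw'] using ht
  have hg : ∀ t ∈ Metric.closedBall (0 : ℂ) (r / ‖w‖),
      DifferentiableAt ℂ (fun t : ℂ => f (x + t • w)) t := fun t ht =>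
    (hf _ (hmem t ht)).comp t (by fun_prop)
  have h1 := Complex.norm_deriv_le_of_forall_mem_sphere_norm_le (f := fun t : ℂ => f (x + t • w))
    (c := 0) (R := r / ‖w‖) (C := C) (by positivity)
    (DifferentiableOn.diffContOnCl (fun t ht => (hg t (Metric.closure_ball_subset_closedBall ht)).differentiableWithinAt))
    (fun t ht => hC _ (hmem t (Metric.sphere_subset_closedBall ht)))
  have h2 : HasDerivAt (fun t : ℂ => f (x + t • w)) (fderiv ℂ f x w) 0 := by
    have h3 : HasFDerivAt f (fderiv ℂ f x) (x + (0 : ℂ) • w) := by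
      simpa using (hf x (by simp [hr.le])).hasFDerivAt
    have h4 : HasDerivAt (fun t : ℂ => x + t • w) w 0 := by
      simpa using ((hasDerivAt_id (0 : ℂ)).smul_const w).const_add x
    exact h3.comp_hasDerivAt 0 h4
  rw [h2.deriv] at h1
  calc _ ≤ C / (r / ‖w‖) := h1
    _ = C / r * ‖w‖ := by field_simp

/-- The directional derivatives of a holomorphic function of several variables are holomorphic: on
the complex line through `x` in the direction `v`, Cauchy's formula expresses the derivative as an
integral of `f` over a circle of fixed radius, which can be differentiated in `x`. -/
theorem differentiableOn_fderiv_apply_complex {E G : Type*} [NormedAddCommGroup E] [NormedSpace ℂ E]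
    [FiniteDimensional ℂ E] [NormedAddCommGroup G] [NormedSpace ℂ G] [FiniteDimensional ℂ G]
    {f : E → G} {W : Set E} (hW : IsOpen W) (hf : DifferentiableOn ℂ f W) (v : E) :
    DifferentiableOn ℂ (fun x => fderiv ℂ f x v) W := by
  have := FiniteDimensional.proper ℂ E
  have := FiniteDimensional.complete ℂ G
  intro x₀ hx₀
  obtain ⟨ρ, hρ, hρW⟩ := Metric.nhds_basis_closedBall.mem_iff.1 (hW.mem_nhds hx₀)
  obtain ⟨r, hr, rfl⟩ : ∃ r > 0, ρ = 3 * r := ⟨ρ / 3, by positivity, by ring⟩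
  have hfd : ∀ y ∈ Metric.closedBall x₀ (3 * r), DifferentiableAt ℂ f y := fun y hy =>
    hf.differentiableAt (hW.mem_nhds (hρW hy))
  obtain ⟨C, hC⟩ := (isCompact_closedBall x₀ (3 * r)).exists_bound_of_continuousOn
    (fun y hy => (hfd y hy).continuousAt.continuousWithinAt)
  have hsub : ∀ y ∈ Metric.ball x₀ (2 * r), Metric.closedBall y r ⊆ Metric.closedBall x₀ (3 * r) := by
    intro y hy z hz
    simp only [Metric.mem_ball, Metric.mem_closedBall] at *
    linarith [dist_triangle z y x₀]
  have hlip : LipschitzOnWith (Real.nnabs (C / r)) f (Metric.ball x₀ (2 * r)) := by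
    refine (convex_ball x₀ (2 * r)).lipschitzOnWith_of_nnnorm_fderiv_le (𝕜 := ℂ) (fun y hy => hfd y ?_)
      fun y hy => ?_
    · exact hsub y hy (by simp [hr.le])
    · have := norm_fderiv_le_of_forall_closedBall hr (fun z hz => hfd z (hsub y hy hz))
        (fun z hz => hC z (hsub y hy hz))
      rw [← NNReal.coe_le_coe]
      rw [Real.coe_nnabs]
      exact this.trans (le_abs_self _)
  -- The radius of the circles: for `x` in the ball of radius `r` they stay in that of radius `2 r`.
  set R : ℝ := r / (‖v‖ + 1) with hR
  have hR0 : 0 < R := by positivity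
  have hRv : R * ‖v‖ ≤ r := by
    rw [hR, div_mul_eq_mul_div, div_le_iff₀ (by positivity)]; nlinarith [norm_nonneg v]
  have hball : ∀ x ∈ Metric.ball x₀ r, ∀ t ∈ Metric.closedBall (0 : ℂ) R,
      x + t • v ∈ Metric.ball x₀ (2 * r) := by
    intro x hx t ht
    simp only [Metric.mem_ball, Metric.mem_closedBall, dist_eq_norm, sub_zero] at *
    have : ‖t • v‖ ≤ r := by
      rw [norm_smul]; exact (mul_le_mul_of_nonneg_right ht (norm_nonneg v)).trans hRv
    calc ‖x + t • v - x₀‖ = ‖(x - x₀) + t • v‖ := by congr 1; abel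
      _ < 2 * r := by linarith [norm_add_le (x - x₀) (t • v)]
  have hb2 : ∀ y ∈ Metric.ball x₀ (2 * r), y ∈ Metric.closedBall x₀ (3 * r) := fun y hy =>
    hsub y hy (by simp [hr.le])
  have hcm : ∀ θ : ℝ, circleMap (0 : ℂ) R θ ∈ Metric.closedBall (0 : ℂ) R := fun θ =>
    circleMap_mem_closedBall _ hR0.le θ
  set κ : ℝ → ℂ := fun θ => deriv (circleMap 0 R) θ * ((circleMap 0 R θ - 0) ^ 2)⁻¹ with hκ
  have hκc : Continuous κ := by
    have : ∀ θ, (circleMap 0 R θ - 0) ^ 2 ≠ 0 := fun θ => by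
      simp [circleMap_eq_center_iff, hR0.ne']
    simp only [hκ, deriv_circleMap]
    fun_prop (disch := exact this _)
  -- Cauchy's formula for the derivative along the line `t ↦ x + t v`.
  have hform : ∀ x ∈ Metric.ball x₀ r, fderiv ℂ f x v =
      (2 * Real.pi * Complex.I : ℂ)⁻¹ • ∫ θ in (0 : ℝ)..2 * Real.pi, κ θ • f (x + circleMap 0 R θ • v) := by
    intro x hx
    obtain ⟨R', hR', hball'⟩ : ∃ R' > R, ∀ t ∈ Metric.ball (0 : ℂ) R', x + t • v ∈ Metric.closedBall x₀ (3 * r) := by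
      refine ⟨2 * r / (‖v‖ + 1), ?_, fun t ht => ?_⟩
      · rw [hR]; exact (div_lt_div_iff_of_pos_right (by positivity)).2 (by linarith)
      · simp only [Metric.mem_ball, Metric.mem_closedBall, dist_eq_norm, sub_zero] at *
        have : ‖t • v‖ ≤ 2 * r := by
          rw [norm_smul]
          calc ‖t‖ * ‖v‖ ≤ (2 * r / (‖v‖ + 1)) * ‖v‖ := by gcongr
            _ ≤ 2 * r := by
              rw [div_mul_eq_mul_div, div_le_iff₀ (by positivity)]; nlinarith [norm_nonneg v]
        calc ‖x + t • v - x₀‖ = ‖(x - x₀) + t • v‖ := by congr 1; abel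
          _ ≤ _ := (norm_add_le _ _).trans (by linarith)
    have h1 := Complex.two_pi_I_inv_smul_circleIntegral_sub_sq_inv_smul_of_differentiable
      (U := Metric.ball (0 : ℂ) R') (c := 0) (w₀ := 0) (R := R) (f := fun t : ℂ => f (x + t • v))
      Metric.isOpen_ball (Metric.closedBall_subset_ball hR')
      (fun t ht => ((hfd _ (hball' t ht)).comp t (by fun_prop)).differentiableWithinAt) (by simp [hR0])
    have h2 : HasDerivAt (fun t : ℂ => f (x + t • v)) (fderiv ℂ f x v) 0 := by
      have h3 : HasFDerivAt f (fderiv ℂ f x) (x + (0 : ℂ) • v) := by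
        simpa using (hfd x (hb2 x (Metric.ball_subset_ball (by linarith) hx))).hasFDerivAt
      have h4 : HasDerivAt (fun t : ℂ => x + t • v) v 0 := by
        simpa using ((hasDerivAt_id (0 : ℂ)).smul_const v).const_add x
      exact h3.comp_hasDerivAt 0 h4
    rw [h2.deriv] at h1
    rw [← h1, circleIntegral]
    simp only [hκ, smul_smul]
  have hev : (fun x => fderiv ℂ f x v) =ᶠ[𝓝 x₀] fun x =>
      (2 * Real.pi * Complex.I : ℂ)⁻¹ • ∫ θ in (0 : ℝ)..2 * Real.pi, κ θ • f (x + circleMap 0 R θ • v) := by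
    filter_upwards [Metric.ball_mem_nhds x₀ hr] with x hx using hform x hx
  refine DifferentiableAt.differentiableWithinAt ?_
  rw [hev.differentiableAt_iff]
  refine DifferentiableAt.const_smul ?_ _
  have hcont : ∀ x ∈ Metric.ball x₀ r, Continuous fun θ : ℝ => κ θ • f (x + circleMap 0 R θ • v) := by
    intro x hx
    refine hκc.smul (continuous_iff_continuousAt.2 fun θ => ?_)
    refine ContinuousAt.comp (g := f) ?_ (by fun_prop)
    exact (hfd _ (hb2 _ (hball x hx _ (hcm θ)))).continuousAt
  -- Only measurability, and not yet continuity, of the derivative is available here.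
  borelize E
  have hmeas : MeasureTheory.StronglyMeasurable
      fun θ : ℝ => fderiv ℂ f (x₀ + circleMap 0 R θ • v) := by
    borelize (E →L[ℂ] G)
    have := FiniteDimensional.proper ℂ (E →L[ℂ] G)
    have h : Continuous fun θ : ℝ => x₀ + circleMap 0 R θ • v := by fun_prop
    exact ((measurable_fderiv ℂ f).comp h.measurable).stronglyMeasurable
  have key := intervalIntegral.hasFDerivAt_integral_of_dominated_loc_of_lip (𝕜 := ℂ)
    (μ := MeasureTheory.volume) (a := 0) (b := 2 * Real.pi) (x₀ := x₀) (s := Metric.ball x₀ r)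
    (F := fun x θ => κ θ • f (x + circleMap 0 R θ • v))
    (F' := fun θ => κ θ • fderiv ℂ f (x₀ + circleMap 0 R θ • v))
    (bound := fun θ => ‖κ θ‖ * (C / r)) (Metric.ball_mem_nhds x₀ hr)
    (by filter_upwards [Metric.ball_mem_nhds x₀ hr] with x hx using
          (hcont x hx).aestronglyMeasurable)
    ((hcont x₀ (Metric.mem_ball_self hr)).intervalIntegrable _ _)
    (hκc.stronglyMeasurable.smul hmeas).aestronglyMeasurable
    (Filter.Eventually.of_forall fun θ _ => ?_)
    ((by fun_prop : Continuous fun θ => ‖κ θ‖ * (C / r)).intervalIntegrable _ _)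
    (Filter.Eventually.of_forall fun θ _ => ?_)
  · exact key.2.differentiableAt
  · refine LipschitzOnWith.of_dist_le_mul fun x hx y hy => ?_
    rw [dist_smul₀, Real.coe_nnabs, abs_mul, abs_norm, mul_assoc]
    refine mul_le_mul_of_nonneg_left ?_ (norm_nonneg _)
    have := hlip.dist_le_mul _ (hball x hx _ (hcm θ)) _ (hball y hy _ (hcm θ))
    simpa only [Real.coe_nnabs, dist_add_right] using this
  · have h1 : HasFDerivAt f (fderiv ℂ f (x₀ + circleMap 0 R θ • v)) (x₀ + circleMap 0 R θ • v) :=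
      (hfd _ (hb2 _ (hball x₀ (Metric.mem_ball_self hr) _ (hcm θ)))).hasFDerivAt
    have h2 := h1.comp x₀ ((hasFDerivAt_id x₀).add_const (circleMap 0 R θ • v))
    exact h2.const_smul (κ θ)

/-- A holomorphic function of several variables is smooth. -/
theorem contDiffOn_of_differentiableOn_complex {E : Type*} [NormedAddCommGroup E] [NormedSpace ℂ E]
    [FiniteDimensional ℂ E] {G : Type*} [NormedAddCommGroup G] [NormedSpace ℂ G]
    [FiniteDimensional ℂ G]
    {f : E → G} {W : Set E} (hW : IsOpen W) (hf : DifferentiableOn ℂ f W) :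
    ContDiffOn ℂ ∞ f W := by
  rw [contDiffOn_infty]
  intro n
  induction n generalizing G with
  | zero => exact contDiffOn_zero.2 hf.continuousOn
  | succ n ih =>
    push_cast
    rw [contDiffOn_succ_iff_fderiv_of_isOpen hW]
    refine ⟨hf, by simp, ?_⟩
    rw [contDiffOn_clm_apply]
    exact fun v => ih (differentiableOn_fderiv_apply_complex hW hf v)

/-- The inverse function theorem for a smooth map on an open set, with a smooth local inverse and
invertible derivatives on the whole source. -/
theorem exists_openPartialHomeomorph_of_contDiffOn {𝕜 : Type*} [RCLike 𝕜] {V V' : Type*}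
    [NormedAddCommGroup V] [NormedSpace 𝕜 V] [CompleteSpace V] [NormedAddCommGroup V']
    [NormedSpace 𝕜 V'] {f : V → V'} {s : Set V} {x : V} (hs : IsOpen s)
    (hf : ContDiffOn 𝕜 ∞ f s) (hx : x ∈ s) (e : V ≃L[𝕜] V')
    (he : HasFDerivAt f (e : V →L[𝕜] V') x) :
    ∃ Φ : OpenPartialHomeomorph V V', x ∈ Φ.source ∧ Φ.source ⊆ s ∧ ⇑Φ = f ∧
      ContDiffOn 𝕜 ∞ Φ.symm Φ.target ∧
      ∀ y ∈ Φ.source, ∃ e' : V ≃L[𝕜] V', HasFDerivAt f (e' : V →L[𝕜] V') y := by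
  have hc : ContDiffAt 𝕜 ∞ f x := hf.contDiffAt (hs.mem_nhds hx)
  set Φ₀ := hc.toOpenPartialHomeomorph f he (by simp)
  have hΦ₀ : ⇑Φ₀ = f := hc.toOpenPartialHomeomorph_coe he (by simp)
  set s' := s ∩ fderiv 𝕜 f ⁻¹' (range ((↑) : (V ≃L[𝕜] V') → (V →L[𝕜] V')))
  have hs' : IsOpen s' :=
    (hf.continuousOn_fderiv_of_isOpen hs (by simp)).isOpen_inter_preimage hs
      (ContinuousLinearEquiv.isOpen)
  have hd : ∀ y ∈ s', ∃ e' : V ≃L[𝕜] V', HasFDerivAt f (e' : V →L[𝕜] V') y := by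
    rintro y ⟨hy, e', he'⟩
    refine ⟨e', ?_⟩
    rw [he']
    exact ((hf.contDiffAt (hs.mem_nhds hy)).differentiableAt (by simp)).hasFDerivAt
  refine ⟨Φ₀.restrOpen s' hs', ?_, ?_, ?_, ?_, ?_⟩
  · exact ⟨hc.mem_toOpenPartialHomeomorph_source he (by simp), hx, e, he.fderiv.symm⟩
  · exact fun y hy => hy.2.1
  · simpa using hΦ₀
  · intro y hy
    have hy' : (Φ₀.restrOpen s' hs').symm y ∈ Φ₀.source ∩ s' :=
      (Φ₀.restrOpen s' hs').map_target hy
    obtain ⟨e', he'⟩ := hd _ hy'.2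
    refine (OpenPartialHomeomorph.contDiffAt_symm (Φ₀.restrOpen s' hs') (f₀' := e') hy ?_ ?_).contDiffWithinAt
    · simpa [hΦ₀] using he'
    · simpa [hΦ₀] using (hf.contDiffAt (hs.mem_nhds hy'.2.1))
  · exact fun y hy => hd y hy.2

/-- A holomorphic function vanishing on the hyperplane `z = 0` is divisible by `z`: the quotient is
`∫₀¹ (∂G/∂z)(k, t z) dt`. -/
theorem exists_eq_mul_of_eq_zero_on_hyperplane {K : Type*} [NormedAddCommGroup K] [NormedSpace ℂ K]
    [FiniteDimensional ℂ K] {G : K × ℂ → ℂ} {U : Set (K × ℂ)} (hU : IsOpen U)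
    (hG : DifferentiableOn ℂ G U) {k₀ : K} (hk₀ : (k₀, 0) ∈ U)
    (h0 : ∀ k, (k, (0 : ℂ)) ∈ U → G (k, 0) = 0) :
    ∃ (q : K × ℂ → ℂ) (V : Set (K × ℂ)), IsOpen V ∧ (k₀, 0) ∈ V ∧ V ⊆ U ∧
      DifferentiableOn ℂ q V ∧ ∀ w ∈ V, G w = w.2 * q w := by
  have := FiniteDimensional.proper ℂ K
  obtain ⟨r, hr, hrU⟩ := Metric.nhds_basis_closedBall.mem_iff.1 (hU.mem_nhds hk₀)
  set D : K × ℂ → ℂ := fun w => fderiv ℂ G w (0, 1) with hD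
  have hGs := contDiffOn_of_differentiableOn_complex hU hG
  have hDd : DifferentiableOn ℂ D U := differentiableOn_fderiv_apply_complex hU hG (0, 1)
  have hDs := contDiffOn_of_differentiableOn_complex hU hDd
  have hcl : ∀ w ∈ Metric.ball (k₀, (0 : ℂ)) r, ∀ t ∈ Icc (0 : ℝ) 1,
      (w.1, (t : ℂ) * w.2) ∈ Metric.closedBall (k₀, (0 : ℂ)) r := by
    intro w hw t ht
    simp only [Metric.mem_ball, Metric.mem_closedBall, Prod.dist_eq, sup_lt_iff, sup_le_iff,
      dist_zero_right, norm_mul, Complex.norm_real, Real.norm_eq_abs, abs_of_nonneg ht.1] at *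
    exact ⟨hw.1.le, (mul_le_of_le_one_left (norm_nonneg _) ht.2).trans hw.2.le⟩
  obtain ⟨C, hC⟩ := (isCompact_closedBall (k₀, (0 : ℂ)) r).exists_bound_of_continuousOn
    (((hDs.continuousOn_fderiv_of_isOpen hU (by simp)).mono hrU))
  have hline : ∀ w : K × ℂ, Continuous fun t : ℝ => (w.1, (t : ℂ) * w.2) := fun w => by fun_prop
  have hcontD : ∀ w ∈ Metric.ball (k₀, (0 : ℂ)) r,
      ContinuousOn (fun t : ℝ => D (w.1, (t : ℂ) * w.2)) (Icc 0 1) := fun w hw =>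
    hDd.continuousOn.comp (hline w).continuousOn fun t ht => hrU (hcl w hw t ht)
  have hI : uIoc (0 : ℝ) 1 ⊆ Icc 0 1 := by
    rw [uIoc_of_le zero_le_one]; exact Ioc_subset_Icc_self
  -- `P t` is the derivative of the contraction `(k, z) ↦ (k, t z)`.
  set P : ℝ → K × ℂ →L[ℂ] K × ℂ := fun t =>
    (ContinuousLinearMap.fst ℂ K ℂ).prod ((t : ℂ) • ContinuousLinearMap.snd ℂ K ℂ) with hP
  have hPc : Continuous P := by
    have : P = fun t : ℝ => ContinuousLinearMap.prodₗᵢ ℂ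
      (ContinuousLinearMap.fst ℂ K ℂ, (t : ℂ) • ContinuousLinearMap.snd ℂ K ℂ) := rfl
    rw [this]
    fun_prop
  have hPn : ∀ t ∈ Icc (0 : ℝ) 1, ‖P t‖ ≤ 1 := by
    intro t ht
    refine ContinuousLinearMap.opNorm_le_bound _ zero_le_one fun w => ?_
    simp only [hP, ContinuousLinearMap.prod_apply, Prod.norm_def, one_mul,
      ContinuousLinearMap.coe_fst', smul_apply, ContinuousLinearMap.coe_snd',
      smul_eq_mul, norm_mul, Complex.norm_real, Real.norm_eq_abs, abs_of_nonneg ht.1]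
    exact sup_le_sup le_rfl (mul_le_of_le_one_left (norm_nonneg _) ht.2)
  refine ⟨fun w => ∫ t in (0 : ℝ)..1, D (w.1, (t : ℂ) * w.2), Metric.ball (k₀, 0) r,
    Metric.isOpen_ball, Metric.mem_ball_self hr,
    fun w hw => hrU (Metric.ball_subset_closedBall hw), ?_, ?_⟩
  · intro w₀ hw₀
    refine (intervalIntegral.hasFDerivAt_integral_of_dominated_of_fderiv_le (𝕜 := ℂ)
      (μ := MeasureTheory.volume) (a := 0) (b := 1) (x₀ := w₀) (s := Metric.ball (k₀, (0 : ℂ)) r)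
      (F := fun w t => D (w.1, (t : ℂ) * w.2))
      (F' := fun w t => (fderiv ℂ D (w.1, (t : ℂ) * w.2)).comp (P t))
      (bound := fun _ => C) (Metric.isOpen_ball.mem_nhds hw₀) ?_ ?_ ?_ ?_ ?_
      ?_).differentiableAt.differentiableWithinAt
    · filter_upwards [Metric.isOpen_ball.mem_nhds hw₀] with w hw
      exact ((hcontD w hw).mono hI).aestronglyMeasurable measurableSet_uIoc
    · refine ContinuousOn.intervalIntegrable ?_
      rw [uIcc_of_le zero_le_one]
      exact hcontD w₀ hw₀
    · refine ContinuousOn.aestronglyMeasurable (ContinuousOn.mono ?_ hI) measurableSet_uIoc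
      exact ((hDs.continuousOn_fderiv_of_isOpen hU (by simp)).comp (hline w₀).continuousOn
        fun t ht => hrU (hcl w₀ hw₀ t ht)).clm_comp hPc.continuousOn
    · refine Filter.Eventually.of_forall fun t ht w hw => ?_
      refine (ContinuousLinearMap.opNorm_comp_le _ _).trans ?_
      have h1 := hC _ (hcl w hw t (hI ht))
      calc _ ≤ ‖fderiv ℂ D (w.1, (t : ℂ) * w.2)‖ * 1 := by gcongr; exact hPn t (hI ht)
        _ ≤ C := by simpa using h1
    · exact intervalIntegrable_const
    · refine Filter.Eventually.of_forall fun t ht w hw => ?_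
      have h1 : HasFDerivAt D (fderiv ℂ D (w.1, (t : ℂ) * w.2)) (P t w) :=
        (hDd.differentiableAt (hU.mem_nhds (hrU (hcl w hw t (hI ht))))).hasFDerivAt
      exact h1.comp w (P t).hasFDerivAt
  · intro w hw
    have hd : ∀ t ∈ uIcc (0 : ℝ) 1, HasDerivAt (fun t : ℝ => G (w.1, (t : ℂ) * w.2))
        (w.2 * D (w.1, (t : ℂ) * w.2)) t := by
      intro t ht
      rw [uIcc_of_le zero_le_one] at ht
      have h1 : HasFDerivAt G (fderiv ℂ G (w.1, (t : ℂ) * w.2)) (w.1, (t : ℂ) * w.2) :=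
        (hG.differentiableAt (hU.mem_nhds (hrU (hcl w hw t ht)))).hasFDerivAt
      have h2 : HasDerivAt (fun t : ℝ => (w.1, (t : ℂ) * w.2)) ((0 : K), w.2) t := by
        refine (hasDerivAt_const t w.1).prodMk ?_
        simpa using (Complex.ofRealCLM.hasDerivAt (x := t)).mul_const w.2
      have h3 := (h1.restrictScalars ℝ).comp_hasDerivAt t h2
      convert! h3 using 1
      rw [ContinuousLinearMap.coe_restrictScalars',
        show ((0 : K), w.2) = w.2 • ((0 : K), (1 : ℂ)) by ext <;> simp, map_smul, smul_eq_mul]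
    have hint : IntervalIntegrable (fun t : ℝ => w.2 * D (w.1, (t : ℂ) * w.2))
        MeasureTheory.volume 0 1 := by
      refine ContinuousOn.intervalIntegrable ?_
      rw [uIcc_of_le zero_le_one]
      exact continuousOn_const.mul (hcontD w hw)
    have h1 := intervalIntegral.integral_eq_sub_of_hasDerivAt hd hint
    have h2 : G (w.1, (0 : ℂ)) = 0 := h0 _ (hrU (by
      simpa using hcl w hw 0 (by simp)))
    simp only [intervalIntegral.integral_const_mul, Complex.ofReal_one, one_mul,
      Complex.ofReal_zero, zero_mul, h2, sub_zero] at h1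
    exact h1.symm

/-! ### Exterior calculus in charts -/

theorem minSmoothness_two_le_infty : minSmoothness ℝ 2 ≤ (∞ : WithTop ℕ∞) := by
  rw [minSmoothness_of_isRCLikeNormedField]
  exact WithTop.coe_le_coe.2 (le_top : (2 : ℕ∞) ≤ ⊤)

section FormCalculus

variable {V : Type*} [NormedAddCommGroup V] [NormedSpace ℝ V] {B : Type*} [TopologicalSpace B]
  {I : ModelWithCorners ℝ V B} [I.Boundaryless] {X : Type*} [TopologicalSpace X] [ChartedSpace B X]
  {k : ℕ}

omit [I.Boundaryless] in
theorem DiffForm.inChart_add (η ζ : DiffForm I X k) (x₀ : X) :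
    (η + ζ).inChart x₀ = η.inChart x₀ + ζ.inChart x₀ := by
  ext y v
  rfl

variable [IsManifold I ∞ X]

omit [IsManifold I ∞ X] in
theorem isOpen_extChartAt_coord_change_source (x₀ x : X) :
    IsOpen ((extChartAt I x₀).symm.trans (extChartAt I x)).source := by
  rw [PartialEquiv.trans_source]
  exact (continuousOn_extChartAt_symm (I := I) x₀).isOpen_inter_preimage (isOpen_extChartAt_target x₀)
    (isOpen_extChartAt_source x)

omit [IsManifold I ∞ X] in
/-- In the preferred chart at `ψ₀⁻¹ y`, the differential of `ψ₀⁻¹` at `y` is that of the coordinate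
change. -/
theorem mfderiv_extChartAt_symm_eq_fderiv [IsManifold I 1 X] (x₀ : X) {y : V} (hy : y ∈ (extChartAt I x₀).target) :
    (mfderiv 𝓘(ℝ, V) I (extChartAt I x₀).symm y : V →L[ℝ] V) =
      fderiv ℝ (extChartAt I ((extChartAt I x₀).symm y) ∘ (extChartAt I x₀).symm) y := by
  have h : MDifferentiableAt 𝓘(ℝ, V) I (extChartAt I x₀).symm y := by
    have := mdifferentiableWithinAt_extChartAt_symm (I := I) (x := x₀) hy
    rwa [I.range_eq_univ, mdifferentiableWithinAt_univ] at this
  rw [h.mfderiv]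
  change fderivWithin ℝ (extChartAt I ((extChartAt I x₀).symm y) ∘ (extChartAt I x₀).symm)
    (range id) y = _
  rw [range_id, fderivWithin_univ]

theorem mfderiv_extChartAt_symm_comp (x₀ x : X) {y : V} (hy : y ∈ (extChartAt I x₀).target)
    (hx : (extChartAt I x₀).symm y ∈ (extChartAt I x).source) :
    (mfderiv 𝓘(ℝ, V) I (extChartAt I x₀).symm y : V →L[ℝ] V) =
      (mfderiv 𝓘(ℝ, V) I (extChartAt I x).symm (extChartAt I x ((extChartAt I x₀).symm y)) :
        V →L[ℝ] V).comp (fderiv ℝ (extChartAt I x ∘ (extChartAt I x₀).symm) y) := by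
  set τ := extChartAt I x ∘ (extChartAt I x₀).symm with hτ
  have hmem : y ∈ ((extChartAt I x₀).symm.trans (extChartAt I x)).source := ⟨hy, hx⟩
  have hopen := isOpen_extChartAt_coord_change_source (I := I) x₀ x
  have hτd : DifferentiableAt ℝ τ y :=
    ((contDiffOn_ext_coord_change (n := ∞) (I := I) x x₀).contDiffAt (hopen.mem_nhds hmem)).differentiableAt
      (by simp)
  have h1 : MDifferentiableAt 𝓘(ℝ, V) I (extChartAt I x).symm (τ y) := by
    have := mdifferentiableWithinAt_extChartAt_symm (I := I) (x := x)
      ((extChartAt I x).map_source hx)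
    rwa [I.range_eq_univ, mdifferentiableWithinAt_univ] at this
  have h2 : (extChartAt I x₀).symm =ᶠ[𝓝 y] (extChartAt I x).symm ∘ τ := by
    filter_upwards [hopen.mem_nhds hmem] with z hz
    exact ((extChartAt I x).left_inv hz.2).symm
  have h3 := mfderiv_comp (I := 𝓘(ℝ, V)) (I' := 𝓘(ℝ, V)) y h1 hτd.mdifferentiableAt
  rw [mfderiv_eq_fderiv] at h3
  rw [h2.mfderiv_eq]
  exact h3

theorem DiffForm.inChart_eq_pullback (η : DiffForm I X k) (x₀ x : X) {y : V}
    (hy : y ∈ (extChartAt I x₀).target) (hx : (extChartAt I x₀).symm y ∈ (extChartAt I x).source) :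
    η.inChart x₀ y = (η.inChart x ((extChartAt I x ∘ (extChartAt I x₀).symm) y)).compContinuousLinearMap
      (fderiv ℝ (extChartAt I x ∘ (extChartAt I x₀).symm) y) := by
  have hp : (extChartAt I x).symm (extChartAt I x ((extChartAt I x₀).symm y)) =
    (extChartAt I x₀).symm y := (extChartAt I x).left_inv hx
  have hη : ∀ p q : X, p = q → (η p : V [⋀^Fin k]→L[ℝ] ℝ) = η q := by rintro p _ rfl; rfl
  have h1 := mfderiv_extChartAt_symm_comp x₀ x hy hx
  ext v
  change (η _ : V [⋀^Fin k]→L[ℝ] ℝ) (fun i => _) = (η _ : V [⋀^Fin k]→L[ℝ] ℝ) (fun i => _)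
  rw [Function.comp_apply, hη _ _ hp]
  congr 1
  funext i
  exact congrArg (fun (A : V →L[ℝ] V) => A (v i)) h1

theorem DiffForm.IsSmooth.extD_inChart {η : DiffForm I X k} (hη : η.IsSmooth) (x₀ : X) {y : V}
    (hy : y ∈ (extChartAt I x₀).target) :
    η.extD.inChart x₀ y = extDeriv (η.inChart x₀) y := by
  set x := (extChartAt I x₀).symm y with hxdef
  have hx : x ∈ (extChartAt I x).source := mem_extChartAt_source x
  set τ := extChartAt I x ∘ (extChartAt I x₀).symm with hτ
  have hmem : y ∈ ((extChartAt I x₀).symm.trans (extChartAt I x)).source := ⟨hy, hx⟩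
  have hopen := isOpen_extChartAt_coord_change_source (I := I) x₀ x
  have hτc : ContDiffAt ℝ ∞ τ y :=
    (contDiffOn_ext_coord_change (n := ∞) (I := I) x x₀).contDiffAt (hopen.mem_nhds hmem)
  have h1 : η.inChart x₀ =ᶠ[𝓝 y] fun z =>
      (η.inChart x (τ z)).compContinuousLinearMap (fderiv ℝ τ z) := by
    filter_upwards [hopen.mem_nhds hmem] with z hz
    exact η.inChart_eq_pullback x₀ x hz.1 hz.2
  have h2 : DifferentiableAt ℝ (η.inChart x) (τ y) :=
    ((hη x).contDiffAt ((isOpen_extChartAt_target x).mem_nhds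
      ((extChartAt I x).map_source hx))).differentiableAt (by simp)
  rw [h1.extDeriv_eq, extDeriv_pullback h2 hτc minSmoothness_two_le_infty]
  ext v
  change (extDeriv (η.inChart x) (extChartAt I x x)) (fun i => _) = _
  have h3 := mfderiv_extChartAt_symm_eq_fderiv (I := I) x₀ hy
  exact congrArg (fun (A : V →L[ℝ] V) => extDeriv (η.inChart x) (extChartAt I x x) (fun i => A (v i))) h3

theorem contDiffOn_extDeriv {W : Set V} (hW : IsOpen W) {f : V → V [⋀^Fin k]→L[ℝ] ℝ}
    (hf : ContDiffOn ℝ ∞ f W) : ContDiffOn ℝ ∞ (extDeriv f) W :=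
  (ContinuousAlternatingMap.alternatizeUncurryFinCLM ℝ V ℝ).contDiff.comp_contDiffOn
    (hf.fderiv_of_isOpen hW (by simp))

theorem DiffForm.IsSmooth.extD {η : DiffForm I X k} (hη : η.IsSmooth) : η.extD.IsSmooth :=
  fun x₀ => (contDiffOn_extDeriv (isOpen_extChartAt_target x₀) (hη x₀)).congr
    fun _ hy => hη.extD_inChart x₀ hy

theorem DiffForm.IsSmooth.extD_isClosed {η : DiffForm I X k} (hη : η.IsSmooth) :
    η.extD.IsClosed := by
  intro x
  have hy := mem_extChartAt_target (I := I) x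
  have h1 : η.extD.inChart x =ᶠ[𝓝 (extChartAt I x x)] extDeriv (η.inChart x) := by
    filter_upwards [(isOpen_extChartAt_target x).mem_nhds hy] with z hz using hη.extD_inChart x hz
  change extDeriv _ _ = 0
  rw [h1.extDeriv_eq]
  exact extDeriv_extDeriv_apply ((hη x).contDiffAt ((isOpen_extChartAt_target x).mem_nhds hy))
    minSmoothness_two_le_infty

omit [I.Boundaryless] [IsManifold I ∞ X] in
theorem DiffForm.IsSmooth.add {η ζ : DiffForm I X k} (hη : η.IsSmooth) (hζ : ζ.IsSmooth) :
    (η + ζ).IsSmooth := fun x₀ => by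
  rw [DiffForm.inChart_add]
  exact (hη x₀).add (hζ x₀)

omit [IsManifold I ∞ X] in
theorem DiffForm.extD_add {η ζ : DiffForm I X k} (hη : η.IsSmooth) (hζ : ζ.IsSmooth) :
    (η + ζ).extD = η.extD + ζ.extD := by
  funext x
  have hx := (isOpen_extChartAt_target (I := I) x).mem_nhds (mem_extChartAt_target (I := I) x)
  change extDeriv _ _ = _
  rw [DiffForm.inChart_add, extDeriv_add (((hη x).contDiffAt hx).differentiableAt (by simp))
    (((hζ x).contDiffAt hx).differentiableAt (by simp))]
  rfl

omit [IsManifold I ∞ X] in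
theorem DiffForm.IsClosed.add {η ζ : DiffForm I X k} (hη : η.IsSmooth) (hζ : ζ.IsSmooth)
    (hη' : η.IsClosed) (hζ' : ζ.IsClosed) : (η + ζ).IsClosed := fun x => by
  rw [DiffForm.extD_add hη hζ, Pi.add_apply, hη' x, hζ' x, add_zero]

end FormCalculus

/-! ### Complex manifolds, real derivatives and holomorphic line bundles -/

section RestrictScalars

variable {E : Type*} [NormedAddCommGroup E] [NormedSpace ℂ E]
  {M : Type*} [TopologicalSpace M] [ChartedSpace E M]
  {E' : Type*} [NormedAddCommGroup E'] [NormedSpace ℂ E']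
  {M' : Type*} [TopologicalSpace M'] [ChartedSpace E' M']
  {F : Type*} [NormedAddCommGroup F] [NormedSpace ℂ F]
  {X : Type*} [TopologicalSpace X] [ChartedSpace (ModelProd E F) X]

theorem ContMDiffWithinAt.real_of_complex {f : M → M'} {n : WithTop ℕ∞} {s : Set M} {x : M}
    (hf : ContMDiffWithinAt 𝓘(ℂ, E) 𝓘(ℂ, E') n f s x) :
    ContMDiffWithinAt 𝓘(ℝ, E) 𝓘(ℝ, E') n f s x :=
  ⟨hf.1, ContDiffWithinAt.restrict_scalars (𝕜 := ℝ) (𝕜' := ℂ) hf.2⟩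

theorem HasMFDerivAt.real_of_complex {f : M → M'} {x : M} {f' : E →L[ℂ] E'}
    (hf : HasMFDerivAt 𝓘(ℂ, E) 𝓘(ℂ, E') f x f') :
    HasMFDerivAt 𝓘(ℝ, E) 𝓘(ℝ, E') f x (f'.restrictScalars ℝ) :=
  ⟨hf.1, HasFDerivWithinAt.restrictScalars (𝕜 := ℝ) (𝕜' := ℂ) hf.2⟩

theorem ContMDiffWithinAt.real_of_complex_to_prod {f : M' → X} {n : WithTop ℕ∞} {s : Set M'}
    {x : M'} (hf : ContMDiffWithinAt 𝓘(ℂ, E') (𝓘(ℂ, E).prod 𝓘(ℂ, F)) n f s x) :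
    ContMDiffWithinAt 𝓘(ℝ, E') (realTotalModel E F) n f s x :=
  ⟨hf.1, ContDiffWithinAt.restrict_scalars (𝕜 := ℝ) (𝕜' := ℂ) hf.2⟩

theorem HasMFDerivAt.real_of_complex_to_prod {f : M' → X} {x : M'} {f' : E' →L[ℂ] E × F}
    (hf : HasMFDerivAt 𝓘(ℂ, E') (𝓘(ℂ, E).prod 𝓘(ℂ, F)) f x f') :
    HasMFDerivAt 𝓘(ℝ, E') (realTotalModel E F) f x (f'.restrictScalars ℝ) :=
  ⟨hf.1, HasFDerivWithinAt.restrictScalars (𝕜 := ℝ) (𝕜' := ℂ) hf.2⟩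

theorem HasMFDerivAt.real_of_complex_from_prod {f : X → M'} {x : X} {f' : E × F →L[ℂ] E'}
    (hf : HasMFDerivAt (𝓘(ℂ, E).prod 𝓘(ℂ, F)) 𝓘(ℂ, E') f x f') :
    HasMFDerivAt (realTotalModel E F) 𝓘(ℝ, E') f x (f'.restrictScalars ℝ) :=
  ⟨hf.1, HasFDerivWithinAt.restrictScalars (𝕜 := ℝ) (𝕜' := ℂ) hf.2⟩

theorem ContMDiffAt.mul_complex {V B X : Type*} [TopologicalSpace X]
    [TopologicalSpace B] [NormedAddCommGroup V] [NormedSpace ℝ V] {I : ModelWithCorners ℝ V B}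
    [ChartedSpace B X] {f g : X → ℂ} {x : X} (hf : ContMDiffAt I 𝓘(ℝ, ℂ) ∞ f x)
    (hg : ContMDiffAt I 𝓘(ℝ, ℂ) ∞ g x) : ContMDiffAt I 𝓘(ℝ, ℂ) ∞ (fun y => f y * g y) x :=
  ((contDiff_fst.mul contDiff_snd : ContDiff ℝ ∞ fun p : ℂ × ℂ =>
    p.1 * p.2).contMDiff.contMDiffAt (x := (f x, g x))).comp x (hf.prodMk_space hg)

end RestrictScalars

section LineBundle

variable {E : Type*} [NormedAddCommGroup E] [NormedSpace ℂ E]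
  {M : Type*} [TopologicalSpace M] [ChartedSpace E M]
  {F : Type*} [NormedAddCommGroup F] [NormedSpace ℂ F]
  {N : M → Type*} [∀ x, AddCommGroup (N x)] [∀ x, Module ℂ (N x)] [∀ x, TopologicalSpace (N x)]
  [TopologicalSpace (Bundle.TotalSpace F N)] [FiberBundle F N] [VectorBundle ℂ F N]

/-- The open set around `x₀` on which both the preferred chart of the base and the preferred
trivialization of the bundle are defined. -/
def trivDomain (F : Type*) [NormedAddCommGroup F] [NormedSpace ℂ F]
    (N : M → Type*) [∀ x, TopologicalSpace (N x)]
    [TopologicalSpace (Bundle.TotalSpace F N)] [FiberBundle F N] (x₀ : M) : Set M :=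
  (chartAt E x₀).source ∩ (trivializationAt F N x₀).baseSet

/-- The local frame of the line bundle `N` given by the preferred trivialization at `x₀` and the
identification `b` of the model fiber with `ℂ`. -/
noncomputable def lineFrame (N : M → Type*) [∀ x, AddCommGroup (N x)] [∀ x, Module ℂ (N x)]
    [∀ x, TopologicalSpace (N x)]
    [TopologicalSpace (Bundle.TotalSpace F N)] [FiberBundle F N] [VectorBundle ℂ F N]
    (b : F ≃L[ℂ] ℂ) (x₀ y : M) : N y :=
  (trivializationAt F N x₀).symmₗ ℂ y (b.symm 1)

/-- The coefficient of `n` with respect to the frame `lineFrame N b x₀`. -/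
noncomputable def frameCoord (b : F ≃L[ℂ] ℂ) (x₀ : M) (u : Bundle.TotalSpace F N) : ℂ :=
  b (trivializationAt F N x₀ u).2

variable (b : F ≃L[ℂ] ℂ) (x₀ : M)

theorem isOpen_trivDomain : IsOpen (trivDomain (E := E) F N x₀) :=
  (chartAt E x₀).open_source.inter (trivializationAt F N x₀).open_baseSet

theorem mem_trivDomain : x₀ ∈ trivDomain (E := E) F N x₀ :=
  ⟨mem_chart_source E x₀, FiberBundle.mem_baseSet_trivializationAt' x₀⟩

theorem symmₗ_eq_smul_lineFrame (y : M) (c : F) :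
    (trivializationAt F N x₀).symmₗ ℂ y c = b c • lineFrame N b x₀ y := by
  rw [lineFrame, ← map_smul, ← map_smul, smul_eq_mul, mul_one, b.symm_apply_apply]

theorem frameCoord_smul_lineFrame {y : M} (hy : y ∈ (trivializationAt F N x₀).baseSet) (c : ℂ) :
    frameCoord b x₀ (⟨y, c • lineFrame N b x₀ y⟩ : Bundle.TotalSpace F N) = c := by
  have h := (trivializationAt F N x₀).linearMapAt_symmₗ (R := ℂ) hy (b.symm c)
  rw [symmₗ_eq_smul_lineFrame b, Bundle.Trivialization.linearMapAt_apply, if_pos hy,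
    b.apply_symm_apply] at h
  rw [frameCoord, h, b.apply_symm_apply]

theorem eq_frameCoord_smul {y : M} (hy : y ∈ (trivializationAt F N x₀).baseSet) (n : N y) :
    n = frameCoord b x₀ (⟨y, n⟩ : Bundle.TotalSpace F N) • lineFrame N b x₀ y := by
  have h := (trivializationAt F N x₀).symmₗ_linearMapAt (R := ℂ) hy n
  rw [symmₗ_eq_smul_lineFrame b, Bundle.Trivialization.linearMapAt_apply, if_pos hy] at h
  exact h.symm

theorem lineFrame_ne_zero {y : M} (hy : y ∈ (trivializationAt F N x₀).baseSet) :
    lineFrame N b x₀ y ≠ 0 := by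
  intro h
  have h1 := frameCoord_smul_lineFrame (N := N) b x₀ hy 1
  have h2 := frameCoord_smul_lineFrame (N := N) b x₀ hy 0
  rw [h, smul_zero] at h1 h2
  exact one_ne_zero (h1.symm.trans h2)


theorem frameCoord_smul {y : M} (hy : y ∈ (trivializationAt F N x₀).baseSet) (a : ℂ) (n : N y) :
    frameCoord b x₀ (⟨y, a • n⟩ : Bundle.TotalSpace F N) =
      a * frameCoord b x₀ (⟨y, n⟩ : Bundle.TotalSpace F N) := by
  conv_lhs => rw [eq_frameCoord_smul b x₀ hy n, ← mul_smul]
  rw [frameCoord_smul_lineFrame b x₀ hy]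

/-- The preferred chart of the total space at any point over `x₀`. -/
theorem extChartAt_totalSpace_apply (u₀ u : Bundle.TotalSpace F N)
    (hu : u.1 ∈ (trivializationAt F N u₀.1).baseSet) :
    extChartAt (realTotalModel E F) u₀ u =
      (chartAt E u₀.1 u.1, b.symm (frameCoord b u₀.1 u)) := by
  rw [FiberBundle.extChartAt, frameCoord, b.symm_apply_apply]
  change (chartAt E u₀.1 (trivializationAt F N u₀.1 u).1, _) = _
  rw [(trivializationAt F N u₀.1).coe_fst' hu]
  rfl

theorem extChartAt_totalSpace_symm_apply (u₀ : Bundle.TotalSpace F N) (y : E) (c : F)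
    (hy : (chartAt E u₀.1).symm y ∈ (trivializationAt F N u₀.1).baseSet) :
    (extChartAt (realTotalModel E F) u₀).symm (y, c) =
      ⟨(chartAt E u₀.1).symm y, b c • lineFrame N b u₀.1 ((chartAt E u₀.1).symm y)⟩ := by
  rw [FiberBundle.extChartAt, ← symmₗ_eq_smul_lineFrame, Bundle.Trivialization.symmₗ_apply _ hy,
    Bundle.Trivialization.mk_symm _ hy]
  rfl

theorem extChartAt_totalSpace_target (u₀ : Bundle.TotalSpace F N) :
    (extChartAt (realTotalModel E F) u₀).target =
      {y : E | y ∈ (chartAt E u₀.1).target ∧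
        (chartAt E u₀.1).symm y ∈ (trivializationAt F N u₀.1).baseSet} ×ˢ univ := by
  rw [FiberBundle.extChartAt_target]
  ext p
  simp

theorem mem_extChartAt_totalSpace_source (u₀ u : Bundle.TotalSpace F N) :
    u ∈ (extChartAt (realTotalModel E F) u₀).source ↔ u.1 ∈ trivDomain (E := E) F N u₀.1 := by
  rw [FiberBundle.extChartAt, PartialEquiv.trans_source]
  constructor
  · rintro ⟨h1, h2⟩
    have h1' : u.1 ∈ (trivializationAt F N u₀.1).baseSet :=
      (trivializationAt F N u₀.1).mem_source.1 h1
    refine ⟨?_, h1'⟩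
    have h3 : (trivializationAt F N u₀.1 u).1 ∈ (extChartAt 𝓘(ℝ, E) u₀.1).source := h2.1
    rw [(trivializationAt F N u₀.1).coe_fst' h1'] at h3
    simpa using h3
  · rintro ⟨h1, h2⟩
    refine ⟨(trivializationAt F N u₀.1).mem_source.2 h2, ?_, mem_univ _⟩
    change (trivializationAt F N u₀.1 u).1 ∈ _
    rw [(trivializationAt F N u₀.1).coe_fst' h2]
    simpa using h1


variable [IsManifold 𝓘(ℂ, E) ω M] [ContMDiffVectorBundle ω F N 𝓘(ℂ, E)]

theorem contMDiffAt_lineFrame {y : M} (hy : y ∈ (trivializationAt F N x₀).baseSet) :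
    ContMDiffAt 𝓘(ℂ, E) (𝓘(ℂ, E).prod 𝓘(ℂ, F)) ω
      (fun y => Bundle.TotalSpace.mk' F y (lineFrame N b x₀ y)) y := by
  rw [(trivializationAt F N x₀).contMDiffAt_section_iff (IB := 𝓘(ℂ, E)) hy]
  refine contMDiffAt_const (c := b.symm 1) |>.congr_of_eventuallyEq ?_
  filter_upwards [(trivializationAt F N x₀).open_baseSet.mem_nhds hy] with z hz
  have h := frameCoord_smul_lineFrame (N := N) b x₀ hz 1
  rw [one_smul, frameCoord] at h
  rw [← h, b.symm_apply_apply]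

theorem isHolomorphicSectionOn_lineFrame :
    IsHolomorphicSectionOn E F (lineFrame N b x₀) (trivializationAt F N x₀).baseSet :=
  fun _ hy => ((contMDiffAt_lineFrame b x₀ hy).mdifferentiableAt
    (by simp)).mdifferentiableWithinAt

theorem smoothSectionAt_lineFrame {y : M} (hy : y ∈ (trivializationAt F N x₀).baseSet) :
    SmoothSectionAt E F (lineFrame N b x₀) y :=
  ContMDiffWithinAt.real_of_complex_to_prod ((contMDiffAt_lineFrame b x₀ hy).of_le le_top)

theorem contMDiffAt_frameCoord {u : Bundle.TotalSpace F N} (hu : u.1 ∈ trivDomain (E := E) F N x₀) :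
    ContMDiffAt (realTotalModel E F) 𝓘(ℝ, ℂ) ∞ (frameCoord b x₀) u := by
  have h1 : ContMDiffAt (realTotalModel E F) 𝓘(ℝ, E × F) ∞
      (extChartAt (realTotalModel E F) (⟨x₀, 0⟩ : Bundle.TotalSpace F N)) u :=
    contMDiffAt_extChartAt' (by
      rw [← extChartAt_source (realTotalModel E F)]
      exact (mem_extChartAt_totalSpace_source _ _).2 hu)
  have h2 : ContDiff ℝ ∞ fun p : E × F => b p.2 :=
    (b.contDiff.restrict_scalars ℝ).comp contDiff_snd
  refine (h2.contMDiff.contMDiffAt.comp u h1).congr_of_eventuallyEq ?_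
  filter_upwards [(FiberBundle.continuous_proj F N).continuousAt.preimage_mem_nhds
    ((trivializationAt F N x₀).open_baseSet.mem_nhds hu.2)] with z hz
  rw [Function.comp_apply, extChartAt_totalSpace_apply b _ _ hz, b.apply_symm_apply]

theorem SmoothSectionAt.frameCoord {σ : (y : M) → N y} {y : M}
    (hσ : SmoothSectionAt E F σ y) (hy : y ∈ trivDomain (E := E) F N x₀) :
    ContMDiffAt 𝓘(ℝ, E) 𝓘(ℝ, ℂ) ∞
      (fun z => frameCoord b x₀ (⟨z, σ z⟩ : Bundle.TotalSpace F N)) y :=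
  ContMDiffAt.comp (g := _root_.frameCoord b x₀) y
    (contMDiffAt_frameCoord (u := (⟨y, σ y⟩ : Bundle.TotalSpace F N)) b x₀ hy) hσ

theorem contMDiffAt_smul_lineFrame {X : Type*} [TopologicalSpace X] {B V : Type*}
    [TopologicalSpace B] [NormedAddCommGroup V] [NormedSpace ℝ V] {I : ModelWithCorners ℝ V B}
    [ChartedSpace B X] {q : X → M} {a : X → ℂ} {x : X}
    (hx : q x ∈ trivDomain (E := E) F N x₀) (hq : ContMDiffAt I 𝓘(ℝ, E) ∞ q x)
    (ha : ContMDiffAt I 𝓘(ℝ, ℂ) ∞ a x) :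
    ContMDiffAt I (realTotalModel E F) ∞
      (fun t => (⟨q t, a t • lineFrame N b x₀ (q t)⟩ : Bundle.TotalSpace F N)) x := by
  have hS : (extChartAt (realTotalModel E F) (⟨x₀, 0⟩ : Bundle.TotalSpace F N)).target ∈
      𝓝 (chartAt E x₀ (q x), b.symm (a x)) := by
    refine (isOpen_extChartAt_target _).mem_nhds ?_
    rw [extChartAt_totalSpace_target]
    refine ⟨⟨(chartAt E x₀).map_source hx.1, ?_⟩, mem_univ _⟩
    rw [(chartAt E x₀).left_inv hx.1]
    exact hx.2
  have h1 := (contMDiffOn_extChartAt_symm (n := ∞) (I := realTotalModel E F)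
    (⟨x₀, 0⟩ : Bundle.TotalSpace F N)).contMDiffAt hS
  have h2 : ContMDiffAt 𝓘(ℝ, E) 𝓘(ℝ, E) ∞ (chartAt E x₀) (q x) :=
    contMDiffAt_extChartAt' (I := 𝓘(ℝ, E)) hx.1
  have h3 : ContMDiffAt 𝓘(ℝ, ℂ) 𝓘(ℝ, F) ∞ b.symm (a x) :=
    (b.symm.contDiff.restrict_scalars ℝ).contMDiff.contMDiffAt
  have h4 : ContMDiffAt I 𝓘(ℝ, E × F) ∞ (fun t => (chartAt E x₀ (q t), b.symm (a t))) x :=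
    (h2.comp x hq).prodMk_space (h3.comp x ha)
  refine (ContMDiffAt.comp x h1 h4).congr_of_eventuallyEq ?_
  filter_upwards [hq.continuousAt.preimage_mem_nhds ((isOpen_trivDomain x₀).mem_nhds hx)] with t ht
  have ht' := (chartAt E x₀).left_inv ht.1
  rw [Function.comp_apply, extChartAt_totalSpace_symm_apply b _ _ _ (by rw [ht']; exact ht.2)]
  rw [ht', b.apply_symm_apply]

theorem smoothSectionAt_smul_lineFrame {a : M → ℂ} {y : M} (hy : y ∈ trivDomain (E := E) F N x₀)
    (ha : ContMDiffAt 𝓘(ℝ, E) 𝓘(ℝ, ℂ) ∞ a y) :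
    SmoothSectionAt E F (fun z => a z • lineFrame N b x₀ z) y :=
  contMDiffAt_smul_lineFrame b x₀ (q := id) hy contMDiffAt_id ha

theorem SmoothSectionAt.smul {σ : (y : M) → N y} {a : M → ℂ} {y : M}
    (ha : ContMDiffAt 𝓘(ℝ, E) 𝓘(ℝ, ℂ) ∞ a y) (b : F ≃L[ℂ] ℂ) (hσ : SmoothSectionAt E F σ y) :
    SmoothSectionAt E F (fun z => a z • σ z) y := by
  have hy := mem_trivDomain (E := E) (F := F) (N := N) y
  have h1 : SmoothSectionAt E F (fun z => (a z * _root_.frameCoord b y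
      (⟨z, σ z⟩ : Bundle.TotalSpace F N)) • lineFrame N b y z) y :=
    smoothSectionAt_smul_lineFrame b y hy (ha.mul_complex (hσ.frameCoord b y hy))
  refine ContMDiffAt.congr_of_eventuallyEq h1 ?_
  filter_upwards [(trivializationAt F N y).open_baseSet.mem_nhds hy.2] with z hz
  rw [mul_smul, ← eq_frameCoord_smul b y hz]

end LineBundle

/-! ### The connection form in a holomorphic frame -/

section Connection

variable {E : Type*} [NormedAddCommGroup E] [NormedSpace ℂ E]
  {M : Type*} [TopologicalSpace M] [ChartedSpace E M] [IsManifold 𝓘(ℂ, E) ω M]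
  {F : Type*} [NormedAddCommGroup F] [NormedSpace ℂ F]
  {N : M → Type*} [∀ x, AddCommGroup (N x)] [∀ x, Module ℂ (N x)] [∀ x, TopologicalSpace (N x)]
  [TopologicalSpace (Bundle.TotalSpace F N)] [FiberBundle F N]
  [∀ x, IsTopologicalAddGroup (N x)] [∀ x, ContinuousSMul ℂ (N x)]
  [VectorBundle ℂ F N] [ContMDiffVectorBundle ω F N 𝓘(ℂ, E)]
  {h : HermitianMetric E F N} {nabla : RealConnection E F N}

theorem SmoothSectionAt.mdifferentiableAt {σ : (y : M) → N y} {x : M}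
    (hσ : SmoothSectionAt E F σ x) :
    MDifferentiableAt 𝓘(ℝ, E) (𝓘(ℝ, E).prod 𝓘(ℝ, F))
      (fun y => Bundle.TotalSpace.mk' F y (σ y)) x :=
  ContMDiffAt.mdifferentiableAt hσ (by simp)

/-- The derivative at `x` of a complex-valued function on `M`. -/
noncomputable def mderivComplex (g : M → ℂ) (x : M) (v : E) : ℂ :=
  mfderiv 𝓘(ℝ, E) 𝓘(ℝ, ℂ) g x v

/-- The Leibniz rule for complex-valued functions, reduced to the one for their real and imaginary
parts by complex linearity of the connection. -/
theorem IsHermitianHolomorphic.leibniz (hn : IsHermitianHolomorphic h nabla) (b : F ≃L[ℂ] ℂ)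
    {g : M → ℂ} {σ : (y : M) → N y} {x : M} (hg : ContMDiffAt 𝓘(ℝ, E) 𝓘(ℝ, ℂ) ∞ g x)
    (hσ : SmoothSectionAt E F σ x) (v : E) :
    nabla (fun y => g y • σ y) x v =
      g x • nabla σ x v + mderivComplex g x v • σ x := by
  have hre : ContMDiffAt 𝓘(ℝ, E) 𝓘(ℝ, ℝ) ∞ (fun y => (g y).re) x :=
    (Complex.reCLM.contDiff.contMDiff.contMDiffAt (x := g x)).comp x hg
  have him : ContMDiffAt 𝓘(ℝ, E) 𝓘(ℝ, ℝ) ∞ (fun y => (g y).im) x :=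
    (Complex.imCLM.contDiff.contMDiff.contMDiffAt (x := g x)).comp x hg
  have hI : SmoothSectionAt E F (fun y => Complex.I • σ y) x :=
    SmoothSectionAt.smul contMDiffAt_const b hσ
  have hreC : ContMDiffAt 𝓘(ℝ, E) 𝓘(ℝ, ℂ) ∞ (fun y => ((g y).re : ℂ)) x :=
    (Complex.ofRealCLM.contDiff.contMDiff.contMDiffAt (x := (g x).re)).comp x hre
  have himC : ContMDiffAt 𝓘(ℝ, E) 𝓘(ℝ, ℂ) ∞ (fun y => ((g y).im : ℂ)) x :=
    (Complex.ofRealCLM.contDiff.contMDiff.contMDiffAt (x := (g x).im)).comp x him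
  have h1 : SmoothSectionAt E F ((fun y => (g y).re) • σ) x := SmoothSectionAt.smul hreC b hσ
  have h2 : SmoothSectionAt E F ((fun y => (g y).im) • fun y => Complex.I • σ y) x :=
    SmoothSectionAt.smul himC b hI
  have hsplit : (fun y => g y • σ y) =
      ((fun y => (g y).re) • σ) + ((fun y => (g y).im) • fun y => Complex.I • σ y) := by
    funext y
    change g y • σ y = ((g y).re : ℂ) • σ y + ((g y).im : ℂ) • Complex.I • σ y
    rw [smul_smul, ← add_smul, Complex.re_add_im]
  have hc := nabla.isCovariantDerivativeOnUniv
  rw [hsplit, hc.add h1.mdifferentiableAt h2.mdifferentiableAt,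
    hc.leibniz hσ.mdifferentiableAt (hre.mdifferentiableAt (by simp)),
    hc.leibniz hI.mdifferentiableAt (him.mdifferentiableAt (by simp))]
  have hdre : (mfderiv 𝓘(ℝ, E) 𝓘(ℝ, ℝ) (fun y => (g y).re) x : E →L[ℝ] ℝ) v =
      (mderivComplex g x v).re := by
    have := mfderiv_comp (I := 𝓘(ℝ, E)) (I' := 𝓘(ℝ, ℂ)) (I'' := 𝓘(ℝ, ℝ)) x
      (Complex.reCLM.differentiableAt (x := g x)).mdifferentiableAt
      (hg.mdifferentiableAt (by simp))
    rw [mfderiv_eq_fderiv, Complex.reCLM.fderiv] at this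
    exact congrArg (fun (A : E →L[ℝ] ℝ) => A v) this
  have hdim : (mfderiv 𝓘(ℝ, E) 𝓘(ℝ, ℝ) (fun y => (g y).im) x : E →L[ℝ] ℝ) v =
      (mderivComplex g x v).im := by
    have := mfderiv_comp (I := 𝓘(ℝ, E)) (I' := 𝓘(ℝ, ℂ)) (I'' := 𝓘(ℝ, ℝ)) x
      (Complex.imCLM.differentiableAt (x := g x)).mdifferentiableAt
      (hg.mdifferentiableAt (by simp))
    rw [mfderiv_eq_fderiv, Complex.imCLM.fderiv] at this
    exact congrArg (fun (A : E →L[ℝ] ℝ) => A v) this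
  change ((g x).re : ℂ) • nabla σ x v
      + Complex.ofReal ((mfderiv 𝓘(ℝ, E) 𝓘(ℝ, ℝ) (fun y => (g y).re) x : E →L[ℝ] ℝ) v) • σ x
    + (((g x).im : ℂ) • nabla (fun y => Complex.I • σ y) x v
      + Complex.ofReal ((mfderiv 𝓘(ℝ, E) 𝓘(ℝ, ℝ) (fun y => (g y).im) x : E →L[ℝ] ℝ) v) • Complex.I • σ x) = _
  rw [hn.complex_linear x σ hσ v, hdre, hdim]
  conv_rhs => rw [← Complex.re_add_im (g x), ← Complex.re_add_im (mderivComplex g x v)]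
  module

theorem RealConnection.congr_of_eventuallyEq {σ τ : (y : M) → N y} {x : M}
    (hσ : SmoothSectionAt E F σ x) (hτ : SmoothSectionAt E F τ x) (hστ : ∀ᶠ y in 𝓝 x, σ y = τ y) :
    nabla σ x = nabla τ x :=
  nabla.isCovariantDerivativeOnUniv.congr_of_eventuallyEq hσ.mdifferentiableAt hτ.mdifferentiableAt
    Filter.univ_mem hστ

/-- The points of the preferred chart of `M` at `x₀` that lie over the domain of the preferred
trivialization of `N` at `x₀`. -/
def trivCoord (F : Type*) [NormedAddCommGroup F] [NormedSpace ℂ F]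
    (N : M → Type*) [∀ x, TopologicalSpace (N x)]
    [TopologicalSpace (Bundle.TotalSpace F N)] [FiberBundle F N] (x₀ : M) : Set E :=
  {z | z ∈ (chartAt E x₀).target ∧ (chartAt E x₀).symm z ∈ (trivializationAt F N x₀).baseSet}

theorem isOpen_trivCoord (x₀ : M) : IsOpen (trivCoord (E := E) F N x₀) :=
  (chartAt E x₀).continuousOn_symm.isOpen_inter_preimage (chartAt E x₀).open_target
    (trivializationAt F N x₀).open_baseSet

theorem symm_mem_trivDomain {x₀ : M} {z : E} (hz : z ∈ trivCoord (E := E) F N x₀) :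
    (chartAt E x₀).symm z ∈ trivDomain (E := E) F N x₀ :=
  ⟨(chartAt E x₀).map_target hz.1, hz.2⟩

theorem chart_mem_trivCoord {x₀ y : M} (hy : y ∈ trivDomain (E := E) F N x₀) :
    chartAt E x₀ y ∈ trivCoord (E := E) F N x₀ :=
  ⟨(chartAt E x₀).map_source hy.1, by rw [(chartAt E x₀).left_inv hy.1]; exact hy.2⟩

/-- The differential of the inverse of the preferred chart at `x₀`. -/
noncomputable def chartSymmDeriv (x₀ : M) (z : E) : E →L[ℝ] E :=
  mfderiv 𝓘(ℝ, E) 𝓘(ℝ, E) (extChartAt 𝓘(ℝ, E) x₀).symm z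

/-- The connection form of `nabla` in the frame `lineFrame N b x₀`, read in the preferred chart
at `x₀`: `∇_v e = A(v) e`. -/
noncomputable def connForm (nabla : RealConnection E F N) (b : F ≃L[ℂ] ℂ) (x₀ : M) (z : E) :
    E →ₗ[ℝ] ℂ :=
  let q := (extChartAt 𝓘(ℝ, E) x₀).symm z
  let D : E →L[ℝ] N q := nabla (lineFrame N b x₀) q
  (b : F →ₗ[ℂ] ℂ).restrictScalars ℝ ∘ₗ
    ((trivializationAt F N x₀).linearMapAt ℂ q).restrictScalars ℝ ∘ₗ D.toLinearMap ∘ₗ (chartSymmDeriv x₀ z).toLinearMap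

variable (b : F ≃L[ℂ] ℂ) (x₀ : M)

theorem connForm_apply {z : E} (hz : z ∈ trivCoord (E := E) F N x₀) (v : E) :
    connForm nabla b x₀ z v = frameCoord b x₀ (⟨(extChartAt 𝓘(ℝ, E) x₀).symm z,
      nabla (lineFrame N b x₀) ((extChartAt 𝓘(ℝ, E) x₀).symm z)
        (chartSymmDeriv x₀ z v : E)⟩ : Bundle.TotalSpace F N) := by
  have h1 := (trivializationAt F N x₀).linearMapAt_apply (R := ℂ)
    (b := (extChartAt 𝓘(ℝ, E) x₀).symm z) (nabla (lineFrame N b x₀) ((extChartAt 𝓘(ℝ, E) x₀).symm z)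
        (chartSymmDeriv x₀ z v : E))
  rw [if_pos (show (extChartAt 𝓘(ℝ, E) x₀).symm z ∈ _ from hz.2)] at h1
  exact congrArg b h1

theorem nabla_lineFrame {z : E} (hz : z ∈ trivCoord (E := E) F N x₀) (v : E) :
    nabla (lineFrame N b x₀) ((extChartAt 𝓘(ℝ, E) x₀).symm z)
        (chartSymmDeriv x₀ z v : E) =
      connForm nabla b x₀ z v • lineFrame N b x₀ ((extChartAt 𝓘(ℝ, E) x₀).symm z) := by
  rw [connForm_apply b x₀ hz]
  exact eq_frameCoord_smul b x₀ hz.2 _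

/-- The vector field on `M` that is constant in the preferred chart at `x₀`. -/
noncomputable def chartField (x₀ : M) (v : E) : (y : M) → TangentSpace 𝓘(ℝ, E) y :=
  VectorField.mpullback 𝓘(ℝ, E) 𝓘(ℝ, E) (extChartAt 𝓘(ℝ, E) x₀) (fun _ => v)

theorem smoothFieldAt_chartField [CompleteSpace E] (v : E) {y : M} (hy : y ∈ (chartAt E x₀).source) :
    SmoothFieldAt (chartField x₀ v) y := by
  refine ContMDiffAt.mpullback_vectorField_preimage (n := ∞) ?_ (contMDiffAt_extChartAt' hy)
    (isInvertible_mfderiv_extChartAt (by simpa using hy)) (by simp)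
  exact contMDiffAt_vectorSpace_iff_contDiffAt.2 contDiffAt_const

theorem chartField_eq (v : E) {y : M} (hy : y ∈ (chartAt E x₀).source) :
    chartField x₀ v y = (chartSymmDeriv x₀ (extChartAt 𝓘(ℝ, E) x₀ y) v : E) := by
  have hy' : y ∈ (extChartAt 𝓘(ℝ, E) x₀).source := by simpa using hy
  have h1 := mfderiv_extChartAt_comp_mfderivWithin_extChartAt_symm' (I := 𝓘(ℝ, E)) hy'
  rw [ModelWithCorners.range_eq_univ, mfderivWithin_univ] at h1
  have hinv := isInvertible_mfderiv_extChartAt (I := 𝓘(ℝ, E)) hy'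
  have h3 : mfderiv 𝓘(ℝ, E) 𝓘(ℝ, E) (extChartAt 𝓘(ℝ, E) x₀) y
      (mfderiv 𝓘(ℝ, E) 𝓘(ℝ, E) (extChartAt 𝓘(ℝ, E) x₀).symm (extChartAt 𝓘(ℝ, E) x₀ y) v) = v :=
    congrArg (fun (A : E →L[ℝ] E) => A v) h1
  obtain ⟨e, he⟩ := hinv
  change (mfderiv 𝓘(ℝ, E) 𝓘(ℝ, E) (extChartAt 𝓘(ℝ, E) x₀) y).inverse v = _
  rw [← he] at h3 ⊢
  rw [ContinuousLinearMap.inverse_equiv]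
  exact (e.symm_apply_eq).2 h3.symm

theorem chartSymmDeriv_self :
    chartSymmDeriv x₀ (extChartAt 𝓘(ℝ, E) x₀ x₀) = ContinuousLinearMap.id ℝ E := by
  rw [chartSymmDeriv, mfderiv_extChartAt_symm_eq_fderiv (I := 𝓘(ℝ, E)) x₀ (mem_extChartAt_target x₀)]
  rw [extChartAt_to_inv]
  refine HasFDerivAt.fderiv ((hasFDerivAt_id _).congr_of_eventuallyEq ?_)
  filter_upwards [(isOpen_extChartAt_target x₀).mem_nhds (mem_extChartAt_target (I := 𝓘(ℝ, E)) x₀)]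
    with z hz using (extChartAt 𝓘(ℝ, E) x₀).right_inv hz

theorem chartField_self (v : E) : chartField x₀ v x₀ = v := by
  rw [chartField_eq x₀ v (mem_chart_source E x₀)]
  exact congrArg (fun (A : E →L[ℝ] E) => A v) (chartSymmDeriv_self x₀)

theorem mlieBracket_chartField [CompleteSpace E] (v w : E) :
    VectorField.mlieBracket 𝓘(ℝ, E) (chartField x₀ v) (chartField x₀ w) x₀ = 0 := by
  have : IsManifold 𝓘(ℝ, E) (minSmoothness ℝ 2) M :=
    IsManifold.of_le minSmoothness_two_le_infty
  have hc : ∀ v : E, MDifferentiableAt 𝓘(ℝ, E) 𝓘(ℝ, E).tangent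
      (fun x => (⟨x, v⟩ : TangentBundle 𝓘(ℝ, E) E)) (extChartAt 𝓘(ℝ, E) x₀ x₀) := fun v =>
    ContMDiffAt.mdifferentiableAt (n := 1)
      (contMDiffAt_vectorSpace_iff_contDiffAt.2 contDiffAt_const) (by simp)
  have h := VectorField.mpullback_mlieBracket (I := 𝓘(ℝ, E)) (I' := 𝓘(ℝ, E))
    (f := extChartAt 𝓘(ℝ, E) x₀) (V := fun _ => v) (W := fun _ => w) (x₀ := x₀) (n := ∞)
    (hc v) (hc w) contMDiffAt_extChartAt minSmoothness_two_le_infty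
  refine h.symm.trans ?_
  have h0 : VectorField.mlieBracket 𝓘(ℝ, E) (fun _ : E => v) (fun _ => w) = 0 := by
    refine VectorField.mlieBracketWithin_univ.symm.trans
      (VectorField.mlieBracketWithin_eq_lieBracketWithin.trans ?_)
    funext z
    simp [VectorField.lieBracketWithin]
    rfl
  rw [h0]
  exact map_zero _

theorem frameCoord_contDiffOn {a : M → ℂ} (ha : ∀ y ∈ trivDomain (E := E) F N x₀,
    ContMDiffAt 𝓘(ℝ, E) 𝓘(ℝ, ℂ) ∞ a y) :
    ContDiffOn ℝ ∞ (fun z => a ((extChartAt 𝓘(ℝ, E) x₀).symm z)) (trivCoord (E := E) F N x₀) := by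
  intro z hz
  have hz' : (extChartAt 𝓘(ℝ, E) x₀).target ∈ 𝓝 z :=
    (isOpen_extChartAt_target x₀).mem_nhds (by simpa using hz.1)
  have h1 := (contMDiffOn_extChartAt_symm (n := ∞) (I := 𝓘(ℝ, E)) x₀).contMDiffAt hz'
  have h2 := ContMDiffAt.comp z (ha _ (symm_mem_trivDomain hz)) h1
  exact (contMDiffAt_iff_contDiffAt.1 h2).contDiffWithinAt

theorem IsHermitianHolomorphic.contDiffOn_connForm [CompleteSpace E]
    (hn : IsHermitianHolomorphic h nabla) (v : E) :
    ContDiffOn ℝ ∞ (fun z => connForm nabla b x₀ z v) (trivCoord (E := E) F N x₀) := by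
  refine (frameCoord_contDiffOn (F := F) (N := N) x₀ (a := fun y => frameCoord b x₀
    (⟨y, nabla (lineFrame N b x₀) y (chartField x₀ v y)⟩ : Bundle.TotalSpace F N)) ?_).congr ?_
  · intro y hy
    exact (hn.smooth y _ _ (smoothSectionAt_lineFrame b x₀ hy.2)
      (smoothFieldAt_chartField x₀ v hy.1)).frameCoord b x₀ hy
  · intro z hz
    have h1 := chartField_eq x₀ v ((chartAt E x₀).map_target hz.1)
    rw [show extChartAt 𝓘(ℝ, E) x₀ ((chartAt E x₀).symm z) = z from
      (chartAt E x₀).right_inv hz.1] at h1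
    rw [connForm_apply b x₀ hz]
    exact congrArg (fun w : E => frameCoord b x₀ (⟨(extChartAt 𝓘(ℝ, E) x₀).symm z,
      nabla (lineFrame N b x₀) ((extChartAt 𝓘(ℝ, E) x₀).symm z) w⟩ : Bundle.TotalSpace F N)) h1.symm

theorem chartSymmDeriv_I_smul {z : E} (hz : z ∈ (chartAt E x₀).target) (v : E) :
    chartSymmDeriv x₀ z (Complex.I • v) = Complex.I • chartSymmDeriv x₀ z v := by
  have h2 : MDifferentiableAt 𝓘(ℂ, E) 𝓘(ℂ, E) (extChartAt 𝓘(ℂ, E) x₀).symm z := by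
    have := mdifferentiableWithinAt_extChartAt_symm (I := 𝓘(ℂ, E)) (x := x₀) (z := z)
      (by simpa using hz)
    rwa [ModelWithCorners.range_eq_univ, mdifferentiableWithinAt_univ] at this
  have h3 : mfderiv 𝓘(ℝ, E) 𝓘(ℝ, E) (extChartAt 𝓘(ℝ, E) x₀).symm z = _ :=
    (HasMFDerivAt.real_of_complex h2.hasMFDerivAt).mfderiv
  rw [chartSymmDeriv, h3]
  exact map_smul (mfderiv 𝓘(ℂ, E) 𝓘(ℂ, E) (extChartAt 𝓘(ℂ, E) x₀).symm z : E →L[ℂ] E) _ _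

/-- The connection form of the Chern connection in a holomorphic frame has type `(1, 0)`. -/
theorem IsHermitianHolomorphic.connForm_I_smul (hn : IsHermitianHolomorphic h nabla) {z : E}
    (hz : z ∈ trivCoord (E := E) F N x₀) (v : E) :
    connForm nabla b x₀ z (Complex.I • v) = Complex.I * connForm nabla b x₀ z v := by
  rw [connForm_apply b x₀ hz, connForm_apply b x₀ hz, chartSymmDeriv_I_smul x₀ hz.1]
  have h2 := hn.holomorphic _ (lineFrame N b x₀) (trivializationAt F N x₀).open_baseSet
    (isHolomorphicSectionOn_lineFrame b x₀) ((extChartAt 𝓘(ℝ, E) x₀).symm z) hz.2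
    (chartSymmDeriv x₀ z v : E)
  exact (congrArg (fun t => frameCoord b x₀ (⟨(extChartAt 𝓘(ℝ, E) x₀).symm z, t⟩ :
    Bundle.TotalSpace F N)) h2).trans (frameCoord_smul b x₀ hz.2 _ _)

end Connection

/-! ### The norm and the curvature in a holomorphic frame -/

section Canonical

variable {E : Type*} [NormedAddCommGroup E] [NormedSpace ℂ E]
  {M : Type*} [TopologicalSpace M] [ChartedSpace E M] [IsManifold 𝓘(ℂ, E) ω M]
  {F : Type*} [NormedAddCommGroup F] [NormedSpace ℂ F]
  {N : M → Type*} [∀ x, AddCommGroup (N x)] [∀ x, Module ℂ (N x)] [∀ x, TopologicalSpace (N x)]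
  [TopologicalSpace (Bundle.TotalSpace F N)] [FiberBundle F N]
  [∀ x, IsTopologicalAddGroup (N x)] [∀ x, ContinuousSMul ℂ (N x)]
  [VectorBundle ℂ F N] [ContMDiffVectorBundle ω F N 𝓘(ℂ, E)]
  {h : HermitianMetric E F N} {nabla : RealConnection E F N}
  (b : F ≃L[ℂ] ℂ) (x₀ : M)

theorem HermitianMetric.inner_self_eq (h : HermitianMetric E F N) (y : M) (n : N y) :
    h.inner y n n = ((h.inner y n n).re : ℂ) :=
  (Complex.conj_eq_iff_real.1 (h.conj_symm y n n)).elim fun r hr => by rw [hr, Complex.ofReal_re]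

/-- The square of the norm of the frame `lineFrame N b x₀`, read in the preferred chart at `x₀`. -/
noncomputable def frameNormSq (h : HermitianMetric E F N) (b : F ≃L[ℂ] ℂ) (x₀ : M) (z : E) : ℝ :=
  (h.inner _ (lineFrame N b x₀ ((extChartAt 𝓘(ℝ, E) x₀).symm z))
    (lineFrame N b x₀ ((extChartAt 𝓘(ℝ, E) x₀).symm z))).re

theorem frameNormSq_pos {z : E} (hz : z ∈ trivCoord (E := E) F N x₀) : 0 < frameNormSq h b x₀ z :=
  h.pos _ _ (lineFrame_ne_zero b x₀ hz.2)

theorem contMDiffAt_inner_lineFrame {y : M} (hy : y ∈ (trivializationAt F N x₀).baseSet) :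
    ContMDiffAt 𝓘(ℝ, E) 𝓘(ℝ, ℂ) ∞
      (fun y => h.inner y (lineFrame N b x₀ y) (lineFrame N b x₀ y)) y := by
  have h1 : ContMDiffAt 𝓘(ℝ, E) 𝓘(ℝ, ℝ) ∞
      (fun y => (h.inner y (lineFrame N b x₀ y) (lineFrame N b x₀ y)).re) y :=
    ContMDiffAt.comp (g := fun u : Bundle.TotalSpace F N => (h.inner u.1 u.2 u.2).re) y
      h.smooth.contMDiffAt (smoothSectionAt_lineFrame b x₀ hy)
  have h2 := (Complex.ofRealCLM.contDiff.contMDiff.contMDiffAt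
    (x := (h.inner y (lineFrame N b x₀ y) (lineFrame N b x₀ y)).re)).comp y h1
  exact h2.congr_of_eventuallyEq (Filter.Eventually.of_forall fun z => h.inner_self_eq z _)

theorem contDiffOn_frameNormSq :
    ContDiffOn ℝ ∞ (frameNormSq h b x₀) (trivCoord (E := E) F N x₀) :=
  Complex.reCLM.contDiff.comp_contDiffOn (frameCoord_contDiffOn (F := F) (N := N) x₀
    fun _ hy => contMDiffAt_inner_lineFrame b x₀ hy.2)

theorem mderivComplex_chartSymmDeriv {g : M → ℂ} {z : E} (hz : z ∈ (chartAt E x₀).target)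
    (hg : MDifferentiableAt 𝓘(ℝ, E) 𝓘(ℝ, ℂ) g ((extChartAt 𝓘(ℝ, E) x₀).symm z)) (v : E) :
    mderivComplex g ((extChartAt 𝓘(ℝ, E) x₀).symm z) (chartSymmDeriv x₀ z v) =
      fderiv ℝ (fun z => g ((extChartAt 𝓘(ℝ, E) x₀).symm z)) z v := by
  have h2 : MDifferentiableAt 𝓘(ℝ, E) 𝓘(ℝ, E) (extChartAt 𝓘(ℝ, E) x₀).symm z := by
    have := mdifferentiableWithinAt_extChartAt_symm (I := 𝓘(ℝ, E)) (x := x₀) (z := z)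
      (by simpa using hz)
    rwa [ModelWithCorners.range_eq_univ, mdifferentiableWithinAt_univ] at this
  have h3 := mfderiv_comp z hg h2
  rw [mfderiv_eq_fderiv] at h3
  exact (congrArg (fun (A : E →L[ℝ] ℂ) => A v) h3).symm

/-- The logarithmic derivative of the norm of the frame is the real part of the connection form,
since the connection is hermitian. -/
theorem IsHermitianHolomorphic.fderiv_frameNormSq (hn : IsHermitianHolomorphic h nabla) {z : E}
    (hz : z ∈ trivCoord (E := E) F N x₀) (v : E) :
    fderiv ℝ (frameNormSq h b x₀) z v =
      2 * frameNormSq h b x₀ z * (connForm nabla b x₀ z v).re := by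
  set q := (extChartAt 𝓘(ℝ, E) x₀).symm z with hq
  have hs := smoothSectionAt_lineFrame (E := E) (N := N) b x₀ hz.2
  have h1 := hn.hermitian q _ _ hs hs (chartSymmDeriv x₀ z v)
  have hg := contMDiffAt_inner_lineFrame (h := h) b x₀ hz.2
  have h2 := mderivComplex_chartSymmDeriv x₀ hz.1 (hg.mdifferentiableAt (by simp)) v
  have h3 := h2.symm.trans h1
  have h4 := nabla_lineFrame (nabla := nabla) b x₀ hz v
  have h5 : h.inner q (connForm nabla b x₀ z v • lineFrame N b x₀ q) (lineFrame N b x₀ q) +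
      h.inner q (lineFrame N b x₀ q) (connForm nabla b x₀ z v • lineFrame N b x₀ q) =
      ((2 * frameNormSq h b x₀ z * (connForm nabla b x₀ z v).re : ℝ) : ℂ) := by
    rw [map_smulₛₗ, LinearMap.smul_apply, map_smul, smul_eq_mul, smul_eq_mul,
      h.inner_self_eq q (lineFrame N b x₀ q), ← add_mul]
    change (conj (connForm nabla b x₀ z v) + connForm nabla b x₀ z v) * (frameNormSq h b x₀ z : ℂ) = _
    rw [add_comm, Complex.add_conj]
    push_cast
    ring
  have h6 : fderiv ℝ (fun z => h.inner _ (lineFrame N b x₀ ((extChartAt 𝓘(ℝ, E) x₀).symm z))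
    (lineFrame N b x₀ ((extChartAt 𝓘(ℝ, E) x₀).symm z))) z v = _ :=
    h3.trans ((congrArg (fun t => h.inner q t (lineFrame N b x₀ q) +
      h.inner q (lineFrame N b x₀ q) t) h4).trans h5)
  have h7 : HasFDerivAt (frameNormSq h b x₀) (Complex.reCLM ∘L fderiv ℝ (fun z =>
      h.inner _ (lineFrame N b x₀ ((extChartAt 𝓘(ℝ, E) x₀).symm z))
    (lineFrame N b x₀ ((extChartAt 𝓘(ℝ, E) x₀).symm z))) z) z := by
    refine Complex.reCLM.hasFDerivAt.comp z (DifferentiableAt.hasFDerivAt ?_)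
    exact ((frameCoord_contDiffOn (F := F) (N := N) x₀
      fun _ hy => contMDiffAt_inner_lineFrame (h := h) b x₀ hy.2).contDiffAt
        ((isOpen_trivCoord x₀).mem_nhds hz)).differentiableAt (by simp)
  rw [h7.fderiv, ContinuousLinearMap.comp_apply, h6]
  exact Complex.ofReal_re _

theorem extChartAt_mem_trivCoord_self :
    extChartAt 𝓘(ℝ, E) x₀ x₀ ∈ trivCoord (E := E) F N x₀ :=
  chart_mem_trivCoord (mem_trivDomain x₀)

/-- The exterior derivative of the connection form is the curvature. It suffices to compare the two
on the commuting vector fields that are constant in the chart; the terms quadratic in the connection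
form cancel. -/
theorem IsHermitianHolomorphic.fderiv_connForm_sub [CompleteSpace E]
    (hn : IsHermitianHolomorphic h nabla)
    {κ : DiffForm 𝓘(ℝ, E) M 2} (hc : HasCurvatureTwoPiI nabla κ) (v w : E) :
    fderiv ℝ (fun z => connForm nabla b x₀ z w) (extChartAt 𝓘(ℝ, E) x₀ x₀) v -
      fderiv ℝ (fun z => connForm nabla b x₀ z v) (extChartAt 𝓘(ℝ, E) x₀ x₀) w =
      2 * Real.pi * Complex.I * (κ x₀ ![v, w] : ℝ) := by
  set z₀ := extChartAt 𝓘(ℝ, E) x₀ x₀ with hz₀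
  have hz : z₀ ∈ trivCoord (E := E) F N x₀ := extChartAt_mem_trivCoord_self x₀
  have hx₀ := mem_trivDomain (E := E) (F := F) (N := N) x₀
  have hs := smoothSectionAt_lineFrame (E := E) (N := N) b x₀ hx₀.2
  have hfield : ∀ w : E, ∀ y ∈ trivDomain (E := E) F N x₀,
      nabla (lineFrame N b x₀) y (chartField x₀ w y) =
        connForm nabla b x₀ (extChartAt 𝓘(ℝ, E) x₀ y) w • lineFrame N b x₀ y := by
    intro w y hy
    have h1 := nabla_lineFrame (nabla := nabla) b x₀ (chart_mem_trivCoord hy) w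
    have h2 : (extChartAt 𝓘(ℝ, E) x₀).symm (chartAt E x₀ y) = y := (chartAt E x₀).left_inv hy.1
    rw [h2] at h1
    exact (congrArg (fun t : E => nabla (lineFrame N b x₀) y t)
      (chartField_eq x₀ w hy.1)).trans h1
  have hsm : ∀ w : E, ContMDiffAt 𝓘(ℝ, E) 𝓘(ℝ, ℂ) ∞
      (fun y => connForm nabla b x₀ (extChartAt 𝓘(ℝ, E) x₀ y) w) x₀ := fun w =>
    ContMDiffAt.comp (g := fun z => connForm nabla b x₀ z w) x₀
      (((hn.contDiffOn_connForm b x₀ w).contDiffAt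
        ((isOpen_trivCoord x₀).mem_nhds hz)).contMDiffAt) contMDiffAt_extChartAt
  have hnn : ∀ v w : E, nabla (fun y => nabla (lineFrame N b x₀) y (chartField x₀ w y)) x₀
      (chartField x₀ v x₀) = (connForm nabla b x₀ z₀ w * connForm nabla b x₀ z₀ v +
        fderiv ℝ (fun z => connForm nabla b x₀ z w) z₀ v) • lineFrame N b x₀ x₀ := by
    intro v w
    have h1 : nabla (fun y => nabla (lineFrame N b x₀) y (chartField x₀ w y)) x₀ =
        nabla (fun y => connForm nabla b x₀ (extChartAt 𝓘(ℝ, E) x₀ y) w • lineFrame N b x₀ y) x₀ := by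
      refine RealConnection.congr_of_eventuallyEq
        (hn.smooth x₀ _ _ hs (smoothFieldAt_chartField x₀ w hx₀.1))
        (SmoothSectionAt.smul (hsm w) b hs) ?_
      filter_upwards [(isOpen_trivDomain x₀).mem_nhds hx₀] with y hy using hfield w y hy
    have h2 := hn.leibniz b (hsm w) hs v
    have h3 : nabla (lineFrame N b x₀) x₀ v = connForm nabla b x₀ z₀ v • lineFrame N b x₀ x₀ :=
      (congrArg (fun t : E => nabla (lineFrame N b x₀) x₀ t) (chartField_self x₀ v)).symm.trans
        (hfield v x₀ hx₀)
    have h4 : mderivComplex (fun y => connForm nabla b x₀ (extChartAt 𝓘(ℝ, E) x₀ y) w) x₀ v =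
        fderiv ℝ (fun z => connForm nabla b x₀ z w) z₀ v := by
      have h5 := mderivComplex_chartSymmDeriv (g := fun y =>
        connForm nabla b x₀ (extChartAt 𝓘(ℝ, E) x₀ y) w) x₀ (z := z₀) hz.1 (by
          rw [hz₀, extChartAt_to_inv]; exact (hsm w).mdifferentiableAt (by simp)) v
      have h6 : (extChartAt 𝓘(ℝ, E) x₀).symm z₀ = x₀ := extChartAt_to_inv x₀
      have h7 : chartSymmDeriv x₀ z₀ v = v :=
        congrArg (fun (A : E →L[ℝ] E) => A v) (chartSymmDeriv_self x₀)
      rw [h6, h7] at h5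
      rw [h5]
      refine congrArg (fun (A : E →L[ℝ] ℂ) => A v) (Filter.EventuallyEq.fderiv_eq ?_)
      filter_upwards [(isOpen_trivCoord x₀).mem_nhds hz] with z hz
      rw [(extChartAt 𝓘(ℝ, E) x₀).right_inv (by simpa using hz.1)]
    refine (congrArg (fun t : E => nabla (fun y => nabla (lineFrame N b x₀) y
      (chartField x₀ w y)) x₀ t) (chartField_self x₀ v)).trans ?_
    refine (congrArg (fun (A : E →L[ℝ] N x₀) => A v) h1).trans (h2.trans ?_)
    rw [h3, h4, smul_smul, ← add_smul]
  have hK := hc x₀ (lineFrame N b x₀) (chartField x₀ v) (chartField x₀ w) hs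
    (smoothFieldAt_chartField x₀ v hx₀.1) (smoothFieldAt_chartField x₀ w hx₀.1)
  rw [hnn, hnn, mlieBracket_chartField, map_zero, sub_zero, ← sub_smul] at hK
  have hK' := smul_left_injective ℂ (lineFrame_ne_zero b x₀ hx₀.2) hK
  have hf : ∀ v w v' w' : E, v = v' → w = w' → κ x₀ ![v, w] = κ x₀ ![v', w'] := by
    rintro v w _ _ rfl rfl; rfl
  rw [show κ x₀ ![v, w] = κ x₀ ![chartField x₀ v x₀, chartField x₀ w x₀] from
    hf _ _ _ _ (chartField_self x₀ v).symm (chartField_self x₀ w).symm]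
  linear_combination hK'

end Canonical

/-! ### The canonical form in local coordinates -/

section Canonical

variable {E : Type*} [NormedAddCommGroup E] [NormedSpace ℂ E]
  {M : Type*} [TopologicalSpace M] [ChartedSpace E M] [IsManifold 𝓘(ℂ, E) ω M]
  {F : Type*} [NormedAddCommGroup F] [NormedSpace ℂ F]
  {N : M → Type*} [∀ x, AddCommGroup (N x)] [∀ x, Module ℂ (N x)] [∀ x, TopologicalSpace (N x)]
  [TopologicalSpace (Bundle.TotalSpace F N)] [FiberBundle F N]
  [∀ x, IsTopologicalAddGroup (N x)] [∀ x, ContinuousSMul ℂ (N x)]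
  [VectorBundle ℂ F N] [ContMDiffVectorBundle ω F N 𝓘(ℂ, E)]
  {h : HermitianMetric E F N} {nabla : RealConnection E F N}
  (b : F ≃L[ℂ] ℂ) (x₀ : M)

theorem verticalProj_apply (u : Bundle.TotalSpace F N) (v : E) (c : F) :
    verticalProj nabla u (v, c) =
      nabla (fun y => frameCoord b u.1 u • lineFrame N b u.1 y) u.1 v +
        b c • lineFrame N b u.1 u.1 := by
  have h1 : (fun y => (trivializationAt F N u.1).symmₗ ℂ y (trivializationAt F N u.1 u).2) =
      fun y => frameCoord b u.1 u • lineFrame N b u.1 y := by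
    funext y
    rw [symmₗ_eq_smul_lineFrame b]
    rfl
  rw [← h1, ← symmₗ_eq_smul_lineFrame]
  rfl

/-- The differential of the inverse of the preferred chart of the total space at `u₀`. -/
noncomputable def totalSymmDeriv (u₀ : Bundle.TotalSpace F N) (p : E × F) : E × F →L[ℝ] E × F :=
  mfderiv 𝓘(ℝ, E × F) (realTotalModel E F) (extChartAt (realTotalModel E F) u₀).symm p

theorem totalSpace_symm_eq (u₀ : Bundle.TotalSpace F N) {p : E × F}
    (hp : p.1 ∈ trivCoord (E := E) F N u₀.1) :
    (extChartAt (realTotalModel E F) u₀).symm p =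
      ⟨(extChartAt 𝓘(ℝ, E) u₀.1).symm p.1,
        b p.2 • lineFrame N b u₀.1 ((extChartAt 𝓘(ℝ, E) u₀.1).symm p.1)⟩ :=
  extChartAt_totalSpace_symm_apply b u₀ p.1 p.2 hp.2

theorem mem_totalSpace_target_iff (u₀ : Bundle.TotalSpace F N) {p : E × F} :
    p ∈ (extChartAt (realTotalModel E F) u₀).target ↔ p.1 ∈ trivCoord (E := E) F N u₀.1 := by
  rw [extChartAt_totalSpace_target]
  exact ⟨fun h => h.1, fun h => ⟨h, mem_univ _⟩⟩

theorem hasFDerivAt_chart_symm (x₀ x₁ : M) {z : E} (hz : z ∈ (chartAt E x₀).target)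
    (hx₁ : (extChartAt 𝓘(ℝ, E) x₀).symm z = x₁) :
    HasFDerivAt (fun z => chartAt E x₁ ((extChartAt 𝓘(ℝ, E) x₀).symm z)) (chartSymmDeriv x₀ z) z := by
  subst hx₁
  have hz' : z ∈ (extChartAt 𝓘(ℝ, E) x₀).target := by simpa using hz
  have h1 : ContMDiffAt 𝓘(ℝ, E) 𝓘(ℝ, E) ∞ (extChartAt 𝓘(ℝ, E) ((extChartAt 𝓘(ℝ, E) x₀).symm z) ∘
      (extChartAt 𝓘(ℝ, E) x₀).symm) z :=
    contMDiffAt_extChartAt.comp z ((contMDiffOn_extChartAt_symm x₀).contMDiffAt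
      ((isOpen_extChartAt_target x₀).mem_nhds hz'))
  have h2 := ((contMDiffAt_iff_contDiffAt.1 h1).differentiableAt (by simp)).hasFDerivAt
  rw [chartSymmDeriv, mfderiv_extChartAt_symm_eq_fderiv (I := 𝓘(ℝ, E)) x₀ hz']
  exact h2

/-- The differential of the inverse of the preferred chart of the total space at `u₀`. Its values are
read in the preferred chart at the image point, so that the second component is the derivative of
the fiber coordinate multiplied by the transition function between the two frames. -/
theorem totalSymmDeriv_apply (u₀ : Bundle.TotalSpace F N) {p : E × F}
    (hp : p.1 ∈ trivCoord (E := E) F N u₀.1) (v : E × F) :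
    totalSymmDeriv u₀ p v =
      (chartSymmDeriv u₀.1 p.1 v.1, b.symm
        (mderivComplex (fun y => frameCoord b ((extChartAt 𝓘(ℝ, E) u₀.1).symm p.1)
            (⟨y, lineFrame N b u₀.1 y⟩ : Bundle.TotalSpace F N))
            ((extChartAt 𝓘(ℝ, E) u₀.1).symm p.1) (chartSymmDeriv u₀.1 p.1 v.1) * b p.2 +
          frameCoord b ((extChartAt 𝓘(ℝ, E) u₀.1).symm p.1)
            (⟨_, lineFrame N b u₀.1 ((extChartAt 𝓘(ℝ, E) u₀.1).symm p.1)⟩ :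
              Bundle.TotalSpace F N) * b v.2)) := by
  set q := (extChartAt 𝓘(ℝ, E) u₀.1).symm p.1 with hq
  set u := (extChartAt (realTotalModel E F) u₀).symm p with hu
  set g : M → ℂ := fun y => frameCoord b q (⟨y, lineFrame N b u₀.1 y⟩ : Bundle.TotalSpace F N)
    with hg
  have huq : u.1 = q := by rw [hu, totalSpace_symm_eq b u₀ hp]
  have hgs : ContMDiffAt 𝓘(ℝ, E) 𝓘(ℝ, ℂ) ∞ g q :=
    (smoothSectionAt_lineFrame (E := E) (N := N) b u₀.1 hp.2).frameCoord b q (mem_trivDomain q)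
  have hgd : HasFDerivAt (fun z => g ((extChartAt 𝓘(ℝ, E) u₀.1).symm z))
      (fderiv ℝ (fun z => g ((extChartAt 𝓘(ℝ, E) u₀.1).symm z)) p.1) p.1 := by
    refine DifferentiableAt.hasFDerivAt ?_
    have h1 := ContMDiffAt.comp p.1 hgs ((contMDiffOn_extChartAt_symm (n := ∞) u₀.1).contMDiffAt
      ((isOpen_extChartAt_target u₀.1).mem_nhds (by simpa using hp.1)))
    exact (contMDiffAt_iff_contDiffAt.1 h1).differentiableAt (by simp)
  have hd1 := (hasFDerivAt_chart_symm u₀.1 q hp.1 rfl).comp p hasFDerivAt_fst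
  have hd2 := (hgd.comp p hasFDerivAt_fst).mul
    ((b.toContinuousLinearMap.restrictScalars ℝ).hasFDerivAt.comp p hasFDerivAt_snd)
  have hd3 := hd1.prodMk ((b.symm.toContinuousLinearMap.restrictScalars ℝ).hasFDerivAt.comp p hd2)
  have heq : (extChartAt (realTotalModel E F) u ∘ (extChartAt (realTotalModel E F) u₀).symm)
      =ᶠ[𝓝 p] fun p' => (chartAt E q ((extChartAt 𝓘(ℝ, E) u₀.1).symm p'.1),
        b.symm (g ((extChartAt 𝓘(ℝ, E) u₀.1).symm p'.1) * b p'.2)) := by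
    have hc : ContinuousAt (fun p' : E × F => (extChartAt 𝓘(ℝ, E) u₀.1).symm p'.1) p :=
      ((continuousOn_extChartAt_symm u₀.1).continuousAt
        ((isOpen_extChartAt_target u₀.1).mem_nhds (by simpa using hp.1))).comp continuousAt_fst
    have hO := (trivializationAt F N q).open_baseSet.mem_nhds
      (FiberBundle.mem_baseSet_trivializationAt' q)
    filter_upwards [hc.preimage_mem_nhds hO, ((isOpen_trivCoord (F := F) (N := N) u₀.1).preimage
      continuous_fst).mem_nhds hp] with p' hp' hp''
    rw [Function.comp_apply, totalSpace_symm_eq b u₀ hp'', extChartAt_totalSpace_apply b _ _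
      (by rw [huq]; exact hp'), huq, frameCoord_smul b q hp', mul_comm]
  have hfin := (hd3.congr_of_eventuallyEq heq).fderiv
  rw [totalSymmDeriv, mfderiv_extChartAt_symm_eq_fderiv (I := realTotalModel E F) u₀
    ((mem_totalSpace_target_iff u₀).2 hp)]
  refine (congrArg (fun (A : E × F →L[ℝ] E × F) => A v) hfin).trans ?_
  rw [mderivComplex_chartSymmDeriv u₀.1 hp.1 (hgs.mdifferentiableAt (by simp))]
  simp only [ContinuousLinearMap.prod_apply, ContinuousLinearMap.comp_apply,
    add_apply, smul_apply, ContinuousLinearMap.coe_fst',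
    ContinuousLinearMap.coe_snd', Function.comp_apply, smul_eq_mul]
  refine Prod.ext rfl (congrArg b.symm ?_)
  change g q * b v.2 + b p.2 * _ = _
  rw [add_comm, mul_comm (b p.2)]

/-- The vertical projection in the coordinates of the preferred chart at `u₀`: at the point with
fiber coordinate `ζ` it is `(v, c) ↦ (ζ A(v) + c) e`, where `A` is the connection form in the
frame `e`. -/
theorem IsHermitianHolomorphic.verticalProj_totalSymmDeriv (hn : IsHermitianHolomorphic h nabla)
    (u₀ : Bundle.TotalSpace F N) {p : E × F}
    (hp : p.1 ∈ trivCoord (E := E) F N u₀.1) (v : E × F) {u : Bundle.TotalSpace F N}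
    (hu : u = ⟨(extChartAt 𝓘(ℝ, E) u₀.1).symm p.1,
        b p.2 • lineFrame N b u₀.1 ((extChartAt 𝓘(ℝ, E) u₀.1).symm p.1)⟩) :
    verticalProj nabla u (totalSymmDeriv u₀ p v) =
      (b p.2 * connForm nabla b u₀.1 p.1 v.1 + b v.2) • lineFrame N b u₀.1 u.1 := by
  rw [totalSymmDeriv_apply b u₀ hp]
  subst hu
  set q := (extChartAt 𝓘(ℝ, E) u₀.1).symm p.1 with hq
  set g : M → ℂ := fun y => frameCoord b q (⟨y, lineFrame N b u₀.1 y⟩ : Bundle.TotalSpace F N)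
    with hg
  rw [verticalProj_apply b]
  have hqs := smoothSectionAt_lineFrame (E := E) (N := N) b q (mem_trivDomain (E := E) (F := F) q).2
  have h0s := smoothSectionAt_lineFrame (E := E) (N := N) b u₀.1 hp.2
  have hgs : ContMDiffAt 𝓘(ℝ, E) 𝓘(ℝ, ℂ) ∞ g q := h0s.frameCoord b q (mem_trivDomain q)
  have hq' := (mem_trivDomain (E := E) (F := F) (N := N) q).2
  have hfr : lineFrame N b u₀.1 q = g q • lineFrame N b q q := eq_frameCoord_smul b q hq' _
  have h1 := hn.leibniz b (contMDiffAt_const (c := frameCoord b q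
    (⟨q, b p.2 • lineFrame N b u₀.1 q⟩ : Bundle.TotalSpace F N))) hqs (chartSymmDeriv u₀.1 p.1 v.1)
  have h2 : nabla (lineFrame N b u₀.1) q = nabla (fun y => g y • lineFrame N b q y) q := by
    refine RealConnection.congr_of_eventuallyEq h0s (SmoothSectionAt.smul hgs b hqs) ?_
    filter_upwards [(trivializationAt F N q).open_baseSet.mem_nhds hq'] with y hy using
      eq_frameCoord_smul b q hy _
  have h3 := hn.leibniz b hgs hqs (chartSymmDeriv u₀.1 p.1 v.1)
  have h4 := nabla_lineFrame (nabla := nabla) b u₀.1 hp v.1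
  have h5 := (congrArg (fun (A : E →L[ℝ] N q) => A (chartSymmDeriv u₀.1 p.1 v.1)) h2).symm.trans h4
  have h6 := h3.symm.trans h5
  have h7 : mderivComplex (fun _ : M => frameCoord b q
      (⟨q, b p.2 • lineFrame N b u₀.1 q⟩ : Bundle.TotalSpace F N)) q
      (chartSymmDeriv u₀.1 p.1 v.1) = 0 := by
    rw [mderivComplex, mfderiv_const]
    rfl
  rw [h7, zero_smul, add_zero] at h1
  refine (congrArg₂ (· + ·) h1 rfl).trans ?_
  rw [b.apply_symm_apply, frameCoord_smul b q hq']
  rw [hfr] at h6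
  change (b p.2 * g q) • nabla (lineFrame N b q) q (chartSymmDeriv u₀.1 p.1 v.1) +
    (mderivComplex g q (chartSymmDeriv u₀.1 p.1 v.1) * b p.2 + g q * b v.2) • lineFrame N b q q =
    (b p.2 * connForm nabla b u₀.1 p.1 v.1 + b v.2) • lineFrame N b u₀.1 q
  have h8 : g q • nabla (lineFrame N b q) q (chartSymmDeriv u₀.1 p.1 v.1) =
    connForm nabla b u₀.1 p.1 v.1 • g q • lineFrame N b q q -
      mderivComplex g q (chartSymmDeriv u₀.1 p.1 v.1) • lineFrame N b q q := eq_sub_of_add_eq h6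
  rw [mul_smul, h8, hfr]
  module

end Canonical

/-! ### The form `p^* κ + d(r² α)` -/

section Canonical

variable {E : Type*} [NormedAddCommGroup E] [NormedSpace ℂ E] [FiniteDimensional ℂ E]
  {M : Type*} [TopologicalSpace M] [ChartedSpace E M] [IsManifold 𝓘(ℂ, E) ω M]
  {F : Type*} [NormedAddCommGroup F] [NormedSpace ℂ F] [FiniteDimensional ℂ F]
  {N : M → Type*} [∀ x, AddCommGroup (N x)] [∀ x, Module ℂ (N x)] [∀ x, TopologicalSpace (N x)]
  [TopologicalSpace (Bundle.TotalSpace F N)] [FiberBundle F N]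
  [∀ x, IsTopologicalAddGroup (N x)] [∀ x, ContinuousSMul ℂ (N x)]
  [VectorBundle ℂ F N] [ContMDiffVectorBundle ω F N 𝓘(ℂ, E)]
  {h : HermitianMetric E F N} {nabla : RealConnection E F N}
  (b : F ≃L[ℂ] ℂ) (x₀ : M)

/-- The form `r² α` on the total space. -/
noncomputable def sqNormTransgression (h : HermitianMetric E F N) (nabla : RealConnection E F N) :
    DiffForm (realTotalModel E F) (Bundle.TotalSpace F N) 1 :=
  fun u => (h.inner u.1 u.2 u.2).re • transgressionForm h nabla u

/-- The factor `r²` cancels the one in the denominator of `α`. On the zero section, where the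
transgression form has the junk value `0`, both sides vanish. -/
theorem sqNormTransgression_apply (u : Bundle.TotalSpace F N) (v : Fin 1 → E × F) :
    sqNormTransgression h nabla u v =
      (2 * Real.pi)⁻¹ * (h.inner u.1 u.2 (verticalProj nabla u (v 0))).im := by
  change (h.inner u.1 u.2 u.2).re * ((2 * Real.pi * (h.inner u.1 u.2 u.2).re)⁻¹ *
    (h.inner u.1 u.2 (verticalProj nabla u (v 0))).im) = _
  by_cases hu : u.2 = 0
  · simp [hu]
  · have := h.pos _ _ hu
    have hp := Real.pi_pos
    field_simp

/-- The vertical projection in local coordinates, as a multiple of the frame. -/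
noncomputable def verticalCoord (nabla : RealConnection E F N) (b : F ≃L[ℂ] ℂ) (x₀ : M) (p : E × F) :
    E × F →ₗ[ℝ] ℂ :=
  (LinearMap.mulLeft ℝ (b p.2)) ∘ₗ connForm nabla b x₀ p.1 ∘ₗ LinearMap.fst ℝ E F +
    (b : F →ₗ[ℂ] ℂ).restrictScalars ℝ ∘ₗ LinearMap.snd ℝ E F

theorem verticalCoord_apply (p v : E × F) :
    verticalCoord nabla b x₀ p v = b p.2 * connForm nabla b x₀ p.1 v.1 + b v.2 := rfl

/-- The form `r² α` in local coordinates. -/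
noncomputable def coordTransgression (h : HermitianMetric E F N) (nabla : RealConnection E F N)
    (b : F ≃L[ℂ] ℂ) (x₀ : M) (p : E × F) : E × F →L[ℝ] ℝ :=
  LinearMap.toContinuousLinearMap (((2 * Real.pi)⁻¹ * frameNormSq h b x₀ p.1) •
    Complex.imLm ∘ₗ (LinearMap.mulLeft ℝ (conj (b p.2))) ∘ₗ verticalCoord nabla b x₀ p)

theorem coordTransgression_apply (p v : E × F) :
    coordTransgression h nabla b x₀ p v = (2 * Real.pi)⁻¹ * frameNormSq h b x₀ p.1 *
      (conj (b p.2) * (b p.2 * connForm nabla b x₀ p.1 v.1 + b v.2)).im := rfl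

theorem IsHermitianHolomorphic.sqNormTransgression_inChart (hn : IsHermitianHolomorphic h nabla)
    (u₀ : Bundle.TotalSpace F N) {p : E × F} (hp : p.1 ∈ trivCoord (E := E) F N u₀.1) :
    (sqNormTransgression h nabla).inChart u₀ p =
      ContinuousAlternatingMap.ofSubsingleton ℝ (E × F) ℝ 0 (coordTransgression h nabla b u₀.1 p) := by
  ext v
  have hu := totalSpace_symm_eq b u₀ hp
  have h1 := hn.verticalProj_totalSymmDeriv b u₀ hp (v 0) hu
  have h2 : ∀ u : Bundle.TotalSpace F N, u = ⟨(extChartAt 𝓘(ℝ, E) u₀.1).symm p.1,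
        b p.2 • lineFrame N b u₀.1 ((extChartAt 𝓘(ℝ, E) u₀.1).symm p.1)⟩ → ∀ c : ℂ,
      (h.inner u.1 u.2 (c • lineFrame N b u₀.1 u.1)).im =
        frameNormSq h b u₀.1 p.1 * (conj (b p.2) * c).im := by
    rintro u rfl c
    rw [map_smul, map_smulₛₗ, LinearMap.smul_apply, h.inner_self_eq, smul_eq_mul, smul_eq_mul,
      ← mul_assoc, mul_comm, mul_comm c]
    exact Complex.im_ofReal_mul _ _
  refine (sqNormTransgression_apply _ _).trans ?_
  have h3 := h2 _ hu (b p.2 * connForm nabla b u₀.1 p.1 (v 0).1 + b (v 0).2)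
  refine (congrArg (fun t => (2 * Real.pi)⁻¹ * t)
    ((congrArg (fun t => (h.inner _ _ t).im) h1).trans h3)).trans ?_
  change _ = coordTransgression h nabla b u₀.1 p (v 0)
  rw [coordTransgression_apply, mul_assoc]

theorem IsHermitianHolomorphic.contDiffOn_coordTransgression (hn : IsHermitianHolomorphic h nabla) :
    ContDiffOn ℝ ∞ (coordTransgression h nabla b x₀) (trivCoord (E := E) F N x₀ ×ˢ univ) := by
  have hE : CompleteSpace E := FiniteDimensional.complete ℂ E
  rw [contDiffOn_clm_apply]
  intro v
  simp only [coordTransgression_apply]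
  have hb : ContDiffOn ℝ ∞ (fun p : E × F => b p.2) (trivCoord (E := E) F N x₀ ×ˢ univ) :=
    ((b.contDiff.restrict_scalars ℝ).comp contDiff_snd).contDiffOn
  have hA := (hn.contDiffOn_connForm b x₀ v.1).comp (contDiffOn_fst (s := trivCoord (E := E) F N x₀ ×ˢ
    (univ : Set F))) fun p hp => hp.1
  have hH := (contDiffOn_frameNormSq (h := h) b x₀).comp (contDiffOn_fst (s := trivCoord (E := E) F N x₀ ×ˢ
    (univ : Set F))) fun p hp => hp.1
  exact (contDiffOn_const.mul hH).mul (Complex.imCLM.contDiff.comp_contDiffOn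
    ((Complex.conjCLE.contDiff.comp_contDiffOn hb).mul ((hb.mul hA).add contDiffOn_const)))

theorem IsHermitianHolomorphic.isSmooth_sqNormTransgression (b : F ≃L[ℂ] ℂ) (hn : IsHermitianHolomorphic h nabla) :
    (sqNormTransgression h nabla).IsSmooth := by
  intro u₀
  have h1 : ContDiff ℝ ∞ fun A : E × F →L[ℝ] ℝ =>
      ContinuousAlternatingMap.ofSubsingleton ℝ (E × F) ℝ (0 : Fin 1) A :=
    (ContinuousAlternatingMap.ofSubsingletonLIE (𝕜 := ℝ) (E := E × F) (F := ℝ)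
      (i := (0 : Fin 1))).contDiff
  have h2 : (extChartAt (realTotalModel E F) u₀).target =
      trivCoord (E := E) F N u₀.1 ×ˢ univ := extChartAt_totalSpace_target u₀
  rw [h2]
  exact (h1.comp_contDiffOn (hn.contDiffOn_coordTransgression b u₀.1)).congr fun p hp =>
    hn.sqNormTransgression_inChart b u₀ hp.1

theorem mfderiv_proj_totalSymmDeriv (b : F ≃L[ℂ] ℂ) (u₀ : Bundle.TotalSpace F N) {p : E × F}
    (hp : p.1 ∈ trivCoord (E := E) F N u₀.1) (v : E × F) :
    (mfderiv (realTotalModel E F) 𝓘(ℝ, E) (Bundle.TotalSpace.proj : Bundle.TotalSpace F N → M)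
      ((extChartAt (realTotalModel E F) u₀).symm p) : E × F →L[ℝ] E) (totalSymmDeriv u₀ p v) =
      chartSymmDeriv u₀.1 p.1 v.1 := by
  have hpt := (mem_totalSpace_target_iff u₀).2 hp
  have h1 : MDifferentiableAt 𝓘(ℝ, E × F) (realTotalModel E F)
      (extChartAt (realTotalModel E F) u₀).symm p :=
    ((contMDiffOn_extChartAt_symm (n := ∞) u₀).contMDiffAt
      ((isOpen_extChartAt_target u₀).mem_nhds hpt)).mdifferentiableAt (by simp)
  have h2 : MDifferentiableAt 𝓘(ℝ, E) 𝓘(ℝ, E) (extChartAt 𝓘(ℝ, E) u₀.1).symm p.1 :=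
    ((contMDiffOn_extChartAt_symm (n := ∞) u₀.1).contMDiffAt
      ((isOpen_extChartAt_target u₀.1).mem_nhds (by simpa using hp.1))).mdifferentiableAt (by simp)
  have h3 := mfderiv_comp p ((Bundle.contMDiff_proj N (n := ∞) (IB := 𝓘(ℝ, E))
    (𝕜 := ℝ) (F := F)).mdifferentiableAt (by simp)) h1
  have hfst : MDifferentiableAt 𝓘(ℝ, E × F) 𝓘(ℝ, E) (Prod.fst : E × F → E) p :=
    differentiableAt_fst.mdifferentiableAt
  have h4 := mfderiv_comp p h2 hfst
  have h5 : (Bundle.TotalSpace.proj : Bundle.TotalSpace F N → M) ∘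
      (extChartAt (realTotalModel E F) u₀).symm =ᶠ[𝓝 p]
      (extChartAt 𝓘(ℝ, E) u₀.1).symm ∘ (Prod.fst : E × F → E) := by
    filter_upwards [(isOpen_extChartAt_target u₀).mem_nhds hpt] with p' hp'
    rw [Function.comp_apply, totalSpace_symm_eq b u₀ ((mem_totalSpace_target_iff u₀).1 hp')]
    rfl
  have h6 := h3.symm.trans (h5.mfderiv_eq.trans h4)
  rw [mfderiv_eq_fderiv, fderiv_fst] at h6
  exact congrArg (fun (A : E × F →L[ℝ] E) => A v) h6

theorem pullback_proj_inChart (b : F ≃L[ℂ] ℂ) {k : ℕ} (κ : DiffForm 𝓘(ℝ, E) M k)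
    (u₀ : Bundle.TotalSpace F N) {p : E × F} (hp : p.1 ∈ trivCoord (E := E) F N u₀.1) :
    (DiffForm.pullback (I' := realTotalModel E F)
      (Bundle.TotalSpace.proj : Bundle.TotalSpace F N → M) κ).inChart u₀ p =
      (κ.inChart u₀.1 p.1).compContinuousLinearMap (ContinuousLinearMap.fst ℝ E F) := by
  ext v
  have h1 : ∀ i, (mfderiv (realTotalModel E F) 𝓘(ℝ, E)
      (Bundle.TotalSpace.proj : Bundle.TotalSpace F N → M)
      ((extChartAt (realTotalModel E F) u₀).symm p) : E × F →L[ℝ] E) (totalSymmDeriv u₀ p (v i)) =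
      chartSymmDeriv u₀.1 p.1 (v i).1 := fun i => mfderiv_proj_totalSymmDeriv b u₀ hp (v i)
  have h2 : ((extChartAt (realTotalModel E F) u₀).symm p).1 = (extChartAt 𝓘(ℝ, E) u₀.1).symm p.1 := by
    rw [totalSpace_symm_eq b u₀ hp]
  have h3 : ∀ q q' : M, q = q' → ∀ w : Fin k → E, κ q w = κ q' w := by rintro q _ rfl w; rfl
  refine (h3 _ _ h2 _).trans ?_
  exact congrArg (κ ((extChartAt 𝓘(ℝ, E) u₀.1).symm p.1)) (funext h1)

theorem isSmooth_pullback_proj (b : F ≃L[ℂ] ℂ) {k : ℕ} {κ : DiffForm 𝓘(ℝ, E) M k}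
    (hκ : κ.IsSmooth) : (DiffForm.pullback (I' := realTotalModel E F)
      (Bundle.TotalSpace.proj : Bundle.TotalSpace F N → M) κ).IsSmooth := by
  intro u₀
  have h2 : (extChartAt (realTotalModel E F) u₀).target =
      trivCoord (E := E) F N u₀.1 ×ˢ univ := extChartAt_totalSpace_target u₀
  rw [h2]
  have h3 : ContDiffOn ℝ ∞ (fun p : E × F => κ.inChart u₀.1 p.1)
      (trivCoord (E := E) F N u₀.1 ×ˢ univ) :=
    (hκ u₀.1).comp contDiffOn_fst fun p hp => by simpa using hp.1.1
  have h4 := (ContinuousAlternatingMap.compContinuousLinearMapCLM (F := ℝ) (ι := Fin k)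
    (ContinuousLinearMap.fst ℝ E F)).contDiff.comp_contDiffOn (n := ∞) h3
  exact h4.congr fun p hp => pullback_proj_inChart b κ u₀ hp.1

theorem isClosed_pullback_proj (b : F ≃L[ℂ] ℂ) {k : ℕ} {κ : DiffForm 𝓘(ℝ, E) M k}
    (hκ : κ.IsSmooth) (hκ' : κ.IsClosed) : (DiffForm.pullback (I' := realTotalModel E F)
      (Bundle.TotalSpace.proj : Bundle.TotalSpace F N → M) κ).IsClosed := by
  intro u
  have hu : (extChartAt (realTotalModel E F) u u) = (extChartAt 𝓘(ℝ, E) u.1 u.1, b.symm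
      (frameCoord b u.1 u)) :=
    extChartAt_totalSpace_apply b u u (FiberBundle.mem_baseSet_trivializationAt' u.1)
  have hmem : (extChartAt (realTotalModel E F) u u).1 ∈ trivCoord (E := E) F N u.1 := by
    rw [hu]; exact extChartAt_mem_trivCoord_self u.1
  have h1 : (DiffForm.pullback (I' := realTotalModel E F)
      (Bundle.TotalSpace.proj : Bundle.TotalSpace F N → M) κ).inChart u =ᶠ[𝓝
        (extChartAt (realTotalModel E F) u u)] fun p =>
      (κ.inChart u.1 p.1).compContinuousLinearMap (fderiv ℝ (Prod.fst : E × F → E) p) := by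
    filter_upwards [((isOpen_trivCoord (F := F) (N := N) u.1).preimage
      continuous_fst).mem_nhds hmem] with p hp
    rw [pullback_proj_inChart b κ u hp, fderiv_fst]
  change extDeriv _ _ = 0
  rw [h1.extDeriv_eq]
  have hd : DifferentiableAt ℝ (κ.inChart u.1) (extChartAt (realTotalModel E F) u u).1 := by
    rw [hu]
    exact ((hκ u.1).contDiffAt ((isOpen_extChartAt_target u.1).mem_nhds
      (mem_extChartAt_target u.1))).differentiableAt (by simp)
  rw [extDeriv_pullback hd contDiffAt_fst minSmoothness_two_le_infty, hu]
  have := hκ' u.1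
  change extDeriv _ _ = 0 at this
  rw [this]
  ext v
  rfl

theorem IsHermitianHolomorphic.isSmooth_canonicalForm (b : F ≃L[ℂ] ℂ)
    (hn : IsHermitianHolomorphic h nabla) {κ : DiffForm 𝓘(ℝ, E) M 2} (hκ : κ.IsSmooth) :
    (canonicalForm h nabla κ).IsSmooth :=
  (isSmooth_pullback_proj b hκ).add (hn.isSmooth_sqNormTransgression b).extD

theorem IsHermitianHolomorphic.isClosed_canonicalForm (b : F ≃L[ℂ] ℂ)
    (hn : IsHermitianHolomorphic h nabla) {κ : DiffForm 𝓘(ℝ, E) M 2} (hκ : κ.IsSmooth)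
    (hκ' : κ.IsClosed) : (canonicalForm h nabla κ).IsClosed :=
  DiffForm.IsClosed.add (isSmooth_pullback_proj b hκ) (hn.isSmooth_sqNormTransgression b).extD
    (isClosed_pullback_proj b hκ hκ') (hn.isSmooth_sqNormTransgression b).extD_isClosed

theorem pullback_proj_apply (κ : DiffForm 𝓘(ℝ, E) M 2) (u : Bundle.TotalSpace F N) (b : F ≃L[ℂ] ℂ)
    (v w : E × F) : (DiffForm.pullback (I' := realTotalModel E F)
      (Bundle.TotalSpace.proj : Bundle.TotalSpace F N → M) κ) u ![v, w] = κ u.1 ![v.1, w.1] := by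
  have hu : (extChartAt (realTotalModel E F) u u).1 = extChartAt 𝓘(ℝ, E) u.1 u.1 := by
    rw [extChartAt_totalSpace_apply b u u (FiberBundle.mem_baseSet_trivializationAt' u.1)]
    rfl
  have hmem : (extChartAt (realTotalModel E F) u u).1 ∈ trivCoord (E := E) F N u.1 := by
    rw [hu]; exact extChartAt_mem_trivCoord_self u.1
  have hid : totalSymmDeriv u (extChartAt (realTotalModel E F) u u) =
      ContinuousLinearMap.id ℝ (E × F) := by
    rw [totalSymmDeriv, mfderiv_extChartAt_symm_eq_fderiv (I := realTotalModel E F) u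
      (mem_extChartAt_target u), extChartAt_to_inv]
    refine HasFDerivAt.fderiv ((hasFDerivAt_id _).congr_of_eventuallyEq ?_)
    filter_upwards [(isOpen_extChartAt_target u).mem_nhds (mem_extChartAt_target u)]
      with z hz using (extChartAt (realTotalModel E F) u).right_inv hz
  have h1 : ∀ v : E × F, (mfderiv (realTotalModel E F) 𝓘(ℝ, E)
      (Bundle.TotalSpace.proj : Bundle.TotalSpace F N → M) u : E × F →L[ℝ] E) v = v.1 := by
    intro v
    have h2 := mfderiv_proj_totalSymmDeriv b u hmem v
    rw [hid, hu, chartSymmDeriv_self, extChartAt_to_inv] at h2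
    exact h2
  have h3 : ∀ v w v' w' : E, v = v' → w = w' → κ u.1 ![v, w] = κ u.1 ![v', w'] := by
    rintro v w _ _ rfl rfl; rfl
  refine Eq.trans ?_ (h3 _ _ _ _ (h1 v) (h1 w))
  refine congrArg (fun t : Fin 2 → E => κ u.1 t) (funext fun i => ?_)
  fin_cases i <;> rfl

/-- The differential of `r² α` in the local coordinates at the base point: `r² κ` comes from the
curvature, and the second term is the standard area form of the fiber applied to the vertical
components. -/
theorem IsHermitianHolomorphic.extD_sqNormTransgression_apply (hn : IsHermitianHolomorphic h nabla)
    {κ : DiffForm 𝓘(ℝ, E) M 2} (hc : HasCurvatureTwoPiI nabla κ) (u : Bundle.TotalSpace F N)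
    (v w : E × F) :
    (sqNormTransgression h nabla).extD u ![v, w] =
      (h.inner u.1 u.2 u.2).re * κ u.1 ![v.1, w.1] +
      frameNormSq h b u.1 (extChartAt 𝓘(ℝ, E) u.1 u.1) / Real.pi *
        (conj (verticalCoord nabla b u.1 (extChartAt (realTotalModel E F) u u) v) *
          verticalCoord nabla b u.1 (extChartAt (realTotalModel E F) u u) w).im := by
  have hE : CompleteSpace E := FiniteDimensional.complete ℂ E
  set p := extChartAt (realTotalModel E F) u u with hpdef
  have hu : p = (extChartAt 𝓘(ℝ, E) u.1 u.1, b.symm (frameCoord b u.1 u)) :=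
    extChartAt_totalSpace_apply b u u (FiberBundle.mem_baseSet_trivializationAt' u.1)
  have hz := extChartAt_mem_trivCoord_self (E := E) (F := F) (N := N) u.1
  have hp1 : p.1 = extChartAt 𝓘(ℝ, E) u.1 u.1 := by rw [hu]
  have hmem : p.1 ∈ trivCoord (E := E) F N u.1 := by rw [hp1]; exact hz
  have hopen : IsOpen (trivCoord (E := E) F N u.1 ×ˢ (univ : Set F)) :=
    (isOpen_trivCoord u.1).prod isOpen_univ
  have hd : DifferentiableAt ℝ (coordTransgression h nabla b u.1) p :=
    ((hn.contDiffOn_coordTransgression b u.1).contDiffAt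
      (hopen.mem_nhds ⟨hmem, mem_univ _⟩)).differentiableAt (by simp)
  have h1 : (sqNormTransgression h nabla).inChart u =ᶠ[𝓝 p] fun p =>
      ContinuousAlternatingMap.ofSubsingleton ℝ (E × F) ℝ (0 : Fin 1)
        (coordTransgression h nabla b u.1 p) := by
    filter_upwards [hopen.mem_nhds ⟨hmem, mem_univ _⟩] with p hp using
      hn.sqNormTransgression_inChart b u hp.1
  refine (congrArg (fun A : (E × F) [⋀^Fin 2]→L[ℝ] ℝ => A ![v, w]) h1.extDeriv_eq).trans ?_
  have hd' : DifferentiableAt ℝ (fun p => ContinuousAlternatingMap.ofSubsingleton ℝ (E × F) ℝ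
      (0 : Fin 1) (coordTransgression h nabla b u.1 p)) p :=
    (ContinuousAlternatingMap.ofSubsingletonLIE (𝕜 := ℝ) (E := E × F) (F := ℝ)
      (i := (0 : Fin 1))).differentiable.differentiableAt.comp p hd
  refine (extDeriv_apply hd' ![v, w]).trans ?_
  rw [Fin.sum_univ_two]
  have hH : HasFDerivAt (fun p : E × F => frameNormSq h b u.1 p.1)
      ((fderiv ℝ (frameNormSq h b u.1) p.1) ∘L ContinuousLinearMap.fst ℝ E F) p :=
    HasFDerivAt.comp p (((contDiffOn_frameNormSq b u.1).contDiffAt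
      ((isOpen_trivCoord u.1).mem_nhds hmem)).differentiableAt (by simp)).hasFDerivAt hasFDerivAt_fst
  have hA : ∀ x : E, HasFDerivAt (fun p : E × F => connForm nabla b u.1 p.1 x)
      ((fderiv ℝ (fun z => connForm nabla b u.1 z x) p.1) ∘L ContinuousLinearMap.fst ℝ E F) p :=
    fun x => HasFDerivAt.comp p (g := fun z => connForm nabla b u.1 z x)
      (((hn.contDiffOn_connForm b u.1 x).contDiffAt
      ((isOpen_trivCoord u.1).mem_nhds hmem)).differentiableAt (by simp)).hasFDerivAt hasFDerivAt_fst
  have hb : HasFDerivAt (fun p : E × F => b p.2)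
      ((b.toContinuousLinearMap.restrictScalars ℝ) ∘L ContinuousLinearMap.snd ℝ E F) p :=
    (b.toContinuousLinearMap.restrictScalars ℝ).hasFDerivAt.comp p hasFDerivAt_snd
  have hcj : HasFDerivAt (fun p : E × F => conj (b p.2))
      ((Complex.conjCLE : ℂ →L[ℝ] ℂ) ∘L ((b.toContinuousLinearMap.restrictScalars ℝ) ∘L
        ContinuousLinearMap.snd ℝ E F)) p :=
    HasFDerivAt.comp p (g := fun z : ℂ => conj z) Complex.conjCLE.hasFDerivAt hb
  have hD : ∀ v w : E × F, fderiv ℝ (fun p => coordTransgression h nabla b u.1 p w) p v =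
      (2 * Real.pi)⁻¹ * (fderiv ℝ (frameNormSq h b u.1) p.1 v.1 *
        (conj (b p.2) * (b p.2 * connForm nabla b u.1 p.1 w.1 + b w.2)).im +
        frameNormSq h b u.1 p.1 * (conj (b v.2) * (b p.2 * connForm nabla b u.1 p.1 w.1 + b w.2) +
          conj (b p.2) * (b v.2 * connForm nabla b u.1 p.1 w.1 +
            b p.2 * fderiv ℝ (fun z => connForm nabla b u.1 z w.1) p.1 v.1)).im) := by
    intro v w
    have h2 := ((hH.const_mul (2 * Real.pi)⁻¹).mul (Complex.imCLM.hasFDerivAt.comp p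
      (hcj.mul ((hb.mul (hA w.1)).add_const (b w.2)))))
    have h3 : (fun p => coordTransgression h nabla b u.1 p w) = _ :=
      funext fun p => coordTransgression_apply b u.1 p w
    rw [h3]
    refine (congrArg (fun (A : E × F →L[ℝ] ℝ) => A v) h2.fderiv).trans ?_
    simp
    ring
  have e1 : (fun x => (ContinuousAlternatingMap.ofSubsingleton ℝ (E × F) ℝ (0 : Fin 1)
      (coordTransgression h nabla b u.1 x)) (Fin.removeNth 0 ![v, w])) =
      fun p => coordTransgression h nabla b u.1 p w := rfl
  have e2 : (fun x => (ContinuousAlternatingMap.ofSubsingleton ℝ (E × F) ℝ (0 : Fin 1)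
      (coordTransgression h nabla b u.1 x)) (Fin.removeNth 1 ![v, w])) =
      fun p => coordTransgression h nabla b u.1 p v := rfl
  rw [e1, e2, show (![v, w] : Fin 2 → E × F) 0 = v from rfl,
    show (![v, w] : Fin 2 → E × F) 1 = w from rfl, hD, hD, hn.fderiv_frameNormSq b u.1 hmem, hn.fderiv_frameNormSq b u.1 hmem]
  have hcurv := hn.fderiv_connForm_sub b u.1 hc v.1 w.1
  rw [← hp1] at hcurv
  have hr : (h.inner u.1 u.2 u.2).re = frameNormSq h b u.1 p.1 * Complex.normSq (b p.2) := by
    rw [hu, b.apply_symm_apply, frameNormSq, extChartAt_to_inv]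
    have h2 := eq_frameCoord_smul b u.1 (FiberBundle.mem_baseSet_trivializationAt' u.1) u.2
    have h3 : h.inner u.1 u.2 u.2 = _ := congrArg (fun t => h.inner u.1 t t) h2
    rw [h3, map_smul, map_smulₛₗ, LinearMap.smul_apply, h.inner_self_eq, smul_eq_mul, smul_eq_mul,
      ← mul_assoc, Complex.mul_conj, ← Complex.ofReal_mul, Complex.ofReal_re, mul_comm,
      Complex.ofReal_re]
  rw [hr, ← hp1, verticalCoord_apply, verticalCoord_apply]
  have hc2 := congrArg Complex.im hcurv
  rw [show (2 * Real.pi * Complex.I * (κ u.1 ![v.1, w.1] : ℝ) : ℂ).im =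
    2 * Real.pi * κ u.1 ![v.1, w.1] by simp, Complex.sub_im] at hc2
  have hpi := Real.pi_ne_zero
  -- With `d‖e‖² = 2 ‖e‖² Re A` and `dA = 2πi κ` inserted, the claim is an identity between the
  -- real and imaginary parts of finitely many complex numbers.
  generalize fderiv ℝ (fun z => connForm nabla b u.1 z w.1) p.1 v.1 = X at *
  generalize fderiv ℝ (fun z => connForm nabla b u.1 z v.1) p.1 w.1 = Y at *
  generalize connForm nabla b u.1 p.1 w.1 = Aw at *
  generalize connForm nabla b u.1 p.1 v.1 = Av at *
  generalize b v.2 = bv at *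
  generalize b w.2 = bw at *
  generalize b p.2 = a at *
  generalize frameNormSq h b u.1 p.1 = H at *
  have e3 : κ u.1 ![v.1, w.1] = (X.im - Y.im) / (2 * Real.pi) := by
    rw [hc2]; field_simp
  rw [e3]
  simp only [Complex.mul_im, Complex.mul_re, Complex.add_im, Complex.add_re, Complex.conj_re,
    Complex.conj_im, Complex.normSq_apply, Fin.val_zero, Fin.val_one, pow_zero, pow_one, one_smul,
    neg_smul]
  field_simp
  ring

end Canonical

/-! ### Compatibility with the complex structure -/

section Canonical

variable {E : Type*} [NormedAddCommGroup E] [NormedSpace ℂ E] [FiniteDimensional ℂ E]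
  {M : Type*} [TopologicalSpace M] [ChartedSpace E M] [IsManifold 𝓘(ℂ, E) ω M]
  {F : Type*} [NormedAddCommGroup F] [NormedSpace ℂ F] [FiniteDimensional ℂ F]
  {N : M → Type*} [∀ x, AddCommGroup (N x)] [∀ x, Module ℂ (N x)] [∀ x, TopologicalSpace (N x)]
  [TopologicalSpace (Bundle.TotalSpace F N)] [FiberBundle F N]
  [∀ x, IsTopologicalAddGroup (N x)] [∀ x, ContinuousSMul ℂ (N x)]
  [VectorBundle ℂ F N] [ContMDiffVectorBundle ω F N 𝓘(ℂ, E)]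
  {h : HermitianMetric E F N} {nabla : RealConnection E F N}

/-- The canonical form at `u` is the sum of the horizontal part `(1 + r²) p^* κ` and of the vertical
part `(‖e‖² / π) Im (conj K · K)`, where `K` is the vertical projection in the frame `e`. -/
theorem IsHermitianHolomorphic.canonicalForm_apply (b : F ≃L[ℂ] ℂ)
    (hn : IsHermitianHolomorphic h nabla)
    {κ : DiffForm 𝓘(ℝ, E) M 2} (hc : HasCurvatureTwoPiI nabla κ) (u : Bundle.TotalSpace F N)
    (v w : E × F) :
    canonicalForm h nabla κ u ![v, w] =
      (1 + (h.inner u.1 u.2 u.2).re) * κ u.1 ![v.1, w.1] +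
      frameNormSq h b u.1 (extChartAt 𝓘(ℝ, E) u.1 u.1) / Real.pi *
        (conj (verticalCoord nabla b u.1 (extChartAt (realTotalModel E F) u u) v) *
          verticalCoord nabla b u.1 (extChartAt (realTotalModel E F) u u) w).im := by
  have h1 := pullback_proj_apply κ u b v w
  have h2 := hn.extD_sqNormTransgression_apply b hc u v w
  refine (congrArg₂ (· + ·) h1 h2).trans ?_
  ring

theorem IsHermitianHolomorphic.verticalCoord_I_smul (b : F ≃L[ℂ] ℂ)
    (hn : IsHermitianHolomorphic h nabla) (u : Bundle.TotalSpace F N) (v : E × F) :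
    verticalCoord nabla b u.1 (extChartAt (realTotalModel E F) u u) (Complex.I • v) =
      Complex.I * verticalCoord nabla b u.1 (extChartAt (realTotalModel E F) u u) v := by
  have hmem : (extChartAt (realTotalModel E F) u u).1 ∈ trivCoord (E := E) F N u.1 :=
    (mem_totalSpace_target_iff u).1 (mem_extChartAt_target u)
  rw [verticalCoord_apply, verticalCoord_apply, Prod.smul_fst, Prod.smul_snd,
    hn.connForm_I_smul b u.1 hmem, map_smul, smul_eq_mul]
  ring

/-- Multiplication by `i` on the tangent spaces of the total space. The tangent spaces are all equal
to `E × F`; since the charts are holomorphic, the constant field `i` is the complex structure. -/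
noncomputable def mulI (E : Type*) [NormedAddCommGroup E] [NormedSpace ℂ E]
    {M : Type*} [TopologicalSpace M] [ChartedSpace E M]
    (F : Type*) [NormedAddCommGroup F] [NormedSpace ℂ F] (N : M → Type*)
    [∀ x, TopologicalSpace (N x)] [TopologicalSpace (Bundle.TotalSpace F N)] [FiberBundle F N] :
    EndField (realTotalModel E F) (Bundle.TotalSpace F N) := fun _ =>
  ((Complex.I • ContinuousLinearMap.id ℂ (E × F)).restrictScalars ℝ : E × F →L[ℝ] E × F)

theorem frameNormSq_self_pos (b : F ≃L[ℂ] ℂ) (x : M) :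
    0 < frameNormSq h b x (extChartAt 𝓘(ℝ, E) x x) :=
  frameNormSq_pos b x (extChartAt_mem_trivCoord_self x)

/-- The canonical form is compatible with the complex structure of the total space. -/
theorem IsHermitianHolomorphic.isCompatibleAt_mulI (b : F ≃L[ℂ] ℂ)
    (hn : IsHermitianHolomorphic h nabla) {κ : DiffForm 𝓘(ℝ, E) M 2} (hκ : IsKahlerForm κ)
    (hc : HasCurvatureTwoPiI nabla κ) (u : Bundle.TotalSpace F N) :
    IsCompatibleAt (canonicalForm h nabla κ) (mulI E F N) u := by
  have hr : 0 ≤ (h.inner u.1 u.2 u.2).re := by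
    by_cases hu : u.2 = 0
    · simp [hu]
    · exact (h.pos _ _ hu).le
  have hH := frameNormSq_self_pos (h := h) b u.1
  have hpi := Real.pi_pos
  refine ⟨fun (v w : E × F) => ?_, fun (v : E × F) hv => ?_⟩
  · refine (hn.canonicalForm_apply b hc u (Complex.I • v) (Complex.I • w)).trans
      (Eq.trans ?_ (hn.canonicalForm_apply b hc u v w).symm)
    rw [hn.verticalCoord_I_smul, hn.verticalCoord_I_smul, Prod.smul_fst, Prod.smul_fst,
      hκ.invariant, map_mul, Complex.conj_I]
    congr 3
    linear_combination (-(conj (verticalCoord nabla b u.1 (extChartAt (realTotalModel E F) u u) v) *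
          verticalCoord nabla b u.1 (extChartAt (realTotalModel E F) u u) w)) * Complex.I_mul_I
  · refine lt_of_lt_of_eq ?_ (hn.canonicalForm_apply b hc u v (Complex.I • v)).symm
    rw [hn.verticalCoord_I_smul, Prod.smul_fst]
    have hK : (conj (verticalCoord nabla b u.1 (extChartAt (realTotalModel E F) u u) v) *
        (Complex.I * verticalCoord nabla b u.1 (extChartAt (realTotalModel E F) u u) v)).im =
        Complex.normSq (verticalCoord nabla b u.1 (extChartAt (realTotalModel E F) u u) v) := by
      simp [Complex.normSq_apply]
    rw [hK]
    have hv' : v ≠ 0 := hv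
    by_cases h1 : v.1 = 0
    · have h2 : v.2 ≠ 0 := fun h2 => hv' (Prod.ext h1 h2)
      rw [h1, verticalCoord_apply, h1, map_zero, mul_zero, zero_add, smul_zero]
      refine lt_of_lt_of_eq ?_ (congrArg (fun t => (1 + (h.inner u.1 u.2 u.2).re) * t + _)
        ((κ u.1).map_coord_zero (m := ![(0 : E), 0]) 0 rfl)).symm
      rw [mul_zero, zero_add]
      exact mul_pos (div_pos hH hpi) (Complex.normSq_pos.2 (by simpa using h2))
    · exact add_pos_of_pos_of_nonneg (mul_pos (by linarith) (hκ.positive u.1 _ h1))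
        (mul_nonneg (div_pos hH hpi).le (Complex.normSq_nonneg _))

/-- A form that is compatible with `J` is nondegenerate on every `J`-invariant set of vectors. -/
theorem IsCompatibleAt.nondegenerateOn {V : Type*} [NormedAddCommGroup V] [NormedSpace ℝ V]
    {B : Type*} [TopologicalSpace B]
    {I : ModelWithCorners ℝ V B} {X : Type*} [TopologicalSpace X] [ChartedSpace B X]
    {Ω : DiffForm I X 2} {J : EndField I X} {x : X} (hJ : IsCompatibleAt Ω J x)
    {K : Set (TangentSpace I x)} (hK : ∀ v ∈ K, J x v ∈ K) : Ω.NondegenerateOn x K := by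
  intro v hv hv'
  by_contra h0
  exact (hJ.2 v h0).ne' (hv' _ (hK v hv))

end Canonical

section AlmostComplex

variable {E : Type*} [NormedAddCommGroup E] [NormedSpace ℂ E]
  {M : Type*} [TopologicalSpace M] [ChartedSpace E M] [IsManifold 𝓘(ℂ, E) ω M]
  {F : Type*} [NormedAddCommGroup F] [NormedSpace ℂ F]
  {N : M → Type*} [∀ x, AddCommGroup (N x)] [∀ x, Module ℂ (N x)] [∀ x, TopologicalSpace (N x)]
  [TopologicalSpace (Bundle.TotalSpace F N)] [FiberBundle F N]
  [VectorBundle ℂ F N] [ContMDiffVectorBundle ω F N 𝓘(ℂ, E)]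

theorem isAlmostComplexOn_mulI (U : Set (Bundle.TotalSpace F N)) :
    IsAlmostComplexOn (realTotalModel E F) (mulI E F N) U := by
  refine ⟨fun u _ (v : E × F) => ?_, fun u _ Y hY => ?_⟩
  · change Complex.I • Complex.I • v = -v
    rw [smul_smul, Complex.I_mul_I, neg_one_smul]
  · have : IsManifold (realTotalModel E F) 1 (Bundle.TotalSpace F N) :=
      IsManifold.of_le (n := ∞) (by simp)
    have hY' := (Bundle.contMDiffAt_section (IB := realTotalModel E F) (F := E × F)
      (E := TangentSpace (realTotalModel E F)) (s := Y) u).1 hY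
    refine (Bundle.contMDiffAt_section (IB := realTotalModel E F) (F := E × F)
      (E := TangentSpace (realTotalModel E F)) (s := fun y => mulI E F N y (Y y)) u).2 ?_
    have hI : ContDiff ℝ ∞ fun v : E × F => Complex.I • v :=
      ((Complex.I • ContinuousLinearMap.id ℂ (E × F)).restrictScalars ℝ).contDiff
    refine (hI.contMDiff.contMDiffAt.comp u hY').congr_of_eventuallyEq ?_
    filter_upwards [(isOpen_extChartAt_source (I := realTotalModel E F) u).mem_nhds
      (mem_extChartAt_source u)] with y hy
    rw [TangentBundle.trivializationAt_apply, Function.comp_apply,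
      TangentBundle.trivializationAt_apply]
    have hy' : y ∈ (extChartAt (𝓘(ℂ, E).prod 𝓘(ℂ, F)) u).source := by
      rw [extChartAt_source] at hy ⊢; exact hy
    have h1 : ContMDiffAt 𝓘(ℂ, E × F) 𝓘(ℂ, E × F) ω
        (extChartAt (𝓘(ℂ, E).prod 𝓘(ℂ, F)) u ∘ (extChartAt (𝓘(ℂ, E).prod 𝓘(ℂ, F)) y).symm)
        (extChartAt (𝓘(ℂ, E).prod 𝓘(ℂ, F)) y y) := by
      refine ContMDiffAt.comp _ (g := extChartAt (𝓘(ℂ, E).prod 𝓘(ℂ, F)) u) ?_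
        ((contMDiffOn_extChartAt_symm y).contMDiffAt
          ((isOpen_extChartAt_target y).mem_nhds (mem_extChartAt_target y)))
      rw [extChartAt_to_inv]
      exact contMDiffAt_extChartAt' (by rwa [extChartAt_source] at hy')
    have h2 : DifferentiableAt ℂ (extChartAt (realTotalModel E F) u ∘
        (extChartAt (realTotalModel E F) y).symm) (extChartAt (realTotalModel E F) y y) :=
      (contMDiffAt_iff_contDiffAt.1 h1).differentiableAt (by simp)
    generalize Y y = w
    change E × F at w
    change (fderivWithin ℝ (extChartAt (realTotalModel E F) u ∘
        (extChartAt (realTotalModel E F) y).symm) (range (realTotalModel E F))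
        (extChartAt (realTotalModel E F) y y)) (Complex.I • w) = Complex.I •
      (fderivWithin ℝ (extChartAt (realTotalModel E F) u ∘
        (extChartAt (realTotalModel E F) y).symm) (range (realTotalModel E F))
        (extChartAt (realTotalModel E F) y y)) w
    rw [ModelWithCorners.range_eq_univ, fderivWithin_univ, h2.fderiv_restrictScalars ℝ]
    exact map_smul (fderiv ℂ (extChartAt (realTotalModel E F) u ∘
        (extChartAt (realTotalModel E F) y).symm) (extChartAt (realTotalModel E F) y y)) _ _

end AlmostComplex

/-! ### Charts adapted to a hypersurface -/

section Adapted

variable {E : Type*} [NormedAddCommGroup E] [NormedSpace ℂ E] [FiniteDimensional ℂ E]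

/-- The model space of a hypersurface in a manifold modelled on `E`. The truncated subtraction is
harmless: a local equation has a nonzero derivative, so `E` has positive dimension wherever
this space occurs as a model. -/
abbrev HypModel (E : Type*) [NormedAddCommGroup E] [NormedSpace ℂ E] : Type :=
  EuclideanSpace ℂ (Fin (Module.finrank ℂ E - 1))

theorem exists_equiv_prod_snd_eq {L : E →L[ℂ] ℂ} (hL : L ≠ 0) :
    ∃ e : E ≃L[ℂ] HypModel E × ℂ, ∀ v, (e v).2 = L v := by
  have hs : Function.Surjective (L : E →ₗ[ℂ] ℂ) := by
    refine LinearMap.surjective ?_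
    intro h
    exact hL (ContinuousLinearMap.coe_injective h)
  have hfr := LinearMap.finrank_range_add_finrank_ker (L : E →ₗ[ℂ] ℂ)
  rw [LinearMap.range_eq_top.2 hs, finrank_top, Module.finrank_self] at hfr
  obtain ⟨p, hp⟩ := LinearMap.exists_leftInverse_of_injective
    (LinearMap.ker (L : E →ₗ[ℂ] ℂ)).subtype (Submodule.ker_subtype _)
  have hk : Module.finrank ℂ (LinearMap.ker (L : E →ₗ[ℂ] ℂ)) = Module.finrank ℂ (HypModel E) := by
    rw [finrank_euclideanSpace_fin]
    omega
  set ι := LinearEquiv.ofFinrankEq _ _ hk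
  set T : E →ₗ[ℂ] HypModel E × ℂ := (ι.toLinearMap ∘ₗ p).prod (L : E →ₗ[ℂ] ℂ)
  have hT : Function.Injective T := by
    rw [← LinearMap.ker_eq_bot, LinearMap.ker_eq_bot']
    intro v hv
    have h1 : ι (p v) = 0 := congrArg Prod.fst hv
    have h2 : v ∈ LinearMap.ker (L : E →ₗ[ℂ] ℂ) := congrArg Prod.snd hv
    have h3 : p v = ⟨v, h2⟩ := congrArg (fun A => A ⟨v, h2⟩) hp
    rw [map_eq_zero_iff _ ι.injective, h3] at h1
    exact congrArg Subtype.val h1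
  have hd : Module.finrank ℂ E = Module.finrank ℂ (HypModel E × ℂ) := by
    rw [Module.finrank_prod, finrank_euclideanSpace_fin, Module.finrank_self]
    omega
  exact ⟨(LinearMap.linearEquivOfInjective T hT hd).toContinuousLinearEquiv, fun v => rfl⟩

variable {M : Type*} [TopologicalSpace M] [ChartedSpace E M] [IsManifold 𝓘(ℂ, E) ω M]

/-- `ψ` is a holomorphic chart of `M` whose last coordinate is `g`. -/
structure IsAdaptedChart (g : M → ℂ) (ψ : OpenPartialHomeomorph M (HypModel E × ℂ)) : Prop where
  contMDiffOn : ContMDiffOn 𝓘(ℂ, E) 𝓘(ℂ, HypModel E × ℂ) ∞ ψ ψ.source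
  contMDiffOn_symm : ContMDiffOn 𝓘(ℂ, HypModel E × ℂ) 𝓘(ℂ, E) ∞ ψ.symm ψ.target
  snd_eq : ∀ y ∈ ψ.source, (ψ y).2 = g y

theorem exists_isAdaptedChart {g : M → ℂ} {U : Set M} (hU : IsOpen U)
    (hg : MDifferentiableOn 𝓘(ℂ, E) 𝓘(ℂ, ℂ) g U) {x : M} (hx : x ∈ U)
    (hgx : mfderiv 𝓘(ℂ, E) 𝓘(ℂ, ℂ) g x ≠ 0) :
    ∃ ψ : OpenPartialHomeomorph M (HypModel E × ℂ), x ∈ ψ.source ∧ ψ.source ⊆ U ∧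
      IsAdaptedChart (E := E) g ψ := by
  have hEc : CompleteSpace E := FiniteDimensional.complete ℂ E
  set φ := chartAt E x with hφ
  set W := φ.target ∩ φ.symm ⁻¹' U with hW
  have hWo : IsOpen W := φ.continuousOn_symm.isOpen_inter_preimage φ.open_target hU
  have hxW : φ x ∈ W := by
    refine ⟨φ.map_source (mem_chart_source E x), ?_⟩
    rw [mem_preimage, φ.left_inv (mem_chart_source E x)]
    exact hx
  have hφs : ContMDiffOn 𝓘(ℂ, E) 𝓘(ℂ, E) ∞ φ.symm φ.target := contMDiffOn_chart_symm
  have hφc : ContMDiffOn 𝓘(ℂ, E) 𝓘(ℂ, E) ∞ φ φ.source := contMDiffOn_chart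
  have hgd : DifferentiableOn ℂ (g ∘ φ.symm) W := by
    intro z hz
    have h1 : MDifferentiableAt 𝓘(ℂ, E) 𝓘(ℂ, E) φ.symm z :=
      (hφs.contMDiffAt (φ.open_target.mem_nhds hz.1)).mdifferentiableAt (by simp)
    have h2 := (hg.mdifferentiableAt (hU.mem_nhds hz.2)).comp z h1
    exact (mdifferentiableAt_iff_differentiableAt.1 h2).differentiableWithinAt
  have hgx' : fderiv ℂ (g ∘ φ.symm) (φ x) ≠ 0 := by
    have h1 := (hg.mdifferentiableAt (hU.mem_nhds hx)).mfderiv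
    intro h2
    apply hgx
    rw [h1]
    change fderivWithin ℂ (g ∘ φ.symm) (range id) (φ x) = 0
    rw [range_id, fderivWithin_univ, h2]
  obtain ⟨e, he⟩ := exists_equiv_prod_snd_eq hgx'
  have hgs := contDiffOn_of_differentiableOn_complex hWo hgd
  set f : E → HypModel E × ℂ := fun z => ((e z).1, g (φ.symm z)) with hf
  have hfs : ContDiffOn ℂ ∞ f W := (contDiff_fst.comp e.contDiff).contDiffOn.prodMk hgs
  have hfd : HasFDerivAt f (e : E →L[ℂ] HypModel E × ℂ) (φ x) := by
    have h1 : HasFDerivAt f (((ContinuousLinearMap.fst ℂ (HypModel E) ℂ) ∘L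
        (e : E →L[ℂ] HypModel E × ℂ)).prod (fderiv ℂ (g ∘ φ.symm) (φ x))) (φ x) :=
      ((ContinuousLinearMap.fst ℂ (HypModel E) ℂ) ∘L
        (e : E →L[ℂ] HypModel E × ℂ)).hasFDerivAt.prodMk
        (hgd.differentiableAt (hWo.mem_nhds hxW)).hasFDerivAt
    convert h1 using 1
    ext v
    · rfl
    · exact he v
  obtain ⟨Φ, hΦx, hΦW, hΦf, hΦs, -⟩ := exists_openPartialHomeomorph_of_contDiffOn hWo hfs hxW e hfd
  refine ⟨φ.trans Φ, ?_, ?_, ?_, ?_, ?_⟩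
  · rw [OpenPartialHomeomorph.trans_source]
    exact ⟨mem_chart_source E x, hΦx⟩
  · rw [OpenPartialHomeomorph.trans_source]
    rintro y ⟨hy, hy'⟩
    have := (hΦW hy').2
    rwa [mem_preimage, φ.left_inv hy] at this
  · rw [OpenPartialHomeomorph.trans_source, OpenPartialHomeomorph.coe_trans, hΦf]
    exact (hfs.mono hΦW).contMDiffOn.comp (hφc.mono inter_subset_left) fun y hy => hy.2
  · rw [OpenPartialHomeomorph.trans_target, OpenPartialHomeomorph.coe_trans_symm]
    exact hφs.comp (hΦs.contMDiffOn.mono inter_subset_left) fun y hy => hy.2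
  · intro y hy
    rw [OpenPartialHomeomorph.trans_source] at hy
    rw [OpenPartialHomeomorph.coe_trans, Function.comp_apply, hΦf]
    change g (φ.symm (φ y)) = _
    rw [φ.left_inv hy.1]

end Adapted

/-! ### Equations for a retraction with holomorphic fibers -/

section LocalRetraction

variable {K : Type*} [NormedAddCommGroup K] [NormedSpace ℂ K] [FiniteDimensional ℂ K]

/-- The linear automorphism `(k, w) ↦ (-k + L w, w)`. -/
noncomputable def negAddEquiv (L : K × ℂ →L[ℝ] K) : (K × (K × ℂ)) ≃L[ℝ] (K × (K × ℂ)) :=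
  ContinuousLinearEquiv.equivOfInverse
    ((-(ContinuousLinearMap.fst ℝ K (K × ℂ)) + L ∘L ContinuousLinearMap.snd ℝ K (K × ℂ)).prod
      (ContinuousLinearMap.snd ℝ K (K × ℂ)))
    ((-(ContinuousLinearMap.fst ℝ K (K × ℂ)) + L ∘L ContinuousLinearMap.snd ℝ K (K × ℂ)).prod
      (ContinuousLinearMap.snd ℝ K (K × ℂ)))
    (fun p => by simp) (fun p => by simp)

/-- The equation `G (k, w) = 0` defines a smooth retraction `w ↦ ρ w` onto the hyperplane
`w.2 = 0`; near the base point each fiber is transverse to the hyperplane. -/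
theorem exists_local_retraction {G : K × (K × ℂ) → K} {k₀ : K}
    (hG : ∀ᶠ p in 𝓝 (k₀, (k₀, (0 : ℂ))), ContDiffAt ℝ ∞ G p)
    (h0 : ∀ᶠ k in 𝓝 k₀, G (k, (k, 0)) = 0)
    (h1 : HasFDerivAt (fun k => G (k₀, (k, 0))) (ContinuousLinearMap.id ℝ K) k₀)
    (h2 : ∀ᶠ p in 𝓝 (k₀, (k₀, (0 : ℂ))), DifferentiableAt ℂ (fun w => G (p.1, w)) p.2) :
    ∃ (ρ : K × ℂ → K) (A : Set K) (O : Set (K × ℂ)), IsOpen A ∧ IsOpen O ∧ k₀ ∈ A ∧ (k₀, 0) ∈ O ∧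
      ContDiffOn ℝ ∞ ρ O ∧ MapsTo ρ O A ∧
      (∀ k ∈ A, ∀ w ∈ O, G (k, w) = 0 ↔ k = ρ w) ∧
      (∀ k ∈ A, (k, (0 : ℂ)) ∈ O → ρ (k, 0) = k) ∧
      ∀ k ∈ A, DifferentiableOn ℂ (fun w => G (k, w)) O ∧
        ∀ w ∈ O, ∃ e : (K × ℂ) ≃L[ℂ] (K × ℂ),
          HasFDerivAt (fun w => (G (k, w), w.2)) (e : (K × ℂ) →L[ℂ] (K × ℂ)) w := by
  have hKc : CompleteSpace K := FiniteDimensional.complete ℂ K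
  set p₀ : K × (K × ℂ) := (k₀, (k₀, 0)) with hp₀
  set D := fderiv ℝ G p₀ with hD
  have hGp : ContDiffAt ℝ ∞ G p₀ := hG.self_of_nhds
  have hGd : HasFDerivAt G D p₀ := (hGp.differentiableAt (by simp)).hasFDerivAt
  have hDw : ∀ κ : K, D (0, (κ, 0)) = κ := by
    intro κ
    have h3 : HasFDerivAt (fun k => G (k₀, (k, (0 : ℂ)))) (D ∘L
      ((0 : K →L[ℝ] K).prod ((ContinuousLinearMap.id ℝ K).prod (0 : K →L[ℝ] ℂ)))) k₀ :=
      HasFDerivAt.comp k₀ (g := G) (f := fun k : K => (k₀, (k, (0 : ℂ)))) hGd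
        ((hasFDerivAt_const _ _).prodMk ((hasFDerivAt_id _).prodMk (hasFDerivAt_const _ _)))
    exact congrArg (fun A : K →L[ℝ] K => A κ) (h3.unique h1)
  have hDd : ∀ κ : K, D (κ, (κ, 0)) = 0 := by
    intro κ
    have h3 : HasFDerivAt (fun k => G (k, (k, (0 : ℂ)))) (D ∘L
      ((ContinuousLinearMap.id ℝ K).prod ((ContinuousLinearMap.id ℝ K).prod (0 : K →L[ℝ] ℂ)))) k₀ :=
      HasFDerivAt.comp k₀ (g := G) (f := fun k : K => (k, (k, (0 : ℂ)))) hGd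
        ((hasFDerivAt_id _).prodMk ((hasFDerivAt_id _).prodMk (hasFDerivAt_const _ _)))
    have h4 : HasFDerivAt (fun k => G (k, (k, (0 : ℂ)))) (0 : K →L[ℝ] K) k₀ :=
      (hasFDerivAt_const (0 : K) k₀).congr_of_eventuallyEq h0
    exact congrArg (fun A : K →L[ℝ] K => A κ) (h3.unique h4)
  set L : K × ℂ →L[ℝ] K := D ∘L ContinuousLinearMap.inr ℝ K (K × ℂ) with hL
  obtain ⟨s, hs, hs'⟩ := hG.exists_mem
  obtain ⟨s₁, hs₁, hs₁o, hp₀s₁⟩ := mem_nhds_iff.1 hs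
  have hGs : ContDiffOn ℝ ∞ G s₁ := fun p hp => (hs' p (hs₁ hp)).contDiffWithinAt
  -- The implicit function theorem: by `h0` and `h1` the derivative of `G` in the first variable is
  -- minus the identity, so that `(k, w) ↦ (G (k, w), w)` is a local diffeomorphism.
  set Ψ : K × (K × ℂ) → K × (K × ℂ) := fun p => (G p, p.2) with hΨ
  have hΨs : ContDiffOn ℝ ∞ Ψ s₁ := hGs.prodMk contDiffOn_snd
  have hΨd : HasFDerivAt Ψ (negAddEquiv L : (K × (K × ℂ)) →L[ℝ] (K × (K × ℂ))) p₀ := by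
    have h3 := hGd.prodMk (hasFDerivAt_snd (𝕜 := ℝ) (p := p₀))
    have h4 : (negAddEquiv L : (K × (K × ℂ)) →L[ℝ] (K × (K × ℂ))) =
        D.prod (ContinuousLinearMap.snd ℝ K (K × ℂ)) := ?_
    · rw [h4]
      exact h3
    refine ContinuousLinearMap.ext fun p => Prod.ext ?_ rfl
    change -p.1 + D (0, p.2) = D p
    have h4 : p = (p.1, (p.1, 0)) + ((0, p.2) - (0, (p.1, 0))) := by
      refine Prod.ext ?_ ?_ <;> simp
    conv_rhs => rw [h4, map_add, map_sub, hDd, hDw]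
    abel
  obtain ⟨Φ, hΦx, hΦs, hΦf, hΦsm, -⟩ :=
    exists_openPartialHomeomorph_of_contDiffOn hs₁o hΨs hp₀s₁ (negAddEquiv L) hΨd
  -- The map `w ↦ (G (k, w), w.2)` stays a local biholomorphism near the base point.
  set Q : K × (K × ℂ) → (K × ℂ →L[ℝ] K × ℂ) := fun p =>
    (fderiv ℝ G p ∘L ContinuousLinearMap.inr ℝ K (K × ℂ)).prod (ContinuousLinearMap.snd ℝ K ℂ)
    with hQ
  have hQc : ContinuousAt Q p₀ := by
    have h3 : ContinuousAt (fderiv ℝ G) p₀ := hGp.continuousAt_fderiv (by simp)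
    have h4 : Continuous fun T : K × (K × ℂ) →L[ℝ] K =>
        (T ∘L ContinuousLinearMap.inr ℝ K (K × ℂ)).prod (ContinuousLinearMap.snd ℝ K ℂ) := by
      rw [continuous_clm_apply]
      intro v
      exact (continuous_eval_const (((0 : K), v) : K × (K × ℂ))).prodMk continuous_const
    exact h4.continuousAt.comp h3
  have hQ0 : ∃ e : (K × ℂ) ≃L[ℝ] (K × ℂ), (e : K × ℂ →L[ℝ] K × ℂ) = Q p₀ := by
    set l : ℂ →L[ℝ] K := L ∘L ContinuousLinearMap.inr ℝ K ℂ with hl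
    refine ⟨ContinuousLinearEquiv.equivOfInverse (Q p₀)
      ((ContinuousLinearMap.fst ℝ K ℂ - l ∘L ContinuousLinearMap.snd ℝ K ℂ).prod
        (ContinuousLinearMap.snd ℝ K ℂ)) ?_ ?_, rfl⟩ <;>
    · intro w
      have h5 : ∀ w : K × ℂ, D (0, w) = w.1 + l w.2 := by
        intro w
        have : (0, w) = ((0, (w.1, 0)) + (0, (0, w.2)) : K × (K × ℂ)) := by
          refine Prod.ext ?_ (Prod.ext ?_ ?_) <;> simp
        rw [this, map_add, hDw]
        rfl
      refine Prod.ext ?_ rfl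
      first
      | (change D (0, w) - l w.2 = w.1; rw [h5]; exact add_sub_cancel_right _ _)
      | (change D (0, (w.1 - l w.2, w.2)) = w.1; rw [h5]; exact sub_add_cancel _ _)
  have hQn : ∀ᶠ p in 𝓝 p₀, Q p ∈ range ((↑) : ((K × ℂ) ≃L[ℝ] (K × ℂ)) → (K × ℂ →L[ℝ] K × ℂ)) :=
    hQc.preimage_mem_nhds (ContinuousLinearEquiv.isOpen.mem_nhds hQ0)
  obtain ⟨A₁, hA₁, O₁, hO₁, hAO⟩ := mem_nhds_prod_iff.1 (Filter.inter_mem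
    (Φ.open_source.mem_nhds hΦx) (Filter.inter_mem h2 (Filter.inter_mem hQn (hs₁o.mem_nhds hp₀s₁))))
  obtain ⟨A, hAA₁, hA, hk₀⟩ := mem_nhds_iff.1 (Filter.inter_mem hA₁ h0)
  obtain ⟨O₂, hO₂, hO₂o, hO₂k⟩ := mem_nhds_iff.1 hO₁
  have hΦp₀ : Φ p₀ = (0, (k₀, 0)) := by
    rw [hΦf, hΨ]
    exact Prod.ext h0.self_of_nhds rfl
  have hsymm0 : Φ.symm (0, (k₀, 0)) = p₀ := by rw [← hΦp₀, Φ.left_inv hΦx]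
  set ρ : K × ℂ → K := fun w => (Φ.symm (0, w)).1 with hρ
  set T : Set (K × ℂ) := (fun w => ((0 : K), w)) ⁻¹' Φ.target with hT
  have hTo : IsOpen T := Φ.open_target.preimage (by fun_prop)
  have hTk : (k₀, (0 : ℂ)) ∈ T := by
    have := Φ.map_source hΦx
    rwa [hΦp₀] at this
  have hρs : ContDiffOn ℝ ∞ ρ T :=
    contDiff_fst.comp_contDiffOn (hΦsm.comp (by fun_prop : ContDiff ℝ ∞
      fun w : K × ℂ => ((0 : K), w)).contDiffOn fun w hw => hw)
  set O : Set (K × ℂ) := (T ∩ O₂) ∩ ((T ∩ O₂) ∩ ρ ⁻¹' A) with hO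
  have hOo : IsOpen O := (hTo.inter hO₂o).inter
    ((hρs.continuousOn.mono inter_subset_left).isOpen_inter_preimage (hTo.inter hO₂o) hA)
  have hmem : ∀ k ∈ A, ∀ w ∈ O, (k, w) ∈ A₁ ×ˢ O₁ := fun k hk w hw =>
    ⟨(hAA₁ hk).1, hO₂ hw.1.2⟩
  have hiff : ∀ k ∈ A, ∀ w ∈ O, G (k, w) = 0 ↔ k = ρ w := by
    intro k hk w hw
    have hsrc := (hAO (hmem k hk w hw)).1
    constructor
    · intro h3
      have h4 : Φ (k, w) = (0, w) := by rw [hΦf, hΨ]; exact Prod.ext h3 rfl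
      have h5 : (k, w) = Φ.symm (0, w) := by rw [← h4, Φ.left_inv hsrc]
      exact congrArg Prod.fst h5
    · intro h3
      have h4 := Φ.right_inv hw.1.1
      rw [hΦf] at h4
      have h5 : (Φ.symm (0, w)).2 = w := congrArg Prod.snd h4
      have h6 : (k, w) = Φ.symm (0, w) := Prod.ext h3 h5.symm
      rw [h6]
      exact congrArg Prod.fst h4
  refine ⟨ρ, A, O, hA, hOo, hk₀, ⟨⟨hTk, hO₂k⟩, ⟨hTk, hO₂k⟩, ?_⟩, hρs.mono fun w hw => hw.1.1,
    fun w hw => hw.2.2, hiff, ?_, ?_⟩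
  · change (Φ.symm (0, (k₀, 0))).1 ∈ A
    rw [hsymm0]
    exact hk₀
  · intro k hk hkO
    exact ((hiff k hk _ hkO).1 (hAA₁ hk).2).symm
  · intro k hk
    have hd : ∀ w ∈ O, DifferentiableAt ℂ (fun w => G (k, w)) w := fun w hw =>
      (hAO (hmem k hk w hw)).2.1
    refine ⟨fun w hw => (hd w hw).differentiableWithinAt, fun w hw => ?_⟩
    obtain ⟨e, he⟩ := (hAO (hmem k hk w hw)).2.2.1
    have hw₁ := (hAO (hmem k hk w hw)).2.2.2
    have h3 : HasFDerivAt (fun w => (G (k, w), w.2)) ((fderiv ℂ (fun w => G (k, w)) w).prod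
      (ContinuousLinearMap.snd ℂ K ℂ)) w := (hd w hw).hasFDerivAt.prodMk hasFDerivAt_snd
    have h4 : HasFDerivAt (fun w => (G (k, w), w.2)) (Q (k, w)) w := by
      have h5 : HasFDerivAt G (fderiv ℝ G (k, w)) (k, w) :=
        ((hGs.contDiffAt (hs₁o.mem_nhds hw₁)).differentiableAt (by simp)).hasFDerivAt
      exact (HasFDerivAt.comp w h5 ((hasFDerivAt_const k w).prodMk (hasFDerivAt_id w))).prodMk
        hasFDerivAt_snd
    have h5 := (h3.restrictScalars ℝ).unique h4
    set C := (fderiv ℂ (fun w => G (k, w)) w).prod (ContinuousLinearMap.snd ℂ K ℂ)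
    have h6 : ∀ v, C v = e v := fun v => by
      rw [← ContinuousLinearEquiv.coe_coe, he, ← h5]; rfl
    have hinj : Function.Injective C := fun v v' hv => e.injective (by rw [← h6, ← h6, hv])
    set C' := (LinearEquiv.ofInjectiveEndo (C : K × ℂ →ₗ[ℂ] K × ℂ) hinj).toContinuousLinearEquiv
    have h7 : (C' : K × ℂ →L[ℂ] K × ℂ) = C := ContinuousLinearMap.ext fun v => rfl
    exact ⟨C', by rw [h7]; exact h3⟩

end LocalRetraction

/-! ### A smooth retraction onto a hypersurface with holomorphic fibers -/

section Retraction

variable {E : Type*} [NormedAddCommGroup E] [NormedSpace ℂ E] [FiniteDimensional ℂ E]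
  {M : Type*} [TopologicalSpace M] [ChartedSpace E M] [IsManifold 𝓘(ℂ, E) ω M]

/-- A family of holomorphic charts `ψ a` around the points `a` of `H` in which `H` is the zero set
of the last coordinate `g a`. -/
structure IsHypersurfaceAtlas (H : Set M) (g : H → M → ℂ)
    (ψ : H → OpenPartialHomeomorph M (HypModel E × ℂ)) : Prop where
  mem_source : ∀ a : H, (a : M) ∈ (ψ a).source
  adapted : ∀ a, IsAdaptedChart (E := E) (g a) (ψ a)
  mem_iff : ∀ a, ∀ y ∈ (ψ a).source, y ∈ H ↔ g a y = 0

variable {H : Set M} {g : H → M → ℂ} {ψ : H → OpenPartialHomeomorph M (HypModel E × ℂ)}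

/-- The transition maps between the charts of `H` given by a hypersurface atlas. -/
noncomputable def hypTransition (ψ : H → OpenPartialHomeomorph M (HypModel E × ℂ)) (a i : H) (k : HypModel E) :
    HypModel E :=
  (ψ a ((ψ i).symm (k, 0))).1

/-- The derivatives of the transition maps. -/
noncomputable def hypTransitionDeriv (ψ : H → OpenPartialHomeomorph M (HypModel E × ℂ)) (a i : H)
    (x : M) : HypModel E →L[ℂ] HypModel E :=
  fderiv ℂ (hypTransition ψ a i) (ψ i x).1

/-- The domain of the transition map `hypTransition ψ a i`. -/
def hypTransitionDomain (ψ : H → OpenPartialHomeomorph M (HypModel E × ℂ)) (a i : H) :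
    Set (HypModel E) :=
  (fun k => (k, (0 : ℂ))) ⁻¹' ((ψ i).target ∩ (ψ i).symm ⁻¹' (ψ a).source)

theorem isOpen_hypTransitionDomain (a i : H) : IsOpen (hypTransitionDomain ψ a i) :=
  ((ψ i).continuousOn_symm.isOpen_inter_preimage (ψ i).open_target (ψ a).open_source).preimage
    (by fun_prop)

namespace IsHypersurfaceAtlas

variable (hψ : IsHypersurfaceAtlas (E := E) H g ψ)
include hψ

theorem snd_eq_zero {a : H} {x : M} (hx : x ∈ H) (hxa : x ∈ (ψ a).source) : (ψ a x).2 = 0 := by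
  rw [(hψ.adapted a).snd_eq x hxa]
  exact (hψ.mem_iff a x hxa).1 hx

theorem mk_fst_zero {a : H} {x : M} (hx : x ∈ H) (hxa : x ∈ (ψ a).source) :
    ((ψ a x).1, (0 : ℂ)) = ψ a x := Prod.ext rfl (hψ.snd_eq_zero hx hxa).symm

theorem symm_mk_zero {a : H} {x : M} (hx : x ∈ H) (hxa : x ∈ (ψ a).source) :
    (ψ a).symm ((ψ a x).1, 0) = x := by
  rw [hψ.mk_fst_zero hx hxa, (ψ a).left_inv hxa]

theorem symm_mem {a : H} {k : HypModel E} (hk : (k, (0 : ℂ)) ∈ (ψ a).target) :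
    (ψ a).symm (k, 0) ∈ H := by
  have h1 := (ψ a).map_target hk
  rw [hψ.mem_iff a _ h1, ← (hψ.adapted a).snd_eq _ h1, (ψ a).right_inv hk]

theorem fst_mem_domain {a i : H} {x : M} (hx : x ∈ H) (hxa : x ∈ (ψ a).source)
    (hxi : x ∈ (ψ i).source) : (ψ i x).1 ∈ hypTransitionDomain ψ a i := by
  change ((ψ i x).1, (0 : ℂ)) ∈ (ψ i).target ∩ (ψ i).symm ⁻¹' (ψ a).source
  rw [hψ.mk_fst_zero hx hxi]
  refine ⟨(ψ i).map_source hxi, ?_⟩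
  rwa [mem_preimage, (ψ i).left_inv hxi]

/-- The transition maps between the adapted charts are holomorphic. -/
theorem differentiableOn_chart_comp_symm (a i : H) :
    DifferentiableOn ℂ (fun w => ψ a ((ψ i).symm w)) ((ψ i).target ∩ (ψ i).symm ⁻¹' (ψ a).source) := by
  have h1 := (hψ.adapted a).contMDiffOn.comp
    ((hψ.adapted i).contMDiffOn_symm.mono (inter_subset_left (t := (ψ i).symm ⁻¹' (ψ a).source)))
    fun w (hw : w ∈ (ψ i).target ∩ (ψ i).symm ⁻¹' (ψ a).source) => hw.2
  exact (contMDiffOn_iff_contDiffOn.1 h1).differentiableOn (by simp)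

theorem differentiableOn_hypTransition (a i : H) :
    DifferentiableOn ℂ (hypTransition ψ a i) (hypTransitionDomain ψ a i) :=
  differentiable_fst.comp_differentiableOn ((hψ.differentiableOn_chart_comp_symm a i).comp
    (by fun_prop : Differentiable ℂ fun k : HypModel E => (k, (0 : ℂ))).differentiableOn
    fun _ hk => hk)

theorem hasFDerivAt_hypTransition {a i : H} {x : M} (hx : x ∈ H) (hxa : x ∈ (ψ a).source)
    (hxi : x ∈ (ψ i).source) :
    HasFDerivAt (hypTransition ψ a i) (hypTransitionDeriv ψ a i x) (ψ i x).1 :=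
  ((hψ.differentiableOn_hypTransition a i).differentiableAt
    ((isOpen_hypTransitionDomain a i).mem_nhds (hψ.fst_mem_domain hx hxa hxi))).hasFDerivAt

theorem hypTransition_apply {a i : H} {x : M} (hx : x ∈ H)
    (hxi : x ∈ (ψ i).source) : hypTransition ψ a i (ψ i x).1 = (ψ a x).1 := by
  rw [hypTransition, hψ.symm_mk_zero hx hxi]

/-- The cocycle identity for the derivatives of the transition maps. -/
theorem hypTransitionDeriv_comp {a c i : H} {x : M} (hx : x ∈ H) (hxa : x ∈ (ψ a).source)
    (hxc : x ∈ (ψ c).source) (hxi : x ∈ (ψ i).source) :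
    (hypTransitionDeriv ψ c a x).comp (hypTransitionDeriv ψ a i x) = hypTransitionDeriv ψ c i x := by
  have h1 := hψ.hasFDerivAt_hypTransition hx hxa hxi
  have h2 := hψ.hasFDerivAt_hypTransition hx hxc hxa
  rw [← hψ.hypTransition_apply hx hxi] at h2
  refine (h2.comp _ h1).unique ((hψ.hasFDerivAt_hypTransition hx hxc hxi).congr_of_eventuallyEq ?_)
  filter_upwards [(isOpen_hypTransitionDomain a i).mem_nhds (hψ.fst_mem_domain hx hxa hxi)] with k hk
  rw [Function.comp_apply, hypTransition, hypTransition, hypTransition,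
    hψ.symm_mk_zero (hψ.symm_mem hk.1) hk.2]

theorem hypTransitionDeriv_self {a : H} {x : M} (hx : x ∈ H) (hxa : x ∈ (ψ a).source) :
    hypTransitionDeriv ψ a a x = ContinuousLinearMap.id ℂ (HypModel E) := by
  refine (hψ.hasFDerivAt_hypTransition hx hxa hxa).unique
    ((hasFDerivAt_id _).congr_of_eventuallyEq ?_)
  filter_upwards [(isOpen_hypTransitionDomain a a).mem_nhds (hψ.fst_mem_domain hx hxa hxa)] with k hk
  rw [hypTransition, (ψ a).right_inv hk.1]
  rfl

end IsHypersurfaceAtlas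

/-- In the chart `ψ a`, the average of the displacements `(ψ i y).1 - (ψ i x).1` from `x ∈ H` to `y`
measured in the charts `ψ i`, each regarded as a tangent vector to `H` at `x`. -/
noncomputable def hypDisplacement {ι : Type*} [Fintype ι] (j : ι → H)
    (ψ : H → OpenPartialHomeomorph M (HypModel E × ℂ)) (χ : ι → M → ℝ) (a : H) (x y : M) :
    HypModel E :=
  ∑ i, χ i x • hypTransitionDeriv ψ a (j i) x ((ψ (j i) y).1 - (ψ (j i) x).1)

variable {ι : Type*} [Fintype ι] {j : ι → H} {χ : ι → M → ℝ}

/-- The displacement transforms like a tangent vector to `H` at `x` under a change of charts, so that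
its vanishing does not depend on the chart. -/
theorem IsHypersurfaceAtlas.hypDisplacement_change (hψ : IsHypersurfaceAtlas (E := E) H g ψ)
    (hχ : ∀ i, tsupport (χ i) ⊆ (ψ (j i)).source) {a c : H} {x : M} (hx : x ∈ H)
    (hxa : x ∈ (ψ a).source) (hxc : x ∈ (ψ c).source) (y : M) :
    hypDisplacement j ψ χ c x y = hypTransitionDeriv ψ c a x (hypDisplacement j ψ χ a x y) := by
  rw [hypDisplacement, hypDisplacement, map_sum]
  refine Finset.sum_congr rfl fun i _ => ?_
  by_cases h0 : χ i x = 0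
  · simp [h0]
  · have hxi := hχ i (subset_tsupport _ h0)
    rw [← hψ.hypTransitionDeriv_comp hx hxa hxc hxi]
    exact (((hypTransitionDeriv ψ c a x).restrictScalars ℝ).map_smul _ _).symm

theorem IsHypersurfaceAtlas.hypDisplacement_eq_zero_iff (hψ : IsHypersurfaceAtlas (E := E) H g ψ)
    (hχ : ∀ i, tsupport (χ i) ⊆ (ψ (j i)).source) {a c : H} {x : M} (hx : x ∈ H)
    (hxa : x ∈ (ψ a).source) (hxc : x ∈ (ψ c).source) (y : M) :
    hypDisplacement j ψ χ c x y = 0 ↔ hypDisplacement j ψ χ a x y = 0 := by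
  constructor
  · intro h
    rw [hψ.hypDisplacement_change hχ hx hxc hxa, h, map_zero]
  · intro h
    rw [hψ.hypDisplacement_change hχ hx hxa hxc, h, map_zero]

/-- The displacement equation satisfies the hypotheses of `exists_local_retraction`. -/
theorem IsHypersurfaceAtlas.exists_retraction_coord (hψ : IsHypersurfaceAtlas (E := E) H g ψ)
    (hχs : ∀ i, ContMDiff 𝓘(ℝ, E) 𝓘(ℝ, ℝ) ∞ (χ i))
    (hχ : ∀ i, tsupport (χ i) ⊆ (ψ (j i)).source) (hχ1 : ∀ x ∈ H, ∑ i, χ i x = 1) (a : H) :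
    ∃ (ρ : HypModel E × ℂ → HypModel E) (A : Set (HypModel E)) (O : Set (HypModel E × ℂ)),
      IsOpen A ∧ IsOpen O ∧ (ψ a a).1 ∈ A ∧ ((ψ a a).1, 0) ∈ O ∧
      ContDiffOn ℝ ∞ ρ O ∧ MapsTo ρ O A ∧
      (∀ k ∈ A, ∀ w ∈ O, hypDisplacement j ψ χ a ((ψ a).symm (k, 0)) ((ψ a).symm w) = 0 ↔ k = ρ w) ∧
      (∀ k ∈ A, (k, (0 : ℂ)) ∈ O → ρ (k, 0) = k) ∧
      ∀ k ∈ A, DifferentiableOn ℂ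
        (fun w => hypDisplacement j ψ χ a ((ψ a).symm (k, 0)) ((ψ a).symm w)) O ∧
        ∀ w ∈ O, ∃ e : (HypModel E × ℂ) ≃L[ℂ] (HypModel E × ℂ),
          HasFDerivAt (fun w => (hypDisplacement j ψ χ a ((ψ a).symm (k, 0)) ((ψ a).symm w), w.2))
            (e : (HypModel E × ℂ) →L[ℂ] (HypModel E × ℂ)) w := by
  set k₀ := (ψ a a).1 with hk₀
  have haa := hψ.mem_source a
  have hk₀a : (k₀, (0 : ℂ)) = ψ a a := hψ.mk_fst_zero a.2 haa
  have hk₀t : (k₀, (0 : ℂ)) ∈ (ψ a).target := by rw [hk₀a]; exact (ψ a).map_source haa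
  have hsymm : (ψ a).symm (k₀, 0) = a := hψ.symm_mk_zero a.2 haa
  -- The terms without the cut-off functions are holomorphic in both variables.
  set τ : ι → HypModel E × (HypModel E × ℂ) → HypModel E := fun i p =>
    hypTransitionDeriv ψ a (j i) ((ψ a).symm (p.1, 0))
      ((ψ (j i) ((ψ a).symm p.2)).1 - (ψ (j i) ((ψ a).symm (p.1, 0))).1) with hτ
  have hτd : ∀ i, (a : M) ∈ (ψ (j i)).source → ∀ᶠ p in 𝓝 (k₀, (k₀, (0 : ℂ))),
      ContDiffAt ℂ ∞ (τ i) p := by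
    intro i hai
    set Wc := (ψ a).target ∩ (ψ a).symm ⁻¹' (ψ (j i)).source with hWc
    have hWo : IsOpen Wc :=
      (ψ a).continuousOn_symm.isOpen_inter_preimage (ψ a).open_target (ψ (j i)).open_source
    have hcd := contDiffOn_of_differentiableOn_complex hWo
      (hψ.differentiableOn_chart_comp_symm (j i) a)
    have hk₀W : (k₀, (0 : ℂ)) ∈ Wc := ⟨hk₀t, by rw [mem_preimage, hsymm]; exact hai⟩
    have hN : ∀ᶠ p in 𝓝 (k₀, (k₀, (0 : ℂ))), (p.1, (0 : ℂ)) ∈ Wc ∧ p.2 ∈ Wc := by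
      refine Filter.Eventually.and ?_ ?_
      · exact ((by fun_prop : Continuous fun p : HypModel E × (HypModel E × ℂ) =>
          (p.1, (0 : ℂ))).continuousAt).preimage_mem_nhds (hWo.mem_nhds hk₀W)
      · exact continuousAt_snd.preimage_mem_nhds (hWo.mem_nhds hk₀W)
    filter_upwards [hN] with p hp
    have h1 : ContDiffAt ℂ ∞ (fun p : HypModel E × (HypModel E × ℂ) =>
        (ψ (j i) ((ψ a).symm p.2)).1) p :=
      contDiffAt_fst.comp p ((hcd.contDiffAt (hWo.mem_nhds hp.2)).comp p contDiffAt_snd)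
    have h2 : ContDiffAt ℂ ∞ (fun p : HypModel E × (HypModel E × ℂ) =>
        (ψ (j i) ((ψ a).symm (p.1, 0))).1) p :=
      contDiffAt_fst.comp p (ContDiffAt.comp p (g := fun w => ψ (j i) ((ψ a).symm w))
        (hcd.contDiffAt (hWo.mem_nhds hp.1))
        (contDiffAt_fst.prodMk contDiffAt_const))
    have h3 : ContDiffAt ℂ ∞ (fderiv ℂ (hypTransition ψ a (j i)))
        (ψ (j i) ((ψ a).symm (p.1, 0))).1 := by
      have h4 := contDiffOn_of_differentiableOn_complex (isOpen_hypTransitionDomain a (j i))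
        (hψ.differentiableOn_hypTransition a (j i))
      exact (h4.contDiffAt ((isOpen_hypTransitionDomain a (j i)).mem_nhds
        (hψ.fst_mem_domain (hψ.symm_mem hp.1.1) ((ψ a).map_target hp.1.1) hp.1.2))).fderiv_right
          (by simp)
    exact (ContDiffAt.comp p (g := fderiv ℂ (hypTransition ψ a (j i))) h3 h2).clm_apply (h1.sub h2)
  have hχ0 : ∀ i, (a : M) ∉ tsupport (χ i) → ∀ᶠ p in 𝓝 (k₀, (k₀, (0 : ℂ))),
      χ i ((ψ a).symm (p.1, 0)) = 0 := by
    intro i hi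
    have h1 : ContinuousAt (fun p : HypModel E × (HypModel E × ℂ) => (ψ a).symm (p.1, 0))
        (k₀, (k₀, (0 : ℂ))) :=
      ContinuousAt.comp (f := fun p : HypModel E × (HypModel E × ℂ) => (p.1, (0 : ℂ)))
        (g := (ψ a).symm) ((ψ a).symm.continuousAt hk₀t) (by fun_prop)
    have h2 := (isClosed_tsupport (χ i)).isOpen_compl.mem_nhds hi
    rw [← hsymm] at h2
    filter_upwards [h1.preimage_mem_nhds h2] with p hp using image_eq_zero_of_notMem_tsupport hp
  refine exists_local_retraction (K := HypModel E)
    (G := fun p => hypDisplacement j ψ χ a ((ψ a).symm (p.1, 0)) ((ψ a).symm p.2)) ?_ ?_ ?_ ?_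
  · have h : ∀ i, ∀ᶠ p in 𝓝 (k₀, (k₀, (0 : ℂ))), ContDiffAt ℝ ∞
        (fun p => χ i ((ψ a).symm (p.1, 0)) • τ i p) p := by
      intro i
      by_cases hi : (a : M) ∈ tsupport (χ i)
      · have h1 : ∀ᶠ p in 𝓝 (k₀, (k₀, (0 : ℂ))), (p.1, (0 : ℂ)) ∈ (ψ a).target :=
          ((by fun_prop : Continuous fun p : HypModel E × (HypModel E × ℂ) =>
          (p.1, (0 : ℂ))).continuousAt).preimage_mem_nhds ((ψ a).open_target.mem_nhds hk₀t)
        filter_upwards [hτd i (hχ i hi), h1] with p hp hp1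
        have h2 : ContMDiffAt 𝓘(ℝ, HypModel E × ℂ) 𝓘(ℝ, ℝ) ∞ (fun w => χ i ((ψ a).symm w))
            (p.1, (0 : ℂ)) :=
          (hχs i).contMDiffAt.comp _ (ContMDiffWithinAt.real_of_complex
            ((hψ.adapted a).contMDiffOn_symm.contMDiffAt ((ψ a).open_target.mem_nhds hp1)))
        have h3 : ContDiffAt ℝ ∞ (fun p : HypModel E × (HypModel E × ℂ) =>
            χ i ((ψ a).symm (p.1, 0))) p :=
          ContDiffAt.comp p (g := fun w => χ i ((ψ a).symm w)) (contMDiffAt_iff_contDiffAt.1 h2)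
            (contDiffAt_fst.prodMk contDiffAt_const)
        exact h3.smul (hp.restrict_scalars ℝ)
      · filter_upwards [(hχ0 i hi).eventually_nhds] with p hp
        refine (contDiffAt_const (c := 0)).congr_of_eventuallyEq ?_
        filter_upwards [hp] with p hp
        rw [hp, zero_smul]
    filter_upwards [Filter.eventually_all.2 h] with p hp
    exact ContDiffAt.sum fun i _ => hp i
  · exact Filter.Eventually.of_forall fun k => by simp [hypDisplacement]
  · have h : ∀ i, HasFDerivAt (fun k => χ i a • hypTransitionDeriv ψ a (j i) a
        ((ψ (j i) ((ψ a).symm (k, 0))).1 - (ψ (j i) a).1))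
        (χ i a • ContinuousLinearMap.id ℝ (HypModel E)) k₀ := by
      intro i
      by_cases hi : χ i a = 0
      · have h0 : χ i a • ContinuousLinearMap.id ℝ (HypModel E) = 0 := by
          refine ContinuousLinearMap.ext fun v => ?_
          change χ i a • v = 0
          rw [hi, zero_smul]
        rw [h0]
        simp only [hi, zero_smul]
        exact hasFDerivAt_const (𝕜 := ℝ) (0 : HypModel E) k₀
      · have hai := hχ i (subset_tsupport _ hi)
        have h3 : HasFDerivAt (fun k => (ψ (j i) ((ψ a).symm (k, 0))).1 - (ψ (j i) a).1)
            (hypTransitionDeriv ψ (j i) a a) k₀ :=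
          (hψ.hasFDerivAt_hypTransition a.2 hai haa).sub_const (ψ (j i) a).1
        have h1 := (((hypTransitionDeriv ψ a (j i) a).hasFDerivAt.comp k₀
          h3).restrictScalars ℝ).const_smul (χ i a)
        rw [hψ.hypTransitionDeriv_comp a.2 hai haa haa, hψ.hypTransitionDeriv_self a.2 haa] at h1
        exact h1
    have h2 := HasFDerivAt.sum (u := Finset.univ) fun i _ => h i
    rw [← Finset.sum_smul, hχ1 a a.2, one_smul] at h2
    simp only [hypDisplacement, hsymm]
    convert h2 using 1
    funext k
    rw [Finset.sum_apply]
  · have h : ∀ i, ∀ᶠ p in 𝓝 (k₀, (k₀, (0 : ℂ))), DifferentiableAt ℂ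
        (fun w => χ i ((ψ a).symm (p.1, 0)) • τ i (p.1, w)) p.2 := by
      intro i
      by_cases hi : (a : M) ∈ tsupport (χ i)
      · filter_upwards [hτd i (hχ i hi)] with p hp
        have h1 : DifferentiableAt ℂ (fun w => τ i (p.1, w)) p.2 :=
          DifferentiableAt.comp p.2 (g := τ i) (f := fun w => (p.1, w))
            (hp.differentiableAt (by simp)) (by fun_prop)
        exact h1.fun_const_smul _
      · filter_upwards [hχ0 i hi] with p hp
        simp only [hp, zero_smul]
        exact differentiableAt_const _
    filter_upwards [Filter.eventually_all.2 h] with p hp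
    exact DifferentiableAt.fun_sum fun i _ => hp i

/-- There is a retraction `ρ` of a neighborhood of the compact hypersurface `H` onto `H` that is
smooth and whose fibers are holomorphic curves transverse to `H`. In the chart `ψ a` near `a` it is
given by the map `r`, and its fibers by the holomorphic equations `Γ = 0`. -/
theorem IsHypersurfaceAtlas.exists_retraction [T2Space M] [CompactSpace M]
    (hψ : IsHypersurfaceAtlas (E := E) H g ψ) (hH : IsClosed H) :
    ∃ ρ : M → M, ∀ a : H, ∃ (r : HypModel E × ℂ → HypModel E) (O : Set (HypModel E × ℂ)),
      IsOpen O ∧ O ⊆ (ψ a).target ∧ ψ a a ∈ O ∧ ContDiffOn ℝ ∞ r O ∧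
      (∀ w ∈ O, (r w, (0 : ℂ)) ∈ (ψ a).target ∧ ρ ((ψ a).symm w) = (ψ a).symm (r w, 0)) ∧
      (∀ k, (k, (0 : ℂ)) ∈ O → r (k, 0) = k) ∧
      ∀ w ∈ O, ∃ Γ : HypModel E × ℂ → HypModel E, DifferentiableOn ℂ Γ O ∧
        (∀ w' ∈ O, Γ w' = 0 ↔ r w' = r w) ∧
        ∀ w' ∈ O, ∃ e : (HypModel E × ℂ) ≃L[ℂ] (HypModel E × ℂ),
          HasFDerivAt (fun w' => (Γ w', w'.2)) (e : (HypModel E × ℂ) →L[ℂ] (HypModel E × ℂ)) w' := by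
  have hcover : H ⊆ ⋃ a : H, (ψ a).source := fun x hx => mem_iUnion_of_mem ⟨x, hx⟩ (hψ.mem_source _)
  obtain ⟨t, ht⟩ := hH.isCompact.elim_finite_subcover _ (fun a => (ψ a).open_source) hcover
  obtain ⟨f, hf⟩ := SmoothPartitionOfUnity.exists_isSubordinate 𝓘(ℝ, E) hH
    (fun i : t => (ψ i).source) (fun i => (ψ i).open_source) (by
      intro x hx
      obtain ⟨i, hi, hxi⟩ := mem_iUnion₂.1 (ht hx)
      exact mem_iUnion_of_mem ⟨i, hi⟩ hxi)
  set χ : t → M → ℝ := fun i => f i with hχdef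
  set j : t → H := fun i => i with hj
  have hχs : ∀ i, ContMDiff 𝓘(ℝ, E) 𝓘(ℝ, ℝ) ∞ (χ i) := fun i => (f i).contMDiff
  have hχ : ∀ i, tsupport (χ i) ⊆ (ψ (j i)).source := hf
  have hχ1 : ∀ x ∈ H, ∑ i, χ i x = 1 := fun x hx => by
    rw [← finsum_eq_sum_of_fintype]
    exact f.sum_eq_one hx
  choose r A O hA hO hkA hkO hrs hrA hiff hr0 hΓ using hψ.exists_retraction_coord hχs hχ hχ1
  have haa : ∀ a : H, ((ψ a a).1, (0 : ℂ)) = ψ a a := fun a => hψ.mk_fst_zero a.2 (hψ.mem_source a)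
  -- The incidence relation `ρ y = x` near the diagonal of `H`.
  let S : Type _ := {p : M × M // ∃ hx : p.1 ∈ H, hypDisplacement j ψ χ ⟨p.1, hx⟩ p.1 p.2 = 0}
  let diag : H → S := fun a => ⟨(a, a), a.2, by simp [hypDisplacement]⟩
  have hdiag : Continuous diag :=
    Continuous.subtype_mk (continuous_subtype_val.prodMk continuous_subtype_val) _
  have hHc : CompactSpace H := isCompact_iff_compactSpace.1 hH.isCompact
  have hS : ∀ (a : H) (p : S), p.1.1 ∈ (ψ a).source → (ψ a p.1.1).1 ∈ A a →
      p.1.2 ∈ (ψ a).source → ψ a p.1.2 ∈ O a → p.1.1 = (ψ a).symm (r a (ψ a p.1.2), 0) := by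
    rintro a ⟨⟨x, y⟩, hx, hxy⟩ h1 h2 h3 h4
    have h5 := (hψ.hypDisplacement_eq_zero_iff hχ hx h1 (hψ.mem_source ⟨x, hx⟩) y).1 hxy
    have h6 := (hiff a _ h2 _ h4).1 (by rw [hψ.symm_mk_zero hx h1, (ψ a).left_inv h3]; exact h5)
    change x = _
    rw [← h6, hψ.symm_mk_zero hx h1]
  have hnhds : ∀ a : H, ∀ᶠ p : S in 𝓝 (diag a), p.1.1 ∈ (ψ a).source ∧ (ψ a p.1.1).1 ∈ A a ∧
      p.1.2 ∈ (ψ a).source ∧ ψ a p.1.2 ∈ O a := by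
    intro a
    have hc : ContinuousAt (fun y => (ψ a y)) (a : M) := (ψ a).continuousAt (hψ.mem_source a)
    have h1 : ∀ᶠ x in 𝓝 (a : M), x ∈ (ψ a).source ∧ (ψ a x).1 ∈ A a :=
      Filter.Eventually.and ((ψ a).open_source.mem_nhds (hψ.mem_source a))
        ((continuousAt_fst.comp hc).preimage_mem_nhds ((hA a).mem_nhds (hkA a)))
    have h2 : ∀ᶠ y in 𝓝 (a : M), y ∈ (ψ a).source ∧ ψ a y ∈ O a :=
      Filter.Eventually.and ((ψ a).open_source.mem_nhds (hψ.mem_source a))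
        (hc.preimage_mem_nhds ((hO a).mem_nhds (haa a ▸ hkO a)))
    have h3 : Filter.Tendsto (fun p : S => p.1.1) (𝓝 (diag a)) (𝓝 (a : M)) :=
      (continuous_fst.comp continuous_subtype_val).continuousAt (x := diag a)
    have h4 : Filter.Tendsto (fun p : S => p.1.2) (𝓝 (diag a)) (𝓝 (a : M)) :=
      (continuous_snd.comp continuous_subtype_val).continuousAt (x := diag a)
    filter_upwards [h3.eventually h1, h4.eventually h2] with p hp hp' using
      ⟨hp.1, hp.2, hp'.1, hp'.2⟩
  -- The projection `(x, y) ↦ y` of the incidence relation is injective on the compact diagonal, and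
  -- locally injective near it, hence injective on a neighborhood `T` of it; `ρ` is its inverse.
  obtain ⟨T, hT, hTinj⟩ := Set.InjOn.exists_mem_nhdsSet (f := fun p : S => p.1.2)
    (s := range diag) (by
      rintro _ ⟨a, rfl⟩ _ ⟨a', rfl⟩ h
      have h' : a = a' := Subtype.ext h
      rw [h']) (isCompact_range hdiag)
    (fun _ _ => (continuous_snd.comp continuous_subtype_val).continuousAt) (by
      rintro _ ⟨a, rfl⟩
      refine ⟨_, hnhds a, ?_⟩
      rintro p ⟨h1, h2, h3, h4⟩ p' ⟨h1', h2', h3', h4'⟩ hpp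
      refine Subtype.ext (Prod.ext ?_ hpp)
      rw [hS a p h1 h2 h3 h4, hS a p' h1' h2' h3' h4']
      exact congrArg (fun y => (ψ a).symm (r a (ψ a y), 0)) hpp)
  classical
  refine ⟨fun y => if h : ∃ p ∈ T, p.1.2 = y then h.choose.1.1 else y, fun a => ?_⟩
  set ρ : M → M := fun y => if h : ∃ p ∈ T, p.1.2 = y then h.choose.1.1 else y with hρ
  have hρT : ∀ p ∈ T, ρ p.1.2 = p.1.1 := by
    intro p hp
    have h : ∃ p' ∈ T, p'.1.2 = p.1.2 := ⟨p, hp, rfl⟩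
    rw [hρ]
    simp only [dif_pos h]
    rw [hTinj h.choose_spec.1 hp h.choose_spec.2]
  have hTa : T ∈ 𝓝 (diag a) := mem_nhdsSet_iff_forall.1 hT _ ⟨a, rfl⟩
  obtain ⟨T', hT', hT'T⟩ := mem_nhds_subtype _ _ _ |>.1 hTa
  have hk₀t : ψ a a ∈ (ψ a).target := (ψ a).map_source (hψ.mem_source a)
  have hk₀O : ψ a a ∈ O a := haa a ▸ hkO a
  have hra : r a (ψ a a) = (ψ a a).1 := by
    rw [← haa a]; exact hr0 a _ (hkA a) (hkO a)
  -- The open set on which `ρ` is given by `r a`.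
  have hrc : ContinuousAt (r a) (ψ a a) := (hrs a).continuousOn.continuousAt ((hO a).mem_nhds hk₀O)
  have hsa : ContinuousAt (ψ a).symm (ψ a a) := (ψ a).symm.continuousAt hk₀t
  have hrc0 : ContinuousAt (fun w => (r a w, (0 : ℂ))) (ψ a a) := hrc.prodMk continuousAt_const
  have hr00 : (r a (ψ a a), (0 : ℂ)) = ψ a a := by rw [hra, haa a]
  have hc2 : ContinuousAt (fun w => ((ψ a).symm (r a w, 0), (ψ a).symm w)) (ψ a a) := by
    refine ContinuousAt.prodMk (ContinuousAt.comp (f := fun w => (r a w, (0 : ℂ)))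
      (g := (ψ a).symm) ?_ hrc0) hsa
    rwa [hr00]
  have hev : ∀ᶠ w in 𝓝 (ψ a a), w ∈ (ψ a).target ∧ w ∈ O a ∧ (w.2 = 0 → w.1 ∈ A a) ∧
      (r a w, (0 : ℂ)) ∈ (ψ a).target ∧ ((ψ a).symm (r a w, 0), (ψ a).symm w) ∈ T' := by
    refine Filter.Eventually.and ((ψ a).open_target.mem_nhds hk₀t) (Filter.Eventually.and
      ((hO a).mem_nhds hk₀O) (Filter.Eventually.and ?_ (Filter.Eventually.and
        (hrc0.preimage_mem_nhds ((ψ a).open_target.mem_nhds (hr00.symm ▸ hk₀t)))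
        (hc2.preimage_mem_nhds ?_))))
    · filter_upwards [continuousAt_fst.preimage_mem_nhds ((hA a).mem_nhds (hkA a))] with w hw _
        using hw
    · simp only [hr00, (ψ a).left_inv (hψ.mem_source a)]
      exact hT'
  obtain ⟨O', hO'sub, hO', haO'⟩ := eventually_nhds_iff.1 hev
  refine ⟨r a, O', hO', fun w hw => (hO'sub w hw).1, haO',
    (hrs a).mono fun w hw => (hO'sub w hw).2.1, fun w hw => ?_, fun k hk => ?_, fun w hw => ?_⟩
  · obtain ⟨h1, h2, -, h3, h4⟩ := hO'sub w hw
    refine ⟨h3, ?_⟩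
    have hxH := hψ.symm_mem h3
    have hz : hypDisplacement j ψ χ a ((ψ a).symm (r a w, 0)) ((ψ a).symm w) = 0 :=
      (hiff a _ (hrA a h2) _ h2).2 rfl
    set p : S := ⟨((ψ a).symm (r a w, 0), (ψ a).symm w), hxH,
      (hψ.hypDisplacement_eq_zero_iff hχ hxH ((ψ a).map_target h3) (hψ.mem_source ⟨_, hxH⟩) _).2 hz⟩
    exact hρT p (hT'T h4)
  · obtain ⟨h1, h2, h3, -⟩ := hO'sub _ hk
    exact hr0 a k (h3 rfl) h2
  · have hwA := hrA a (hO'sub w hw).2.1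
    refine ⟨fun w' => hypDisplacement j ψ χ a ((ψ a).symm (r a w, 0)) ((ψ a).symm w'),
      (hΓ a _ hwA).1.mono fun w hw => (hO'sub w hw).2.1, fun w' hw' => ?_, fun w' hw' =>
        (hΓ a _ hwA).2 w' (hO'sub w' hw').2.1⟩
    rw [hiff a _ hwA w' (hO'sub w' hw').2.1, eq_comm]

end Retraction

/-! ### The zero locus of a transverse linear functional on a hermitian line bundle -/

section Functional

variable {E : Type*} [NormedAddCommGroup E] [NormedSpace ℂ E] [FiniteDimensional ℂ E]
  {M : Type*} [TopologicalSpace M] [ChartedSpace E M] [IsManifold 𝓘(ℂ, E) ω M]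
  {F : Type*} [NormedAddCommGroup F] [NormedSpace ℂ F]
  {N : M → Type*} [∀ x, AddCommGroup (N x)] [∀ x, Module ℂ (N x)] [∀ x, TopologicalSpace (N x)]
  [TopologicalSpace (Bundle.TotalSpace F N)] [FiberBundle F N]
  [∀ x, IsTopologicalAddGroup (N x)] [∀ x, ContinuousSMul ℂ (N x)]
  [VectorBundle ℂ F N] [ContMDiffVectorBundle ω F N 𝓘(ℂ, E)]

/-- The value of the linear functionals `ℓ` on the frame `lineFrame N b x₀`. -/
noncomputable def pairCoeff (ℓ : (y : M) → N y →ₗ[ℂ] ℂ) (b : F ≃L[ℂ] ℂ) (x₀ y : M) : ℂ :=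
  ℓ y (lineFrame N b x₀ y)

/-- The family `ℓ` of linear functionals on the fibers is holomorphic and vanishes transversely. -/
structure IsTransverseFunctional (E : Type*) [NormedAddCommGroup E] [NormedSpace ℂ E]
    {M : Type*} [TopologicalSpace M] [ChartedSpace E M]
    {F : Type*} [NormedAddCommGroup F] [NormedSpace ℂ F]
    {N : M → Type*} [∀ x, AddCommGroup (N x)] [∀ x, Module ℂ (N x)] [∀ x, TopologicalSpace (N x)]
    [TopologicalSpace (Bundle.TotalSpace F N)] [FiberBundle F N] [VectorBundle ℂ F N]
    (ℓ : (y : M) → N y →ₗ[ℂ] ℂ) (b : F ≃L[ℂ] ℂ) : Prop where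
  holomorphic : ∀ x₀, ∀ y ∈ (trivializationAt F N x₀).baseSet,
    MDifferentiableAt 𝓘(ℂ, E) 𝓘(ℂ, ℂ) (pairCoeff ℓ b x₀) y
  transverse : ∀ x, ℓ x = 0 → mfderiv 𝓘(ℂ, E) 𝓘(ℂ, ℂ) (pairCoeff ℓ b x) x ≠ 0

variable {ℓ : (y : M) → N y →ₗ[ℂ] ℂ} {b : F ≃L[ℂ] ℂ}

theorem apply_eq_frameCoord_mul_pairCoeff (ℓ : (y : M) → N y →ₗ[ℂ] ℂ) (b : F ≃L[ℂ] ℂ) (x₀ : M) {y : M}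
    (hy : y ∈ (trivializationAt F N x₀).baseSet) (n : N y) :
    ℓ y n = frameCoord b x₀ (⟨y, n⟩ : Bundle.TotalSpace F N) * pairCoeff ℓ b x₀ y := by
  conv_lhs => rw [eq_frameCoord_smul b x₀ hy n]
  rw [map_smul, smul_eq_mul, pairCoeff]

theorem pairCoeff_eq_zero_iff {x₀ y : M} (hy : y ∈ (trivializationAt F N x₀).baseSet) :
    pairCoeff ℓ b x₀ y = 0 ↔ ℓ y = 0 := by
  constructor
  · intro h
    ext n
    rw [apply_eq_frameCoord_mul_pairCoeff ℓ b x₀ hy n, h, mul_zero]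
    rfl
  · intro h
    rw [pairCoeff, h]
    rfl

/-- The square of the norm of the frame `lineFrame N b x₀`. -/
noncomputable def frameSq (h : HermitianMetric E F N) (b : F ≃L[ℂ] ℂ) (x₀ y : M) : ℝ :=
  (h.inner y (lineFrame N b x₀ y) (lineFrame N b x₀ y)).re

variable {h : HermitianMetric E F N}

theorem frameSq_pos {x₀ y : M} (hy : y ∈ (trivializationAt F N x₀).baseSet) : 0 < frameSq h b x₀ y :=
  h.pos _ _ (lineFrame_ne_zero b x₀ hy)

theorem contMDiffAt_frameSq {x₀ y : M} (hy : y ∈ (trivializationAt F N x₀).baseSet) :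
    ContMDiffAt 𝓘(ℝ, E) 𝓘(ℝ, ℝ) ∞ (frameSq h b x₀) y :=
  ContMDiffAt.comp (g := fun u : Bundle.TotalSpace F N => (h.inner u.1 u.2 u.2).re) y
      h.smooth.contMDiffAt (smoothSectionAt_lineFrame b x₀ hy)

theorem inner_smul_self_re (h : HermitianMetric E F N) (y : M) (c : ℂ) (n : N y) :
    (h.inner y (c • n) (c • n)).re = ‖c‖ ^ 2 * (h.inner y n n).re := by
  rw [map_smul, map_smulₛₗ, LinearMap.smul_apply, h.inner_self_eq, smul_eq_mul, smul_eq_mul,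
    ← mul_assoc, Complex.mul_conj, ← Complex.ofReal_mul, Complex.ofReal_re, Complex.ofReal_re,
    Complex.normSq_eq_norm_sq]

theorem inner_self_re_eq (h : HermitianMetric E F N) (b : F ≃L[ℂ] ℂ) {x₀ : M} {u : Bundle.TotalSpace F N}
    (hu : u.1 ∈ (trivializationAt F N x₀).baseSet) :
    (h.inner u.1 u.2 u.2).re = ‖frameCoord b x₀ u‖ ^ 2 * frameSq h b x₀ u.1 := by
  conv_lhs => rw [eq_frameCoord_smul b x₀ hu u.2, inner_smul_self_re]
  rfl

/-- The square of the norm of the functional `ℓ y`. -/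
noncomputable def functionalSq (h : HermitianMetric E F N) (b : F ≃L[ℂ] ℂ)
    (ℓ : (y : M) → N y →ₗ[ℂ] ℂ) (y : M) : ℝ :=
  ‖pairCoeff ℓ b y y‖ ^ 2 / frameSq h b y y

theorem functionalSq_eq (h : HermitianMetric E F N) (b : F ≃L[ℂ] ℂ)
    (ℓ : (y : M) → N y →ₗ[ℂ] ℂ) {x₀ y : M} (hy : y ∈ (trivializationAt F N x₀).baseSet) :
    functionalSq h b ℓ y = ‖pairCoeff ℓ b x₀ y‖ ^ 2 / frameSq h b x₀ y := by
  have hyy := FiberBundle.mem_baseSet_trivializationAt' (F := F) (E := N) y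
  set c := frameCoord b x₀ (⟨y, lineFrame N b y y⟩ : Bundle.TotalSpace F N)
  have h1 : lineFrame N b y y = c • lineFrame N b x₀ y := eq_frameCoord_smul b x₀ hy _
  have hc : c ≠ 0 := by
    intro hc
    rw [hc, zero_smul] at h1
    exact lineFrame_ne_zero b y hyy h1
  have h2 := (frameSq_pos (h := h) (b := b) hy).ne'
  have h3 : frameSq h b y y = ‖c‖ ^ 2 * frameSq h b x₀ y := by
    rw [frameSq, h1, inner_smul_self_re]; rfl
  have h4 : pairCoeff ℓ b y y = c * pairCoeff ℓ b x₀ y := by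
    rw [pairCoeff, h1, map_smul]; rfl
  rw [functionalSq, h3, h4, norm_mul]
  have := norm_ne_zero_iff.2 hc
  field_simp

/-- The Cauchy–Schwarz inequality, an equality in rank one. -/
theorem norm_apply_sq (h : HermitianMetric E F N) (b : F ≃L[ℂ] ℂ)
    (ℓ : (y : M) → N y →ₗ[ℂ] ℂ) (u : Bundle.TotalSpace F N) :
    ‖ℓ u.1 u.2‖ ^ 2 = functionalSq h b ℓ u.1 * (h.inner u.1 u.2 u.2).re := by
  have hu := FiberBundle.mem_baseSet_trivializationAt' (F := F) (E := N) u.1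
  rw [apply_eq_frameCoord_mul_pairCoeff ℓ b u.1 hu, inner_self_re_eq h b hu, functionalSq, norm_mul]
  have := (frameSq_pos (h := h) (b := b) hu).ne'
  field_simp

theorem functionalSq_nonneg (y : M) : 0 ≤ functionalSq h b ℓ y :=
  div_nonneg (sq_nonneg _) (frameSq_pos (FiberBundle.mem_baseSet_trivializationAt' y)).le

theorem functionalSq_eq_zero_iff {y : M} : functionalSq h b ℓ y = 0 ↔ ℓ y = 0 := by
  have hy := FiberBundle.mem_baseSet_trivializationAt' (F := F) (E := N) y
  have h1 := (frameSq_pos (h := h) (b := b) hy).ne'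
  rw [functionalSq, div_eq_zero_iff, or_iff_left h1, sq_eq_zero_iff, norm_eq_zero,
    pairCoeff_eq_zero_iff hy]

theorem IsTransverseFunctional.continuous_functionalSq (hℓ : IsTransverseFunctional E ℓ b) :
    Continuous (functionalSq h b ℓ) := by
  rw [continuous_iff_continuousAt]
  intro x
  have hx := FiberBundle.mem_baseSet_trivializationAt' (F := F) (E := N) x
  have h1 : ContinuousAt (fun y => ‖pairCoeff ℓ b x y‖ ^ 2 / frameSq h b x y) x :=
    ((hℓ.holomorphic x x hx).continuousAt.norm.pow 2).div (contMDiffAt_frameSq hx).continuousAt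
      (frameSq_pos hx).ne'
  refine h1.congr ?_
  filter_upwards [(trivializationAt F N x).open_baseSet.mem_nhds hx] with y hy
  rw [functionalSq_eq h b ℓ hy]

theorem IsTransverseFunctional.isClosed_zeros (h : HermitianMetric E F N) (hℓ : IsTransverseFunctional E ℓ b) :
    IsClosed {y | ℓ y = 0} := by
  have h1 : {y | ℓ y = 0} = functionalSq h b ℓ ⁻¹' {0} := by
    ext y
    exact functionalSq_eq_zero_iff.symm
  rw [h1]
  exact isClosed_singleton.preimage hℓ.continuous_functionalSq

theorem IsTransverseFunctional.exists_atlas (hℓ : IsTransverseFunctional E ℓ b) :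
    ∃ ψ : {y | ℓ y = 0} → OpenPartialHomeomorph M (HypModel E × ℂ),
      IsHypersurfaceAtlas (E := E) {y | ℓ y = 0} (fun a => pairCoeff ℓ b a) ψ ∧
      ∀ a, (ψ a).source ⊆ trivDomain (E := E) F N (a : M) := by
  have h1 : ∀ a : {y | ℓ y = 0}, ∃ ψ : OpenPartialHomeomorph M (HypModel E × ℂ),
      (a : M) ∈ ψ.source ∧ ψ.source ⊆ trivDomain (E := E) F N (a : M) ∧
      IsAdaptedChart (E := E) (pairCoeff ℓ b a) ψ := fun a =>
    exists_isAdaptedChart (isOpen_trivDomain (a : M))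
      (fun y hy => (hℓ.holomorphic a y hy.2).mdifferentiableWithinAt) (mem_trivDomain (a : M))
      (hℓ.transverse a a.2)
  choose ψ hψ1 hψ2 hψ3 using h1
  exact ⟨ψ, ⟨hψ1, hψ3, fun a y hy => (pairCoeff_eq_zero_iff (hψ2 a hy).2).symm⟩, hψ2⟩

/-- `Θ` is a smooth chart around `a` in which the fibers of the retraction `ρ` are the sets where
the first coordinate is constant, and in which the absolute value of the second coordinate is the
norm of `ℓ`. The fibers of `ρ` are holomorphic curves parametrized by the coefficient of `ℓ`. -/
structure IsTubeChart (h : HermitianMetric E F N) (b : F ≃L[ℂ] ℂ) (ℓ : (y : M) → N y →ₗ[ℂ] ℂ)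
    (ρ : M → M) (a : M) (Θ : OpenPartialHomeomorph M (HypModel E × ℂ)) : Prop where
  mem_source : a ∈ Θ.source
  source_subset : Θ.source ⊆ trivDomain (E := E) F N a
  contMDiffOn : ContMDiffOn 𝓘(ℝ, E) 𝓘(ℝ, HypModel E × ℂ) ∞ Θ Θ.source
  contMDiffOn_symm : ContMDiffOn 𝓘(ℝ, HypModel E × ℂ) 𝓘(ℝ, E) ∞ Θ.symm Θ.target
  norm_snd_sq : ∀ y ∈ Θ.source, ‖(Θ y).2‖ ^ 2 = functionalSq h b ℓ y
  retraction_mem : ∀ y ∈ Θ.source, ℓ (ρ y) = 0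
  retraction_self : ∀ y ∈ Θ.source, ℓ y = 0 → ρ y = y
  fst_eq_iff : ∀ y ∈ Θ.source, ∀ y' ∈ Θ.source, (Θ y).1 = (Θ y').1 ↔ ρ y = ρ y'
  exists_curve : ∀ y ∈ Θ.source, ∃ (O : Set ℂ) (γ : ℂ → M), IsOpen O ∧ pairCoeff ℓ b a y ∈ O ∧
    ContMDiffOn 𝓘(ℂ, ℂ) 𝓘(ℂ, E) ∞ γ O ∧
    (∀ t ∈ O, γ t ∈ Θ.source ∧ ρ (γ t) = ρ y ∧ pairCoeff ℓ b a (γ t) = t) ∧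
    ∀ᶠ y' in 𝓝 y, ρ y' = ρ y → pairCoeff ℓ b a y' ∈ O ∧ γ (pairCoeff ℓ b a y') = y'

/-- The linear automorphism `(κ, c) ↦ (κ + l c, t c)`. -/
noncomputable def shearEquiv {K : Type*} [NormedAddCommGroup K] [NormedSpace ℝ K] (l : ℂ →L[ℝ] K)
    {t : ℝ} (ht : t ≠ 0) : (K × ℂ) ≃L[ℝ] (K × ℂ) :=
  ContinuousLinearEquiv.equivOfInverse
    ((ContinuousLinearMap.fst ℝ K ℂ + l ∘L ContinuousLinearMap.snd ℝ K ℂ).prod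
      (t • ContinuousLinearMap.snd ℝ K ℂ))
    ((ContinuousLinearMap.fst ℝ K ℂ - t⁻¹ • (l ∘L ContinuousLinearMap.snd ℝ K ℂ)).prod
      (t⁻¹ • ContinuousLinearMap.snd ℝ K ℂ))
    (fun p => by
      refine Prod.ext ?_ ?_
      · change p.1 + l p.2 - t⁻¹ • l (t • p.2) = p.1
        rw [map_smul, smul_smul, inv_mul_cancel₀ ht, one_smul, add_sub_cancel_right]
      · change t⁻¹ • t • p.2 = p.2
        rw [smul_smul, inv_mul_cancel₀ ht, one_smul])
    (fun p => by
      refine Prod.ext ?_ ?_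
      · change p.1 - t⁻¹ • l p.2 + l (t⁻¹ • p.2) = p.1
        rw [map_smul, sub_add_cancel]
      · change t • t⁻¹ • p.2 = p.2
        rw [smul_smul, mul_inv_cancel₀ ht, one_smul])

/-- The retraction onto the zero locus of `ℓ` has tube charts `(r, ‖e‖⁻¹ ℓ e)` around all points of
the zero locus, where `r` is the retraction in an adapted chart and `e` is a holomorphic frame. -/
theorem IsTransverseFunctional.exists_isTubeChart [T2Space M] [CompactSpace M]
    (h : HermitianMetric E F N) (hℓ : IsTransverseFunctional E ℓ b) :
    ∃ ρ : M → M, ∀ a, ℓ a = 0 → ∃ Θ, IsTubeChart h b ℓ ρ a Θ := by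
  obtain ⟨ψ, hψ, hψt⟩ := hℓ.exists_atlas
  obtain ⟨ρ, hρ⟩ := hψ.exists_retraction (hℓ.isClosed_zeros h)
  refine ⟨ρ, fun a₀ ha₀ => ?_⟩
  set a : {y | ℓ y = 0} := ⟨a₀, ha₀⟩ with ha
  obtain ⟨r, O, hO, hOt, haO, hrs, hrρ, hr0, hΓ⟩ := hρ a
  have haa : ((ψ a a).1, (0 : ℂ)) = ψ a a := hψ.mk_fst_zero a.2 (hψ.mem_source a)
  -- The scaling factor that turns the coefficient of `ℓ` into its norm.
  set lam : HypModel E × ℂ → ℝ := fun w => (Real.sqrt (frameSq h b a₀ ((ψ a).symm w)))⁻¹ with hlam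
  have hsrc : ∀ w ∈ O, (ψ a).symm w ∈ (trivializationAt F N a₀).baseSet := fun w hw =>
    (hψt a ((ψ a).map_target (hOt hw))).2
  have hlamc : ContDiffOn ℝ ∞ lam O := by
    intro w hw
    have h1 : ContMDiffAt 𝓘(ℝ, HypModel E × ℂ) 𝓘(ℝ, ℝ) ∞
        (fun w => frameSq h b a₀ ((ψ a).symm w)) w :=
      (contMDiffAt_frameSq (hsrc w hw)).comp w (ContMDiffWithinAt.real_of_complex
        ((hψ.adapted a).contMDiffOn_symm.contMDiffAt ((ψ a).open_target.mem_nhds (hOt hw))))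
    have h2 := frameSq_pos (h := h) (b := b) (hsrc w hw)
    exact (((contMDiffAt_iff_contDiffAt.1 h1).sqrt h2.ne').inv
      (Real.sqrt_pos.2 h2).ne').contDiffWithinAt
  have hlam0 : ∀ w ∈ O, lam w ≠ 0 := fun w hw =>
    inv_ne_zero (Real.sqrt_pos.2 (frameSq_pos (h := h) (b := b) (hsrc w hw))).ne'
  set f : HypModel E × ℂ → HypModel E × ℂ := fun w => (r w, lam w • w.2) with hf
  have hfs : ContDiffOn ℝ ∞ f O := hrs.prodMk (hlamc.smul contDiffOn_snd)
  set w₀ := ψ a a with hw₀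
  have hw₀2 : w₀.2 = 0 := by rw [← haa]
  have hrd : HasFDerivAt r (fderiv ℝ r w₀) w₀ :=
    ((hrs.contDiffAt (hO.mem_nhds haO)).differentiableAt (by simp)).hasFDerivAt
  have hrk : ∀ κ : HypModel E, fderiv ℝ r w₀ (κ, 0) = κ := by
    intro κ
    have h1 : HasFDerivAt (fun k : HypModel E => r (k, 0))
        (fderiv ℝ r w₀ ∘L (ContinuousLinearMap.id ℝ (HypModel E)).prod 0) w₀.1 := by
      refine HasFDerivAt.comp w₀.1 (g := r) (f := fun k : HypModel E => (k, (0 : ℂ))) ?_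
        ((hasFDerivAt_id _).prodMk (hasFDerivAt_const _ _))
      rwa [haa]
    have h2 : HasFDerivAt (fun k : HypModel E => r (k, 0)) (ContinuousLinearMap.id ℝ (HypModel E))
        w₀.1 := by
      refine (hasFDerivAt_id _).congr_of_eventuallyEq ?_
      have h3 : Continuous fun k : HypModel E => (k, (0 : ℂ)) := by fun_prop
      filter_upwards [h3.continuousAt.preimage_mem_nhds (hO.mem_nhds (haa.symm ▸ haO))] with k hk
        using hr0 k hk
    exact congrArg (fun A : HypModel E →L[ℝ] HypModel E => A κ) (h1.unique h2)
  set l : ℂ →L[ℝ] HypModel E := fderiv ℝ r w₀ ∘L ContinuousLinearMap.inr ℝ (HypModel E) ℂ with hl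
  have hfd : HasFDerivAt f (shearEquiv l (hlam0 w₀ haO) :
      (HypModel E × ℂ) →L[ℝ] (HypModel E × ℂ)) w₀ := by
    have h1 : HasFDerivAt lam (fderiv ℝ lam w₀) w₀ :=
      ((hlamc.contDiffAt (hO.mem_nhds haO)).differentiableAt (by simp)).hasFDerivAt
    have h2 := hrd.prodMk (h1.smul (hasFDerivAt_snd (𝕜 := ℝ) (p := w₀)))
    have h3 : (shearEquiv l (hlam0 w₀ haO) : (HypModel E × ℂ) →L[ℝ] (HypModel E × ℂ)) =
        (fderiv ℝ r w₀).prod (lam w₀ • ContinuousLinearMap.snd ℝ (HypModel E) ℂ +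
          (fderiv ℝ lam w₀).smulRight w₀.2) := by
      refine ContinuousLinearMap.ext fun p => Prod.ext ?_ ?_
      · change p.1 + fderiv ℝ r w₀ (0, p.2) = fderiv ℝ r w₀ p
        have h4 : p = (p.1, 0) + (0, p.2) := by simp
        conv_rhs => rw [h4, map_add, hrk]
      · change lam w₀ • p.2 = lam w₀ • p.2 + fderiv ℝ lam w₀ p • w₀.2
        rw [hw₀2, smul_zero, add_zero]
    rw [h3]
    exact h2
  obtain ⟨Φ, hΦx, hΦs, hΦf, hΦsm, -⟩ :=
    exists_openPartialHomeomorph_of_contDiffOn hO hfs haO (shearEquiv l (hlam0 w₀ haO)) hfd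
  have hψO : ∀ y ∈ ((ψ a).trans Φ).source, y ∈ (ψ a).source ∧ ψ a y ∈ O := by
    intro y hy
    rw [OpenPartialHomeomorph.trans_source] at hy
    exact ⟨hy.1, hΦs hy.2⟩
  have hρy : ∀ y ∈ ((ψ a).trans Φ).source, ρ y = (ψ a).symm (r (ψ a y), 0) := by
    intro y hy
    obtain ⟨h1, h2⟩ := hψO y hy
    have := (hrρ _ h2).2
    rwa [(ψ a).left_inv h1] at this
  have hρiff : ∀ y ∈ (ψ a).source, ψ a y ∈ O → ∀ y' ∈ (ψ a).source, ψ a y' ∈ O →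
      (r (ψ a y) = r (ψ a y') ↔ ρ y = ρ y') := by
    intro y hy hyO y' hy' hyO'
    have h1 := hrρ _ hyO
    have h2 := hrρ _ hyO'
    rw [(ψ a).left_inv hy] at h1
    rw [(ψ a).left_inv hy'] at h2
    rw [h1.2, h2.2]
    constructor
    · intro h3; rw [h3]
    · intro h3
      exact congrArg Prod.fst ((ψ a).symm.injOn h1.1 h2.1 h3)
  refine ⟨(ψ a).trans Φ, ?_, ?_, ?_, ?_, ?_, ?_, ?_, ?_, ?_⟩
  · rw [OpenPartialHomeomorph.trans_source]
    exact ⟨hψ.mem_source a, hΦx⟩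
  · exact fun y hy => hψt a (hψO y hy).1
  · rw [OpenPartialHomeomorph.trans_source, OpenPartialHomeomorph.coe_trans, hΦf]
    refine (hfs.mono hΦs).contMDiffOn.comp (t := Φ.source) (fun y hy => ?_) fun y hy => hy.2
    exact ContMDiffWithinAt.real_of_complex ((hψ.adapted a).contMDiffOn.mono inter_subset_left y hy)
  · rw [OpenPartialHomeomorph.trans_target, OpenPartialHomeomorph.coe_trans_symm]
    refine ContMDiffOn.comp (t := (ψ a).target) (fun y hy =>
      ContMDiffWithinAt.real_of_complex ((hψ.adapted a).contMDiffOn_symm y hy))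
      (hΦsm.contMDiffOn.mono inter_subset_left) fun y hy => hy.2
  · intro y hy
    obtain ⟨h1, h2⟩ := hψO y hy
    have h3 := frameSq_pos (h := h) (b := b) (hψt a h1).2
    rw [OpenPartialHomeomorph.coe_trans, Function.comp_apply, hΦf, functionalSq_eq h b ℓ (hψt a h1).2]
    change ‖(Real.sqrt (frameSq h b a₀ ((ψ a).symm (ψ a y))))⁻¹ • (ψ a y).2‖ ^ 2 = _
    rw [(ψ a).left_inv h1, (hψ.adapted a).snd_eq y h1, norm_smul, mul_pow, norm_inv,
      Real.norm_of_nonneg (Real.sqrt_nonneg _), inv_pow, Real.sq_sqrt h3.le, div_eq_inv_mul]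
  · intro y hy
    rw [hρy y hy]
    exact hψ.symm_mem (hrρ _ (hψO y hy).2).1
  · intro y hy hy0
    obtain ⟨h1, h2⟩ := hψO y hy
    rw [hρy y hy]
    have h3 : ((ψ a y).1, (0 : ℂ)) = ψ a y := hψ.mk_fst_zero hy0 h1
    have h4 := hr0 (ψ a y).1 (h3.symm ▸ h2)
    rw [h3] at h4
    rw [h4, h3, (ψ a).left_inv h1]
  · intro y hy y' hy'
    obtain ⟨h1, h2⟩ := hψO y hy
    obtain ⟨h1', h2'⟩ := hψO y' hy'
    rw [OpenPartialHomeomorph.coe_trans, Function.comp_apply, Function.comp_apply, hΦf]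
    exact hρiff y h1 h2 y' h1' h2'
  · intro y hy
    obtain ⟨h1, h2⟩ := hψO y hy
    -- The curve is `t ↦ Ξ⁻¹ (0, t)`, where the biholomorphic map `Ξ` consists of the equation `Γ`
    -- of the fiber of the retraction and of the last coordinate, the coefficient of `ℓ`.
    obtain ⟨Γ, hΓd, hΓ0, hΓe⟩ := hΓ _ h2
    obtain ⟨e, he⟩ := hΓe _ h2
    have hyΦ : ψ a y ∈ Φ.source := by
      rw [OpenPartialHomeomorph.trans_source] at hy
      exact hy.2
    have hΞs : ContDiffOn ℂ ∞ (fun w => (Γ w, w.2)) Φ.source :=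
      ((contDiffOn_of_differentiableOn_complex hO hΓd).mono hΦs).prodMk contDiffOn_snd
    obtain ⟨Ξ, hΞy, hΞsub, hΞf, hΞsm, -⟩ :=
      exists_openPartialHomeomorph_of_contDiffOn Φ.open_source hΞs hyΦ e he
    have hg : ∀ y' ∈ (ψ a).source, (ψ a y').2 = pairCoeff ℓ b a₀ y' := (hψ.adapted a).snd_eq
    have hΞy0 : ∀ y' ∈ (ψ a).source, ψ a y' ∈ Ξ.source → ρ y' = ρ y →
        Ξ (ψ a y') = (0, pairCoeff ℓ b a₀ y') := by
      intro y' hy' hy'Ξ hρ'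
      have hO' := hΦs (hΞsub hy'Ξ)
      rw [hΞf]
      refine Prod.ext ?_ (hg y' hy')
      exact (hΓ0 _ hO').2 ((hρiff y' hy' hO' y h1 h2).2 hρ')
    have hc : Continuous fun t : ℂ => ((0 : HypModel E), t) := by fun_prop
    refine ⟨(fun t => ((0 : HypModel E), t)) ⁻¹' Ξ.target, fun t => (ψ a).symm (Ξ.symm (0, t)),
      Ξ.open_target.preimage hc, ?_, ?_, ?_, ?_⟩
    · rw [mem_preimage, ← hΞy0 y h1 hΞy rfl]
      exact Ξ.map_source hΞy
    · refine (hψ.adapted a).contMDiffOn_symm.comp (hΞsm.comp (by fun_prop : ContDiff ℂ ∞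
        fun t : ℂ => ((0 : HypModel E), t)).contDiffOn fun t ht => ht).contMDiffOn fun t ht => ?_
      exact hOt (hΦs (hΞsub (Ξ.map_target ht)))
    · intro t ht
      set w := Ξ.symm (0, t) with hw
      have hwΦ := hΞsub (Ξ.map_target ht)
      have hwO := hΦs hwΦ
      have hwt := hOt hwO
      have h3 := Ξ.right_inv ht
      rw [hΞf] at h3
      have h4 : Γ w = 0 := congrArg Prod.fst h3
      have h5 : w.2 = t := congrArg Prod.snd h3
      have h6 := (ψ a).map_target hwt
      have h7 := (ψ a).right_inv hwt
      refine ⟨?_, ?_, ?_⟩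
      · rw [OpenPartialHomeomorph.trans_source]
        refine ⟨h6, ?_⟩
        rw [mem_preimage, h7]
        exact hwΦ
      · refine (hρiff _ h6 (h7.symm ▸ hwO) y h1 h2).1 ?_
        rw [h7]
        exact (hΓ0 w hwO).1 h4
      · rw [← hg _ h6, h7, h5]
    · filter_upwards [(ψ a).open_source.mem_nhds h1,
        ((ψ a).continuousAt h1).preimage_mem_nhds (Ξ.open_source.mem_nhds hΞy)] with y' hy' hy'Ξ hρ'
      have h3 := hΞy0 y' hy' hy'Ξ hρ'
      refine ⟨?_, ?_⟩
      · rw [mem_preimage, ← h3]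
        exact Ξ.map_source hy'Ξ
      · rw [← h3, Ξ.left_inv hy'Ξ, (ψ a).left_inv hy']

end Functional

/-! ### A tubular neighborhood of uniform radius -/

section Tube

variable {E : Type*} [NormedAddCommGroup E] [NormedSpace ℂ E] [FiniteDimensional ℂ E]
  {M : Type*} [TopologicalSpace M] [ChartedSpace E M] [IsManifold 𝓘(ℂ, E) ω M]
  {F : Type*} [NormedAddCommGroup F] [NormedSpace ℂ F]
  {N : M → Type*} [∀ x, AddCommGroup (N x)] [∀ x, Module ℂ (N x)] [∀ x, TopologicalSpace (N x)]
  [TopologicalSpace (Bundle.TotalSpace F N)] [FiberBundle F N]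
  [∀ x, IsTopologicalAddGroup (N x)] [∀ x, ContinuousSMul ℂ (N x)]
  [VectorBundle ℂ F N] [ContMDiffVectorBundle ω F N 𝓘(ℂ, E)]
  {ℓ : (y : M) → N y →ₗ[ℂ] ℂ} {b : F ≃L[ℂ] ℂ} {h : HermitianMetric E F N}
  {ρ : M → M} {a : M} {Θ : OpenPartialHomeomorph M (HypModel E × ℂ)}

theorem IsTubeChart.snd_eq_zero_iff (hΘ : IsTubeChart h b ℓ ρ a Θ) {y : M} (hy : y ∈ Θ.source) :
    (Θ y).2 = 0 ↔ ℓ y = 0 := by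
  rw [← functionalSq_eq_zero_iff (h := h) (b := b), ← hΘ.norm_snd_sq y hy, sq_eq_zero_iff,
    norm_eq_zero]

theorem IsTubeChart.mk_fst_zero (hΘ : IsTubeChart h b ℓ ρ a Θ) {y : M} (hy : y ∈ Θ.source)
    (hy0 : ℓ y = 0) : ((Θ y).1, (0 : ℂ)) = Θ y :=
  Prod.ext rfl ((hΘ.snd_eq_zero_iff hy).2 hy0).symm

theorem IsTubeChart.apply_symm_eq_zero (hΘ : IsTubeChart h b ℓ ρ a Θ) {k : HypModel E}
    (hk : (k, (0 : ℂ)) ∈ Θ.target) : ℓ (Θ.symm (k, 0)) = 0 := by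
  rw [← hΘ.snd_eq_zero_iff (Θ.map_target hk), Θ.right_inv hk]

/-- In a tube chart the retraction is the projection to the first coordinate. -/
theorem IsTubeChart.retraction_eq (hΘ : IsTubeChart h b ℓ ρ a Θ) {y : M} (hy : y ∈ Θ.source)
    (hk : ((Θ y).1, (0 : ℂ)) ∈ Θ.target) : ρ y = Θ.symm ((Θ y).1, 0) := by
  have h1 := Θ.map_target hk
  rw [← hΘ.retraction_self _ h1 (hΘ.apply_symm_eq_zero hk)]
  refine (hΘ.fst_eq_iff y hy _ h1).1 ?_
  rw [Θ.right_inv hk]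

theorem IsTubeChart.continuousAt_retraction (hΘ : IsTubeChart h b ℓ ρ a Θ) {z : M}
    (hz : z ∈ Θ.source) (hz0 : ℓ z = 0) : ContinuousAt ρ z := by
  have h1 : ContinuousAt (fun y => ((Θ y).1, (0 : ℂ))) z :=
    (Θ.continuousAt hz).fst.prodMk continuousAt_const
  have h2 : ((Θ z).1, (0 : ℂ)) ∈ Θ.target := by
    rw [hΘ.mk_fst_zero hz hz0]
    exact Θ.map_source hz
  have h3 : ContinuousAt (fun y => Θ.symm ((Θ y).1, (0 : ℂ))) z :=
    ContinuousAt.comp (g := Θ.symm) (Θ.continuousAt_symm h2) h1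
  refine h3.congr ?_
  filter_upwards [Θ.open_source.mem_nhds hz, h1.preimage_mem_nhds (Θ.open_target.mem_nhds h2)]
    with y hy hy' using (hΘ.retraction_eq hy hy').symm

/-- The tube chart `Θ` covers the whole tube of radius `ε` over the open set `A` of the zero locus
of `ℓ`. -/
structure IsTubeBox (h : HermitianMetric E F N) (b : F ≃L[ℂ] ℂ) (ℓ : (y : M) → N y →ₗ[ℂ] ℂ)
    (ρ : M → M) (ε : ℝ) (Θ : OpenPartialHomeomorph M (HypModel E × ℂ)) (A : Set (HypModel E)) :
    Prop where
  isOpen : IsOpen A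
  prod_subset : A ×ˢ Metric.ball 0 ε ⊆ Θ.target
  mem_source : ∀ y, functionalSq h b ℓ y < ε ^ 2 → ∀ k ∈ A, ρ y = Θ.symm (k, 0) → y ∈ Θ.source

theorem IsTubeBox.mk_zero_mem {ε : ℝ} {A : Set (HypModel E)} (hA : IsTubeBox h b ℓ ρ ε Θ A)
    (hε : 0 < ε) {k : HypModel E} (hk : k ∈ A) : (k, (0 : ℂ)) ∈ Θ.target :=
  hA.prod_subset ⟨hk, Metric.mem_ball_self hε⟩

theorem IsTubeBox.fst_eq {ε : ℝ} {A : Set (HypModel E)} (hA : IsTubeBox h b ℓ ρ ε Θ A)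
    (hε : 0 < ε) (hΘ : IsTubeChart h b ℓ ρ a Θ) {y : M} (hy : functionalSq h b ℓ y < ε ^ 2)
    {k : HypModel E} (hk : k ∈ A) (hyk : ρ y = Θ.symm (k, 0)) : (Θ y).1 = k := by
  have h1 := Θ.map_target (hA.mk_zero_mem hε hk)
  have h2 := (hΘ.fst_eq_iff y (hA.mem_source y hy k hk hyk) _ h1).2 (by
    rw [hyk, hΘ.retraction_self _ h1 (hΘ.apply_symm_eq_zero (hA.mk_zero_mem hε hk))])
  rw [h2, Θ.right_inv (hA.mk_zero_mem hε hk)]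

/-- By compactness of the zero locus, finitely many tube charts cover a tube of uniform radius. -/
theorem IsTransverseFunctional.exists_isTubeBox [T2Space M] [CompactSpace M]
    (hℓ : IsTransverseFunctional E ℓ b)
    (hρ : ∀ a, ℓ a = 0 → ∃ Θ, IsTubeChart h b ℓ ρ a Θ) :
    ∃ ε : ℝ, 0 < ε ∧ ε ≤ 1 ∧ (∀ y, functionalSq h b ℓ y < ε ^ 2 → ℓ (ρ y) = 0) ∧
      ∀ z, ℓ z = 0 → ∃ a Θ A, IsTubeChart h b ℓ ρ a Θ ∧ IsTubeBox h b ℓ ρ ε Θ A ∧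
        z ∈ Θ.source ∧ (Θ z).1 ∈ A := by
  set H : Set M := {y | ℓ y = 0} with hH
  have hHc : IsCompact H := (hℓ.isClosed_zeros h).isCompact
  rcases isEmpty_or_nonempty M with hM | ⟨⟨m⟩⟩
  · exact ⟨1, one_pos, le_rfl, fun y => isEmptyElim y, fun z => isEmptyElim z⟩
  have : Nonempty (OpenPartialHomeomorph M (HypModel E × ℂ)) :=
    -- A junk value for the function `Θ` chosen below, away from the zero locus.
    ⟨{  toFun := fun _ => 0, invFun := fun _ => m, source := ∅, target := ∅
        map_source' := fun _ h => h, map_target' := fun _ h => h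
        left_inv' := fun _ h => h.elim, right_inv' := fun _ h => h.elim
        open_source := isOpen_empty, open_target := isOpen_empty
        continuousOn_toFun := continuousOn_empty _
        continuousOn_invFun := continuousOn_empty _ }⟩
  choose! Θ hΘ using hρ
  have hδ : ∀ a, ℓ a = 0 → ∃ δ > 0, Metric.closedBall (Θ a a).1 δ ×ˢ Metric.closedBall (0 : ℂ) δ ⊆
      (Θ a).target := by
    intro a ha
    obtain ⟨δ, hδ, hδs⟩ := Metric.nhds_basis_closedBall.mem_iff.1
      ((Θ a).open_target.mem_nhds ((Θ a).map_source (hΘ a ha).mem_source))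
    refine ⟨δ, hδ, ?_⟩
    rw [← (hΘ a ha).mk_fst_zero (hΘ a ha).mem_source ha, ← closedBall_prod_same] at hδs
    exact hδs
  choose! δ hδ0 hδ using hδ
  have hz : ∀ a, ℓ a = 0 → ∀ k ∈ Metric.closedBall (Θ a a).1 (δ a), (k, (0 : ℂ)) ∈ (Θ a).target :=
    fun a ha k hk => hδ a ha ⟨hk, Metric.mem_closedBall_self (hδ0 a ha).le⟩
  set C : M → Set M := fun a =>
    (fun k => (Θ a).symm (k, (0 : ℂ))) '' Metric.closedBall (Θ a a).1 (δ a) with hC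
  have hCc : ∀ a, ℓ a = 0 → IsClosed (C a) := fun a ha => by
    refine ((isCompact_closedBall _ _).image_of_continuousOn ?_).isClosed
    exact (Θ a).continuousOn_symm.comp (by fun_prop) fun k hk => hz a ha k hk
  have hCs : ∀ a, ℓ a = 0 → C a ⊆ (Θ a).source := by
    rintro a ha _ ⟨k, hk, rfl⟩
    exact (Θ a).map_target (hz a ha k hk)
  -- Near the zero locus the closed piece `C a` is the image under `ρ` of points of the chart only,
  -- because `ρ` is continuous there and fixes the zero locus.
  set O : M → Set M := fun a => interior {y | ρ y ∈ C a → y ∈ (Θ a).source} with hO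
  have hHO : ∀ a, ℓ a = 0 → H ⊆ O a := by
    intro a ha z hzH
    have h1 := (hΘ z hzH).continuousAt_retraction (hΘ z hzH).mem_source hzH
    have h2 := (hΘ z hzH).retraction_self z (hΘ z hzH).mem_source hzH
    refine mem_interior_iff_mem_nhds.2 ?_
    by_cases hzC : z ∈ C a
    · exact Filter.mem_of_superset ((Θ a).open_source.mem_nhds (hCs a ha hzC)) fun y hy _ => hy
    · have h3 : (C a)ᶜ ∈ 𝓝 (ρ z) := (hCc a ha).isOpen_compl.mem_nhds (h2.symm ▸ hzC)
      exact Filter.mem_of_superset (h1.preimage_mem_nhds h3) fun y hy hy' => absurd hy' hy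
  set W : M → Set M := fun a =>
    (Θ a).source ∩ Θ a ⁻¹' (Metric.ball (Θ a a).1 (δ a) ×ˢ univ) with hW
  have hWo : ∀ a, IsOpen (W a) := fun a =>
    (Θ a).isOpen_inter_preimage (Metric.isOpen_ball.prod isOpen_univ)
  obtain ⟨t, htH⟩ := hHc.elim_nhds_subcover' (fun a _ => W a) fun a ha =>
    (hWo a).mem_nhds ⟨(hΘ a ha).mem_source, Metric.mem_ball_self (hδ0 a ha), mem_univ _⟩
  have htc' : ∀ z ∈ H, ∃ a ∈ t, z ∈ W a := fun z hz => by
    simpa using htH hz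
  set G : Set M := (⋃ a ∈ t, W a) ∩ ⋂ a ∈ t, O a with hG
  have hGo : IsOpen G := by
    refine IsOpen.inter (isOpen_biUnion fun a _ => hWo _) ?_
    exact isOpen_biInter_finset (s := t) (f := fun a => O a) fun a _ => isOpen_interior
  have hHG : H ⊆ G := fun z hz => by
    refine ⟨?_, mem_iInter₂.2 fun a _ => hHO a a.2 hz⟩
    obtain ⟨a, ha, hza⟩ := htc' z hz
    exact mem_iUnion₂.2 ⟨a, ha, hza⟩
  have hqc := hℓ.continuous_functionalSq (h := h)
  -- Off the open set `G` the function `functionalSq` is bounded below.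
  obtain ⟨c, hc0, hc⟩ : ∃ c > 0, ∀ y, functionalSq h b ℓ y < c → y ∈ G := by
    rcases (Gᶜ).eq_empty_or_nonempty with hGe | hGe
    · exact ⟨1, one_pos, fun y _ => by rw [compl_empty_iff.1 hGe]; trivial⟩
    · obtain ⟨y₀, hy₀, hmin⟩ := hGo.isClosed_compl.isCompact.exists_isMinOn hGe hqc.continuousOn
      refine ⟨functionalSq h b ℓ y₀, (functionalSq_nonneg y₀).lt_of_ne fun h0 => ?_, fun y hy => ?_⟩
      · exact hy₀ (hHG (functionalSq_eq_zero_iff.1 h0.symm))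
      · by_contra hyG
        exact absurd (hmin hyG) (not_le.2 hy)
  have hd : ∃ d > 0, ∀ a ∈ t, d ≤ δ a := by
    rcases t.eq_empty_or_nonempty with ht | ht
    · exact ⟨1, one_pos, by simp [ht]⟩
    · obtain ⟨a, ha, hmin⟩ := t.exists_min_image (fun a => δ a) ht
      exact ⟨δ a, hδ0 a a.2, hmin⟩
  obtain ⟨d, hd0, hd⟩ := hd
  set ε := min (min (Real.sqrt c) d) 1 with hε
  have hε0 : 0 < ε := lt_min (lt_min (Real.sqrt_pos.2 hc0) hd0) one_pos
  have hεG : ∀ y, functionalSq h b ℓ y < ε ^ 2 → y ∈ G := by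
    intro y hy
    refine hc y (hy.trans_le ?_)
    calc ε ^ 2 ≤ Real.sqrt c ^ 2 :=
          pow_le_pow_left₀ hε0.le ((min_le_left _ _).trans (min_le_left _ _)) 2
      _ = c := Real.sq_sqrt hc0.le
  refine ⟨ε, hε0, min_le_right _ _, fun y hy => ?_, fun z hzH => ?_⟩
  · obtain ⟨a, ha, hya⟩ := mem_iUnion₂.1 (hεG y hy).1
    exact (hΘ a a.2).retraction_mem y hya.1
  · obtain ⟨a, ha, hza⟩ := htc' z hzH
    refine ⟨a, Θ a, Metric.ball (Θ a a).1 (δ a), hΘ a a.2,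
      ⟨Metric.isOpen_ball, ?_, fun y hy k hk hyk => ?_⟩, hza.1, hza.2.1⟩
    · refine Subset.trans (prod_mono Metric.ball_subset_closedBall ?_) (hδ a a.2)
      exact Metric.ball_subset_closedBall.trans (Metric.closedBall_subset_closedBall
        (((min_le_left _ _).trans (min_le_right _ _)).trans (hd a ha)))
    · have h1 := interior_subset (mem_iInter₂.1 (hεG y hy).2 a ha)
      exact h1 (hyk ▸ ⟨k, Metric.ball_subset_closedBall hk, rfl⟩)

end Tube

/-! ### The disc bundle of the tubular neighborhood in the total space -/

theorem IsTubularFoliation.isSubmanifold {V : Type*} [NormedAddCommGroup V] [NormedSpace ℝ V]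
    {B : Type*} [TopologicalSpace B] {I : ModelWithCorners ℝ V B} {X : Type*} [TopologicalSpace X]
    [ChartedSpace B X] {Z U : Set X} {D : X → Set X} (hD : IsTubularFoliation I Z U D) :
    IsSubmanifold I Z := by
  intro x hx
  obtain ⟨m, k, Φ, hΦ, hxΦ⟩ := hD.locally_trivial x hx
  refine ⟨m, k, Φ.symm, hxΦ, hΦ.smooth_symm, ?_, fun y hy => ?_⟩
  · rw [Φ.symm_symm]
    exact hΦ.smooth
  · rw [← hΦ.mem_iff _ (Φ.map_target hy), Φ.right_inv hy]

/-- The squared euclidean norm on `ℂ × ℂ` in real coordinates. -/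
theorem exists_realEquiv_norm_sq :
    ∃ (k : ℕ) (e : (ℂ × ℂ) ≃L[ℝ] EuclideanSpace ℝ (Fin k)),
      ∀ p, ‖e p‖ ^ 2 = ‖p.1‖ ^ 2 + ‖p.2‖ ^ 2 := by
  refine ⟨_, (WithLp.prodContinuousLinearEquiv 2 ℝ ℂ ℂ).symm.trans
    (stdOrthonormalBasis ℝ (WithLp 2 (ℂ × ℂ))).repr.toContinuousLinearEquiv, fun p => ?_⟩
  change ‖(stdOrthonormalBasis ℝ (WithLp 2 (ℂ × ℂ))).repr (WithLp.toLp 2 p)‖ ^ 2 = _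
  rw [LinearIsometryEquiv.norm_map, WithLp.prod_norm_sq_eq_of_L2]
  rfl

section Discs

variable {E : Type*} [NormedAddCommGroup E] [NormedSpace ℂ E] [FiniteDimensional ℂ E]
  {M : Type*} [TopologicalSpace M] [ChartedSpace E M] [IsManifold 𝓘(ℂ, E) ω M]
  {F : Type*} [NormedAddCommGroup F] [NormedSpace ℂ F]
  {N : M → Type*} [∀ x, AddCommGroup (N x)] [∀ x, Module ℂ (N x)] [∀ x, TopologicalSpace (N x)]
  [TopologicalSpace (Bundle.TotalSpace F N)] [FiberBundle F N]
  [∀ x, IsTopologicalAddGroup (N x)] [∀ x, ContinuousSMul ℂ (N x)]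
  [VectorBundle ℂ F N] [ContMDiffVectorBundle ω F N 𝓘(ℂ, E)]

/-- The points of the zero section over the zero locus of the functional `ℓ`. -/
def zerosOver (F : Type*) {M : Type*} {N : M → Type*} [∀ x, AddCommGroup (N x)]
    [∀ x, Module ℂ (N x)] (ℓ : (y : M) → N y →ₗ[ℂ] ℂ) : Set (Bundle.TotalSpace F N) :=
  {u | ℓ u.1 = 0 ∧ u.2 = 0}

/-- The function `‖ℓ‖² + r²`, whose zeros are the points of `zerosOver F ℓ`. -/
noncomputable def tubeSq (h : HermitianMetric E F N) (b : F ≃L[ℂ] ℂ) (ℓ : (y : M) → N y →ₗ[ℂ] ℂ)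
    (u : Bundle.TotalSpace F N) : ℝ :=
  functionalSq h b ℓ u.1 + (h.inner u.1 u.2 u.2).re

/-- The tube of radius `ε` around `zerosOver F ℓ`. -/
def tube (h : HermitianMetric E F N) (b : F ≃L[ℂ] ℂ) (ℓ : (y : M) → N y →ₗ[ℂ] ℂ) (ε : ℝ) :
    Set (Bundle.TotalSpace F N) :=
  {u | tubeSq h b ℓ u < ε ^ 2}

/-- The slice of the tube through `x`, a fiber of the retraction `ρ`. -/
def tubeDisc (h : HermitianMetric E F N) (b : F ≃L[ℂ] ℂ) (ℓ : (y : M) → N y →ₗ[ℂ] ℂ) (ρ : M → M)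
    (ε : ℝ) (x : Bundle.TotalSpace F N) : Set (Bundle.TotalSpace F N) :=
  {u ∈ tube h b ℓ ε | ρ u.1 = x.1}

variable {ℓ : (y : M) → N y →ₗ[ℂ] ℂ} {b : F ≃L[ℂ] ℂ} {h : HermitianMetric E F N}
  {ρ : M → M} {a : M} {Θ : OpenPartialHomeomorph M (HypModel E × ℂ)}

theorem HermitianMetric.inner_self_re_nonneg (h : HermitianMetric E F N) (u : Bundle.TotalSpace F N) :
    0 ≤ (h.inner u.1 u.2 u.2).re := by
  by_cases hu : u.2 = 0
  · rw [hu, map_zero, Complex.zero_re]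
  · exact (h.pos _ _ hu).le

theorem HermitianMetric.inner_self_re_eq_zero_iff (h : HermitianMetric E F N)
    (u : Bundle.TotalSpace F N) : (h.inner u.1 u.2 u.2).re = 0 ↔ u.2 = 0 := by
  constructor
  · intro h0
    by_contra hu
    exact (h.pos _ _ hu).ne' h0
  · intro hu
    rw [hu, map_zero, Complex.zero_re]

theorem tubeSq_eq_zero_iff {u : Bundle.TotalSpace F N} :
    tubeSq h b ℓ u = 0 ↔ u ∈ zerosOver F ℓ := by
  rw [tubeSq, add_eq_zero_iff_of_nonneg (functionalSq_nonneg _) (h.inner_self_re_nonneg u),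
    functionalSq_eq_zero_iff, h.inner_self_re_eq_zero_iff]
  rfl

theorem functionalSq_lt_of_mem_tube {ε : ℝ} {u : Bundle.TotalSpace F N} (hu : u ∈ tube h b ℓ ε) :
    functionalSq h b ℓ u.1 < ε ^ 2 :=
  (le_add_of_nonneg_right (h.inner_self_re_nonneg u)).trans_lt hu

theorem IsTransverseFunctional.isOpen_tube (hℓ : IsTransverseFunctional E ℓ b) (ε : ℝ) :
    IsOpen (tube h b ℓ ε) :=
  isOpen_lt ((hℓ.continuous_functionalSq.comp (FiberBundle.continuous_proj F N)).add
    h.smooth.continuous) continuous_const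

/-- The coordinates on the total space given by a tube chart of the base and a unitary frame. -/
noncomputable def tubeCoord (h : HermitianMetric E F N) (b : F ≃L[ℂ] ℂ) (a : M)
    (Θ : OpenPartialHomeomorph M (HypModel E × ℂ)) (u : Bundle.TotalSpace F N) :
    HypModel E × ℂ × ℂ :=
  ((Θ u.1).1, (Θ u.1).2, Real.sqrt (frameSq h b a u.1) • frameCoord b a u)

/-- The inverse of `tubeCoord`. -/
noncomputable def tubePoint (h : HermitianMetric E F N) (b : F ≃L[ℂ] ℂ) (a : M)
    (Θ : OpenPartialHomeomorph M (HypModel E × ℂ)) (p : HypModel E × ℂ × ℂ) :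
    Bundle.TotalSpace F N :=
  ⟨Θ.symm (p.1, p.2.1), ((Real.sqrt (frameSq h b a (Θ.symm (p.1, p.2.1))))⁻¹ • p.2.2 : ℂ) •
    lineFrame N b a (Θ.symm (p.1, p.2.1))⟩

theorem IsTubeChart.tubeSq_eq (hΘ : IsTubeChart h b ℓ ρ a Θ) {u : Bundle.TotalSpace F N}
    (hu : u.1 ∈ Θ.source) :
    tubeSq h b ℓ u = ‖(tubeCoord h b a Θ u).2.1‖ ^ 2 + ‖(tubeCoord h b a Θ u).2.2‖ ^ 2 := by
  have h1 := (hΘ.source_subset hu).2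
  rw [tubeSq, inner_self_re_eq h b h1, tubeCoord, hΘ.norm_snd_sq _ hu, norm_smul, mul_pow,
    Real.norm_of_nonneg (Real.sqrt_nonneg _), Real.sq_sqrt (frameSq_pos h1).le, mul_comm (frameSq h b a u.1)]

theorem IsTubeChart.tubePoint_tubeCoord (hΘ : IsTubeChart h b ℓ ρ a Θ) {u : Bundle.TotalSpace F N}
    (hu : u.1 ∈ Θ.source) : tubePoint h b a Θ (tubeCoord h b a Θ u) = u := by
  have h1 := (hΘ.source_subset hu).2
  have h2 := (Real.sqrt_pos.2 (frameSq_pos (h := h) (b := b) h1)).ne'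
  obtain ⟨y, n⟩ := u
  change (⟨Θ.symm (Θ y), ((Real.sqrt (frameSq h b a (Θ.symm (Θ y))))⁻¹ •
    Real.sqrt (frameSq h b a y) • frameCoord b a _ : ℂ) • lineFrame N b a (Θ.symm (Θ y))⟩ :
      Bundle.TotalSpace F N) = _
  rw [Θ.left_inv hu, smul_smul, inv_mul_cancel₀ h2, one_smul, ← eq_frameCoord_smul b a h1 n]

theorem IsTubeChart.tubeCoord_tubePoint (hΘ : IsTubeChart h b ℓ ρ a Θ) {p : HypModel E × ℂ × ℂ}
    (hp : (p.1, p.2.1) ∈ Θ.target) : tubeCoord h b a Θ (tubePoint h b a Θ p) = p := by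
  have h1 := (hΘ.source_subset (Θ.map_target hp)).2
  have h2 := (Real.sqrt_pos.2 (frameSq_pos (h := h) (b := b) h1)).ne'
  have h3 := Θ.right_inv hp
  have h4 : (Θ (tubePoint h b a Θ p).1).1 = p.1 := congrArg Prod.fst h3
  have h5 : (Θ (tubePoint h b a Θ p).1).2 = p.2.1 := congrArg Prod.snd h3
  refine Prod.ext h4 (Prod.ext h5 ?_)
  change Real.sqrt (frameSq h b a (Θ.symm (p.1, p.2.1))) • frameCoord b a
    (⟨Θ.symm (p.1, p.2.1), _ • lineFrame N b a _⟩ : Bundle.TotalSpace F N) = _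
  rw [frameCoord_smul_lineFrame b a h1, smul_smul, mul_inv_cancel₀ h2, one_smul]

theorem contMDiffAt_sqrt_frameSq {x₀ y : M} (hy : y ∈ (trivializationAt F N x₀).baseSet) :
    ContMDiffAt 𝓘(ℝ, E) 𝓘(ℝ, ℝ) ∞ (fun y => Real.sqrt (frameSq h b x₀ y)) y :=
  (Real.contDiffAt_sqrt (frameSq_pos hy).ne').contMDiffAt.comp y (contMDiffAt_frameSq hy)

theorem IsTubeChart.contMDiffAt_tubeCoord (hΘ : IsTubeChart h b ℓ ρ a Θ)
    {u : Bundle.TotalSpace F N} (hu : u.1 ∈ Θ.source) :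
    ContMDiffAt (realTotalModel E F) 𝓘(ℝ, HypModel E × ℂ × ℂ) ∞ (tubeCoord h b a Θ) u := by
  have hp : ContMDiffAt (realTotalModel E F) 𝓘(ℝ, E) ∞
      (fun u : Bundle.TotalSpace F N => u.1) u := Bundle.contMDiffAt_proj N
  have h1 : ContMDiffAt (realTotalModel E F) 𝓘(ℝ, HypModel E × ℂ) ∞
      (fun u : Bundle.TotalSpace F N => Θ u.1) u :=
    (hΘ.contMDiffOn.contMDiffAt (Θ.open_source.mem_nhds hu)).comp u hp
  have h2 : ContMDiffAt (realTotalModel E F) 𝓘(ℝ, ℝ) ∞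
      (fun u : Bundle.TotalSpace F N => Real.sqrt (frameSq h b a u.1)) u :=
    ContMDiffAt.comp (g := fun y => Real.sqrt (frameSq h b a y)) u
      (contMDiffAt_sqrt_frameSq (hΘ.source_subset hu).2) hp
  have h3 := contMDiffAt_frameCoord b a (hΘ.source_subset hu)
  exact (contDiff_fst.contMDiff.contMDiffAt.comp u h1).prodMk_space
    ((contDiff_snd.contMDiff.contMDiffAt.comp u h1).prodMk_space (h2.smul h3))

theorem IsTubeChart.contMDiffAt_tubePoint (hΘ : IsTubeChart h b ℓ ρ a Θ) {p : HypModel E × ℂ × ℂ}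
    (hp : (p.1, p.2.1) ∈ Θ.target) :
    ContMDiffAt 𝓘(ℝ, HypModel E × ℂ × ℂ) (realTotalModel E F) ∞ (tubePoint h b a Θ) p := by
  have h1 : ContMDiffAt 𝓘(ℝ, HypModel E × ℂ × ℂ) 𝓘(ℝ, E) ∞
      (fun p : HypModel E × ℂ × ℂ => Θ.symm (p.1, p.2.1)) p :=
    ContMDiffAt.comp (g := Θ.symm) (f := fun p : HypModel E × ℂ × ℂ => (p.1, p.2.1)) p
      (hΘ.contMDiffOn_symm.contMDiffAt (Θ.open_target.mem_nhds hp))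
      (contDiff_fst.prodMk contDiff_snd.fst).contMDiff.contMDiffAt
  have h0 := hΘ.source_subset (Θ.map_target hp)
  have h2 : ContMDiffAt 𝓘(ℝ, HypModel E × ℂ × ℂ) 𝓘(ℝ, ℝ) ∞
      (fun p : HypModel E × ℂ × ℂ => Real.sqrt (frameSq h b a (Θ.symm (p.1, p.2.1)))) p :=
    ContMDiffAt.comp (g := fun y => Real.sqrt (frameSq h b a y)) p
      (contMDiffAt_sqrt_frameSq h0.2) h1
  have h3 : ContMDiffAt 𝓘(ℝ, HypModel E × ℂ × ℂ) 𝓘(ℝ, ℂ) ∞ (fun p : HypModel E × ℂ × ℂ =>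
      (Real.sqrt (frameSq h b a (Θ.symm (p.1, p.2.1))))⁻¹ • p.2.2) p := by
    rw [contMDiffAt_iff_contDiffAt] at h2 ⊢
    exact (h2.inv (Real.sqrt_pos.2 (frameSq_pos h0.2)).ne').smul contDiff_snd.snd.contDiffAt
  exact contMDiffAt_smul_lineFrame b a h0 h1 h3

/-- A tube chart whose domain contains a whole piece of the tube gives a local trivialization of
the family of slices. -/
theorem IsTubeBox.exists_isDiscChart {ε : ℝ} {A : Set (HypModel E)} (hA : IsTubeBox h b ℓ ρ ε Θ A)
    (hε : 0 < ε) (hΘ : IsTubeChart h b ℓ ρ a Θ) :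
    ∃ (m k : ℕ) (Φ : OpenPartialHomeomorph (EuclideanSpace ℝ (Fin m) × EuclideanSpace ℝ (Fin k))
      (Bundle.TotalSpace F N)),
      IsDiscChart (realTotalModel E F) (zerosOver F ℓ) (tubeDisc h b ℓ ρ ε) Φ ∧
      ∀ u ∈ tube h b ℓ ε, u.1 ∈ Θ.source → (Θ u.1).1 ∈ A → u ∈ Φ.target := by
  obtain ⟨k, e₂, he₂⟩ := exists_realEquiv_norm_sq
  set e₁ : HypModel E ≃L[ℝ] EuclideanSpace ℝ (Fin (Module.finrank ℝ (HypModel E))) := toEuclidean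
  set P := EuclideanSpace ℝ (Fin (Module.finrank ℝ (HypModel E))) × EuclideanSpace ℝ (Fin k)
  set S : Set P := (e₁.symm ⁻¹' A) ×ˢ Metric.ball 0 1 with hS
  set T : Set (Bundle.TotalSpace F N) :=
    {u | u ∈ tube h b ℓ ε ∧ u.1 ∈ Θ.source ∧ (Θ u.1).1 ∈ A} with hT
  -- `fw` and `bk` pass to real euclidean coordinates and rescale the disc to radius one.
  set fw : P → HypModel E × ℂ × ℂ := fun p => (e₁.symm p.1, e₂.symm (ε • p.2)) with hfw
  set bk : HypModel E × ℂ × ℂ → P := fun q => (e₁ q.1, ε⁻¹ • e₂ q.2) with hbk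
  have hfwbk : ∀ q, fw (bk q) = q := fun q => by
    refine Prod.ext (e₁.symm_apply_apply _) ?_
    change e₂.symm (ε • ε⁻¹ • e₂ q.2) = q.2
    rw [smul_smul, mul_inv_cancel₀ hε.ne', one_smul, e₂.symm_apply_apply]
  have hbkto : ∀ p, bk (fw p) = p := fun p => by
    refine Prod.ext (e₁.apply_symm_apply _) ?_
    change ε⁻¹ • e₂ (e₂.symm (ε • p.2)) = p.2
    rw [e₂.apply_symm_apply, smul_smul, inv_mul_cancel₀ hε.ne', one_smul]
  have hnorm : ∀ p, ‖(fw p).2.1‖ ^ 2 + ‖(fw p).2.2‖ ^ 2 = ε ^ 2 * ‖p.2‖ ^ 2 := fun p => by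
    rw [← he₂]
    change ‖e₂ (e₂.symm (ε • p.2))‖ ^ 2 = _
    rw [e₂.apply_symm_apply, norm_smul, mul_pow, Real.norm_of_nonneg hε.le]
  have hlt : ∀ p ∈ S, ‖(fw p).2.1‖ ^ 2 + ‖(fw p).2.2‖ ^ 2 < ε ^ 2 := fun p hp => by
    rw [hnorm]
    have h1 : ‖p.2‖ < 1 := mem_ball_zero_iff.1 hp.2
    exact mul_lt_of_lt_one_right (pow_pos hε 2) (pow_lt_one₀ (norm_nonneg _) h1 two_ne_zero)
  have htgt : ∀ p ∈ S, ((fw p).1, (fw p).2.1) ∈ Θ.target := fun p hp => by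
    refine hA.prod_subset ⟨hp.1, mem_ball_zero_iff.2 ?_⟩
    refine lt_of_pow_lt_pow_left₀ 2 hε.le ((le_add_of_nonneg_right (sq_nonneg _)).trans_lt (hlt p hp))
  have htoc : ContDiff ℝ ∞ fw := by
    refine (e₁.symm.contDiff.comp contDiff_fst).prodMk (e₂.symm.contDiff.comp ?_)
    exact contDiff_snd.const_smul ε
  have hbkc : ContDiff ℝ ∞ bk :=
    (e₁.contDiff.comp contDiff_fst).prodMk ((e₂.contDiff.comp contDiff_snd).const_smul ε⁻¹)
  have hsq : ∀ p ∈ S, tubeSq h b ℓ (tubePoint h b a Θ (fw p)) = ε ^ 2 * ‖p.2‖ ^ 2 := fun p hp => by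
    rw [hΘ.tubeSq_eq (Θ.map_target (htgt p hp)), hΘ.tubeCoord_tubePoint (htgt p hp), hnorm]
  have hfst : ∀ p ∈ S, Θ (tubePoint h b a Θ (fw p)).1 = ((fw p).1, (fw p).2.1) := fun p hp =>
    Θ.right_inv (htgt p hp)
  have hmt : ∀ p ∈ S, tubePoint h b a Θ (fw p) ∈ T := fun p hp => by
    refine ⟨?_, Θ.map_target (htgt p hp), ?_⟩
    · change tubeSq h b ℓ _ < _
      rw [hsq p hp, ← hnorm]
      exact hlt p hp
    · rw [hfst p hp]
      exact hp.1
  have hc1 : ContMDiffOn 𝓘(ℝ, P) (realTotalModel E F) ∞ (fun p => tubePoint h b a Θ (fw p)) S :=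
    fun p hp => ((hΘ.contMDiffAt_tubePoint (htgt p hp)).comp p
      htoc.contMDiff.contMDiffAt).contMDiffWithinAt
  have hc2 : ContMDiffOn (realTotalModel E F) 𝓘(ℝ, P) ∞ (fun u => bk (tubeCoord h b a Θ u)) T :=
    fun u hu => (hbkc.contMDiff.contMDiffAt.comp u
      (hΘ.contMDiffAt_tubeCoord hu.2.1)).contMDiffWithinAt
  have hSo : IsOpen S := (hA.isOpen.preimage e₁.symm.continuous).prod Metric.isOpen_ball
  have hri : ∀ u ∈ T, tubePoint h b a Θ (fw (bk (tubeCoord h b a Θ u))) = u := fun u hu => by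
    rw [hfwbk, hΘ.tubePoint_tubeCoord hu.2.1]
  have hli : ∀ p ∈ S, bk (tubeCoord h b a Θ (tubePoint h b a Θ (fw p))) = p := fun p hp => by
    rw [hΘ.tubeCoord_tubePoint (htgt p hp), hbkto]
  have hms : ∀ u ∈ T, bk (tubeCoord h b a Θ u) ∈ S := fun u hu => by
    refine ⟨?_, mem_ball_zero_iff.2 ?_⟩
    · change e₁.symm (e₁ _) ∈ A
      rw [e₁.symm_apply_apply]
      exact hu.2.2
    · have h1 := hnorm (bk (tubeCoord h b a Θ u))
      rw [hfwbk, ← hΘ.tubeSq_eq hu.2.1] at h1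
      have h2 : tubeSq h b ℓ u < ε ^ 2 := hu.1
      rw [h1] at h2
      refine lt_of_pow_lt_pow_left₀ 2 zero_le_one ?_
      rw [one_pow]
      exact (mul_lt_iff_lt_one_right (pow_pos hε 2)).1 h2
  have hTo : IsOpen T := by
    have h1 : IsOpen ((fun u : Bundle.TotalSpace F N => u.1) ⁻¹' (Θ.source ∩ Θ ⁻¹' (A ×ˢ univ))) :=
      (Θ.isOpen_inter_preimage (hA.isOpen.prod isOpen_univ)).preimage (FiberBundle.continuous_proj F N)
    have h2 : T = {u | u.1 ∈ Θ.source ∩ Θ ⁻¹' (A ×ˢ univ)} ∩ (fun u => tubeCoord h b a Θ u) ⁻¹'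
        {q | ‖q.2.1‖ ^ 2 + ‖q.2.2‖ ^ 2 < ε ^ 2} := by
      ext u
      constructor
      · rintro ⟨hu1, hu2, hu3⟩
        refine ⟨⟨hu2, hu3, mem_univ _⟩, ?_⟩
        rw [mem_preimage, mem_ofPred_eq, ← hΘ.tubeSq_eq hu2]
        exact hu1
      · rintro ⟨⟨hu2, hu3, -⟩, hu1⟩
        rw [mem_preimage, mem_ofPred_eq, ← hΘ.tubeSq_eq hu2] at hu1
        exact ⟨hu1, hu2, hu3⟩
    rw [h2]
    refine ContinuousOn.isOpen_inter_preimage (fun u hu => ?_) h1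
      (isOpen_lt (by fun_prop) continuous_const)
    exact (hΘ.contMDiffAt_tubeCoord hu.1).continuousAt.continuousWithinAt
  refine ⟨_, k,
    { toFun := fun p => tubePoint h b a Θ (fw p)
      invFun := fun u => bk (tubeCoord h b a Θ u)
      source := S
      target := T
      map_source' := hmt
      map_target' := hms
      left_inv' := hli
      right_inv' := hri
      open_source := hSo
      open_target := hTo
      continuousOn_toFun := hc1.continuousOn
      continuousOn_invFun := hc2.continuousOn }, ⟨⟨e₁.symm ⁻¹' A, rfl⟩, hc1, hc2, ?_, ?_⟩,
    fun u hu hu1 hu2 => ⟨hu, hu1, hu2⟩⟩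
  · intro p hp
    change tubePoint h b a Θ (fw p) ∈ zerosOver F ℓ ↔ _
    rw [← tubeSq_eq_zero_iff (h := h) (b := b), hsq p hp, mul_eq_zero, or_iff_right (pow_pos hε 2).ne',
      sq_eq_zero_iff, norm_eq_zero]
  · rintro ⟨p₁, p₂⟩ hp hp2
    have hp2' : p₂ = 0 := hp2
    subst hp2'
    have hk : (fw (p₁, 0)).2 = 0 := by
      change e₂.symm (ε • (0 : EuclideanSpace ℝ (Fin k))) = 0
      rw [smul_zero, map_zero]
    have hb : (tubePoint h b a Θ (fw (p₁, 0))).1 = Θ.symm (e₁.symm p₁, 0) := by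
      change Θ.symm ((fw (p₁, 0)).1, (fw (p₁, 0)).2.1) = _
      rw [hk]
      rfl
    change {u ∈ tube h b ℓ ε | ρ u.1 = (tubePoint h b a Θ (fw (p₁, 0))).1} = _
    rw [hb]
    ext u
    constructor
    · rintro ⟨hu, huρ⟩
      have h1 := hA.mem_source _ (functionalSq_lt_of_mem_tube hu) _ hp.1 huρ
      have h2 := hA.fst_eq hε hΘ (functionalSq_lt_of_mem_tube hu) hp.1 huρ
      have huT : u ∈ T := ⟨hu, h1, h2 ▸ hp.1⟩
      refine ⟨bk (tubeCoord h b a Θ u), ⟨?_, (hms u huT).2⟩, hri u huT⟩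
      change e₁ (Θ u.1).1 = p₁
      rw [h2, e₁.apply_symm_apply]
    · rintro ⟨⟨q₁, z⟩, ⟨hq, hz⟩, rfl⟩
      have hq' : q₁ = p₁ := hq
      subst hq'
      have hqS : (q₁, z) ∈ S := ⟨hp.1, hz⟩
      refine ⟨(hmt _ hqS).1, ?_⟩
      have h3 := hfst _ hqS
      have h4 : (Θ (tubePoint h b a Θ (fw (q₁, z))).1).1 = e₁.symm q₁ := congrArg Prod.fst h3
      have h5 := hΘ.retraction_eq (hmt _ hqS).2.1 (by
        rw [h4]
        exact hA.mk_zero_mem hε hp.1)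
      rw [h4] at h5
      exact h5

/-- The tube is a tubular neighborhood of `zerosOver F ℓ`, foliated by the fibers of the
retraction. -/
theorem IsTransverseFunctional.isTubularFoliation_tube (hℓ : IsTransverseFunctional E ℓ b) {ε : ℝ}
    (hε : 0 < ε) (hρ : ∀ y, functionalSq h b ℓ y < ε ^ 2 → ℓ (ρ y) = 0)
    (hΘ : ∀ z, ℓ z = 0 → ∃ a Θ A, IsTubeChart h b ℓ ρ a Θ ∧ IsTubeBox h b ℓ ρ ε Θ A ∧
        z ∈ Θ.source ∧ (Θ z).1 ∈ A) :
    IsTubularFoliation (realTotalModel E F) (zerosOver F ℓ) (tube h b ℓ ε)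
      (tubeDisc h b ℓ ρ ε) where
  isOpen := hℓ.isOpen_tube ε
  eq_iUnion := by
    ext u
    rw [mem_iUnion₂]
    constructor
    · intro hu
      exact ⟨⟨ρ u.1, 0⟩, ⟨hρ _ (functionalSq_lt_of_mem_tube hu), rfl⟩, hu, rfl⟩
    · rintro ⟨x, -, hu⟩
      exact hu.1
  disjoint := by
    rintro ⟨x, n⟩ ⟨-, hn⟩ ⟨x', n'⟩ ⟨-, hn'⟩ hne
    rw [Function.onFun, Set.disjoint_left]
    rintro u ⟨-, hu⟩ ⟨-, hu'⟩
    have h1 : x = x' := hu.symm.trans hu'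
    subst h1
    exact hne (congrArg (Bundle.TotalSpace.mk x) (hn.trans hn'.symm))
  locally_trivial := by
    intro x hx
    obtain ⟨a, Θ, A, h1, h2, h3, h4⟩ := hΘ x.1 hx.1
    obtain ⟨m, k, Φ, hΦ, hΦt⟩ := h2.exists_isDiscChart hε h1
    refine ⟨m, k, Φ, hΦ, hΦt x ?_ h3 h4⟩
    change tubeSq h b ℓ x < _
    rw [tubeSq_eq_zero_iff.2 hx]
    exact pow_pos hε 2

end Discs

/-! ### Holomorphic parametrizations of submanifolds -/

section Parametrization

variable {V : Type*} [NormedAddCommGroup V] [NormedSpace ℝ V]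
  {B : Type*} [TopologicalSpace B] {I : ModelWithCorners ℝ V B} {X : Type*} [TopologicalSpace X]
  [ChartedSpace B X]

/-- `c` is a smooth parametrization by the open set `O` of a neighborhood of `y` in `S`, with
inverse `g`, and its derivative intertwines multiplication by `i` with `J`. -/
structure IsHolomorphicParam (I : ModelWithCorners ℝ V B) (J : EndField I X) (S : Set X) (y : X)
    {d : ℕ} (O : Set (EuclideanSpace ℂ (Fin d))) (c : EuclideanSpace ℂ (Fin d) → X)
    (g : X → EuclideanSpace ℂ (Fin d)) : Prop where
  isOpen : IsOpen O
  contMDiffOn : ContMDiffOn 𝓘(ℝ, EuclideanSpace ℂ (Fin d)) I ∞ c O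
  mapsTo : MapsTo c O S
  left_inv : ∀ z ∈ O, g (c z) = z
  mdifferentiableAt : ∀ z ∈ O, MDifferentiableAt I 𝓘(ℝ, EuclideanSpace ℂ (Fin d)) g (c z)
  mem : g y ∈ O
  apply_eq : c (g y) = y
  right_inv : ∀ᶠ y' in 𝓝 y, y' ∈ S → g y' ∈ O ∧ c (g y') = y'
  mfderiv_smul : ∀ z ∈ O, ∀ v : EuclideanSpace ℂ (Fin d),
    mfderiv 𝓘(ℝ, EuclideanSpace ℂ (Fin d)) I c z (Complex.I • v) =
      J (c z) (mfderiv 𝓘(ℝ, EuclideanSpace ℂ (Fin d)) I c z v)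

variable {J : EndField I X} {S : Set X} {y : X} {d : ℕ} {O : Set (EuclideanSpace ℂ (Fin d))}
  {c : EuclideanSpace ℂ (Fin d) → X} {g : X → EuclideanSpace ℂ (Fin d)}

theorem IsHolomorphicParam.mdifferentiableAt_param (hc : IsHolomorphicParam I J S y O c g)
    {z : EuclideanSpace ℂ (Fin d)} (hz : z ∈ O) :
    MDifferentiableAt 𝓘(ℝ, EuclideanSpace ℂ (Fin d)) I c z :=
  (hc.contMDiffOn.contMDiffAt (hc.isOpen.mem_nhds hz)).mdifferentiableAt (by simp)

theorem IsHolomorphicParam.mfderiv_injective (hc : IsHolomorphicParam I J S y O c g)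
    {z : EuclideanSpace ℂ (Fin d)} (hz : z ∈ O) :
    Function.Injective (mfderiv 𝓘(ℝ, EuclideanSpace ℂ (Fin d)) I c z) := by
  have h1 := ((hc.mdifferentiableAt z hz).hasMFDerivAt.comp z
    (hc.mdifferentiableAt_param hz).hasMFDerivAt)
  have h2 : HasMFDerivAt 𝓘(ℝ, EuclideanSpace ℂ (Fin d)) 𝓘(ℝ, EuclideanSpace ℂ (Fin d)) (g ∘ c) z
      (ContinuousLinearMap.id ℝ (EuclideanSpace ℂ (Fin d))) := by
    refine (hasMFDerivAt_id z).congr_of_eventuallyEq ?_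
    filter_upwards [hc.isOpen.mem_nhds hz] with w hw using hc.left_inv w hw
  have h3 := h1.mfderiv.symm.trans h2.mfderiv
  intro v w hvw
  have h4 : ∀ v : EuclideanSpace ℂ (Fin d),
      mfderiv I 𝓘(ℝ, EuclideanSpace ℂ (Fin d)) g (c z)
        (mfderiv 𝓘(ℝ, EuclideanSpace ℂ (Fin d)) I c z v) = v := fun v =>
    congrArg (fun A : EuclideanSpace ℂ (Fin d) →L[ℝ] EuclideanSpace ℂ (Fin d) => A v) h3
  exact (h4 v).symm.trans ((congrArg (mfderiv I 𝓘(ℝ, EuclideanSpace ℂ (Fin d)) g (c z)) hvw).trans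
    (h4 w))

theorem IsHolomorphicParam.tangentVectors_eq (hc : IsHolomorphicParam I J S y O c g) :
    tangentVectors I S y = {v : V | ∃ z : EuclideanSpace ℂ (Fin d),
      v = mfderiv 𝓘(ℝ, EuclideanSpace ℂ (Fin d)) I c (g y) z} := by
  ext v
  constructor
  · rintro ⟨γ, hγ0, hγs, hγS, hγv⟩
    have hcd := (hc.mdifferentiableAt_param hc.mem).hasMFDerivAt
    have hgd := (hc.mdifferentiableAt _ hc.mem).hasMFDerivAt
    rw [hc.apply_eq, ← hγ0] at hgd
    have hγd := (hγs.mdifferentiableAt (by simp)).hasMFDerivAt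
    have h1 := hgd.comp 0 hγd
    have h0 : (g ∘ γ) 0 = g y := congrArg g hγ0
    rw [← h0] at hcd
    have h2 := hcd.comp 0 h1
    have h3 : γ =ᶠ[𝓝 0] c ∘ g ∘ γ := by
      have h4 := hγs.continuousAt.eventually (hγ0.symm ▸ hc.right_inv)
      filter_upwards [hγS, h4] with t ht ht' using (ht' ht).2.symm
    have h4 := (h2.congr_of_eventuallyEq h3).mfderiv
    refine ⟨mfderiv I 𝓘(ℝ, EuclideanSpace ℂ (Fin d)) g (γ 0)
      (mfderiv 𝓘(ℝ, ℝ) I γ 0 (1 : ℝ)), ?_⟩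
    refine hγv.symm.trans ?_
    rw [← h0]
    exact congrArg (fun A : ℝ →L[ℝ] V => A 1) h4
  · rintro ⟨z, rfl⟩
    set line : ℝ → EuclideanSpace ℂ (Fin d) := fun t => g y + t • z with hline
    have hl : ContDiff ℝ ∞ line := by fun_prop
    have hl0 : line 0 = g y := by simp [hline]
    have hO : ∀ᶠ t in 𝓝 (0 : ℝ), line t ∈ O :=
      hl.continuous.continuousAt.preimage_mem_nhds (hl0.symm ▸ hc.isOpen.mem_nhds hc.mem)
    have hcs := hc.contMDiffOn.contMDiffAt (hc.isOpen.mem_nhds hc.mem)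
    rw [← hl0] at hcs
    refine ⟨c ∘ line, ?_, hcs.comp 0 hl.contMDiff.contMDiffAt, ?_, ?_⟩
    · rw [Function.comp_apply, hl0, hc.apply_eq]
    · filter_upwards [hO] with t ht using hc.mapsTo ht
    · have hld : HasFDerivAt line ((1 : ℝ →L[ℝ] ℝ).smulRight z) 0 := by
        have := ((hasFDerivAt_id (𝕜 := ℝ) (0 : ℝ)).smul_const z).const_add (g y)
        exact this
      have h1 := ((hcs.mdifferentiableAt (by simp)).hasMFDerivAt.comp 0
        hld.hasMFDerivAt).mfderiv
      have h2 := congrArg (fun A : ℝ →L[ℝ] V => A 1) h1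
      refine h2.trans ?_
      rw [← hl0]
      change mfderiv 𝓘(ℝ, EuclideanSpace ℂ (Fin d)) I c (line 0) ((1 : ℝ) • z) = _
      rw [one_smul]

theorem IsHolomorphicParam.invariant (hc : IsHolomorphicParam I J S y O c g) :
    ∀ v ∈ tangentVectors I S y, J y v ∈ tangentVectors I S y := by
  intro v hv
  rw [hc.tangentVectors_eq] at hv ⊢
  obtain ⟨z, rfl⟩ := hv
  refine ⟨Complex.I • z, ?_⟩
  have h1 := hc.mfderiv_smul (g y) hc.mem z
  rw [hc.apply_eq] at h1
  exact h1.symm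

theorem isIntegrableAlong_of_isHolomorphicParam
    (hS : ∀ y ∈ S, ∃ (d : ℕ) (O : Set (EuclideanSpace ℂ (Fin d))) (c : EuclideanSpace ℂ (Fin d) → X)
      (g : X → EuclideanSpace ℂ (Fin d)), IsHolomorphicParam I J S y O c g) :
    IsIntegrableAlong J S := by
  intro y hy
  obtain ⟨d, O, c, g, hc⟩ := hS y hy
  refine ⟨d, O, c, hc.isOpen, hc.contMDiffOn, ?_, hc.mapsTo.image_subset, ⟨_, hc.mem, hc.apply_eq⟩,
    ?_, fun z hz => ⟨hc.mfderiv_injective hz, hc.mfderiv_smul z hz⟩⟩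
  · intro z hz w hw hzw
    rw [← hc.left_inv z hz, ← hc.left_inv w hw, hzw]
  · rw [mem_nhdsWithin_iff_eventually]
    filter_upwards [hc.right_inv] with y' hy' hyS using ⟨_, (hy' hyS).1, (hy' hyS).2⟩

end Parametrization

section Hessian

/-- The second order chain rule at a critical point. -/
theorem fderiv_fderiv_comp_of_fderiv_eq_zero {P V : Type*} [NormedAddCommGroup P] [NormedSpace ℝ P]
    [NormedAddCommGroup V] [NormedSpace ℝ V] {W : Type*} [NormedAddCommGroup W] [NormedSpace ℝ W]
    {f : V → W} {c : P → V} {p : P} (hc : ContDiffAt ℝ ∞ c p) (hf : ContDiffAt ℝ ∞ f (c p))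
    (h0 : fderiv ℝ f (c p) = 0) (v w : P) :
    fderiv ℝ (fderiv ℝ (f ∘ c)) p v w =
      fderiv ℝ (fderiv ℝ f) (c p) (fderiv ℝ c p v) (fderiv ℝ c p w) := by
  have h1 : fderiv ℝ (f ∘ c) =ᶠ[𝓝 p] fun q => fderiv ℝ f (c q) ∘L fderiv ℝ c q := by
    have h2 : ∀ᶠ q in 𝓝 p, ContDiffAt ℝ 1 c q :=
      (hc.of_le (show (1 : WithTop ℕ∞) ≤ ∞ from by simp) : ContDiffAt ℝ 1 c p).eventually (by exact_mod_cast ENat.one_ne_top)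
    have h3 : ∀ᶠ q in 𝓝 (c p), ContDiffAt ℝ 1 f q :=
      (hf.of_le (show (1 : WithTop ℕ∞) ≤ ∞ from by simp) : ContDiffAt ℝ 1 f (c p)).eventually (by exact_mod_cast ENat.one_ne_top)
    filter_upwards [h2, hc.continuousAt.eventually h3] with q hq hq'
    exact fderiv_comp q (hq'.differentiableAt (by simp)) (hq.differentiableAt (by simp))
  have h2 : HasFDerivAt (fderiv ℝ c) (fderiv ℝ (fderiv ℝ c) p) p :=
    ((hc.fderiv_right (m := ∞) le_rfl).differentiableAt (by simp)).hasFDerivAt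
  have h3 : HasFDerivAt (fderiv ℝ f) (fderiv ℝ (fderiv ℝ f) (c p)) (c p) :=
    ((hf.fderiv_right (m := ∞) le_rfl).differentiableAt (by simp)).hasFDerivAt
  have h4 := ((h3.comp p (hc.differentiableAt (by simp)).hasFDerivAt).clm_comp h2).congr_of_eventuallyEq
    h1
  rw [h4.fderiv]
  change (fderiv ℝ f (c p)) (fderiv ℝ (fderiv ℝ c) p v w) +
    fderiv ℝ (fderiv ℝ f) (c p) (fderiv ℝ c p v) (fderiv ℝ c p w) = _
  rw [h0]
  simp

/-- The Hessian of the function `(z₀, z₁) ↦ z₀ z₁`. -/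
theorem fderiv_fderiv_mul_coord (z v w : EuclideanSpace ℂ (Fin 2)) :
    fderiv ℝ (fderiv ℝ fun z : EuclideanSpace ℂ (Fin 2) => z 0 * z 1) z v w =
      v 0 * w 1 + v 1 * w 0 := by
  set p : Fin 2 → EuclideanSpace ℂ (Fin 2) →L[ℝ] ℂ := fun i =>
    (EuclideanSpace.proj i : EuclideanSpace ℂ (Fin 2) →L[ℂ] ℂ).restrictScalars ℝ with hp
  have h1 : fderiv ℝ (fun z : EuclideanSpace ℂ (Fin 2) => z 0 * z 1) =
      fun z => p 0 z • p 1 + p 1 z • p 0 := by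
    funext z
    exact ((p 0).hasFDerivAt.mul (p 1).hasFDerivAt).fderiv
  have h2 := (((p 0).hasFDerivAt (x := z)).smul_const (p 1)).add
    (((p 1).hasFDerivAt (x := z)).smul_const (p 0))
  rw [h1]
  refine (congrArg (fun A : EuclideanSpace ℂ (Fin 2) →L[ℝ] EuclideanSpace ℂ (Fin 2) →L[ℝ] ℂ =>
    A v w) h2.fderiv).trans ?_
  rfl

theorem eq_zero_of_mul_coord {v : EuclideanSpace ℂ (Fin 2)}
    (hv : ∀ w : EuclideanSpace ℂ (Fin 2), v 0 * w 1 + v 1 * w 0 = 0) : v = 0 := by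
  have h0 := hv !₂[0, 1]
  have h1 := hv !₂[1, 0]
  ext i
  fin_cases i
  · simpa using h0
  · simpa using h1

variable {V : Type*} [NormedAddCommGroup V] [NormedSpace ℝ V]
  {B : Type*} [TopologicalSpace B] {I : ModelWithCorners ℝ V B} {X : Type*} [TopologicalSpace X]
  [ChartedSpace B X] [I.Boundaryless] [IsManifold I ∞ X]

/-- At a critical point, the Hessian of `f` on a submanifold parametrized by `c` is the Hessian of
`f ∘ c`. -/
theorem IsHolomorphicParam.hessianAt_eq {J : EndField I X} {S : Set X} {y : X} {d : ℕ}
    {O : Set (EuclideanSpace ℂ (Fin d))} {c : EuclideanSpace ℂ (Fin d) → X}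
    {g : X → EuclideanSpace ℂ (Fin d)} (hc : IsHolomorphicParam I J S y O c g)
    {f : X → ℂ} (hf : ContMDiffAt I 𝓘(ℝ, ℂ) ∞ f y) (hf0 : mfderiv I 𝓘(ℝ, ℂ) f y = 0)
    (v w : EuclideanSpace ℂ (Fin d)) :
    hessianAt I f y (mfderiv 𝓘(ℝ, EuclideanSpace ℂ (Fin d)) I c (g y) v : V)
        (mfderiv 𝓘(ℝ, EuclideanSpace ℂ (Fin d)) I c (g y) w : V) =
      fderiv ℝ (fderiv ℝ (f ∘ c)) (g y) v w := by
  have hcs := hc.contMDiffOn.contMDiffAt (hc.isOpen.mem_nhds hc.mem)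
  set c' : EuclideanSpace ℂ (Fin d) → V := extChartAt I y ∘ c with hc'
  set f' : V → ℂ := f ∘ (extChartAt I y).symm with hf'
  have hc'y : c' (g y) = extChartAt I y y := congrArg (extChartAt I y) hc.apply_eq
  have hcc : ContDiffAt ℝ ∞ c' (g y) := by
    rw [← contMDiffAt_iff_contDiffAt]
    refine ContMDiffAt.comp (g y) ?_ hcs
    rw [hc.apply_eq]
    exact contMDiffAt_extChartAt
  have hfc : ContDiffAt ℝ ∞ f' (c' (g y)) := by
    rw [← contMDiffAt_iff_contDiffAt, hc'y]
    refine ContMDiffAt.comp _ (g := f) (by rwa [extChartAt_to_inv])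
      ((contMDiffOn_extChartAt_symm y).contMDiffAt (extChartAt_target_mem_nhds y))
  have hfd : fderiv ℝ f' (c' (g y)) = 0 := by
    rw [hc'y]
    have h1 := (hf.mdifferentiableAt (by simp)).mfderiv
    rw [ModelWithCorners.range_eq_univ, fderivWithin_univ] at h1
    exact h1.symm.trans hf0
  have hcd : (mfderiv 𝓘(ℝ, EuclideanSpace ℂ (Fin d)) I c (g y) : EuclideanSpace ℂ (Fin d) →L[ℝ] V)
      = fderiv ℝ c' (g y) := by
    have h1 := (hcs.mdifferentiableAt (by simp)).mfderiv
    rw [ModelWithCorners.range_eq_univ, fderivWithin_univ] at h1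
    refine h1.trans ?_
    rw [writtenInExtChartAt, hc.apply_eq]
    rfl
  have h1 := fderiv_fderiv_comp_of_fderiv_eq_zero hcc hfc hfd v w
  have h2 : f' ∘ c' =ᶠ[𝓝 (g y)] f ∘ c := by
    have h3 : c ⁻¹' (extChartAt I y).source ∈ 𝓝 (g y) :=
      hcs.continuousAt.preimage_mem_nhds (hc.apply_eq.symm ▸ extChartAt_source_mem_nhds y)
    filter_upwards [h3] with z hz
    exact congrArg f ((extChartAt I y).left_inv hz)
  rw [h2.fderiv.fderiv_eq, ← hcd, hc'y] at h1
  exact h1.symm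

/-- The Hessian of `f` is nondegenerate on a complex surface with coordinates `z₀`, `z₁` in which `f`
is the product `z₀ z₁`. -/
theorem IsHolomorphicParam.hessianAt_nondegenerate {J : EndField I X} {S : Set X} {y : X}
    {O : Set (EuclideanSpace ℂ (Fin 2))} {c : EuclideanSpace ℂ (Fin 2) → X}
    {g : X → EuclideanSpace ℂ (Fin 2)} (hc : IsHolomorphicParam I J S y O c g)
    {f : X → ℂ} (hf : ContMDiffAt I 𝓘(ℝ, ℂ) ∞ f y) (hf0 : mfderiv I 𝓘(ℝ, ℂ) f y = 0)
    (hfc : ∀ z ∈ O, f (c z) = z 0 * z 1) :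
    ∀ v ∈ tangentVectors I S y, (∀ w ∈ tangentVectors I S y, hessianAt I f y v w = 0) → v = 0 := by
  intro v hv hvw
  rw [hc.tangentVectors_eq] at hv hvw
  obtain ⟨z, rfl⟩ := hv
  have hz : z = 0 := eq_zero_of_mul_coord fun w => by
    have h1 := hvw _ ⟨w, rfl⟩
    have h2 : f ∘ c =ᶠ[𝓝 (g y)] fun z => z 0 * z 1 := by
      filter_upwards [hc.isOpen.mem_nhds hc.mem] with z hz using hfc z hz
    rw [← fderiv_fderiv_mul_coord (g y), ← h2.fderiv.fderiv_eq, ← hc.hessianAt_eq hf hf0]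
    exact h1
  rw [hz]
  exact map_zero (mfderiv 𝓘(ℝ, EuclideanSpace ℂ (Fin 2)) I c (g y))

end Hessian

/-! ### Holomorphic charts of the slices and of the critical set -/

section Slices

variable {E : Type*} [NormedAddCommGroup E] [NormedSpace ℂ E] [FiniteDimensional ℂ E]
  {M : Type*} [TopologicalSpace M] [ChartedSpace E M] [IsManifold 𝓘(ℂ, E) ω M]
  {F : Type*} [NormedAddCommGroup F] [NormedSpace ℂ F]
  {N : M → Type*} [∀ x, AddCommGroup (N x)] [∀ x, Module ℂ (N x)] [∀ x, TopologicalSpace (N x)]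
  [TopologicalSpace (Bundle.TotalSpace F N)] [FiberBundle F N]
  [∀ x, IsTopologicalAddGroup (N x)] [∀ x, ContinuousSMul ℂ (N x)]
  [VectorBundle ℂ F N] [ContMDiffVectorBundle ω F N 𝓘(ℂ, E)]

theorem contMDiffAt_of_mdifferentiableOn_complex {g : M → ℂ} {U : Set M} (hU : IsOpen U)
    (hg : MDifferentiableOn 𝓘(ℂ, E) 𝓘(ℂ, ℂ) g U) {x : M} (hx : x ∈ U) :
    ContMDiffAt 𝓘(ℂ, E) 𝓘(ℂ, ℂ) ∞ g x := by
  set φ := chartAt E x with hφ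
  have hW : IsOpen (φ.target ∩ φ.symm ⁻¹' U) :=
    φ.continuousOn_symm.isOpen_inter_preimage φ.open_target hU
  have hφs : ContMDiffOn 𝓘(ℂ, E) 𝓘(ℂ, E) ∞ φ.symm φ.target := contMDiffOn_chart_symm
  have hφc : ContMDiffOn 𝓘(ℂ, E) 𝓘(ℂ, E) ∞ φ φ.source := contMDiffOn_chart
  have hgd : DifferentiableOn ℂ (g ∘ φ.symm) (φ.target ∩ φ.symm ⁻¹' U) := by
    intro z hz
    have h1 : MDifferentiableAt 𝓘(ℂ, E) 𝓘(ℂ, E) φ.symm z :=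
      (hφs.contMDiffAt (φ.open_target.mem_nhds hz.1)).mdifferentiableAt (by simp)
    have h2 := (hg.mdifferentiableAt (hU.mem_nhds hz.2)).comp z h1
    exact (mdifferentiableAt_iff_differentiableAt.1 h2).differentiableWithinAt
  have hxs := mem_chart_source E x
  have hxW : φ x ∈ φ.target ∩ φ.symm ⁻¹' U :=
    ⟨φ.map_source hxs, by rwa [mem_preimage, φ.left_inv hxs]⟩
  have h1 : ContMDiffAt 𝓘(ℂ, E) 𝓘(ℂ, ℂ) ∞ (g ∘ φ.symm) (φ x) :=
    ((contDiffOn_of_differentiableOn_complex hW hgd).contDiffAt (hW.mem_nhds hxW)).contMDiffAt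
  refine (h1.comp x (hφc.contMDiffAt (φ.open_source.mem_nhds hxs))).congr_of_eventuallyEq ?_
  filter_upwards [φ.open_source.mem_nhds hxs] with y hy
  exact congrArg g (φ.left_inv hy).symm

theorem contMDiffAt_frameCoord_complex (b : F ≃L[ℂ] ℂ) {x₀ : M} {u : Bundle.TotalSpace F N}
    (hu : u.1 ∈ (trivializationAt F N x₀).baseSet) :
    ContMDiffAt (𝓘(ℂ, E).prod 𝓘(ℂ, F)) 𝓘(ℂ, ℂ) ω (frameCoord b x₀) u :=
  b.contDiff.contMDiff.contMDiffAt.comp u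
    (((trivializationAt F N x₀).contMDiffAt_iff (IB := 𝓘(ℂ, E)) (f := id)
      ((trivializationAt F N x₀).mem_source.2 hu)).1 contMDiffAt_id).2

theorem contMDiffAt_smul_lineFrame_complex (b : F ≃L[ℂ] ℂ) {x₀ : M} {n : WithTop ℕ∞}
    {B V X : Type*} [TopologicalSpace X] [TopologicalSpace B] [NormedAddCommGroup V]
    [NormedSpace ℂ V] {I : ModelWithCorners ℂ V B} [ChartedSpace B X]
    [ContMDiffVectorBundle n F N 𝓘(ℂ, E)] {q : X → M} {a : X → ℂ} {x : X}
    (hx : q x ∈ (trivializationAt F N x₀).baseSet) (hq : ContMDiffAt I 𝓘(ℂ, E) n q x)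
    (ha : ContMDiffAt I 𝓘(ℂ, ℂ) n a x) :
    ContMDiffAt I (𝓘(ℂ, E).prod 𝓘(ℂ, F)) n
      (fun t => (⟨q t, a t • lineFrame N b x₀ (q t)⟩ : Bundle.TotalSpace F N)) x := by
  rw [(trivializationAt F N x₀).contMDiffAt_iff (IB := 𝓘(ℂ, E))
    ((trivializationAt F N x₀).mem_source.2 hx)]
  refine ⟨hq, (b.symm.contDiff.contMDiff.contMDiffAt.comp x ha).congr_of_eventuallyEq ?_⟩
  filter_upwards [hq.continuousAt.preimage_mem_nhds
    ((trivializationAt F N x₀).open_baseSet.mem_nhds hx)] with t ht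
  have h1 := frameCoord_smul_lineFrame (N := N) b x₀ ht (a t)
  rw [frameCoord] at h1
  exact (b.symm_apply_eq.2 h1.symm).symm

variable [FiniteDimensional ℂ F]

theorem mfderiv_smul_I_of_complex {d : ℕ} {c : EuclideanSpace ℂ (Fin d) → Bundle.TotalSpace F N}
    {z : EuclideanSpace ℂ (Fin d)}
    (hc : MDifferentiableAt 𝓘(ℂ, EuclideanSpace ℂ (Fin d)) (𝓘(ℂ, E).prod 𝓘(ℂ, F)) c z)
    (v : EuclideanSpace ℂ (Fin d)) :
    mfderiv 𝓘(ℝ, EuclideanSpace ℂ (Fin d)) (realTotalModel E F) c z (Complex.I • v) =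
      mulI E F N (c z) (mfderiv 𝓘(ℝ, EuclideanSpace ℂ (Fin d)) (realTotalModel E F) c z v) := by
  set c' : EuclideanSpace ℂ (Fin d) →L[ℂ] E × F :=
    mfderiv 𝓘(ℂ, EuclideanSpace ℂ (Fin d)) (𝓘(ℂ, E).prod 𝓘(ℂ, F)) c z with hc'
  have h1 := (HasMFDerivAt.real_of_complex_to_prod (f' := c') hc.hasMFDerivAt).mfderiv
  have h2 : ∀ w : EuclideanSpace ℂ (Fin d),
      (mfderiv 𝓘(ℝ, EuclideanSpace ℂ (Fin d)) (realTotalModel E F) c z w : E × F) = c' w :=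
    fun w => congrArg (fun A : EuclideanSpace ℂ (Fin d) →L[ℝ] E × F => A w) h1
  refine (h2 (Complex.I • v)).trans ?_
  refine (map_smul c' Complex.I v).trans ?_
  exact congrArg (fun w : E × F => Complex.I • w) (h2 v).symm

variable {ℓ : (y : M) → N y →ₗ[ℂ] ℂ} {b : F ≃L[ℂ] ℂ} {h : HermitianMetric E F N}
  {ρ : M → M} {a : M} {Θ : OpenPartialHomeomorph M (HypModel E × ℂ)}

theorem contDiff_euclidean_pair :
    ContDiff ℝ ∞ fun p : ℂ × ℂ => (!₂[p.1, p.2] : EuclideanSpace ℂ (Fin 2)) := by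
  have h1 : ContDiff ℂ ∞ fun p : ℂ × ℂ => (!₂[p.1, p.2] : EuclideanSpace ℂ (Fin 2)) := by
    rw [contDiff_euclidean]
    intro i
    fin_cases i
    · exact contDiff_fst
    · exact contDiff_snd
  exact h1.restrict_scalars ℝ

/-- The slices of the tube have holomorphic coordinates in which the functional `ℓ`, as a function on
the total space, is the product of the coordinates. -/
theorem IsTubeChart.exists_isHolomorphicParam (hℓ : IsTransverseFunctional E ℓ b)
    (hΘ : IsTubeChart h b ℓ ρ a Θ) {ε : ℝ} {x u : Bundle.TotalSpace F N}
    (hu : u ∈ tubeDisc h b ℓ ρ ε x) (huΘ : u.1 ∈ Θ.source) :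
    ∃ (O : Set (EuclideanSpace ℂ (Fin 2))) (c : EuclideanSpace ℂ (Fin 2) → Bundle.TotalSpace F N)
      (g : Bundle.TotalSpace F N → EuclideanSpace ℂ (Fin 2)),
      IsHolomorphicParam (realTotalModel E F) (mulI E F N) (tubeDisc h b ℓ ρ ε x) u O c g ∧
      ∀ z ∈ O, ℓ (c z).1 (c z).2 = z 0 * z 1 := by
  obtain ⟨O₁, γ, hO₁, huO, hγs, hγ, hγu⟩ := hΘ.exists_curve u.1 huΘ
  -- The slice is the restriction of the line bundle to the curve `γ`: the coordinates are the
  -- coefficient of `ℓ`, which parametrizes the curve, and the fiber coordinate.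
  have hbs : ∀ t ∈ O₁, γ t ∈ (trivializationAt F N a).baseSet := fun t ht =>
    (hΘ.source_subset (hγ t ht).1).2
  set c : EuclideanSpace ℂ (Fin 2) → Bundle.TotalSpace F N := fun z =>
    ⟨γ (z 0), z 1 • lineFrame N b a (γ (z 0))⟩ with hc
  set g : Bundle.TotalSpace F N → EuclideanSpace ℂ (Fin 2) := fun u =>
    !₂[pairCoeff ℓ b a u.1, frameCoord b a u] with hg
  set O₂ : Set (EuclideanSpace ℂ (Fin 2)) := {z | z 0 ∈ O₁} with hO₂
  have hO₂o : IsOpen O₂ := hO₁.preimage (by fun_prop)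
  have hcs : ∀ z ∈ O₂, ContMDiffAt 𝓘(ℂ, EuclideanSpace ℂ (Fin 2)) (𝓘(ℂ, E).prod 𝓘(ℂ, F)) ∞ c z := by
    intro z hz
    have : ContMDiffVectorBundle ∞ F N 𝓘(ℂ, E) := ContMDiffVectorBundle.of_le (n := ω) le_top
    have h0 : ∀ i : Fin 2, ContDiff ℂ ∞ fun z : EuclideanSpace ℂ (Fin 2) => z i := fun i => by
      fun_prop
    exact contMDiffAt_smul_lineFrame_complex b (q := fun z : EuclideanSpace ℂ (Fin 2) => γ (z 0))
      (hbs _ hz) ((hγs.contMDiffAt (hO₁.mem_nhds hz)).comp z (h0 0).contMDiff.contMDiffAt)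
      (h0 1).contMDiff.contMDiffAt
  have hcr : ContMDiffOn 𝓘(ℝ, EuclideanSpace ℂ (Fin 2)) (realTotalModel E F) ∞ c O₂ := fun z hz =>
    (ContMDiffWithinAt.real_of_complex_to_prod (hcs z hz)).mono (subset_univ _)
  have hgc : ∀ z ∈ O₂, g (c z) = z := by
    intro z hz
    have h1 : pairCoeff ℓ b a (γ (z 0)) = z 0 := (hγ _ hz).2.2
    have h2 : frameCoord b a (c z) = z 1 := frameCoord_smul_lineFrame b a (hbs _ hz) (z 1)
    ext i
    fin_cases i
    · exact h1
    · exact h2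
  have hcg : ∀ v : Bundle.TotalSpace F N, v.1 ∈ (trivializationAt F N a).baseSet →
      γ (pairCoeff ℓ b a v.1) = v.1 → c (g v) = v := by
    rintro ⟨y, n⟩ hy hv
    exact (congrArg (fun y' => (⟨y', frameCoord b a (⟨y, n⟩ : Bundle.TotalSpace F N) •
      lineFrame N b a y'⟩ : Bundle.TotalSpace F N)) hv).trans
        (congrArg (Bundle.TotalSpace.mk y) (eq_frameCoord_smul b a hy n).symm)
  have hub := (hΘ.source_subset huΘ).2
  have hcgu : c (g u) = u := hcg u hub (hγu.self_of_nhds rfl).2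
  refine ⟨O₂ ∩ c ⁻¹' tube h b ℓ ε, c, g, ⟨?_, hcr.mono inter_subset_left, ?_,
    fun z hz => hgc z hz.1, ?_, ⟨huO, ?_⟩, hcgu, ?_, ?_⟩, ?_⟩
  · exact hcr.continuousOn.isOpen_inter_preimage hO₂o (hℓ.isOpen_tube ε)
  · exact fun z hz => ⟨hz.2, ((hγ _ hz.1).2.1).trans hu.2⟩
  · intro z hz
    have h1 : MDifferentiableAt (realTotalModel E F) 𝓘(ℝ, ℂ)
        (fun u : Bundle.TotalSpace F N => pairCoeff ℓ b a u.1) (c z) := by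
      have h2 : MDifferentiableAt 𝓘(ℝ, E) 𝓘(ℝ, ℂ) (pairCoeff ℓ b a) (c z).1 :=
        (HasMFDerivAt.real_of_complex (hℓ.holomorphic a _ (hbs _ hz.1)).hasMFDerivAt).mdifferentiableAt
      exact MDifferentiableAt.comp (c z) h2
        ((Bundle.contMDiffAt_proj N (n := ∞)).mdifferentiableAt (by simp))
    have h3 : MDifferentiableAt (realTotalModel E F) 𝓘(ℝ, ℂ) (frameCoord b a) (c z) :=
      (contMDiffAt_frameCoord b a (hΘ.source_subset (hγ _ hz.1).1)).mdifferentiableAt (by simp)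
    exact MDifferentiableAt.comp (c z)
      (g := fun p : ℂ × ℂ => (!₂[p.1, p.2] : EuclideanSpace ℂ (Fin 2)))
      (contDiff_euclidean_pair.contMDiff.mdifferentiableAt (by simp)) (h1.prodMk_space h3)
  · rw [mem_preimage, hcgu]
    exact hu.1
  · have h1 : ∀ᶠ v : Bundle.TotalSpace F N in 𝓝 u, v.1 ∈ (trivializationAt F N a).baseSet :=
      (FiberBundle.continuous_proj F N).continuousAt.preimage_mem_nhds
        ((trivializationAt F N a).open_baseSet.mem_nhds hub)
    filter_upwards [h1, (FiberBundle.continuous_proj F N).continuousAt.eventually hγu] with v hv hv' hvD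
    obtain ⟨h2, h3⟩ := hv' (hvD.2.trans hu.2.symm)
    have h4 := hcg v hv h3
    refine ⟨⟨h2, ?_⟩, h4⟩
    rw [mem_preimage, h4]
    exact hvD.1
  · exact fun z hz => mfderiv_smul_I_of_complex ((hcs z hz.1).mdifferentiableAt (by simp))
  · intro z hz
    change ℓ (γ (z 0)) (z 1 • lineFrame N b a (γ (z 0))) = _
    rw [map_smul, smul_eq_mul, mul_comm]
    exact congrArg (· * z 1) (hγ _ hz.1).2.2

/-- The zero locus of `ℓ` in the zero section is a complex submanifold. -/
theorem IsTransverseFunctional.exists_isHolomorphicParam_zerosOver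
    (hℓ : IsTransverseFunctional E ℓ b) {u : Bundle.TotalSpace F N} (hu : u ∈ zerosOver F ℓ) :
    ∃ (d : ℕ) (O : Set (EuclideanSpace ℂ (Fin d)))
      (c : EuclideanSpace ℂ (Fin d) → Bundle.TotalSpace F N)
      (g : Bundle.TotalSpace F N → EuclideanSpace ℂ (Fin d)),
      IsHolomorphicParam (realTotalModel E F) (mulI E F N) (zerosOver F ℓ) u O c g := by
  obtain ⟨ψ', hψ', -⟩ := hℓ.exists_atlas
  set a : {y | ℓ y = 0} := ⟨u.1, hu.1⟩
  set ψ := ψ' a with hψ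
  have had := hψ'.adapted a
  set O : Set (HypModel E) := {k | (k, (0 : ℂ)) ∈ ψ.target} with hO
  have hi : Continuous fun k : HypModel E => (k, (0 : ℂ)) := by fun_prop
  set c : HypModel E → Bundle.TotalSpace F N := fun k => ⟨ψ.symm (k, 0), 0⟩ with hc
  set g : Bundle.TotalSpace F N → HypModel E := fun u => (ψ u.1).1 with hg
  have hcs : ∀ k ∈ O, ContMDiffAt 𝓘(ℂ, HypModel E) (𝓘(ℂ, E).prod 𝓘(ℂ, F)) ∞ c k := by
    intro k hk
    have : ContMDiffVectorBundle ∞ F N 𝓘(ℂ, E) := ContMDiffVectorBundle.of_le (n := ω) le_top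
    have h1 : ContDiff ℂ ∞ fun k : HypModel E => (k, (0 : ℂ)) := contDiff_id.prodMk contDiff_const
    have h2 : ContMDiffAt 𝓘(ℂ, HypModel E) 𝓘(ℂ, E) ∞ (fun k : HypModel E => ψ.symm (k, 0)) k :=
      ContMDiffAt.comp (g := ψ.symm) (f := fun k : HypModel E => (k, (0 : ℂ))) k
        (had.contMDiffOn_symm.contMDiffAt (ψ.open_target.mem_nhds hk)) h1.contMDiff.contMDiffAt
    exact ContMDiffAt.comp (g := Bundle.zeroSection F N) k
      (Bundle.contMDiff_zeroSection ℂ N).contMDiffAt h2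
  have hua : u.1 ∈ ψ.source := hψ'.mem_source a
  have hcg : ∀ v : Bundle.TotalSpace F N, v.1 ∈ ψ.source → v ∈ zerosOver F ℓ →
      g v ∈ O ∧ c (g v) = v := by
    rintro ⟨y, n⟩ hy ⟨hv1, hv2⟩
    have h1 : ((ψ y).1, (0 : ℂ)) = ψ y := hψ'.mk_fst_zero hv1 hy
    refine ⟨?_, ?_⟩
    · change ((ψ y).1, (0 : ℂ)) ∈ ψ.target
      rw [h1]
      exact ψ.map_source hy
    · change (⟨ψ.symm ((ψ y).1, 0), 0⟩ : Bundle.TotalSpace F N) = _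
      rw [h1, ψ.left_inv hy]
      exact congrArg (Bundle.TotalSpace.mk y) hv2.symm
  refine ⟨_, O, c, g, ψ.open_target.preimage hi, ?_, ?_, ?_, ?_, (hcg u hua hu).1, (hcg u hua hu).2,
    ?_, ?_⟩
  · exact fun k hk => (ContMDiffWithinAt.real_of_complex_to_prod (hcs k hk)).mono (subset_univ _)
  · exact fun k hk => ⟨hψ'.symm_mem hk, rfl⟩
  · intro k hk
    change (ψ (ψ.symm (k, 0))).1 = k
    rw [ψ.right_inv hk]
  · intro k hk
    have h1 : MDifferentiableAt 𝓘(ℝ, E) 𝓘(ℝ, HypModel E × ℂ) ψ (c k).1 :=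
      (HasMFDerivAt.real_of_complex ((had.contMDiffOn.contMDiffAt
        (ψ.open_source.mem_nhds (ψ.map_target hk))).mdifferentiableAt
          (by simp)).hasMFDerivAt).mdifferentiableAt
    have h2 : MDifferentiableAt 𝓘(ℝ, HypModel E × ℂ) 𝓘(ℝ, HypModel E)
        (Prod.fst : HypModel E × ℂ → HypModel E) (ψ (c k).1) :=
      (contDiff_fst (𝕜 := ℝ) (n := ∞)).contMDiff.mdifferentiableAt (by simp)
    exact MDifferentiableAt.comp (c k) (g := fun y => (ψ y).1) (MDifferentiableAt.comp _ h2 h1)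
      ((Bundle.contMDiffAt_proj N (n := ∞)).mdifferentiableAt (by simp))
  · have h1 : ∀ᶠ v : Bundle.TotalSpace F N in 𝓝 u, v.1 ∈ ψ.source :=
      (FiberBundle.continuous_proj F N).continuousAt.preimage_mem_nhds
        (ψ.open_source.mem_nhds hua)
    filter_upwards [h1] with v hv hvZ using hcg v hv hvZ
  · exact fun z hz => mfderiv_smul_I_of_complex ((hcs z hz).mdifferentiableAt (by simp))

end Slices

/-! ### Connected components, and tubular neighborhoods in the plane -/

/-- A compact set in which every point has a connected neighborhood has finitely many components. -/
theorem finite_connectedComponents_of_isCompact {X : Type*} [TopologicalSpace X] {Z : Set X}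
    (hZ : IsCompact Z) (hc : ∀ u ∈ Z, ∃ C, C ⊆ Z ∧ IsPreconnected C ∧ C ∈ 𝓝[Z] u) :
    Finite (ConnectedComponents Z) := by
  have : CompactSpace Z := isCompact_iff_compactSpace.1 hZ
  choose! C hCZ hCc hCn using hc
  obtain ⟨t, ht⟩ := CompactSpace.elim_nhds_subcover (fun u : Z => Subtype.val ⁻¹' C u) fun u =>
    (mem_nhds_subtype_iff_nhdsWithin).2 (by
      rw [Subtype.image_preimage_coe]
      exact Filter.inter_mem self_mem_nhdsWithin (hCn u u.2))
  refine Finite.of_surjective (fun u : t => ConnectedComponents.mk (u : Z)) fun q => ?_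
  obtain ⟨z, rfl⟩ := ConnectedComponents.surjective_coe q
  have hz : z ∈ ⋃ u ∈ t, (Subtype.val ⁻¹' C (u : Z) : Set Z) := by
    rw [ht]
    trivial
  obtain ⟨u, hu, hzu⟩ := mem_iUnion₂.1 hz
  refine ⟨⟨u, hu⟩, ConnectedComponents.coe_eq_coe'.2 ?_⟩
  have h1 : IsPreconnected (Subtype.val ⁻¹' C (u : Z) : Set Z) := by
    rw [← Topology.IsInducing.subtypeVal.isPreconnected_image, Subtype.image_preimage_coe,
      inter_eq_right.2 (hCZ u u.2)]
    exact hCc u u.2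
  have hu' : (u : X) ∈ C u := mem_of_mem_nhdsWithin u.2 (hCn u u.2)
  exact h1.subset_connectedComponent hzu hu'

theorem IsHolomorphicParam.exists_isPreconnected {V : Type*} [NormedAddCommGroup V]
    [NormedSpace ℝ V] {B : Type*} [TopologicalSpace B] {I : ModelWithCorners ℝ V B} {X : Type*}
    [TopologicalSpace X] [ChartedSpace B X] {J : EndField I X} {S : Set X} {y : X} {d : ℕ}
    {O : Set (EuclideanSpace ℂ (Fin d))} {c : EuclideanSpace ℂ (Fin d) → X}
    {g : X → EuclideanSpace ℂ (Fin d)} (hc : IsHolomorphicParam I J S y O c g) :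
    ∃ C, C ⊆ S ∧ IsPreconnected C ∧ C ∈ 𝓝[S] y := by
  obtain ⟨r, hr, hrO⟩ := Metric.isOpen_iff.1 hc.isOpen _ hc.mem
  refine ⟨c '' Metric.ball (g y) r, (hc.mapsTo.mono_left hrO).image_subset, ?_, ?_⟩
  · exact (convex_ball _ _).isPreconnected.image _ (hc.contMDiffOn.continuousOn.mono hrO)
  · have h1 := (hc.mdifferentiableAt _ hc.mem).continuousAt
    rw [hc.apply_eq] at h1
    rw [mem_nhdsWithin_iff_eventually]
    filter_upwards [hc.right_inv, h1.eventually (Metric.ball_mem_nhds _ hr)] with y' h2 h3 h4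
    exact ⟨g y', h3, (h2 h4).2⟩

theorem isTubularFoliation_empty {V : Type*} [NormedAddCommGroup V] [NormedSpace ℝ V]
    {B : Type*} [TopologicalSpace B] (I : ModelWithCorners ℝ V B) {X : Type*} [TopologicalSpace X]
    [ChartedSpace B X] (D : X → Set X) : IsTubularFoliation I (∅ : Set X) ∅ D where
  isOpen := isOpen_empty
  eq_iUnion := by simp
  disjoint := pairwiseDisjoint_empty
  locally_trivial := fun x hx => hx.elim

theorem isTubularFoliation_unit_disc :
    IsTubularFoliation 𝓘(ℝ, ℂ) ({0} : Set ℂ) (Metric.ball 0 1) fun _ => Metric.ball 0 1 where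
  isOpen := Metric.isOpen_ball
  eq_iUnion := by simp
  disjoint := pairwiseDisjoint_singleton _ _
  locally_trivial := by
    rintro x rfl
    set e : ℂ ≃ₗᵢ[ℝ] EuclideanSpace ℝ (Fin 2) := Complex.orthonormalBasisOneI.repr
    set P := EuclideanSpace ℝ (Fin 0) × EuclideanSpace ℝ (Fin 2)
    have h1 : ContDiff ℝ ∞ fun p : P => e.symm p.2 :=
      e.symm.toContinuousLinearEquiv.contDiff.comp contDiff_snd
    have h2 : ContDiff ℝ ∞ fun z : ℂ => ((0, e z) : P) :=
      contDiff_const.prodMk e.toContinuousLinearEquiv.contDiff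
    refine ⟨0, 2,
      { toFun := fun p => e.symm p.2
        invFun := fun z => (0, e z)
        source := univ ×ˢ Metric.ball 0 1
        target := Metric.ball 0 1
        map_source' := fun p hp => mem_ball_zero_iff.2 (by
          rw [LinearIsometryEquiv.norm_map]
          exact mem_ball_zero_iff.1 hp.2)
        map_target' := fun z hz => ⟨mem_univ _, mem_ball_zero_iff.2 (by
          rw [LinearIsometryEquiv.norm_map]
          exact mem_ball_zero_iff.1 hz)⟩
        left_inv' := fun p _ => Prod.ext (Subsingleton.elim _ _) (e.apply_symm_apply p.2)
        right_inv' := fun z _ => e.symm_apply_apply z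
        open_source := isOpen_univ.prod Metric.isOpen_ball
        open_target := Metric.isOpen_ball
        continuousOn_toFun := h1.continuous.continuousOn
        continuousOn_invFun := h2.continuous.continuousOn },
      ⟨⟨univ, rfl⟩, h1.contMDiff.contMDiffOn, h2.contMDiff.contMDiffOn, fun p _ => ?_,
        fun p _ _ => ?_⟩, Metric.mem_ball_self one_pos⟩
    · change e.symm p.2 = 0 ↔ _
      rw [LinearIsometryEquiv.map_eq_zero_iff]
    · ext z
      constructor
      · intro hz
        refine ⟨(p.1, e z), ⟨rfl, mem_ball_zero_iff.2 ?_⟩, e.symm_apply_apply z⟩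
        rw [LinearIsometryEquiv.norm_map]
        exact mem_ball_zero_iff.1 hz
      · rintro ⟨q, ⟨-, hq⟩, rfl⟩
        refine mem_ball_zero_iff.2 ?_
        change ‖e.symm q.2‖ < 1
        rw [LinearIsometryEquiv.norm_map]
        exact mem_ball_zero_iff.1 hq

/-- Multiplication by `i`, as a complex structure on the plane. -/
noncomputable def constMulI : ℂ → ℂ →L[ℝ] ℂ := fun _ =>
  (Complex.I • ContinuousLinearMap.id ℂ ℂ).restrictScalars ℝ

theorem isPositiveComplexStructureOn_constMulI (W : Set ℂ) :
    IsPositiveComplexStructureOn constMulI W where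
  smooth := contDiffOn_const
  sq := fun z _ v => by
    change Complex.I * (Complex.I * v) = -v
    rw [← mul_assoc, Complex.I_mul_I, neg_one_mul]
  positive := fun z _ => by
    change 0 < (Complex.I * 1).im
    simp

/-! ### The fibration given by a transverse linear functional -/

section Fibration

variable {E : Type*} [NormedAddCommGroup E] [NormedSpace ℂ E] [FiniteDimensional ℂ E]
  {M : Type*} [TopologicalSpace M] [ChartedSpace E M] [IsManifold 𝓘(ℂ, E) ω M]
  {F : Type*} [NormedAddCommGroup F] [NormedSpace ℂ F] [FiniteDimensional ℂ F]
  {N : M → Type*} [∀ x, AddCommGroup (N x)] [∀ x, Module ℂ (N x)] [∀ x, TopologicalSpace (N x)]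
  [TopologicalSpace (Bundle.TotalSpace F N)] [FiberBundle F N]
  [∀ x, IsTopologicalAddGroup (N x)] [∀ x, ContinuousSMul ℂ (N x)]
  [VectorBundle ℂ F N] [ContMDiffVectorBundle ω F N 𝓘(ℂ, E)]
  {ℓ : (y : M) → N y →ₗ[ℂ] ℂ} {b : F ≃L[ℂ] ℂ} {h : HermitianMetric E F N}

/-- The family of linear functionals `ℓ` as a function on the total space. -/
def functionalMap (F : Type*) {M : Type*} {N : M → Type*} [∀ x, AddCommGroup (N x)]
    [∀ x, Module ℂ (N x)] (ℓ : (y : M) → N y →ₗ[ℂ] ℂ) : Bundle.TotalSpace F N → ℂ :=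
  fun u => ℓ u.1 u.2

theorem functionalMap_eventuallyEq (ℓ : (y : M) → N y →ₗ[ℂ] ℂ) (b : F ≃L[ℂ] ℂ)
    (u : Bundle.TotalSpace F N) :
    functionalMap F ℓ =ᶠ[𝓝 u] fun v => frameCoord b u.1 v * pairCoeff ℓ b u.1 v.1 := by
  have h1 : ∀ᶠ v : Bundle.TotalSpace F N in 𝓝 u, v.1 ∈ (trivializationAt F N u.1).baseSet :=
    (FiberBundle.continuous_proj F N).continuousAt.preimage_mem_nhds
      ((trivializationAt F N u.1).open_baseSet.mem_nhds
        (FiberBundle.mem_baseSet_trivializationAt' u.1))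
  filter_upwards [h1] with v hv using apply_eq_frameCoord_mul_pairCoeff ℓ b u.1 hv v.2

theorem IsTransverseFunctional.contMDiffAt_pairCoeff (hℓ : IsTransverseFunctional E ℓ b) {x₀ y : M}
    (hy : y ∈ (trivializationAt F N x₀).baseSet) :
    ContMDiffAt 𝓘(ℂ, E) 𝓘(ℂ, ℂ) ∞ (pairCoeff ℓ b x₀) y :=
  contMDiffAt_of_mdifferentiableOn_complex (trivializationAt F N x₀).open_baseSet
    (fun z hz => (hℓ.holomorphic x₀ z hz).mdifferentiableWithinAt) hy

theorem IsTransverseFunctional.contMDiff_functionalMap (hℓ : IsTransverseFunctional E ℓ b) :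
    ContMDiff (realTotalModel E F) 𝓘(ℝ, ℂ) ∞ (functionalMap F ℓ) := by
  intro u
  have hu := FiberBundle.mem_baseSet_trivializationAt' (F := F) (E := N) u.1
  have h1 := contMDiffAt_frameCoord b u.1 (u := u) (mem_trivDomain (E := E) (F := F) (N := N) u.1)
  have h2 : ContMDiffAt 𝓘(ℝ, E) 𝓘(ℝ, ℂ) ∞ (pairCoeff ℓ b u.1) u.1 :=
    ContMDiffWithinAt.real_of_complex (hℓ.contMDiffAt_pairCoeff hu)
  have h3 : ContMDiffAt (realTotalModel E F) 𝓘(ℝ, ℂ) ∞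
      (fun v : Bundle.TotalSpace F N => pairCoeff ℓ b u.1 v.1) u :=
    ContMDiffAt.comp u h2 (Bundle.contMDiffAt_proj N)
  exact (h1.mul_complex h3).congr_of_eventuallyEq (functionalMap_eventuallyEq ℓ b u)

theorem IsTransverseFunctional.mdifferentiableAt_functionalMap (hℓ : IsTransverseFunctional E ℓ b)
    (u : Bundle.TotalSpace F N) :
    MDifferentiableAt (𝓘(ℂ, E).prod 𝓘(ℂ, F)) 𝓘(ℂ, ℂ) (functionalMap F ℓ) u := by
  have hu := FiberBundle.mem_baseSet_trivializationAt' (F := F) (E := N) u.1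
  have h1 : MDifferentiableAt (𝓘(ℂ, E).prod 𝓘(ℂ, F)) 𝓘(ℂ, ℂ) (frameCoord b u.1) u :=
    (contMDiffAt_frameCoord_complex b hu).mdifferentiableAt (by simp)
  have h2 : MDifferentiableAt (𝓘(ℂ, E).prod 𝓘(ℂ, F)) 𝓘(ℂ, ℂ)
      (fun v : Bundle.TotalSpace F N => pairCoeff ℓ b u.1 v.1) u :=
    MDifferentiableAt.comp u (hℓ.holomorphic u.1 u.1 hu)
      ((Bundle.contMDiffAt_proj N (n := ω)).mdifferentiableAt (by simp))
  exact (h1.mul h2).congr_of_eventuallyEq (functionalMap_eventuallyEq ℓ b u)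

/-- The real derivative of the holomorphic function `functionalMap F ℓ` is complex linear. -/
theorem IsTransverseFunctional.mfderiv_functionalMap_apply (hℓ : IsTransverseFunctional E ℓ b)
    (u : Bundle.TotalSpace F N) (v : E × F) :
    (mfderiv (realTotalModel E F) 𝓘(ℝ, ℂ) (functionalMap F ℓ) u v : ℂ) =
      mfderiv (𝓘(ℂ, E).prod 𝓘(ℂ, F)) 𝓘(ℂ, ℂ) (functionalMap F ℓ) u v := by
  have h1 := (HasMFDerivAt.real_of_complex_from_prod (E := E) (F := F) (E' := ℂ)
    (f := functionalMap F ℓ) (x := u) (f' := (mfderiv (𝓘(ℂ, E).prod 𝓘(ℂ, F)) 𝓘(ℂ, ℂ) (functionalMap F ℓ) u : E × F →L[ℂ] ℂ))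
    (hℓ.mdifferentiableAt_functionalMap u).hasMFDerivAt).mfderiv
  exact congrArg (fun A : E × F →L[ℝ] ℂ => A v) h1

theorem IsTransverseFunctional.mfderiv_functionalMap_mulI (hℓ : IsTransverseFunctional E ℓ b)
    (u : Bundle.TotalSpace F N) (v : E × F) :
    (mfderiv (realTotalModel E F) 𝓘(ℝ, ℂ) (functionalMap F ℓ) u (mulI E F N u v) : ℂ) =
      constMulI (functionalMap F ℓ u) (mfderiv (realTotalModel E F) 𝓘(ℝ, ℂ) (functionalMap F ℓ) u v) := by
  refine (hℓ.mfderiv_functionalMap_apply u (Complex.I • v)).trans ?_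
  refine (map_smul (mfderiv (𝓘(ℂ, E).prod 𝓘(ℂ, F)) 𝓘(ℂ, ℂ) (functionalMap F ℓ) u :
    E × F →L[ℂ] ℂ) Complex.I v).trans ?_
  exact congrArg (fun w : ℂ => Complex.I * w) (hℓ.mfderiv_functionalMap_apply u v).symm

/-- In a local frame `functionalMap F ℓ` is the product of the fiber coordinate and the coefficient
of `ℓ`, which vanishes to first order, so that its derivative vanishes only where both do. -/
theorem IsTransverseFunctional.mfderiv_functionalMap_eq_zero_iff
    (hℓ : IsTransverseFunctional E ℓ b) (u : Bundle.TotalSpace F N) :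
    mfderiv (𝓘(ℂ, E).prod 𝓘(ℂ, F)) 𝓘(ℂ, ℂ) (functionalMap F ℓ) u = 0 ↔ u ∈ zerosOver F ℓ := by
  have hu := FiberBundle.mem_baseSet_trivializationAt' (F := F) (E := N) u.1
  set ζ := frameCoord b u.1 u with hζ
  have huζ : (⟨u.1, ζ • lineFrame N b u.1 u.1⟩ : Bundle.TotalSpace F N) = u :=
    congrArg (Bundle.TotalSpace.mk u.1) (eq_frameCoord_smul b u.1 hu u.2).symm
  constructor
  · intro h0
    have hd : HasMFDerivAt (𝓘(ℂ, E).prod 𝓘(ℂ, F)) 𝓘(ℂ, ℂ) (functionalMap F ℓ) u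
        (0 : E × F →L[ℂ] ℂ) := h0 ▸ (hℓ.mdifferentiableAt_functionalMap u).hasMFDerivAt
    have hℓu : pairCoeff ℓ b u.1 u.1 = 0 := by
      have h1 : ContMDiffAt 𝓘(ℂ, ℂ) (𝓘(ℂ, E).prod 𝓘(ℂ, F)) ω
          (fun t : ℂ => (⟨u.1, t • lineFrame N b u.1 u.1⟩ : Bundle.TotalSpace F N)) ζ :=
        contMDiffAt_smul_lineFrame_complex b (q := fun _ => u.1) (a := id) hu contMDiffAt_const
          contMDiffAt_id
      have h2 := (h1.mdifferentiableAt (by simp)).hasMFDerivAt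
      have hd' : HasMFDerivAt (𝓘(ℂ, E).prod 𝓘(ℂ, F)) 𝓘(ℂ, ℂ) (functionalMap F ℓ)
          (⟨u.1, ζ • lineFrame N b u.1 u.1⟩ : Bundle.TotalSpace F N) (0 : E × F →L[ℂ] ℂ) := by
        rw [huζ]
        exact hd
      have h3 : HasFDerivAt (functionalMap F ℓ ∘ fun t : ℂ =>
          (⟨u.1, t • lineFrame N b u.1 u.1⟩ : Bundle.TotalSpace F N)) (0 : ℂ →L[ℂ] ℂ) ζ :=
        (hasMFDerivAt_iff_hasFDerivAt.1 (HasMFDerivAt.comp ζ hd' h2)).congr_fderiv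
          (ContinuousLinearMap.zero_comp _)
      have h4 : HasDerivAt (functionalMap F ℓ ∘ fun t : ℂ =>
          (⟨u.1, t • lineFrame N b u.1 u.1⟩ : Bundle.TotalSpace F N)) (pairCoeff ℓ b u.1 u.1) ζ := by
        have h5 := (hasDerivAt_id ζ).mul_const (pairCoeff ℓ b u.1 u.1)
        rw [one_mul] at h5
        refine h5.congr_of_eventuallyEq (Filter.Eventually.of_forall fun t => ?_)
        exact map_smul (ℓ u.1) t _
      exact h4.unique h3.hasDerivAt
    have hℓu' := (pairCoeff_eq_zero_iff hu).1 hℓu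
    refine ⟨hℓu', ?_⟩
    have h1 : ContMDiffAt 𝓘(ℂ, E) (𝓘(ℂ, E).prod 𝓘(ℂ, F)) ω
        (fun y : M => (⟨y, ζ • lineFrame N b u.1 y⟩ : Bundle.TotalSpace F N)) u.1 :=
      contMDiffAt_smul_lineFrame_complex b (q := id) (a := fun _ => ζ) hu contMDiffAt_id
        contMDiffAt_const
    have h2 := (h1.mdifferentiableAt (by simp)).hasMFDerivAt
    have h3 := HasMFDerivAt.comp u.1 (huζ.symm ▸ hd) h2
    have h4 : HasMFDerivAt 𝓘(ℂ, E) 𝓘(ℂ, ℂ) (functionalMap F ℓ ∘ fun y : M =>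
        (⟨y, ζ • lineFrame N b u.1 y⟩ : Bundle.TotalSpace F N)) u.1
        (ζ • (mfderiv 𝓘(ℂ, E) 𝓘(ℂ, ℂ) (pairCoeff ℓ b u.1) u.1 : E →L[ℂ] ℂ)) := by
      have h5 := ((hℓ.holomorphic u.1 u.1 hu).hasMFDerivAt).const_smul ζ
      refine h5.congr_of_eventuallyEq (Filter.Eventually.of_forall fun y => ?_)
      exact map_smul (ℓ y) ζ _
    have h5 : ζ • (mfderiv 𝓘(ℂ, E) 𝓘(ℂ, ℂ) (pairCoeff ℓ b u.1) u.1 : E →L[ℂ] ℂ) = 0 := by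
      refine (hasMFDerivAt_unique h4 h3).trans ?_
      exact ContinuousLinearMap.zero_comp _
    have h6 : ζ = 0 := (smul_eq_zero.1 h5).resolve_right (hℓ.transverse u.1 hℓu')
    rw [eq_frameCoord_smul b u.1 hu u.2]
    exact (congrArg (· • lineFrame N b u.1 u.1) h6).trans (zero_smul ℂ _)
  · rintro ⟨h1, h2⟩
    have hζ0 : frameCoord b u.1 u = 0 := by
      have h3 := frameCoord_smul_lineFrame (N := N) b u.1 hu 0
      rw [zero_smul] at h3
      rw [← h3]
      exact congrArg (fun n => frameCoord b u.1 (⟨u.1, n⟩ : Bundle.TotalSpace F N)) h2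
    have hg0 : pairCoeff ℓ b u.1 u.1 = 0 := (pairCoeff_eq_zero_iff hu).2 h1
    have h3 : MDifferentiableAt (𝓘(ℂ, E).prod 𝓘(ℂ, F)) 𝓘(ℂ, ℂ) (frameCoord b u.1) u :=
      (contMDiffAt_frameCoord_complex b hu).mdifferentiableAt (by simp)
    have h4 : MDifferentiableAt (𝓘(ℂ, E).prod 𝓘(ℂ, F)) 𝓘(ℂ, ℂ)
        (fun v : Bundle.TotalSpace F N => pairCoeff ℓ b u.1 v.1) u :=
      MDifferentiableAt.comp u (hℓ.holomorphic u.1 u.1 hu)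
        ((Bundle.contMDiffAt_proj N (n := ω)).mdifferentiableAt (by simp))
    have h5 := ((h3.hasMFDerivAt.mul h4.hasMFDerivAt).congr_of_eventuallyEq
      (functionalMap_eventuallyEq ℓ b u)).mfderiv
    set A : E × F →L[ℂ] ℂ := mfderiv (𝓘(ℂ, E).prod 𝓘(ℂ, F)) 𝓘(ℂ, ℂ) (frameCoord b u.1) u
    set B : E × F →L[ℂ] ℂ := mfderiv (𝓘(ℂ, E).prod 𝓘(ℂ, F)) 𝓘(ℂ, ℂ)
      (fun v : Bundle.TotalSpace F N => pairCoeff ℓ b u.1 v.1) u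
    refine h5.trans (ContinuousLinearMap.ext fun v => ?_)
    change frameCoord b u.1 u * B v + pairCoeff ℓ b u.1 u.1 * A v = 0
    rw [hζ0, hg0, zero_mul, zero_mul, add_zero]

theorem IsTransverseFunctional.critSet_functionalMap (hℓ : IsTransverseFunctional E ℓ b) :
    critSet (realTotalModel E F) (functionalMap F ℓ) = zerosOver F ℓ := by
  ext u
  rw [← hℓ.mfderiv_functionalMap_eq_zero_iff u]
  set A : E × F →L[ℂ] ℂ :=
    mfderiv (𝓘(ℂ, E).prod 𝓘(ℂ, F)) 𝓘(ℂ, ℂ) (functionalMap F ℓ) u with hA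
  have hA' : ∀ v : E × F, (mfderiv (realTotalModel E F) 𝓘(ℝ, ℂ) (functionalMap F ℓ) u v : ℂ) = A v :=
    hℓ.mfderiv_functionalMap_apply u
  change ¬ Function.Surjective _ ↔ A = 0
  constructor
  · intro hs
    by_contra h0
    obtain ⟨v, hv⟩ : ∃ v, A v ≠ 0 := by
      by_contra! h1
      exact h0 (ContinuousLinearMap.ext h1)
    have h1 : ∀ w : ℂ, A ((w / A v) • v) = w := fun w => by
      rw [map_smul, smul_eq_mul, div_mul_cancel₀ w hv]
    exact hs fun w => ⟨_, (hA' _).trans (h1 w)⟩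
  · intro h0 hs
    obtain ⟨v, hv⟩ := hs (1 : ℂ)
    have h1 : A v = 1 := (hA' v).symm.trans hv
    rw [h0] at h1
    exact zero_ne_one h1

theorem zerosOver_eq_image_zeroSection :
    zerosOver F ℓ = Bundle.zeroSection F N '' {y | ℓ y = 0} := by
  ext u
  constructor
  · rintro ⟨h1, h2⟩
    exact ⟨u.1, h1, congrArg (Bundle.TotalSpace.mk u.1) h2.symm⟩
  · rintro ⟨y, hy, rfl⟩
    exact ⟨hy, rfl⟩

theorem IsTransverseFunctional.isCompact_zerosOver [CompactSpace M]
    (h : HermitianMetric E F N) (hℓ : IsTransverseFunctional E ℓ b) :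
    IsCompact (zerosOver F ℓ) := by
  rw [zerosOver_eq_image_zeroSection]
  exact (hℓ.isClosed_zeros h).isCompact.image
    (Bundle.contMDiff_zeroSection (n := ω) (IB := 𝓘(ℂ, E)) ℂ N).continuous

/-- The total space has no compact component: each fiber is connected and unbounded. -/
theorem HermitianMetric.not_isCompact_connectedComponent (h : HermitianMetric E F N) (b : F ≃L[ℂ] ℂ)
    (u : Bundle.TotalSpace F N) : ¬ IsCompact (connectedComponent u) := by
  intro hc
  have hu := FiberBundle.mem_baseSet_trivializationAt' (F := F) (E := N) u.1
  set line : ℂ → Bundle.TotalSpace F N := fun t => ⟨u.1, t • lineFrame N b u.1 u.1⟩ with hline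
  have hlc : Continuous line := by
    have h1 : ContMDiff 𝓘(ℂ, ℂ) (𝓘(ℂ, E).prod 𝓘(ℂ, F)) ω line := fun t =>
      contMDiffAt_smul_lineFrame_complex b (q := fun _ => u.1) (a := id) hu contMDiffAt_const
        contMDiffAt_id
    exact h1.continuous
  have hlu : line (frameCoord b u.1 u) = u :=
    congrArg (Bundle.TotalSpace.mk u.1) (eq_frameCoord_smul b u.1 hu u.2).symm
  have hsub : range line ⊆ connectedComponent u :=
    (isPreconnected_range hlc).subset_connectedComponent ⟨_, hlu⟩
  obtain ⟨C, hC⟩ := (hc.image h.smooth.continuous).bddAbove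
  have h1 : ∀ t : ℝ, t ^ 2 * frameSq h b u.1 u.1 ≤ C := by
    intro t
    have h2 := hC ⟨line t, hsub ⟨t, rfl⟩, rfl⟩
    have h3 : (h.inner (line t).1 (line t).2 (line t).2).re = t ^ 2 * frameSq h b u.1 u.1 := by
      refine (inner_smul_self_re h u.1 (t : ℂ) (lineFrame N b u.1 u.1)).trans ?_
      rw [Complex.norm_real, Real.norm_eq_abs, sq_abs]
      rfl
    exact h3 ▸ h2
  have hpos := frameSq_pos (h := h) (b := b) hu
  have h2 := h1 (Real.sqrt ((|C| + 1) / frameSq h b u.1 u.1))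
  rw [Real.sq_sqrt (div_nonneg (by positivity) hpos.le), div_mul_cancel₀ _ hpos.ne'] at h2
  linarith [le_abs_self C]

/-- The linear functional `ℓ`, as a function on the total space, is a Lefschetz–Bott fibration for
the canonical form. -/
theorem IsTransverseFunctional.isLefschetzBottFibration [T2Space M] [CompactSpace M]
    (hℓ : IsTransverseFunctional E ℓ b) {nabla : RealConnection E F N}
    (hn : IsHermitianHolomorphic h nabla) {κ : DiffForm 𝓘(ℝ, E) M 2} (hκ : IsKahlerForm κ)
    (hc : HasCurvatureTwoPiI nabla κ) :
    IsLefschetzBottFibration (realTotalModel E F) (canonicalForm h nabla κ) (functionalMap F ℓ) := by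
  obtain ⟨ρ, hρ⟩ := hℓ.exists_isTubeChart h
  obtain ⟨ε, hε, hε1, hερ, hεΘ⟩ := hℓ.exists_isTubeBox hρ
  have hfol := hℓ.isTubularFoliation_tube hε hερ hεΘ
  have hcrit := hℓ.critSet_functionalMap
  have hcompat := hn.isCompatibleAt_mulI b hκ hc
  have hdisc : ∀ x ∈ zerosOver F ℓ, ∀ u ∈ tubeDisc h b ℓ ρ ε x,
      ∃ (O : Set (EuclideanSpace ℂ (Fin 2))) (c : EuclideanSpace ℂ (Fin 2) → Bundle.TotalSpace F N)
      (g : Bundle.TotalSpace F N → EuclideanSpace ℂ (Fin 2)),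
      IsHolomorphicParam (realTotalModel E F) (mulI E F N) (tubeDisc h b ℓ ρ ε x) u O c g ∧
      ∀ z ∈ O, ℓ (c z).1 (c z).2 = z 0 * z 1 := by
    intro x hx u hu
    obtain ⟨a, Θ, A, hΘ, hA, hxΘ, hxA⟩ := hεΘ x.1 hx.1
    refine hΘ.exists_isHolomorphicParam hℓ hu ?_
    refine hA.mem_source _ (functionalSq_lt_of_mem_tube hu.1) _ hxA ?_
    rw [hu.2, hΘ.mk_fst_zero hxΘ hx.1, Θ.left_inv hxΘ]
  have hmaps : MapsTo (functionalMap F ℓ) (tube h b ℓ ε) (Metric.ball 0 1) := by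
    intro u hu
    rw [mem_ball_zero_iff]
    have h1 := norm_apply_sq h b ℓ u
    have h2 : functionalSq h b ℓ u.1 + (h.inner u.1 u.2 u.2).re < 1 :=
      lt_of_lt_of_le hu (pow_le_one₀ hε.le hε1)
    have h3 := functionalSq_nonneg (h := h) (b := b) (ℓ := ℓ) u.1
    have h4 := h.inner_self_re_nonneg u
    have h5 : ‖functionalMap F ℓ u‖ ^ 2 < 1 ^ 2 := by
      change ‖ℓ u.1 u.2‖ ^ 2 < _
      rw [h1]
      nlinarith
    exact lt_of_pow_lt_pow_left₀ 2 zero_le_one h5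
  -- If the zero locus is empty, so is the tube, and the set of critical values.
  have hW : ∃ W : Set ℂ, IsTubularNeighborhood 𝓘(ℝ, ℂ) (functionalMap F ℓ '' zerosOver F ℓ) W ∧
      MapsTo (functionalMap F ℓ) (tube h b ℓ ε) W := by
    rcases (zerosOver F ℓ).eq_empty_or_nonempty with h0 | h0
    · refine ⟨∅, ⟨fun _ => ∅, ?_⟩, ?_⟩
      · rw [h0, image_empty]
        exact isTubularFoliation_empty _ _
      · rw [hfol.eq_iUnion, h0]
        simp
    · refine ⟨Metric.ball 0 1, ⟨fun _ => Metric.ball 0 1, ?_⟩, hmaps⟩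
      have h1 : functionalMap F ℓ '' zerosOver F ℓ = {0} := by
        refine (h0.image _).subset_singleton_iff.1 ?_
        rintro _ ⟨u, hu, rfl⟩
        change ℓ u.1 u.2 = 0
        rw [hu.1]
        rfl
      rw [h1]
      exact isTubularFoliation_unit_disc
  obtain ⟨W, hW, hmW⟩ := hW
  refine
    { open_manifold := h.not_isCompact_connectedComponent b
      even_dim := ?_
      form_smooth := hn.isSmooth_canonicalForm b hκ.smooth
      form_closed := hn.isClosed_canonicalForm b hκ.smooth hκ.closed
      smooth := hℓ.contMDiff_functionalMap
      crit_submanifold := ?_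
      crit_components := ?_
      nondegenerate := ?_
      local_model := ⟨tube h b ℓ ε, W, mulI E F N, constMulI, ?_, ?_, isAlmostComplexOn_mulI _,
        fun u _ => hcompat u, isPositiveComplexStructureOn_constMulI W, hmW,
        fun u _ v => hℓ.mfderiv_functionalMap_mulI u v, tube h b ℓ ε, tubeDisc h b ℓ ρ ε, ?_, ?_⟩ }
  · rw [finrank_real_of_complex]
    exact even_two_mul _
  · rw [hcrit]
    exact hfol.isSubmanifold
  · rw [hcrit]
    refine finite_connectedComponents_of_isCompact (hℓ.isCompact_zerosOver h) fun u hu => ?_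
    obtain ⟨d, O, c, g, hcg⟩ := hℓ.exists_isHolomorphicParam_zerosOver hu
    exact hcg.exists_isPreconnected
  · refine fun u => (hcompat u).nondegenerateOn fun v hv => ?_
    refine (hℓ.mfderiv_functionalMap_mulI u v).trans ?_
    exact (congrArg (fun w : ℂ => Complex.I * w) hv).trans (mul_zero Complex.I)
  · rw [hcrit]
    exact ⟨_, hfol⟩
  · rw [hcrit]
    exact hW
  · rw [hcrit]
    exact
      { subset := Subset.rfl
        foliation := hfol
        closed := fun u _ => hn.isClosed_canonicalForm b hκ.smooth hκ.closed u
        almostComplex := fun u hu => by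
          obtain ⟨d, O, c, g, hcg⟩ := hℓ.exists_isHolomorphicParam_zerosOver hu
          exact hcg.invariant
        compatible := fun u _ => hcompat u
        disc_holomorphic := fun x hx u hu => by
          obtain ⟨O, c, g, hcg, -⟩ := hdisc x hx u hu
          exact hcg.invariant
        disc_integrable := fun x hx => isIntegrableAlong_of_isHolomorphicParam fun u hu => by
          obtain ⟨O, c, g, hcg, -⟩ := hdisc x hx u hu
          exact ⟨2, O, c, g, hcg⟩ }
  · intro x hx
    rw [hcrit] at hx
    have hxD : x ∈ tubeDisc h b ℓ ρ ε x := by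
      obtain ⟨a, Θ, A, hΘ, hA, hxΘ, hxA⟩ := hεΘ x.1 hx.1
      refine ⟨?_, hΘ.retraction_self _ hxΘ hx.1⟩
      change tubeSq h b ℓ x < ε ^ 2
      rw [tubeSq_eq_zero_iff.2 hx]
      exact pow_pos hε 2
    obtain ⟨O, c, g, hcg, hfc⟩ := hdisc x hx x hxD
    refine hcg.hessianAt_nondegenerate (hℓ.contMDiff_functionalMap x) ?_ hfc
    have h1 := (hℓ.mfderiv_functionalMap_eq_zero_iff x).2 hx
    refine ContinuousLinearMap.ext fun v => (hℓ.mfderiv_functionalMap_apply x v).trans ?_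
    exact congrArg (fun A : E × F →L[ℂ] ℂ => A v) h1

end Fibration

/-! ### Divisibility by the equation of a hypersurface -/

section Hypersurface

variable {E : Type*} [NormedAddCommGroup E] [NormedSpace ℂ E]
  {M : Type*} [TopologicalSpace M] [ChartedSpace E M]
  {H U : Set M} {f : M → ℂ}

theorem IsLocalEquation.mdifferentiableAt (hf : IsLocalEquation (E := E) H U f) {x : M}
    (hx : x ∈ U) : MDifferentiableAt 𝓘(ℂ, E) 𝓘(ℂ, ℂ) f x :=
  hf.holomorphic.mdifferentiableAt (hf.isOpen.mem_nhds hx)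

/-- A smooth reduced hypersurface is nowhere dense. -/
theorem IsLocalEquation.frequently_notMem (hf : IsLocalEquation (E := E) H U f) {x : M}
    (hx : x ∈ U) (hxH : x ∈ H) : ∃ᶠ y in 𝓝 x, y ∉ H := by
  intro h
  have h1 : f =ᶠ[𝓝 x] fun _ => 0 := by
    filter_upwards [h, hf.isOpen.mem_nhds hx] with y hy hyU
    exact (hf.zero_iff y hyU).1 (not_not.1 hy)
  refine hf.regular x hx hxH ?_
  rw [h1.mfderiv_eq]
  exact mfderiv_const

/-- A holomorphic function that vanishes on a reduced hypersurface is divisible by its equation. -/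
theorem IsLocalEquation.exists_eq_mul [FiniteDimensional ℂ E] [IsManifold 𝓘(ℂ, E) ω M]
    (hf : IsLocalEquation (E := E) H U f) {x : M}
    (hx : x ∈ U) (hxH : x ∈ H) {σ : M → ℂ} {W : Set M} (hW : IsOpen W) (hxW : x ∈ W)
    (hσ : MDifferentiableOn 𝓘(ℂ, E) 𝓘(ℂ, ℂ) σ W) (h0 : ∀ y ∈ W, y ∈ H → σ y = 0) :
    ∃ (V : Set M) (Q : M → ℂ), IsOpen V ∧ x ∈ V ∧ V ⊆ U ∩ W ∧
      MDifferentiableOn 𝓘(ℂ, E) 𝓘(ℂ, ℂ) Q V ∧ ∀ y ∈ V, σ y = f y * Q y := by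
  obtain ⟨ψ, hψx, hψU, hψ⟩ := exists_isAdaptedChart (hf.isOpen.inter hW)
    (hf.holomorphic.mono inter_subset_left) ⟨hx, hxW⟩ (hf.regular x hx hxH)
  have hd : DifferentiableOn ℂ (σ ∘ ψ.symm) ψ.target := by
    intro z hz
    have h1 := (hψ.contMDiffOn_symm.contMDiffAt (ψ.open_target.mem_nhds hz)).mdifferentiableAt
      (by simp)
    have h2 := (hσ.mdifferentiableAt (hW.mem_nhds (hψU (ψ.map_target hz)).2)).comp z h1
    exact (mdifferentiableAt_iff_differentiableAt.1 h2).differentiableWithinAt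
  have hx0 : ((ψ x).1, (0 : ℂ)) = ψ x :=
    Prod.ext rfl (((hf.zero_iff x hx).1 hxH).symm.trans (hψ.snd_eq x hψx).symm)
  obtain ⟨q, V, hV, hxV, hVt, hq, hqe⟩ := exists_eq_mul_of_eq_zero_on_hyperplane ψ.open_target hd
    (hx0.symm ▸ ψ.map_source hψx) fun k hk => by
      have h1 := ψ.map_target hk
      refine h0 _ (hψU h1).2 ((hf.zero_iff _ (hψU h1).1).2 ?_)
      rw [← hψ.snd_eq _ h1, ψ.right_inv hk]
  refine ⟨ψ.source ∩ ψ ⁻¹' V, q ∘ ψ, ψ.isOpen_inter_preimage hV, ⟨hψx, ?_⟩, fun y hy => hψU hy.1,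
    fun y hy => ?_, fun y hy => ?_⟩
  · rw [mem_preimage, ← hx0]
    exact hxV
  · have h1 := (hψ.contMDiffOn.contMDiffAt (ψ.open_source.mem_nhds hy.1)).mdifferentiableAt
      (by simp)
    have h2 : MDifferentiableAt 𝓘(ℂ, HypModel E × ℂ) 𝓘(ℂ, ℂ) q (ψ y) :=
      mdifferentiableAt_iff_differentiableAt.2 (hq.differentiableAt (hV.mem_nhds hy.2))
    exact (h2.comp y h1).mdifferentiableWithinAt
  · have h1 := hqe _ hy.2
    rw [Function.comp_apply, ψ.left_inv hy.1, hψ.snd_eq y hy.1] at h1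
    exact h1

end Hypersurface

/-! ### Transversality of the defining section -/

section DualBundle

variable {E : Type*} [NormedAddCommGroup E] [NormedSpace ℂ E] [FiniteDimensional ℂ E]
  {M : Type*} [TopologicalSpace M] [ChartedSpace E M] [IsManifold 𝓘(ℂ, E) ω M]
  {L : M → Type*} [∀ x, AddCommGroup (L x)] [∀ x, Module ℂ (L x)] [∀ x, TopologicalSpace (L x)]
  [TopologicalSpace (Bundle.TotalSpace ℂ L)] [FiberBundle ℂ L] [VectorBundle ℂ ℂ L]
  [ContMDiffVectorBundle ω ℂ L 𝓘(ℂ, E)] {H : Set M}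

theorem finrank_fiber_eq_one (L : M → Type*) [∀ x, AddCommGroup (L x)] [∀ x, Module ℂ (L x)]
    [∀ x, TopologicalSpace (L x)] [TopologicalSpace (Bundle.TotalSpace ℂ L)] [FiberBundle ℂ L]
    [VectorBundle ℂ ℂ L] (y : M) : Module.finrank ℂ (L y) = 1 := by
  rw [((trivializationAt ℂ L y).linearEquivAt ℂ y
    (FiberBundle.mem_baseSet_trivializationAt' y)).finrank_eq, Module.finrank_self]

theorem exists_eq_smul_of_fiber_ne_zero {y : M} {e : L y} (he : e ≠ 0) (v : L y) :
    ∃ c : ℂ, c • e = v :=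
  (finrank_eq_one_iff_of_nonzero' e he).1 (finrank_fiber_eq_one L y) v

theorem dualFiber_apply_ne_zero {y : M} {φ : DualFiber L y} (hφ : φ ≠ 0) {e : L y} (he : e ≠ 0) :
    (φ e : ℂ) ≠ 0 := by
  intro h0
  refine hφ (ContinuousLinearMap.ext fun v => ?_)
  obtain ⟨c, rfl⟩ := exists_eq_smul_of_fiber_ne_zero he v
  refine (map_smul φ c e).trans ?_
  exact (congrArg (fun z : ℂ => c * z) h0).trans (mul_zero c)

theorem eq_of_dualFiber_apply_eq {y : M} {φ : DualFiber L y} (hφ : φ ≠ 0) {v w : L y}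
    (hvw : (φ v : ℂ) = φ w) : v = w := by
  by_contra h
  refine dualFiber_apply_ne_zero hφ (sub_ne_zero.2 h) ?_
  exact (map_sub φ v w).trans (sub_eq_zero.2 hvw)

theorem mdifferentiableAt_dualFiber_apply {φ : (y : M) → DualFiber L y} {v : (y : M) → L y} {x : M}
    (hφ : MDifferentiableAt 𝓘(ℂ, E) (𝓘(ℂ, E).prod 𝓘(ℂ, ℂ →L[ℂ] ℂ))
      (fun y => Bundle.TotalSpace.mk' (ℂ →L[ℂ] ℂ) y (φ y)) x)
    (hv : MDifferentiableAt 𝓘(ℂ, E) (𝓘(ℂ, E).prod 𝓘(ℂ, ℂ))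
      (fun y => Bundle.TotalSpace.mk' ℂ y (v y)) x) :
    MDifferentiableAt 𝓘(ℂ, E) 𝓘(ℂ, ℂ) (fun y => (φ y (v y) : ℂ)) x :=
  ((mdifferentiableAt_totalSpace 𝓘(ℂ, E) _).1 (MDifferentiableAt.clm_bundle_apply (b := id) hφ hv)).2

/-- The evaluation functionals of a section `s` of `L` on the fibers of the dual bundle. -/
noncomputable def evalFunctional (s : (y : M) → L y) (y : M) : DualFiber L y →ₗ[ℂ] ℂ where
  toFun n := n (s y)
  map_add' _ _ := rfl
  map_smul' _ _ := rfl

/-- The identification of the model fiber of the dual bundle with `ℂ` by evaluation at `1`. -/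
noncomputable def dualModelEquiv : (ℂ →L[ℂ] ℂ) ≃L[ℂ] ℂ :=
  (ContinuousLinearMap.toSpanSingletonCLE (𝕜 := ℂ) (E := ℂ)).symm

/-- The frame of the dual bundle given by the preferred trivialization at `x`. -/
noncomputable def dualFrame (L : M → Type*) [∀ x, AddCommGroup (L x)] [∀ x, Module ℂ (L x)]
    [∀ x, TopologicalSpace (L x)] [TopologicalSpace (Bundle.TotalSpace ℂ L)] [FiberBundle ℂ L]
    [VectorBundle ℂ ℂ L] (x y : M) : DualFiber L y :=
  lineFrame (DualFiber L) dualModelEquiv x y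

theorem evalFunctional_eq_zero_iff {s : (y : M) → L y} {y : M} :
    evalFunctional s y = 0 ↔ s y = 0 := by
  have hy := FiberBundle.mem_baseSet_trivializationAt' (F := ℂ →L[ℂ] ℂ) (E := DualFiber L) y
  constructor
  · intro h0
    by_contra hs
    exact dualFiber_apply_ne_zero (lineFrame_ne_zero dualModelEquiv y hy) hs
      (congrArg (fun A : DualFiber L y →ₗ[ℂ] ℂ => A (lineFrame (DualFiber L) dualModelEquiv y y)) h0)
  · intro h0
    refine LinearMap.ext fun n => ?_
    exact (congrArg n h0).trans (map_zero n)

theorem mdifferentiableAt_dualFrame_apply {v : (y : M) → L y} {x₀ y : M}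
    (hy : y ∈ (trivializationAt (ℂ →L[ℂ] ℂ) (DualFiber L) x₀).baseSet)
    (hv : MDifferentiableAt 𝓘(ℂ, E) (𝓘(ℂ, E).prod 𝓘(ℂ, ℂ))
      (fun y => Bundle.TotalSpace.mk' ℂ y (v y)) y) :
    MDifferentiableAt 𝓘(ℂ, E) 𝓘(ℂ, ℂ) (fun y => (dualFrame L x₀ y (v y) : ℂ)) y :=
  mdifferentiableAt_dualFiber_apply
    ((contMDiffAt_lineFrame dualModelEquiv x₀ hy).mdifferentiableAt (by simp)) hv

/-- A holomorphic section with zero locus `H` of the line bundle of `H` is, near each point, a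
nonzero constant multiple of the canonical section `f e`: the quotient of the two sections extends
holomorphically over `H` by the reducedness of `H`, and `M` is compact. -/
theorem IsLineBundleOfHypersurface.exists_const_mul [T2Space M] [CompactSpace M]
    (hL : IsLineBundleOfHypersurface E H L) {s : (x : M) → L x}
    (hs : IsHolomorphicSectionOn E ℂ s univ) (hsH : {x | s x = 0} = H) {x : M} (hx : x ∈ H) :
    ∃ (U : Set M) (f : M → ℂ) (e : (y : M) → L y) (c : ℂ), x ∈ U ∧
      IsLocalEquation (E := E) H U f ∧ IsHolomorphicSectionOn E ℂ e U ∧ e x ≠ 0 ∧ c ≠ 0 ∧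
      ∀ᶠ y in 𝓝 x, s y = (c * f y) • e y := by
  obtain ⟨U, f, e, hU, hfe⟩ := hL
  have hxU : ∀ x, x ∈ U x := fun x => (hU x).1
  have hf : ∀ x, IsLocalEquation (E := E) H (U x) (f x) := fun x => (hU x).2.1
  have he : ∀ x, IsHolomorphicSectionOn E ℂ (e x) (U x) := fun x => (hU x).2.2.1
  have he0 : ∀ x, ∀ y ∈ U x, e x y ≠ 0 := fun x => (hU x).2.2.2
  have hs0 : ∀ y, s y = 0 ↔ y ∈ H := fun y => Set.ext_iff.1 hsH y
  set s₀ : (y : M) → L y := fun y => f y y • e y y with hs₀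
  have hs₀e : ∀ x, ∀ y ∈ U x, s₀ y = f x y • e x y := fun x y hy => hfe y x y ⟨hxU y, hy⟩
  have hs₀0 : ∀ y, y ∉ H → s₀ y ≠ 0 := fun y hy =>
    smul_ne_zero (fun h0 => hy (((hf y).zero_iff y (hxU y)).2 h0)) (he0 y y (hxU y))
  -- Near each point the quotient of the sections `s` and `s₀` extends to a holomorphic function.
  have hloc : ∀ x, ∃ (V : Set M) (Q : M → ℂ), IsOpen V ∧ x ∈ V ∧
      MDifferentiableOn 𝓘(ℂ, E) 𝓘(ℂ, ℂ) Q V ∧ ∀ y ∈ V, s y = Q y • s₀ y := by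
    intro x
    set B := (trivializationAt (ℂ →L[ℂ] ℂ) (DualFiber L) x).baseSet
    have hBo : IsOpen B := (trivializationAt (ℂ →L[ℂ] ℂ) (DualFiber L) x).open_baseSet
    have hxB : x ∈ B := FiberBundle.mem_baseSet_trivializationAt' x
    have hfr : ∀ y ∈ B, dualFrame L x y ≠ 0 := fun y hy => lineFrame_ne_zero dualModelEquiv x hy
    set q : M → ℂ := fun y => (dualFrame L x y (s y) : ℂ) / (dualFrame L x y (e x y) : ℂ) with hq
    have hUo := (hf x).isOpen
    have hqd : MDifferentiableOn 𝓘(ℂ, E) 𝓘(ℂ, ℂ) q (U x ∩ B) := fun y hy => by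
      have h1 := mdifferentiableAt_dualFrame_apply (E := E) hy.2
        (hs.mdifferentiableAt Filter.univ_mem : MDifferentiableAt _ _ _ y)
      have h2 := mdifferentiableAt_dualFrame_apply (E := E) hy.2
        ((he x).mdifferentiableAt (hUo.mem_nhds hy.1))
      exact (h1.div h2 (dualFiber_apply_ne_zero (hfr y hy.2) (he0 x y hy.1))).mdifferentiableWithinAt
    have hqs : ∀ y ∈ U x ∩ B, s y = q y • e x y := fun y hy => by
      refine eq_of_dualFiber_apply_eq (hfr y hy.2) ?_
      refine Eq.trans ?_ (map_smul (dualFrame L x y) (q y) (e x y)).symm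
      exact (div_mul_cancel₀ _ (dualFiber_apply_ne_zero (hfr y hy.2) (he0 x y hy.1))).symm
    by_cases hxH : x ∈ H
    · obtain ⟨V, Q, hV, hxV, hVU, hQ, hQe⟩ := (hf x).exists_eq_mul (hxU x) hxH (hUo.inter hBo)
        ⟨hxU x, hxB⟩ hqd fun y hy hyH => by
          have h1 := hqs y hy
          rw [(hs0 y).2 hyH] at h1
          exact (smul_eq_zero.1 h1.symm).resolve_right (he0 x y hy.1)
      refine ⟨V, Q, hV, hxV, hQ, fun y hy => ?_⟩
      have hy' := (hVU hy).2
      rw [hqs y hy', hQe y hy, hs₀e x y hy'.1, smul_smul, mul_comm]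
    · have hfc : ContinuousAt (f x) x := ((hf x).mdifferentiableAt (hxU x)).continuousAt
      have hfx : f x x ≠ 0 := fun h0 => hxH (((hf x).zero_iff x (hxU x)).2 h0)
      obtain ⟨V, hVs, hV, hxV⟩ := mem_nhds_iff.1 (Filter.inter_mem
        ((hUo.inter hBo).mem_nhds ⟨hxU x, hxB⟩) (hfc.eventually_ne hfx))
      refine ⟨V, fun y => q y / f x y, hV, hxV, fun y hy => ?_, fun y hy => ?_⟩
      · have h1 := hqd.mdifferentiableAt ((hUo.inter hBo).mem_nhds (hVs hy).1)
        exact (h1.div ((hf x).mdifferentiableAt (hVs hy).1.1) (hVs hy).2).mdifferentiableWithinAt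
      · rw [hs₀e x y (hVs hy).1.1, hqs y (hVs hy).1, smul_smul, div_mul_cancel₀ _ (hVs hy).2]
  choose V Q hV hxV hQ hQs using hloc
  -- These quotients agree off `H`, which is nowhere dense, and hence everywhere.
  have hQeq : ∀ x, ∀ y ∈ V x, Q y y = Q x y := by
    intro x y hy
    have hoff : ∀ z, z ∈ V x → z ∈ V y → z ∉ H → Q y z = Q x z := fun z hzx hzy hz =>
      smul_left_injective ℂ (hs₀0 z hz) ((hQs y z hzy).symm.trans (hQs x z hzx))
    by_cases hyH : y ∈ H
    · by_contra hne
      have h1 : ContinuousAt (Q y) y := ((hQ y).mdifferentiableAt ((hV y).mem_nhds (hxV y))).continuousAt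
      have h2 : ContinuousAt (Q x) y := ((hQ x).mdifferentiableAt ((hV x).mem_nhds hy)).continuousAt
      have h3 : ∀ᶠ z in 𝓝 y, Q y z ≠ Q x z :=
        (h1.prodMk h2).eventually (isOpen_ne_fun continuous_fst continuous_snd |>.mem_nhds hne)
      obtain ⟨z, hz, hz1, hz2, hz3⟩ := (((hf y).frequently_notMem (hxU y) hyH).and_eventually
        (h3.and (((hV x).mem_nhds hy |> Filter.Eventually.and) ((hV y).mem_nhds (hxV y))))).exists
      exact hz1 (hoff z hz2 hz3 hz)
    · exact hoff y hy (hxV y) hyH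
  set R : M → ℂ := fun y => Q y y with hR
  have hRd : MDifferentiable 𝓘(ℂ, E) 𝓘(ℂ, ℂ) R := fun x => by
    refine ((hQ x).mdifferentiableAt ((hV x).mem_nhds (hxV x))).congr_of_eventuallyEq ?_
    filter_upwards [(hV x).mem_nhds (hxV x)] with y hy using hQeq x y hy
  have : IsManifold 𝓘(ℂ, E) 1 M := IsManifold.of_le (n := ω) le_top
  -- A holomorphic function on a compact manifold is locally constant.
  have hRc : ∀ᶠ y in 𝓝 x, R y = R x :=
    (IsLocallyConstant.iff_eventually_eq R).1 hRd.isLocallyConstant x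
  have hsR : ∀ y, s y = R y • s₀ y := fun y => hQs y y (hxV y)
  refine ⟨U x, f x, e x, R x, hxU x, hf x, he x, he0 x x (hxU x), fun h0 => ?_, ?_⟩
  · refine (hf x).frequently_notMem (hxU x) hx ?_
    filter_upwards [hRc] with y hy
    rw [not_not, ← hs0, hsR, hy, h0, zero_smul]
  · filter_upwards [hRc, (hf x).isOpen.mem_nhds (hxU x)] with y hy hyU
    rw [hsR, hy, hs₀e x y hyU, smul_smul]

/-- Evaluation of the section `s` on the dual bundle is holomorphic and vanishes transversely,
because `s` is a constant multiple of the section given by the reduced equations of `H`. -/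
theorem IsLineBundleOfHypersurface.isTransverseFunctional [T2Space M] [CompactSpace M]
    (hL : IsLineBundleOfHypersurface E H L) {s : (x : M) → L x}
    (hs : IsHolomorphicSectionOn E ℂ s univ) (hsH : {x | s x = 0} = H) :
    IsTransverseFunctional E (evalFunctional s) dualModelEquiv where
  holomorphic := fun x₀ y hy => mdifferentiableAt_dualFrame_apply hy
    (hs.mdifferentiableAt Filter.univ_mem)
  transverse := by
    intro x hx
    have hxH : x ∈ H := hsH ▸ evalFunctional_eq_zero_iff.1 hx
    obtain ⟨U, f, e, c, hxU, hf, he, hex, hc, hsc⟩ := hL.exists_const_mul hs hsH hxH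
    have hxB := FiberBundle.mem_baseSet_trivializationAt' (F := ℂ →L[ℂ] ℂ) (E := DualFiber L) x
    set t : M → ℂ := fun y => (dualFrame L x y (e y) : ℂ) with ht
    have htx : t x ≠ 0 := dualFiber_apply_ne_zero (lineFrame_ne_zero dualModelEquiv x hxB) hex
    have htd : MDifferentiableAt 𝓘(ℂ, E) 𝓘(ℂ, ℂ) t x :=
      mdifferentiableAt_dualFrame_apply hxB (he.mdifferentiableAt (hf.isOpen.mem_nhds hxU))
    have hfd := hf.mdifferentiableAt hxU
    have heq : pairCoeff (evalFunctional s) dualModelEquiv x =ᶠ[𝓝 x] fun y => (c * f y) * t y := by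
      filter_upwards [hsc] with y hy
      exact (congrArg (dualFrame L x y) hy).trans (map_smul (dualFrame L x y) (c * f y) (e y))
    have hfx : f x = 0 := (hf.zero_iff x hxU).1 hxH
    set A : E →L[ℂ] ℂ := mfderiv 𝓘(ℂ, E) 𝓘(ℂ, ℂ) f x with hA
    set T : E →L[ℂ] ℂ := mfderiv 𝓘(ℂ, E) 𝓘(ℂ, ℂ) t x with hT
    have h1 := (((hfd.hasMFDerivAt.const_smul c).mul htd.hasMFDerivAt).congr_of_eventuallyEq heq).mfderiv
    obtain ⟨v, hv⟩ : ∃ v, A v ≠ 0 := by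
      by_contra! h0
      exact hf.regular x hxU hxH (ContinuousLinearMap.ext h0)
    intro h0
    have h2 : (c * f x) * T v + t x * (c * A v) = 0 :=
      (congrArg (fun D : E →L[ℂ] ℂ => D v) h1).symm.trans
        (congrArg (fun D : E →L[ℂ] ℂ => D v) h0)
    rw [hfx, mul_zero, zero_mul, zero_add] at h2
    exact mul_ne_zero htx (mul_ne_zero hc hv) h2

end DualBundle

theorem mainTheorem7
    {E : Type*} [NormedAddCommGroup E] [NormedSpace ℂ E] [FiniteDimensional ℂ E]
    {M : Type*} [TopologicalSpace M] [ChartedSpace E M] [IsManifold 𝓘(ℂ, E) ω M]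
    [T2Space M] [CompactSpace M]
    (κ : DiffForm 𝓘(ℝ, E) M 2) (hκ : IsKahlerForm κ)
    (H : Set M) (hH : IsSmoothHypersurface E H)
    {L : M → Type*} [∀ x, AddCommGroup (L x)] [∀ x, Module ℂ (L x)] [∀ x, TopologicalSpace (L x)]
    [TopologicalSpace (Bundle.TotalSpace ℂ L)] [FiberBundle ℂ L] [VectorBundle ℂ ℂ L]
    [ContMDiffVectorBundle ω ℂ L 𝓘(ℂ, E)]
    (hL : IsLineBundleOfHypersurface E H L)
    (s : (x : M) → L x) (hs : IsHolomorphicSectionOn E ℂ s Set.univ)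
    (hsH : {x | s x = 0} = H)
    (h : HermitianMetric E (ℂ →L[ℂ] ℂ) (DualFiber L))
    (nabla : RealConnection E (ℂ →L[ℂ] ℂ) (DualFiber L))
    (hnabla : IsHermitianHolomorphic h nabla)
    (hcurv : HasCurvatureTwoPiI nabla κ) :
    (∀ x, (canonicalForm h nabla κ).NondegenerateOn x Set.univ) ∧
    IsLefschetzBottFibration (realTotalModel E (ℂ →L[ℂ] ℂ))
      (canonicalForm h nabla κ) (pairingMap s) ∧
    critSet (realTotalModel E (ℂ →L[ℂ] ℂ)) (pairingMap s) =
      Bundle.zeroSection (ℂ →L[ℂ] ℂ) (DualFiber L) '' H := by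
  have hℓ := hL.isTransverseFunctional hs hsH
  refine ⟨fun u => (hnabla.isCompatibleAt_mulI dualModelEquiv hκ hcurv u).nondegenerateOn
    fun _ _ => mem_univ _, hℓ.isLefschetzBottFibration hnabla hκ hcurv,
    hℓ.critSet_functionalMap.trans ?_⟩
  rw [zerosOver_eq_image_zeroSection]
  congr 1
  ext y
  rw [← hsH]
  exact evalFunctional_eq_zero_iff
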